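/- Let $S/R$ be a Galois extension of commutative rings whose group is cyclic of order $n\ge 1$ with generator $\sigma$. For an invertible (rank one projective) $S$-module $J$ and an automorphism $\tau$ of $S$ let $\tau(J)$ be $J$ with $s\in S$ acting as $\tau^{-1}(s)$. If $\tau^m=1$, then $\tau$ acts $\tau$-semilinearly on $J\otimes_S\tau(J)\otimes_S\cdots\otimes_S\tau^{m-1}(J)$ by $j_0\otimes j_1\otimes\cdots\otimes j_{m-1}\mapsto j_{m-1}\otimes j_0\otimes\cdots\otimes j_{m-2}$; if moreover $\tau$ generates the Galois group, of order $m$, of $S$ over the fixed ring $S'=S^{\tau}$, let $N_{S/S'}(J)$ be the $S'$-module of $\tau$-fixed elements. Given an $S$-linear isomorphism $\varphi: J\otimes_S\sigma(J)\otimes_S\cdots\otimes_S\sigma^{n-1}(J)\to S$ which commutes with $\sigma$, the almost cyclic algebra $\Delta(S/R,\sigma,J,\varphi)$ is the $R$-algebra generated by $S$ and the symbols $jt$ ($j\in J$, additive in $j$), with $s\cdot jt=(sj)t$, $jt\cdot s=(\sigma(s)j)t$ and $(j_0t)(j_1t)\cdots(j_{n-1}t)=\varphi(j_0\otimes\cdots\otimes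 j_{n-1})$. Let $A=\Delta(S/R,\sigma,I,\varphi)$ and $B=\Delta(S/R,\sigma,J,\psi)$ be almost cyclic algebras. 1. Let $e_S\in S\otimes_R S$ be the idempotent associated to the multiplication map $\mu:S\otimes_RS\to S$, that is, $\mu(e_S)=1$ and $\mu$ is injective on $e_S(S\otimes_RS)$. Let $IJ=I\otimes_SJ$, and let $\varphi\otimes\psi$ be the isomorphism with $(\varphi\otimes\psi)\big((x_0\otimes y_0)\otimes\cdots\otimes(x_{n-1}\otimes y_{n-1})\big)=\varphi(x_0\otimes\cdots\otimes x_{n-1})\,\psi(y_0\otimes\cdots\otimes y_{n-1})$. Then this isomorphism exists, commutes with $\sigma$, and $e_S(A\otimes_RB)e_S\cong\Delta(S/R,\sigma,IJ,\varphi\otimes\psi)$ as $R$-algebras, by an isomorphism that sends $e_S(s\otimes1)e_S$ to $s$ for all $s\in S$. 2. Let $mk=n$, $S'=S^{\sigma^k}$, and write $\sigma$ also for the restriction of $\sigma$ to $S'$. Let $A^m=A\otimes_R\cdots\otimes_RA$ ($m$ factors), and let $e'\in S\otimes_R\cdots\otimes_RS$ be the idempotent associated to the map $S\otimes_R\cdots\otimes_RS\to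 S\otimes_{S'}\cdots\otimes_{S'}S$. Let $D$ be the centralizer of $S'$ in $A$. An idempotent $f$ of $D\otimes_{S'}\cdots\otimes_{S'}D$ ($m$ factors) is associated to the exterior power if, whenever $T'$ is a commutative $S'$-algebra and $T'\otimes_{S'}D\cong\mathrm{End}_{T'}(V)$ with $V$ a finitely generated projective $T'$-module, $f$ acts on $V^{\otimes m}$ with the same kernel as $V^{\otimes m}\to\bigwedge^mV$. Let $e_{m,S'}\in e'A^me'$ be an idempotent which is the image of an element of $D\otimes_R\cdots\otimes_RD$ whose image in $D\otimes_{S'}\cdots\otimes_{S'}D$ is an idempotent associated to the exterior power. Such idempotents exist; $S'/R$ is cyclic Galois of degree $k$ with generator $\sigma$; $N_{S/S'}(I)$ is an invertible $S'$-module; and for every such idempotent $$e_{m,S'}A^me_{m,S'}\cong\Delta\big(S'/R,\sigma,N_{S/S'}(I),\,(-1)^{m-1}\varphi\big)$$ as $R$-algebras, by an isomorphism that sends $e_{m,S'}\,s\,e_{m,S'}$ to $s$ for all $s\in S'$, where $s$ is placed in any one of the $m$ tensor factors. Here $\varphi$ is regarded as an isomorphism $N_{S/S'}(I)\otimes_{S'}\sigma(N_{S/S'}(I))\otimes_{S'}\cdots\otimes_{S'}\sigma^{k-1}(N_{S/S'}(I))\to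 S'$, commuting with $\sigma$, through the identification of $\bigotimes_{i<k}\sigma^i\big(\bigotimes_{l<m}\sigma^{kl}(I)\big)$ with $\bigotimes_{p<n}\sigma^p(I)$, $p=i+kl$. -/

import Mathlib

open scoped TensorProduct

namespace AlmostCyclic

noncomputable section

universe uR uS uJ uI uA

/-! ### Cyclic Galois extensions of commutative rings -/

/-- `S/R` is a Galois extension of commutative rings whose group is cyclic of order `n`, generated
by `σ`: `R ⊆ S`, `S` is a finitely generated projective `R`-module, `σ ^ n = 1`, and the twisted
group ring `⨁ S σ ^ i` maps isomorphically onto `End_R(S)`. -/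
structure IsCyclicGalois (R : Type uR) (S : Type uS) [CommRing R] [CommRing S] [Algebra R S]
    (n : ℕ) (σ : S ≃ₐ[R] S) : Prop where
  pos : 0 < n
  pow_eq_one : σ ^ n = 1
  injective : Function.Injective (algebraMap R S)
  finite : Module.Finite R S
  projective : Module.Projective R S
  bijective : Function.Bijective (fun c : Fin n → S =>
    ∑ i, LinearMap.mulLeft R (c i) ∘ₗ (σ ^ (i : ℕ)).toLinearMap)

section Fixed

variable {R : Type uR} {S : Type uS} [CommRing R] [CommRing S] [Algebra R S]

/-- The fixed ring `S ^ τ`. -/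
def fixedRing (τ : S ≃ₐ[R] S) : Subalgebra R S :=
  AlgHom.equalizer (τ : S →ₐ[R] S) (AlgHom.id R S)

theorem mem_fixedRing {τ : S ≃ₐ[R] S} {s : S} : s ∈ fixedRing τ ↔ τ s = s := Iff.rfl

/-- The automorphism that `σ` induces on the fixed ring of `σ ^ k`. -/
def fixedRingAut (σ : S ≃ₐ[R] S) (k : ℕ) : fixedRing (σ ^ k) ≃ₐ[R] fixedRing (σ ^ k) where
  toFun s := ⟨σ s, by
    have hs : (σ ^ k) (s : S) = s := s.2
    rw [mem_fixedRing, ← AlgEquiv.mul_apply, ← pow_succ, pow_succ', AlgEquiv.mul_apply, hs]⟩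
  invFun s := ⟨σ.symm s, by
    have hs : (σ ^ k) (s : S) = s := s.2
    rw [mem_fixedRing, AlgEquiv.eq_symm_apply, ← AlgEquiv.mul_apply, ← pow_succ', pow_succ,
      AlgEquiv.mul_apply, AlgEquiv.apply_symm_apply, hs]⟩
  left_inv s := by ext; simp
  right_inv s := by ext; simp
  map_mul' s t := by ext; simp
  map_add' s t := by ext; simp
  commutes' r := by ext; simp

theorem fixedRingAut_pow_apply (σ : S ≃ₐ[R] S) (k i : ℕ) (s : fixedRing (σ ^ k)) :
    (((fixedRingAut σ k) ^ i) s : S) = (σ ^ i) (s : S) := by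
  induction i generalizing s with
  | zero => rfl
  | succ i ih => rw [pow_succ, pow_succ, AlgEquiv.mul_apply, AlgEquiv.mul_apply, ih]; rfl

theorem fixedRingAut_pow (σ : S ≃ₐ[R] S) (k : ℕ) : (fixedRingAut σ k) ^ k = 1 := by
  ext s
  rw [fixedRingAut_pow_apply]
  exact s.2

end Fixed

/-! ### Twisted modules and norms -/

section Norm

variable {R : Type uR} {S : Type uS} [CommRing R] [CommRing S] [Algebra R S]

theorem update_comp_finRotate_symm {M : Type uJ} {m : ℕ} (j : Fin m → M) (i : Fin m) (x : M) :
    Function.update j i x ∘ (finRotate m).symm =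
      Function.update (j ∘ (finRotate m).symm) (finRotate m i) x := by
  simpa only [Equiv.symm_symm] using Function.update_comp_equiv j (finRotate m).symm i x

/-- The twisted module `τ(J)`: the abelian group `J`, on which `s` acts as `τ⁻¹(s)`. For an ideal
`J` of `S` this is the ideal `τ(J)`, an element `j` standing for `τ(j)`. -/
@[nolint unusedArguments]
def Twist (_τ : S ≃ₐ[R] S) (J : Type uJ) : Type uJ := J

variable {J : Type uJ} [AddCommGroup J]

instance (τ : S ≃ₐ[R] S) : AddCommGroup (Twist τ J) := inferInstanceAs (AddCommGroup J)

/-- The identity map `J → τ(J)`. -/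
def Twist.of (τ : S ≃ₐ[R] S) : J ≃+ Twist τ J := AddEquiv.refl J

theorem of_update (τ : S ≃ₐ[R] S) {m : ℕ} (j : Fin m → J) (i : Fin m) (x : J) :
    (fun l : Fin m => Twist.of (τ ^ (l : ℕ)) (Function.update j i x l)) =
      Function.update (fun l : Fin m => Twist.of (τ ^ (l : ℕ)) (j l)) i
        (Twist.of (τ ^ (i : ℕ)) x) := by
  funext l
  by_cases h : l = i
  · subst h; simp
  · simp [h]

theorem of_symm_update (τ : S ≃ₐ[R] S) {m : ℕ} (j : (i : Fin m) → Twist (τ ^ (i : ℕ)) J)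
    (i : Fin m) (x : Twist (τ ^ (i : ℕ)) J) :
    (fun l : Fin m => (Twist.of (τ ^ (l : ℕ))).symm (Function.update j i x l)) =
      Function.update (fun l : Fin m => (Twist.of (τ ^ (l : ℕ))).symm (j l)) i
        ((Twist.of (τ ^ (i : ℕ))).symm x) := by
  funext l
  by_cases h : l = i
  · subst h; simp
  · simp [h]

variable [Module S J]

instance (τ : S ≃ₐ[R] S) : Module S (Twist τ J) := Module.compHom J (τ.symm : S →+* S)

theorem Twist.smul_of (τ : S ≃ₐ[R] S) (s : S) (j : J) :
    s • Twist.of τ j = Twist.of τ (τ.symm s • j) := rfl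

theorem Twist.of_smul (τ : S ≃ₐ[R] S) (s : S) (j : J) :
    Twist.of τ (s • j) = τ s • Twist.of τ j := by
  rw [Twist.smul_of, AlgEquiv.symm_apply_apply]

/-- `J ⊗ τ(J) ⊗ ⋯ ⊗ τ ^ (m - 1)(J)`, the tensor products being over `S`. -/
abbrev NormTensor (τ : S ≃ₐ[R] S) (m : ℕ) (J : Type uJ) [AddCommGroup J] [Module S J] :=
  ⨂[S] i : Fin m, Twist (τ ^ (i : ℕ)) J

/-- The pure tensor `j 0 ⊗ j 1 ⊗ ⋯ ⊗ j (m - 1)` in `J ⊗ τ(J) ⊗ ⋯ ⊗ τ ^ (m - 1)(J)`. -/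
def pureTensor (τ : S ≃ₐ[R] S) {m : ℕ} (j : Fin m → J) : NormTensor τ m J :=
  PiTensorProduct.tprod S fun i => Twist.of (τ ^ (i : ℕ)) (j i)

theorem pureTensor_update_add (τ : S ≃ₐ[R] S) {m : ℕ} (j : Fin m → J) (i : Fin m) (x y : J) :
    pureTensor τ (Function.update j i (x + y)) =
      pureTensor τ (Function.update j i x) + pureTensor τ (Function.update j i y) := by
  simp only [pureTensor, of_update, map_add, MultilinearMap.map_update_add]

theorem pureTensor_update_smul (τ : S ≃ₐ[R] S) {m : ℕ} (j : Fin m → J) (i : Fin m) (s : S)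
    (x : J) : pureTensor τ (Function.update j i (s • x)) =
      (τ ^ (i : ℕ)) s • pureTensor τ (Function.update j i x) := by
  simp only [pureTensor, of_update, Twist.of_smul, MultilinearMap.map_update_smul]

theorem pow_finRotate {τ : S ≃ₐ[R] S} {m : ℕ} (h : τ ^ m = 1) (i : Fin m) :
    τ ^ ((finRotate m i : Fin m) : ℕ) = τ * τ ^ (i : ℕ) := by
  rw [← pow_succ']
  cases m with
  | zero => exact i.elim0
  | succ m =>
    rw [coe_finRotate]
    split_ifs with hi
    · rw [hi, Fin.val_last, h, pow_zero]
    · rfl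

/-- Auxiliary to `rotation`. -/
def rotationAux (τ : S ≃ₐ[R] S) (m : ℕ) (J : Type uJ) [AddCommGroup J] [Module S J]
    (h : τ ^ m = 1) :
    MultilinearMap S (fun i : Fin m => Twist (τ ^ (i : ℕ)) J)
      (Twist τ.symm (NormTensor τ m J)) :=
  MultilinearMap.mk' (fun j => Twist.of τ.symm (pureTensor τ
      ((fun i : Fin m => (Twist.of (τ ^ (i : ℕ))).symm (j i)) ∘ (finRotate m).symm)))
    (fun j i x y => by
      simp only [of_symm_update, update_comp_finRotate_symm, map_add, pureTensor_update_add])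
    (fun j i s x => by
      have hs : (Twist.of (τ ^ (i : ℕ))).symm (s • x) =
          (τ ^ (i : ℕ)).symm s • (Twist.of (τ ^ (i : ℕ))).symm x := rfl
      simp only [of_symm_update, update_comp_finRotate_symm, hs, pureTensor_update_smul,
        pow_finRotate h, AlgEquiv.mul_apply, AlgEquiv.apply_symm_apply, Twist.smul_of]
      rfl)

/-- When `τ ^ m = 1`, the `τ`-semilinear action of `τ` on `J ⊗ τ(J) ⊗ ⋯ ⊗ τ ^ (m - 1)(J)`; it sends
`j 0 ⊗ j 1 ⊗ ⋯ ⊗ j (m - 1)` to `j (m - 1) ⊗ j 0 ⊗ ⋯ ⊗ j (m - 2)`. For an ideal `J` this is the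
action of `τ` on the ideal `J τ(J) ⋯ τ ^ (m - 1)(J)`. -/
def rotation (τ : S ≃ₐ[R] S) (m : ℕ) (J : Type uJ) [AddCommGroup J] [Module S J]
    (h : τ ^ m = 1) : NormTensor τ m J →+ NormTensor τ m J :=
  (Twist.of (J := NormTensor τ m J) τ.symm).symm.toAddMonoidHom.comp
    (PiTensorProduct.lift (rotationAux τ m J h)).toAddMonoidHom

theorem rotation_pureTensor (τ : S ≃ₐ[R] S) (m : ℕ) (h : τ ^ m = 1) (j : Fin m → J) :
    rotation τ m J h (pureTensor τ j) = pureTensor τ (j ∘ (finRotate m).symm) := by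
  exact PiTensorProduct.lift.tprod (φ := rotationAux τ m J h)
    (fun i : Fin m => Twist.of (τ ^ (i : ℕ)) (j i))

theorem rotation_smul (τ : S ≃ₐ[R] S) (m : ℕ) (h : τ ^ m = 1) (s : S) (x : NormTensor τ m J) :
    rotation τ m J h (s • x) = τ s • rotation τ m J h x := by
  exact (PiTensorProduct.lift (rotationAux τ m J h)).map_smul s x

/-- The norm `N(J) = (J ⊗ τ(J) ⊗ ⋯ ⊗ τ ^ (m - 1)(J)) ^ τ`, a module over the fixed ring of `τ`. -/
def normModule (τ : S ≃ₐ[R] S) (m : ℕ) (J : Type uJ) [AddCommGroup J] [Module S J]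
    (h : τ ^ m = 1) : Submodule (fixedRing τ) (NormTensor τ m J) where
  carrier := {x | rotation τ m J h x = x}
  add_mem' {x y} hx hy := by
    change rotation τ m J h x = x at hx
    change rotation τ m J h y = y at hy
    change rotation τ m J h (x + y) = x + y
    rw [map_add, hx, hy]
  zero_mem' := map_zero _
  smul_mem' s x hx := by
    change rotation τ m J h x = x at hx
    have hs : τ (s : S) = s := s.2
    change rotation τ m J h ((s : S) • x) = (s : S) • x
    rw [rotation_smul, hs, hx]

/-- A `G`-preserving isomorphism `φ : J ⊗ σ(J) ⊗ ⋯ ⊗ σ ^ (n - 1)(J) ≅ S`, where `G` is the cyclic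
group generated by `σ`. -/
structure NormTrivialization (σ : S ≃ₐ[R] S) (n : ℕ) (J : Type uJ) [AddCommGroup J] [Module S J]
    (h : σ ^ n = 1) where
  equiv : NormTensor σ n J ≃ₗ[S] S
  equivariant : ∀ x, equiv (rotation σ n J h x) = σ (equiv x)

end Norm

/-! ### Almost cyclic algebras -/

section Delta

variable {R : Type uR} {S : Type uS} [CommRing R] [CommRing S] [Algebra R S]
  {J : Type uJ} [AddCommGroup J] [Module S J] {σ : S ≃ₐ[R] S} {n : ℕ} {h : σ ^ n = 1}

/-- The relations of `Δ(S/R, σ, J, φ)` between the generators `s ∈ S` and `j ∈ J` (an element `j`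
stands for `j t`, so that `j s = σ(s) j`). All but the last present the twisted tensor ring
`S ⊕ Jt ⊕ (Jt)² ⊕ ⋯`; the last one identifies the product `x = (j₀ t) ⋯ (jₙ₋₁ t)` with `φ(x)`. -/
inductive DeltaRel (φ : NormTrivialization σ n J h) :
    FreeAlgebra R (S ⊕ J) → FreeAlgebra R (S ⊕ J) → Prop
  | base_algebraMap (r : R) :
      DeltaRel φ (FreeAlgebra.ι R (.inl (algebraMap R S r))) (algebraMap R _ r)
  | base_add (s t : S) : DeltaRel φ (FreeAlgebra.ι R (.inl (s + t)))
      (FreeAlgebra.ι R (.inl s) + FreeAlgebra.ι R (.inl t))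
  | base_mul (s t : S) : DeltaRel φ (FreeAlgebra.ι R (.inl (s * t)))
      (FreeAlgebra.ι R (.inl s) * FreeAlgebra.ι R (.inl t))
  | mod_add (j l : J) : DeltaRel φ (FreeAlgebra.ι R (.inr (j + l)))
      (FreeAlgebra.ι R (.inr j) + FreeAlgebra.ι R (.inr l))
  | left_mul (s : S) (j : J) : DeltaRel φ (FreeAlgebra.ι R (.inl s) * FreeAlgebra.ι R (.inr j))
      (FreeAlgebra.ι R (.inr (s • j)))
  | right_mul (s : S) (j : J) : DeltaRel φ (FreeAlgebra.ι R (.inr j) * FreeAlgebra.ι R (.inl s))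
      (FreeAlgebra.ι R (.inr (σ s • j)))
  | norm (j : Fin n → J) :
      DeltaRel φ (List.ofFn fun i => FreeAlgebra.ι R (Sum.inr (j i) : S ⊕ J)).prod
        (FreeAlgebra.ι R (.inl (φ.equiv (pureTensor σ j))))

/-- The almost cyclic algebra `Δ(S/R, σ, J, φ)`. -/
def Delta (φ : NormTrivialization σ n J h) : Type (max uR uS uJ) := RingQuot (DeltaRel φ)

instance (φ : NormTrivialization σ n J h) : Ring (Delta φ) :=
  inferInstanceAs (Ring (RingQuot (DeltaRel φ)))

instance (φ : NormTrivialization σ n J h) : Algebra R (Delta φ) :=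
  inferInstanceAs (Algebra R (RingQuot (DeltaRel φ)))

/-- The canonical map `S → Δ(S/R, σ, J, φ)`. -/
def Delta.ofBase (φ : NormTrivialization σ n J h) : S →ₐ[R] Delta φ :=
  let f : S → Delta φ := fun s =>
    RingQuot.mkAlgHom R (DeltaRel φ) (FreeAlgebra.ι R (Sum.inl s : S ⊕ J))
  have hr : ∀ r : R, f (algebraMap R S r) = algebraMap R (Delta φ) r := fun r =>
    (RingQuot.mkAlgHom_rel R (DeltaRel.base_algebraMap (φ := φ) r)).trans (AlgHom.commutes _ r)
  { toFun := f
    map_one' := by rw [← map_one (algebraMap R S), hr, map_one]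
    map_mul' := fun s t =>
      (RingQuot.mkAlgHom_rel R (DeltaRel.base_mul (φ := φ) s t)).trans (map_mul _ _ _)
    map_zero' := by rw [← map_zero (algebraMap R S), hr, map_zero]
    map_add' := fun s t =>
      (RingQuot.mkAlgHom_rel R (DeltaRel.base_add (φ := φ) s t)).trans (map_add _ _ _)
    commutes' := hr }

end Delta

/-! ### The trivializations on products and norms -/

section Operations

variable {R : Type uR} {S : Type uS} [CommRing R] [CommRing S] [Algebra R S]
  {I : Type uI} [AddCommGroup I] [Module S I] {J : Type uJ} [AddCommGroup J] [Module S J]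
  {σ : S ≃ₐ[R] S} {n : ℕ} {h : σ ^ n = 1}

/-- `θ` is the trivialization `φ ⊗ ψ` of the norm of `IJ = I ⊗ J`; as the pure tensors span, there
is at most one such `θ`. -/
def IsProduct (φ : NormTrivialization σ n I h) (ψ : NormTrivialization σ n J h)
    (θ : NormTrivialization σ n (I ⊗[S] J) h) : Prop :=
  ∀ (x : Fin n → I) (y : Fin n → J),
    θ.equiv (pureTensor σ fun i => x i ⊗ₜ[S] y i) =
      φ.equiv (pureTensor σ x) * ψ.equiv (pureTensor σ y)

/-- Let `n = m k`, `S' = S ^ (σ ^ k)` and `N = N_{S/S'}(J) ⊆ ⨂_{l < m} σ ^ (k l)(J)`. The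
trivialization `θ` of `N_{S'/R}(N)` is `c` times the one that `φ` induces through the identification
`N_{S'/R}(N_{S/S'}(J)) = N_{S/R}(J)`. Here `Φ` is the `R`-multilinear map (unique, as the pure
tensors span) which evaluates `φ` after the identification of
`⨂_{i < k} σ ^ i(⨂_{l < m} σ ^ (k l)(J))` with `⨂_{p < n} σ ^ p(J)`, where `p = i + k l`. -/
def IsIteratedNorm {m k : ℕ} (hmk : m * k = n) (φ : NormTrivialization σ n J h)
    (hτ : (σ ^ k) ^ m = 1) (c : R)
    (θ : NormTrivialization (fixedRingAut σ k) k (normModule (σ ^ k) m J hτ)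
      (fixedRingAut_pow σ k)) : Prop :=
  ∃ Φ : MultilinearMap R (fun _ : Fin k => NormTensor (σ ^ k) m J) S,
    (∀ x : Fin k → Fin m → J,
      Φ (fun i => pureTensor (σ ^ k) (x i)) = φ.equiv (pureTensor σ fun p : Fin n =>
        x (finProdFinEquiv.symm (Fin.cast hmk.symm p)).2
          (finProdFinEquiv.symm (Fin.cast hmk.symm p)).1)) ∧
    ∀ y : Fin k → normModule (σ ^ k) m J hτ,
      (θ.equiv (pureTensor (fixedRingAut σ k) y) : S) = c • Φ (fun i => (y i : NormTensor _ m J))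

theorem pow_pow_eq_one {m k : ℕ} (hmk : m * k = n) (h : σ ^ n = 1) : (σ ^ k) ^ m = 1 := by
  rw [← pow_mul, mul_comm, hmk, h]

end Operations

/-! ### Corners and idempotents -/

section Corner

variable {R : Type uR} {A : Type uA} [CommRing R] [Ring A] [Algebra R A] {e : A}

/-- The element `e x e` of the corner `eAe`. -/
def toCorner (he : IsIdempotentElem e) (x : A) : he.Corner := ⟨e * x * e, x, rfl⟩

theorem corner_mul (he : IsIdempotentElem e) (x : he.Corner) : e * x.1 = x.1 :=
  ((Subsemigroup.mem_corner_iff he).mp x.2).1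

theorem mul_corner (he : IsIdempotentElem e) (x : he.Corner) : x.1 * e = x.1 :=
  ((Subsemigroup.mem_corner_iff he).mp x.2).2

/-- The corner `eAe`, a ring with identity `e`, is an `R`-algebra. -/
instance cornerAlgebra (he : IsIdempotentElem e) : Algebra R he.Corner where
  smul r x := ⟨r • x.1, (Subsemigroup.mem_corner_iff he).mpr
    ⟨by rw [mul_smul_comm, corner_mul], by rw [smul_mul_assoc, mul_corner]⟩⟩
  algebraMap :=
    { toFun := fun r => ⟨r • e, (Subsemigroup.mem_corner_iff he).mpr
        ⟨by rw [mul_smul_comm, he.eq], by rw [smul_mul_assoc, he.eq]⟩⟩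
      map_one' := Subtype.ext (one_smul R e)
      map_mul' := fun r s => Subtype.ext (by
        change (r * s) • e = (r • e) * (s • e)
        rw [smul_mul_smul_comm, he.eq])
      map_zero' := Subtype.ext (zero_smul R e)
      map_add' := fun r s => Subtype.ext (add_smul r s e) }
  commutes' r x := Subtype.ext (by
    change (r • e) * x.1 = x.1 * (r • e)
    rw [smul_mul_assoc, mul_smul_comm, corner_mul, mul_corner])
  smul_def' r x := Subtype.ext (by
    change r • x.1 = (r • e) * x.1
    rw [smul_mul_assoc, corner_mul])

end Corner

/-- `e` is the idempotent associated to a surjective homomorphism `f : X → Y` of commutative rings: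
`e` is idempotent, `f e = 1`, and `f` is injective on `e X`, so that `e X ≅ Y`. -/
structure IsAssociatedIdempotent {X : Type uS} {Y : Type uA} [CommRing X] [CommRing Y]
    (f : X →+* Y) (e : X) : Prop where
  idem : IsIdempotentElem e
  map_eq_one : f e = 1
  injOn : ∀ x, f (e * x) = 0 → e * x = 0

/-! ### Tensor powers -/

section Power

/-- The canonical map `C ⊗_R ⋯ ⊗_R C → C ⊗_T ⋯ ⊗_T C` for an `R`-algebra `T` and a `T`-algebra
`C`. -/
def changeBase (R : Type uR) (T : Type uS) (C : Type uA) [CommRing R] [CommRing T] [Ring C]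
    [Algebra R T] [Algebra R C] [Algebra T C] [IsScalarTower R T C] (m : ℕ) :
    (⨂[R] _ : Fin m, C) →ₐ[R] ⨂[T] _ : Fin m, C :=
  PiTensorProduct.liftAlgHom ((PiTensorProduct.tprod T).restrictScalars R)
    rfl (fun x y => (PiTensorProduct.tprod_mul_tprod x y).symm)

variable {T : Type uS} {C : Type uA} [CommRing T] [Ring C] [Algebra T C]

/-- If `C ⊗_T T' ≅ End_{T'}(V)` via `θ`, the induced action of `C ⊗_T ⋯ ⊗_T C` on
`V ⊗_{T'} ⋯ ⊗_{T'} V`. -/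
def tensorAction {T' V : Type uS} [CommRing T'] [Algebra T T'] [AddCommGroup V] [Module T' V]
    [Module T V] [IsScalarTower T T' V] (θ : T' ⊗[T] C ≃ₐ[T'] Module.End T' V) (m : ℕ) :
    (⨂[T] _ : Fin m, C) →ₗ[T] Module.End T' (⨂[T'] _ : Fin m, V) :=
  PiTensorProduct.lift
    (((PiTensorProduct.mapMultilinear T' (fun _ : Fin m => V) (fun _ => V)).restrictScalars
      T).compLinearMap fun _ => (θ.toLinearMap.restrictScalars T) ∘ₗ
        (Algebra.TensorProduct.includeRight (R := T) (A := T') (B := C)).toLinearMap)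

/-- The natural map `V ⊗ ⋯ ⊗ V → ⋀^m V`. -/
def toExteriorPower (T' V : Type uS) [CommRing T'] [AddCommGroup V] [Module T' V] (m : ℕ) :
    (⨂[T'] _ : Fin m, V) →ₗ[T'] ⋀[T']^m V :=
  PiTensorProduct.lift (exteriorPower.ιMulti T' m).toMultilinearMap

/-- For an Azumaya algebra `C/T` of degree `m`: the idempotent `f ∈ C ⊗_T ⋯ ⊗_T C` (`m` factors) is
associated to the `m`-th exterior power, that is, whenever `C ⊗_T T' ≅ End_{T'}(V)`, it acts on
`V ⊗ ⋯ ⊗ V` as a projection with the same kernel as `V ⊗ ⋯ ⊗ V → ⋀^m V`. -/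
def IsExteriorIdempotent (m : ℕ) (f : ⨂[T] _ : Fin m, C) : Prop :=
  IsIdempotentElem f ∧
    ∀ (T' V : Type uS) [CommRing T'] [Algebra T T'] [AddCommGroup V] [Module T' V] [Module T V]
      [IsScalarTower T T' V] [Module.Finite T' V] [Module.Projective T' V]
      (θ : T' ⊗[T] C ≃ₐ[T'] Module.End T' V),
      LinearMap.ker (tensorAction θ m f) = LinearMap.ker (toExteriorPower T' V m)

variable {R : Type uR} {S : Type uS} {A : Type uA} [CommRing R] [CommRing S] [Algebra R S]
  [Ring A] [Algebra R A]

/-- The centralizer in `A` of a subring `S'` of `S`, where `S` maps to `A` by `ι`. -/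
def relCentralizer (ι : S →ₐ[R] A) (S' : Subalgebra R S) : Subalgebra R A :=
  Subalgebra.centralizer R (ι '' (S' : Set S))

/-- The map from `S'` to its centralizer. -/
def toRelCentralizer (ι : S →ₐ[R] A) (S' : Subalgebra R S) : S' →ₐ[R] relCentralizer ι S' :=
  (ι.comp S'.val).codRestrict _ (by
    rintro s _ ⟨t, -, rfl⟩
    change ι t * ι (s : S) = ι (s : S) * ι t
    rw [← map_mul, mul_comm, map_mul])

instance (ι : S →ₐ[R] A) (S' : Subalgebra R S) : Algebra S' (relCentralizer ι S') :=
  (toRelCentralizer ι S').toRingHom.toAlgebra' (fun s x => Subtype.ext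
    (x.2 (ι (s : S)) ⟨s, s.2, rfl⟩))

instance (ι : S →ₐ[R] A) (S' : Subalgebra R S) : IsScalarTower R S' (relCentralizer ι S') :=
  IsScalarTower.of_algebraMap_eq fun r => ((toRelCentralizer ι S').commutes r).symm

/-- `g` is an idempotent `e_{m,S'}` of `A ⊗_R ⋯ ⊗_R A` (`m` factors). Let `e'` be the idempotent
associated to `S ⊗_R ⋯ ⊗_R S → S ⊗_{S'} ⋯ ⊗_{S'} S` and let `B` be the centralizer of `S'` in `A`.
Then `g` lies in the corner `e' (A ⊗_R ⋯ ⊗_R A) e'`, comes from `b ∈ B ⊗_R ⋯ ⊗_R B`, and corresponds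
to an idempotent of `B ⊗_{S'} ⋯ ⊗_{S'} B` associated to the `m`-th exterior power. -/
structure IsPowerIdempotent (ι : S →ₐ[R] A) (S' : Subalgebra R S) (m : ℕ)
    (g : ⨂[R] _ : Fin m, A) : Prop where
  idem : IsIdempotentElem g
  exists_eq : ∃ (e' : ⨂[R] _ : Fin m, S) (b : ⨂[R] _ : Fin m, relCentralizer ι S'),
    IsAssociatedIdempotent (changeBase R S' S m).toRingHom e' ∧
    PiTensorProduct.map (fun _ : Fin m => ι.toLinearMap) e' * g = g ∧
    g * PiTensorProduct.map (fun _ : Fin m => ι.toLinearMap) e' = g ∧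
    PiTensorProduct.map (fun _ : Fin m => (relCentralizer ι S').val.toLinearMap) b = g ∧
    IsExteriorIdempotent m (changeBase R S' (relCentralizer ι S') m b)

end Power

end

end AlmostCyclic

open AlmostCyclic

/-! Everything is graded by the Galois group. Coordinates `x a`, `y a` of S/R with Σ σ^h(x a) σ^g(y
a) equal to 1 or 0 according as h ≡ g or not split every R-algebra over S into components of degree
h, on which z s = σ^h(s) z; the projection is z ↦ Σ σ^h(x a) z (y a). In Δ(S/R, σ, J, φ) each degree
contains elements w with companions w' of the opposite degree and Σ w w' = 1, because the values of
φ generate the unit ideal. A homomorphism out of Δ is therefore controlled in degree zero, which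
gives the recognition principle `Delta.exists_algEquiv`: an algebra in which S is its own
centralizer, with an image of J satisfying the relations, is Δ. Both parts exhibit such data in a
corner. That S embeds in Δ (`Delta.ofBase_injective`) rests on the equivariance of φ and on the
switch of J ⊗ J being the identity for invertible J.

Products: the idempotent e makes the two actions of S agree, so e(xt ⊗ yt) is balanced and defines
the image of I ⊗ J. An element of the corner that commutes with S commutes with S ⊗ S, hence comes
from S ⊗ S, which e cuts down to S.

Powers: the centralizer D of S' is a crossed algebra for S/S' and σ^k. It has a symmetric trace with
dual bases d, d', and γ = Σ d ⊗ d' acts as the transposition on the tensor powers of every splitting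
module V (`tensorAction_γ`), since V is invertible over T' ⊗ S and the idempotent on which two
actions of S agree generates the unit two-sided ideal. So all permutations, and the antisymmetrizer,
live in the tensor power of D over S'. Let E be the diagonal idempotent, on which S in slot i acts
through σ^(ki) in slot 0. If c has trace 1 from S to S', then E c · anti is an exterior idempotent
(`Frame.isExteriorIdempotent_ext`), because the exterior power sees only the multidegrees that are
permutations. For any exterior idempotent f, the elements α = f E c and β = E · anti satisfy αβ = f
and βα = p, where p = E · anti · E c; so the corners of f and p are isomorphic.

Between two copies of E only the powers of the rotation survive. Hence p = (Σ ε^l E U^l) c, where U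
is the rotation in the E-corner, E U^m = E, U s = σ^k(s) U, and ε = (-1)^(m-1) is the sign of an
m-cycle. This p performs Galois descent from S to S': in its corner S' is its own centralizer, and U
p = ε p. The brackets E(j₀t ⊗ ⋯ ⊗ jₘ₋₁t) realize the norm tensor module, U implementing its
rotation, so the brackets of fixed elements commute with U. A product of k brackets is φ times U:
gathering the m slots into one lists all n generators in the order i + kl and costs one rotation.
That factor U is the source of the sign (`NormBracket.exists_equiv`). -/

open scoped TensorProduct
namespace AlmostCyclic
noncomputable section

/-! ### Modules whose tensor square is symmetric -/

section Swap

variable {S M Q : Type*} [CommRing S] [AddCommGroup M] [Module S M]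

/-- The switch map of `M ⊗ M` is the identity; this holds for invertible modules. -/
def IsSwap (S M : Type*) [CommRing S] [AddCommGroup M] [Module S M] : Prop :=
  ∀ x y : M, x ⊗ₜ[S] y = y ⊗ₜ[S] x

theorem isSwap_of_invertible [Module.Invertible S M] : IsSwap S M :=
  fun _ _ => Module.Invertible.tmul_comm ..

/-- A balanced biadditive map factors through the tensor product, where the switch is the identity.
This is the form in which invertibility is used throughout. -/
theorem IsSwap.symm_of_balanced (h : IsSwap S M) [AddCommGroup Q] (B : M → M → Q)
    (hl : ∀ x x' y, B (x + x') y = B x y + B x' y) (hr : ∀ x y y', B x (y + y') = B x y + B x y')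
    (hs : ∀ (s : S) x y, B (s • x) y = B x (s • y)) (x y : M) : B x y = B y x := by
  let B' : M →+ M →+ Q := AddMonoidHom.mk' (fun x => AddMonoidHom.mk' (B x) (hr x))
    (fun x x' => AddMonoidHom.ext fun y => hl x x' y)
  have := congrArg (TensorProduct.liftAddHom B' (fun s x y => hs s x y)) (h x y)
  exact this

theorem IsSwap.apply_smul (h : IsSwap S M) (f : M →ₗ[S] S) (x y : M) : f x • y = f y • x :=
  h.symm_of_balanced (fun x y => f x • y) (by simp [add_smul]) (by simp)
    (by intro s x y; simp [smul_smul, mul_comm]) x y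

/-- If f u = 1, the interchange of u and x gives x = f(x) u. -/
theorem IsSwap.injective_of_surjective (h : IsSwap S M) (f : M →ₗ[S] S)
    (hf : Function.Surjective f) : Function.Injective f := by
  rw [injective_iff_map_eq_zero]
  intro x hx
  obtain ⟨u, hu⟩ := hf 1
  have := h.apply_smul f u x
  rwa [hu, hx, one_smul, zero_smul] at this

/-- A module on which functionals can be interchanged with vectors, and whose functionals generate
the unit ideal, is invertible. -/
theorem invertible_of_apply_smul (h : ∀ (f : M →ₗ[S] S) (x y : M), f x • y = f y • x)
    (h1 : Ideal.span {s | ∃ (f : M →ₗ[S] S) (x : M), f x = s} = ⊤) : Module.Invertible S M := by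
  have hc : ∀ (f : M →ₗ[S] S) (x : M), f x ∈ LinearMap.range (contractLeft S M) := fun f x =>
    ⟨f ⊗ₜ x, contractLeft_apply f x⟩
  have hs : Function.Surjective (contractLeft S M) := by
    rw [← LinearMap.range_eq_top, ← top_le_iff, ← h1]
    refine Ideal.span_le.mpr ?_
    rintro _ ⟨f, x, rfl⟩
    exact hc f x
  refine ⟨⟨?_, hs⟩⟩
  rw [injective_iff_map_eq_zero]
  -- Scalars obtained by contraction can be interchanged between z and u. With u of contraction 1,
  -- an element z of contraction 0 must vanish.
  have key : ∀ z u : Module.Dual S M ⊗[S] M, contractLeft S M z • u = contractLeft S M u • z := by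
    intro z u
    induction z with
    | zero => simp
    | add z z' hz hz' => rw [map_add, add_smul, hz, hz', smul_add]
    | tmul f x =>
      induction u with
      | zero => simp
      | add z z' hz hz' => rw [map_add, add_smul, smul_add, hz, hz']
      | tmul g y =>
        rw [contractLeft_apply, contractLeft_apply, ← TensorProduct.tmul_smul, h f x y,
          TensorProduct.tmul_smul, TensorProduct.smul_tmul', TensorProduct.smul_tmul']
        congr 1
        ext w
        rw [LinearMap.smul_apply, LinearMap.smul_apply, smul_eq_mul, smul_eq_mul]
        have := congrArg g (h f y w)
        rw [map_smul, map_smul, smul_eq_mul, smul_eq_mul] at this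
        rw [this, mul_comm]
  intro z hz
  obtain ⟨u, hu⟩ := hs 1
  have := key u z
  rwa [hu, hz, one_smul, zero_smul] at this

end Swap

/-! ### Norm tensors -/

section NormTensor

variable {R S J K Q : Type*} [CommRing R] [CommRing S] [Algebra R S]
  [AddCommGroup J] [Module S J] [AddCommGroup K] [Module S K] {σ : S ≃ₐ[R] S} {n : ℕ}

theorem normTensor_induction {P : NormTensor σ n J → Prop}
    (hp : ∀ (s : S) (j : Fin n → J), P (s • pureTensor σ j)) (ha : ∀ x y, P x → P y → P (x + y))
    (x : NormTensor σ n J) : P x := by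
  induction x using PiTensorProduct.induction_on with
  | smul_tprod r f => exact hp r _
  | add x y hx hy => exact ha x y hx hy

/-- Additive in each variable, and `σ ^ i`-semilinear in the variable `i`. -/
structure IsTwisted (σ : S ≃ₐ[R] S) [AddCommGroup Q] [Module S Q] (Θ : (Fin n → K) → Q) :
    Prop where
  map_add : ∀ (x : Fin n → K) (i : Fin n) (a b : K), Θ (Function.update x i (a + b)) =
    Θ (Function.update x i a) + Θ (Function.update x i b)
  map_smul : ∀ (x : Fin n → K) (i : Fin n) (s : S) (a : K), Θ (Function.update x i (s • a)) =
    (σ ^ (i : ℕ)) s • Θ (Function.update x i a)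

theorem isTwisted_pureTensor : IsTwisted σ (pureTensor σ : (Fin n → J) → _) :=
  ⟨fun x i a b => pureTensor_update_add σ x i a b, fun x i s a => pureTensor_update_smul σ x i s a⟩

section

variable [AddCommGroup Q] [Module S Q]

theorem IsTwisted.comp {Q' : Type*} [AddCommGroup Q'] [Module S Q'] {Θ : (Fin n → K) → Q}
    (h : IsTwisted σ Θ) (f : Q →ₗ[S] Q') : IsTwisted σ (fun x => f (Θ x)) :=
  ⟨fun x i a b => by rw [h.map_add, _root_.map_add],
    fun x i s a => by rw [h.map_smul, _root_.map_smul]⟩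

/-- The linear map on the norm tensor module defined by a twisted multilinear map. -/
def IsTwisted.lift {Θ : (Fin n → K) → Q} (h : IsTwisted σ Θ) : NormTensor σ n K →ₗ[S] Q :=
  PiTensorProduct.lift (MultilinearMap.mk'
    (fun j : (i : Fin n) → Twist (σ ^ (i : ℕ)) K =>
      Θ (fun i : Fin n => (Twist.of (σ ^ (i : ℕ))).symm (j i)))
    (fun j i x y => by simp only [of_symm_update, _root_.map_add, h.map_add])
    (fun j i s x => by
      have hs : (Twist.of (σ ^ (i : ℕ))).symm (s • x) =
        (σ ^ (i : ℕ)).symm s • (Twist.of (σ ^ (i : ℕ))).symm x := rfl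
      simp only [of_symm_update, hs, h.map_smul, AlgEquiv.apply_symm_apply]))

theorem IsTwisted.lift_pureTensor {Θ : (Fin n → K) → Q} (h : IsTwisted σ Θ) (x : Fin n → K) :
    h.lift (pureTensor σ x) = Θ x :=
  PiTensorProduct.lift.tprod _

/-- Interchanging the entries of two pure tensors in one slot. -/
theorem IsTwisted.swap_slot (hK : IsSwap S K) {Q' Q'' : Type*} [AddCommGroup Q'] [Module S Q']
    [AddCommGroup Q''] [Module S Q''] {Θ : (Fin n → K) → Q} {Θ' : (Fin n → K) → Q'}
    (h : IsTwisted σ Θ) (h' : IsTwisted σ Θ') (B : Q →ₗ[S] Q' →ₗ[S] Q'') (x y : Fin n → K)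
    (i : Fin n) :
    B (Θ x) (Θ' y) = B (Θ (Function.update x i (y i))) (Θ' (Function.update y i (x i))) := by
  have := hK.symm_of_balanced
    (fun a b => B (Θ (Function.update x i a)) (Θ' (Function.update y i b)))
    (by intro a b c; simp only [h.map_add, _root_.map_add, LinearMap.add_apply])
    (by intro a b c; simp only [h'.map_add, _root_.map_add])
    (by intro s a b; simp only [h.map_smul, h'.map_smul, _root_.map_smul, LinearMap.smul_apply])
    (x i) (y i)
  simpa only [Function.update_eq_self] using this

/-- The slots are exchanged one at a time. All slots together give the symmetry of the norm tensor
module; a proper subset is needed to compare words in the generators. -/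
theorem IsTwisted.swap_piecewise (hK : IsSwap S K) {Q' Q'' : Type*} [AddCommGroup Q']
    [Module S Q'] [AddCommGroup Q''] [Module S Q''] {Θ : (Fin n → K) → Q} {Θ' : (Fin n → K) → Q'}
    (h : IsTwisted σ Θ) (h' : IsTwisted σ Θ') (B : Q →ₗ[S] Q' →ₗ[S] Q'') (x y : Fin n → K)
    (s : Finset (Fin n)) : B (Θ x) (Θ' y) = B (Θ (s.piecewise y x)) (Θ' (s.piecewise x y)) := by
  induction s using Finset.induction with
  | empty => simp
  | insert i s hi ih =>
    rw [ih, h.swap_slot hK h' B _ _ i, Finset.piecewise_insert, Finset.piecewise_insert]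
    simp [hi]

end

theorem IsSwap.normTensor (hJ : IsSwap S J) : IsSwap S (NormTensor σ n J) := by
  intro x y
  induction x using normTensor_induction with
  | ha x x' hx hx' => rw [TensorProduct.add_tmul, hx, hx', TensorProduct.tmul_add]
  | hp s j =>
    induction y using normTensor_induction with
    | ha x x' hx hx' => rw [TensorProduct.tmul_add, hx, hx', TensorProduct.add_tmul]
    | hp t l =>
      have := (isTwisted_pureTensor (σ := σ) (n := n) (J := J)).swap_piecewise hJ
        isTwisted_pureTensor (TensorProduct.mk S _ _) j l Finset.univ
      simp only [TensorProduct.mk_apply, Finset.piecewise_univ] at this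
      rw [TensorProduct.smul_tmul_smul, TensorProduct.smul_tmul_smul, this, mul_comm]

/-- A twisted multilinear form which is equivariant under rotation and whose values generate the
unit ideal defines a trivialization. -/
theorem exists_normTrivialization (hK : IsSwap S K) (hσ : σ ^ n = 1) {Θ : (Fin n → K) → S}
    (h : IsTwisted σ Θ) (h1 : Ideal.span (Set.range Θ) = ⊤)
    (hr : ∀ x, Θ (x ∘ (finRotate n).symm) = σ (Θ x)) :
    ∃ θ : NormTrivialization σ n K hσ, ∀ x, θ.equiv (pureTensor σ x) = Θ x := by
  have hs : Function.Surjective h.lift := by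
    rw [← LinearMap.range_eq_top, ← top_le_iff, ← h1]
    refine Ideal.span_le.mpr ?_
    rintro _ ⟨x, rfl⟩
    exact ⟨_, h.lift_pureTensor x⟩
  -- Injectivity costs nothing: the norm tensor module is again symmetric, and a surjective
  -- functional on such a module is injective.
  refine ⟨⟨LinearEquiv.ofBijective h.lift ⟨hK.normTensor.injective_of_surjective _ hs, hs⟩,
    fun x => ?_⟩, fun x => h.lift_pureTensor x⟩
  change h.lift _ = σ (h.lift x)
  induction x using normTensor_induction with
  | ha x y hx hy => rw [map_add, map_add, map_add, map_add, hx, hy]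
  | hp s j =>
    rw [rotation_smul, map_smul, rotation_pureTensor, h.lift_pureTensor, map_smul, smul_eq_mul,
      smul_eq_mul, map_mul, h.lift_pureTensor, hr]

/-! ### Trivializations as twisted multilinear forms -/

section Trivialization

variable {hσ : σ ^ n = 1} (φ : NormTrivialization σ n J hσ)

/-- The value of a trivialization on a pure tensor. -/
def NormTrivialization.val (x : Fin n → J) : S := φ.equiv (pureTensor σ x)

theorem NormTrivialization.isTwisted : IsTwisted σ φ.val :=
  isTwisted_pureTensor.comp φ.equiv.toLinearMap

theorem NormTrivialization.val_rotate (x : Fin n → J) :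
    φ.val (x ∘ (finRotate n).symm) = σ (φ.val x) := by
  rw [NormTrivialization.val, ← rotation_pureTensor σ n hσ, φ.equivariant]; rfl

/-- The preimage of 1 is a combination of pure tensors, so 1 is a combination of values. -/
theorem NormTrivialization.span_val : Ideal.span (Set.range φ.val) = ⊤ := by
  rw [Ideal.eq_top_iff_one]
  have h : ∀ z : NormTensor σ n J, φ.equiv z ∈ Ideal.span (Set.range φ.val) := by
    intro z
    induction z using normTensor_induction with
    | ha x y hx hy => rw [map_add]; exact add_mem hx hy
    | hp s j =>
      rw [map_smul]
      exact Ideal.mul_mem_left _ _ (Ideal.subset_span ⟨j, rfl⟩)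
  simpa using h (φ.equiv.symm 1)

end Trivialization

end NormTensor

end
end AlmostCyclic

namespace AlmostCyclic
noncomputable section

/-! ### Galois coordinates -/

section Coords

variable {R S : Type*} [CommRing R] [CommRing S] [Algebra R S]

theorem pow_eq_pow_of_modEq {G : Type*} [Monoid G] {g : G} {n : ℕ} (h : g ^ n = 1) {i j : ℕ}
    (hij : i ≡ j [MOD n]) : g ^ i = g ^ j := by
  rw [pow_eq_pow_mod i h, pow_eq_pow_mod j h, hij]

theorem sum_range_mul {M : Type*} [AddCommMonoid M] (f : ℕ → M) (m k : ℕ) :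
    ∑ p ∈ Finset.range (m * k), f p =
      ∑ l ∈ Finset.range m, ∑ i ∈ Finset.range k, f (i + k * l) := by
  induction m with
  | zero => simp
  | succ m ih =>
    rw [Nat.succ_mul, Finset.sum_range_add, ih, Finset.sum_range_succ]
    congr 1
    exact Finset.sum_congr rfl fun i _ => by rw [add_comm, mul_comm]

theorem sum_modEq_eq {n : ℕ} {M : Type*} [AddCommMonoid M] (hn : 0 < n) (f : ℕ → M) (g : ℕ)
    (hf : ∀ i j, i ≡ j [MOD n] → f i = f j) :
    (∑ i ∈ Finset.range n, if i ≡ g [MOD n] then f i else 0) = f g := by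
  have : ∀ i ∈ Finset.range n, (if i ≡ g [MOD n] then f i else 0) =
      if i = g % n then f i else 0 := by
    intro i hi
    have : i ≡ g [MOD n] ↔ i = g % n := by
      rw [Nat.ModEq, Nat.mod_eq_of_lt (Finset.mem_range.mp hi)]
    simp only [this]
  rw [Finset.sum_congr rfl this, Finset.sum_ite_eq' (Finset.range n) (g % n) f,
    if_pos (Finset.mem_range.mpr (Nat.mod_lt _ hn))]
  exact hf _ _ (Nat.mod_modEq g n)

theorem sum_range_pow_apply {n : ℕ} {σ : S ≃ₐ[R] S} (hσ : σ ^ n = 1) (s : S) :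
    ∑ i ∈ Finset.range n, (σ ^ i) (σ s) = ∑ i ∈ Finset.range n, (σ ^ i) s := by
  have h1 : ∀ i, (σ ^ i) (σ s) = (σ ^ (i + 1)) s := fun i => by rw [pow_succ]; rfl
  simp_rw [h1]
  have h2 := Finset.sum_range_succ (fun i => (σ ^ i) s) n
  rw [Finset.sum_range_succ'] at h2
  have h3 : (σ ^ n) s = (σ ^ 0) s := by rw [hσ, pow_zero]
  rw [h3] at h2
  exact add_right_cancel h2

/-- Coordinates `x`, `y` for a cyclic Galois extension, its trace, and an element of trace `1`. -/
structure GaloisCoords (R : Type*) {S : Type*} [CommRing R] [CommRing S] [Algebra R S]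
    (n : ℕ) (σ : S ≃ₐ[R] S) where
  pos : 0 < n
  pow : σ ^ n = 1
  inj : Function.Injective (algebraMap R S)
  N : ℕ
  x : Fin N → S
  y : Fin N → S
  orth : ∀ h g : ℕ, ∑ a, (σ ^ h) (x a) * (σ ^ g) (y a) = if h ≡ g [MOD n] then 1 else 0
  fixed : ∀ s, σ s = s → ∃ r, algebraMap R S r = s
  tr : S →ₗ[R] R
  algebraMap_tr : ∀ s, algebraMap R S (tr s) = ∑ i ∈ Finset.range n, (σ ^ i) s
  c : S
  tr_c : tr c = 1

namespace GaloisCoords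

variable {n : ℕ} {σ : S ≃ₐ[R] S}

/-- The relations for the pairs (0, h) suffice, since σ^h carries them to all others. Traces are
fixed by σ, hence come from R, and the injectivity of R → S makes their choice linear. -/
theorem exists_of (pos : 0 < n) (pow : σ ^ n = 1) (inj : Function.Injective (algebraMap R S))
    {N : ℕ} (x y : Fin N → S)
    (orth : ∀ h : ℕ, ∑ a, x a * (σ ^ h) (y a) = if n ∣ h then 1 else 0)
    (fixed : ∀ s, σ s = s → ∃ r, algebraMap R S r = s)
    (hc : ∃ c : S, ∑ i ∈ Finset.range n, (σ ^ i) c = 1) :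
    ∃ G : GaloisCoords R n σ, ∃ h : G.N = N, ∀ a, G.x a = x (Fin.cast h a) ∧
      G.y a = y (Fin.cast h a) := by
  have hfix : ∀ s, ∃ r, algebraMap R S r = ∑ i ∈ Finset.range n, (σ ^ i) s := fun s => by
    apply fixed
    rw [map_sum, ← sum_range_pow_apply pow]
    refine Finset.sum_congr rfl fun i _ => ?_
    rw [← AlgEquiv.mul_apply, ← AlgEquiv.mul_apply, ← pow_succ, ← pow_succ']
  choose t ht using hfix
  obtain ⟨c, hc⟩ := hc
  refine ⟨{ pos := pos, pow := pow, inj := inj, N := N, x := x, y := y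
            orth := fun h g => ?_
            fixed := fixed
            tr := { toFun := t
                    map_add' := fun a b => inj ?_
                    map_smul' := fun r a => inj ?_ }
            algebraMap_tr := ht
            c := c
            tr_c := inj ?_ }, rfl, fun a => ⟨rfl, rfl⟩⟩
  · obtain ⟨d, hd⟩ : ∃ d, h + d ≡ g [MOD n] := by
      -- This is g - h modulo n, written without subtracting h.
      refine ⟨g + h * (n - 1), ?_⟩
      have : h + (g + h * (n - 1)) = g + h * n := by
        obtain ⟨n', rfl⟩ := Nat.exists_eq_succ_of_ne_zero pos.ne'
        rw [Nat.succ_sub_one, Nat.mul_succ]; ring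
      rw [this]
      exact Nat.add_mul_mod_self_right g h n
    rw [← pow_eq_pow_of_modEq pow hd, pow_add]
    simp_rw [AlgEquiv.mul_apply, ← map_mul]
    rw [← map_sum, orth]
    have : n ∣ d ↔ h ≡ g [MOD n] := by
      rw [← Nat.modEq_zero_iff_dvd]
      constructor
      · intro h0
        exact ((h0.add_left h).symm.trans hd)
      · intro h0
        exact (Nat.ModEq.add_left_cancel' h (hd.trans h0.symm))
    simp only [this]
    split_ifs <;> simp
  · rw [map_add, ht, ht, ht, ← Finset.sum_add_distrib]
    simp
  · rw [ht, RingHom.id_apply, smul_eq_mul, map_mul, ht, Finset.mul_sum]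
    refine Finset.sum_congr rfl fun i _ => ?_
    rw [map_smul, Algebra.smul_def]
  · rw [map_one]
    exact (ht c).trans hc

variable (G : GaloisCoords R n σ)

theorem modEq (G : GaloisCoords R n σ) (i j : ℕ) (h : i ≡ j [MOD n]) (s : S) :
    (σ ^ i) s = (σ ^ j) s := by
  rw [pow_eq_pow_of_modEq G.pow h]

theorem tr_apply (s : S) : G.tr (σ s) = G.tr s := by
  apply G.inj
  rw [G.algebraMap_tr, G.algebraMap_tr, sum_range_pow_apply G.pow]

theorem tr_pow_apply (i : ℕ) (s : S) : G.tr ((σ ^ i) s) = G.tr s := by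
  induction i with
  | zero => rfl
  | succ i ih => rw [pow_succ', AlgEquiv.mul_apply, G.tr_apply, ih]

/-- Expanding the trace, orthogonality keeps only the conjugate with i ≡ g. For g = 0 this says that
x and y are dual bases for the trace form. -/
theorem sum_orth (s : S) (g : ℕ) :
    ∑ a, algebraMap R S (G.tr (s * G.x a)) * (σ ^ g) (G.y a) = (σ ^ g) s := by
  simp_rw [G.algebraMap_tr, Finset.sum_mul]
  rw [Finset.sum_comm]
  simp_rw [map_mul, mul_assoc, ← Finset.mul_sum, G.orth, mul_ite, mul_one, mul_zero]
  exact sum_modEq_eq G.pos (fun i => (σ ^ i) s) g fun i j h => G.modEq i j h s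

theorem sum_orth' (s : S) (g : ℕ) :
    ∑ a, algebraMap R S (G.tr (s * G.y a)) * (σ ^ g) (G.x a) = (σ ^ g) s := by
  simp_rw [G.algebraMap_tr, Finset.sum_mul]
  rw [Finset.sum_comm]
  simp_rw [map_mul, mul_assoc, ← Finset.mul_sum, mul_comm _ ((σ ^ g) _), G.orth, mul_ite,
    mul_one, mul_zero, Nat.ModEq.comm (n := n) (a := g)]
  exact sum_modEq_eq G.pos (fun i => (σ ^ i) s) g fun i j h => G.modEq i j h s

theorem sum_tr_smul_y (s : S) : ∑ a, G.tr (s * G.x a) • G.y a = s := by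
  simp_rw [Algebra.smul_def]
  exact G.sum_orth s 0

theorem sum_tr_smul_x (s : S) : ∑ a, G.tr (s * G.y a) • G.x a = s := by
  simp_rw [Algebra.smul_def]
  exact G.sum_orth' s 0

theorem sum_mul_self : ∑ a, G.x a * G.y a = 1 := by
  have := G.orth 0 0
  rwa [if_pos (Nat.ModEq.refl _)] at this

/-- The separability element `∑ x a ⊗ y a` is central. -/
theorem sum_central {M : Type*} [AddCommGroup M] [Module R M] (B : S →ₗ[R] S →ₗ[R] M) (s : S) :
    ∑ a, B (s * G.x a) (G.y a) = ∑ a, B (G.x a) (s * G.y a) := by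
  have h1 : ∀ a, B (s * G.x a) (G.y a) =
      ∑ b, G.tr (s * G.x a * G.y b) • B (G.x b) (G.y a) := fun a => by
    conv_lhs => rw [← G.sum_tr_smul_x (s * G.x a)]
    simp
  have h2 : ∀ b, B (G.x b) (s * G.y b) =
      ∑ a, G.tr (s * G.y b * G.x a) • B (G.x b) (G.y a) := fun b => by
    conv_lhs => rw [← G.sum_tr_smul_y (s * G.y b)]
    simp
  simp_rw [h1, h2]
  rw [Finset.sum_comm]
  refine Finset.sum_congr rfl fun b _ => Finset.sum_congr rfl fun a _ => ?_
  rw [mul_right_comm]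

/-- The coefficient of σ^g in an endomorphism u is Σ u(x a) σ^g(y a); this formula gives both the
uniqueness and the existence of the coefficients. -/
theorem isCyclicGalois (G : GaloisCoords R n σ) : IsCyclicGalois R S n σ where
  pos := G.pos
  pow_eq_one := G.pow
  injective := G.inj
  finite := Module.Finite.of_surjective (Fintype.linearCombination R G.x) fun s =>
    ⟨fun a => G.tr (s * G.y a), by simp [Fintype.linearCombination_apply, G.sum_tr_smul_x]⟩
  projective := by
    refine Module.Projective.of_split
      (LinearMap.pi fun a => G.tr ∘ₗ LinearMap.mulRight R (G.y a))
      (Fintype.linearCombination R G.x) ?_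
    ext s
    simp [Fintype.linearCombination_apply, G.sum_tr_smul_x]
  bijective := by
    constructor
    · have key : ∀ (c : Fin n → S) (g : Fin n),
          c g = ∑ a, (∑ i, c i * (σ ^ (i : ℕ)) (G.x a)) * (σ ^ (g : ℕ)) (G.y a) := fun c g => by
        simp_rw [Finset.sum_mul]
        rw [Finset.sum_comm]
        simp_rw [mul_assoc, ← Finset.mul_sum, G.orth]
        rw [Finset.sum_eq_single g]
        · rw [if_pos (Nat.ModEq.refl _), mul_one]
        · intro i _ hi
          rw [if_neg, mul_zero]
          intro h
          exact hi (Fin.ext (Nat.ModEq.eq_of_lt_of_lt h i.2 g.2))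
        · simp
      intro c d hcd
      have h : ∀ s, ∑ i, c i * (σ ^ (i : ℕ)) s = ∑ i, d i * (σ ^ (i : ℕ)) s := fun s => by
        simpa using LinearMap.congr_fun hcd s
      funext g
      rw [key c g, key d g]
      simp_rw [h]
    · intro u
      refine ⟨fun i => ∑ a, u (G.x a) * (σ ^ (i : ℕ)) (G.y a), ?_⟩
      ext s
      have h : u s = ∑ a, u (G.x a) * algebraMap R S (G.tr (s * G.y a)) := by
        conv_lhs => rw [← G.sum_tr_smul_x s, map_sum]
        exact Finset.sum_congr rfl fun a _ => by rw [map_smul, Algebra.smul_def, mul_comm]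
      rw [h]
      simp_rw [G.algebraMap_tr, Finset.mul_sum]
      rw [Finset.sum_comm, Finset.sum_range]
      simp only [LinearMap.coe_sum, Finset.sum_apply, LinearMap.comp_apply,
        LinearMap.mulLeft_apply, AlgEquiv.toLinearMap_apply, map_mul, Finset.sum_mul]
      exact Finset.sum_congr rfl fun i _ => Finset.sum_congr rfl fun a _ => by ring

end GaloisCoords

/-- A dual basis x, ξ of the projective R-module S becomes a system of coordinates. As an
endomorphism of S, each ξ a has values in R and is unchanged by composition with σ, so its
coefficients in the twisted group ring are the conjugates of a single y a, that is, ξ a is the trace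
of multiplication by y a. Comparing coefficients in id = Σ ξ a(·) x a gives the orthogonality
relations. -/
theorem IsCyclicGalois.exists_coords {n : ℕ} {σ : S ≃ₐ[R] S} (H : IsCyclicGalois R S n σ) :
    Nonempty (GaloisCoords R n σ) := by
  have := H.finite
  have := H.projective
  have hpow := H.pow_eq_one
  obtain ⟨N, f, hf⟩ := Module.Finite.exists_fin' R S
  obtain ⟨g, hg⟩ := Module.projective_lifting_property f LinearMap.id hf
  let x : Fin N → S := fun a => f (Pi.single a 1)
  let ξ : Fin N → S →ₗ[R] R := fun a => LinearMap.proj a ∘ₗ g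
  have hx : ∀ s, ∑ a, ξ a s • x a = s := fun s => by
    have h1 : f (g s) = s := LinearMap.congr_fun hg s
    conv_rhs => rw [← h1, ← Finset.univ_sum_single (g s), map_sum]
    refine Finset.sum_congr rfl fun a _ => ?_
    change g s a • f (Pi.single a 1) = _
    rw [← map_smul]
    congr 1
    ext b
    simp [Pi.single_apply]
  -- The ideal 𝔞 of the values of ξ satisfies S = 𝔞 S. By Nakayama some r ≡ 1 modulo 𝔞 kills S, and
  -- r = 0 because R embeds in S.
  have hone : Ideal.span {r | ∃ a s, ξ a s = r} = ⊤ := by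
    obtain ⟨r, hr, h0⟩ := Submodule.exists_sub_one_mem_and_smul_eq_zero_of_fg_of_le_smul
      (Ideal.span {r | ∃ a s, ξ a s = r}) (⊤ : Submodule R S) Module.Finite.fg_top (by
        intro s _
        rw [← hx s]
        exact sum_mem fun a _ => Submodule.smul_mem_smul (Ideal.subset_span ⟨a, s, rfl⟩) trivial)
    have : r = 0 := H.injective (by
      have := h0 1 trivial
      rwa [Algebra.smul_def, mul_one, ← map_zero (algebraMap R S)] at this)
    rw [this, zero_sub, neg_mem_iff] at hr
    exact (Ideal.eq_top_iff_one _).mpr hr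
  have hfun : ∀ a, ∃ y : S, ∀ s, algebraMap R S (ξ a s) =
      ∑ i ∈ Finset.range n, (σ ^ i) (y * s) := fun a => by
    obtain ⟨c, hc⟩ := H.bijective.2 (Algebra.linearMap R S ∘ₗ ξ a)
    have hc' : ∀ s, ∑ i, c i * (σ ^ (i : ℕ)) s = algebraMap R S (ξ a s) := fun s => by
      simpa using LinearMap.congr_fun hc s
    have hrot : (fun i => σ (c ((finRotate n).symm i))) = c := by
      apply H.bijective.1
      refine Eq.trans ?_ hc.symm
      ext s
      change _ = algebraMap R S (ξ a s)
      rw [← AlgEquiv.commutes σ, ← hc', map_sum]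
      simp only [LinearMap.coe_sum, Finset.sum_apply, LinearMap.comp_apply,
        LinearMap.mulLeft_apply, map_mul]
      conv_lhs => rw [← Equiv.sum_comp (finRotate n)]
      simp only [Equiv.symm_apply_apply]
      refine Finset.sum_congr rfl fun i _ => ?_
      rw [pow_finRotate hpow]; rfl
    have hci : ∀ (i : ℕ) (hi : i < n), c ⟨i, hi⟩ = (σ ^ i) (c ⟨0, H.pos⟩) := by
      intro i
      induction i with
      | zero => intro _; rfl
      | succ i ih =>
        intro hi
        rw [pow_succ', AlgEquiv.mul_apply, ← ih (by omega)]
        have h1 := congrFun hrot (finRotate n ⟨i, by omega⟩)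
        simp only [Equiv.symm_apply_apply] at h1
        rw [h1]
        congr 1
        obtain ⟨n', rfl⟩ := Nat.exists_eq_succ_of_ne_zero H.pos.ne'
        exact (finRotate_of_lt (by omega)).symm
    refine ⟨c ⟨0, H.pos⟩, fun s => ?_⟩
    rw [← hc', Finset.sum_range]
    refine Finset.sum_congr rfl fun i _ => ?_
    rw [map_mul, ← hci i i.2]
  choose y hy using hfun
  have horth : ∀ h : ℕ, ∑ a, x a * (σ ^ h) (y a) = if n ∣ h then 1 else 0 := by
    have h1 : (fun i : Fin n => ∑ a, x a * (σ ^ (i : ℕ)) (y a)) = Pi.single ⟨0, H.pos⟩ 1 := by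
      apply H.bijective.1
      ext s
      have h2 := hx s
      simp_rw [Algebra.smul_def, hy, Finset.sum_range, Finset.sum_mul] at h2
      rw [Finset.sum_comm] at h2
      have h3 : ∀ i : Fin n, (Pi.single (⟨0, H.pos⟩ : Fin n) (1 : S) : Fin n → S) i *
          (σ ^ (i : ℕ)) s = if i = ⟨0, H.pos⟩ then s else 0 := fun i => by
        by_cases hi : i = ⟨0, H.pos⟩
        · subst hi; simp
        · simp [hi]
      simp only [LinearMap.coe_sum, Finset.sum_apply, LinearMap.comp_apply,
        LinearMap.mulLeft_apply, AlgEquiv.toLinearMap_apply, h3]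
      rw [Finset.sum_ite_eq' Finset.univ, if_pos (Finset.mem_univ _)]
      refine Eq.trans ?_ h2
      refine Finset.sum_congr rfl fun i _ => ?_
      rw [Finset.sum_mul]
      refine Finset.sum_congr rfl fun a _ => ?_
      rw [map_mul]; ring
    intro h
    rw [pow_eq_pow_mod h hpow]
    refine (congrFun h1 ⟨h % n, Nat.mod_lt _ H.pos⟩).trans ?_
    by_cases hd : n ∣ h
    · rw [if_pos hd]
      have : (⟨h % n, Nat.mod_lt _ H.pos⟩ : Fin n) = ⟨0, H.pos⟩ :=
        Fin.ext (Nat.mod_eq_zero_of_dvd hd)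
      rw [this, Pi.single_eq_same]
    · rw [if_neg hd]
      refine Pi.single_eq_of_ne (fun hh => hd ?_) _
      exact Nat.dvd_of_mod_eq_zero (Fin.ext_iff.mp hh)
  have hfixed : ∀ s, σ s = s → ∃ r, algebraMap R S r = s := by
    intro s hs
    have hpows : ∀ i : ℕ, (σ ^ i) s = s := fun i => by
      induction i with
      | zero => rfl
      | succ i ih => rw [pow_succ, AlgEquiv.mul_apply, hs, ih]
    -- Every endomorphism is a combination of powers of σ with coefficients in S, so it commutes
    -- with multiplication by a fixed element. Applied to ξ a, this puts s ξ a(u) into R, and the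
    -- values of ξ generate the unit ideal.
    have hcomm : ∀ (u : S →ₗ[R] S) (t : S), u (s * t) = s * u t := fun u t => by
      obtain ⟨c, rfl⟩ := H.bijective.2 u
      simp only [LinearMap.coe_sum, Finset.sum_apply, LinearMap.comp_apply,
        LinearMap.mulLeft_apply, AlgEquiv.toLinearMap_apply, map_mul, hpows, Finset.mul_sum]
      exact Finset.sum_congr rfl fun i _ => by ring
    have : ∀ t ∈ Ideal.span {r | ∃ a s, ξ a s = r},
        ∃ r, algebraMap R S r = s * algebraMap R S t := by
      intro t ht
      induction ht using Submodule.span_induction with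
      | mem t ht =>
        obtain ⟨a, u, rfl⟩ := ht
        exact ⟨_, hcomm (Algebra.linearMap R S ∘ₗ ξ a) u⟩
      | zero => exact ⟨0, by simp⟩
      | add t u _ _ ht hu =>
        obtain ⟨r, hr⟩ := ht
        obtain ⟨r', hr'⟩ := hu
        exact ⟨r + r', by rw [map_add, map_add, mul_add, hr, hr']⟩
      | smul q t _ ht =>
        obtain ⟨r, hr⟩ := ht
        exact ⟨q * r, by rw [smul_eq_mul, map_mul, map_mul, hr]; ring⟩
    simpa using this 1 (by rw [hone]; trivial)
  -- Each value ξ a(u) is the trace of y a · u, and the traces form an ideal of R.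
  have htrace : ∃ c : S, ∑ i ∈ Finset.range n, (σ ^ i) c = 1 := by
    have : ∀ t ∈ Ideal.span {r | ∃ a s, ξ a s = r},
        ∃ c, ∑ i ∈ Finset.range n, (σ ^ i) c = algebraMap R S t := by
      intro t ht
      induction ht using Submodule.span_induction with
      | mem t ht =>
        obtain ⟨a, u, rfl⟩ := ht
        exact ⟨_, (hy a u).symm⟩
      | zero => exact ⟨0, by simp⟩
      | add t u _ _ ht hu =>
        obtain ⟨r, hr⟩ := ht
        obtain ⟨r', hr'⟩ := hu
        exact ⟨r + r', by simp_rw [map_add, Finset.sum_add_distrib, hr, hr']⟩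
      | smul q t _ ht =>
        obtain ⟨r, hr⟩ := ht
        refine ⟨q • r, ?_⟩
        simp_rw [map_smul, ← Finset.smul_sum, hr, Algebra.smul_def]
        rw [← map_mul]; rfl
    simpa using this 1 (by rw [hone]; trivial)
  exact ⟨(GaloisCoords.exists_of H.pos hpow H.injective x y horth hfixed htrace).choose⟩

/-! ### Intermediate extensions -/

/-- `τ` as an automorphism over its fixed ring. -/
def fixedRingEquiv (τ : S ≃ₐ[R] S) : S ≃ₐ[fixedRing τ] S :=
  { τ with commutes' := fun s => s.2 }

theorem fixedRingEquiv_pow_apply (τ : S ≃ₐ[R] S) (i : ℕ) (s : S) :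
    ((fixedRingEquiv τ) ^ i) s = (τ ^ i) s := by
  induction i generalizing s with
  | zero => rfl
  | succ i ih => rw [pow_succ, pow_succ, AlgEquiv.mul_apply, AlgEquiv.mul_apply, ih]; rfl

namespace GaloisCoords

variable {n : ℕ} {σ : S ≃ₐ[R] S} {m k : ℕ}

/-- The same x and y serve over the fixed ring, as n divides kh exactly when m divides h. An element
of trace 1 over S' is the sum of the first k conjugates of one of trace 1 over R. -/
theorem exists_top (G : GaloisCoords R n σ) (hmk : m * k = n) :
    ∃ G' : GaloisCoords (fixedRing (σ ^ k)) m (fixedRingEquiv (σ ^ k)),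
    ∃ h : G'.N = G.N, ∀ a, G'.x a = G.x (Fin.cast h a) ∧ G'.y a = G.y (Fin.cast h a) := by
  have hm : 0 < m := Nat.pos_of_ne_zero (by rintro rfl; simpa [← hmk] using G.pos)
  have hk : 0 < k := Nat.pos_of_ne_zero (by rintro rfl; simpa [← hmk] using G.pos)
  refine exists_of hm ?_ Subtype.val_injective G.x G.y (fun h => ?_) (fun s hs => ⟨⟨s, hs⟩, rfl⟩)
    ⟨∑ i ∈ Finset.range k, (σ ^ i) G.c, ?_⟩
  · ext s
    rw [fixedRingEquiv_pow_apply, pow_pow_eq_one hmk G.pow]; rfl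
  · simp_rw [fixedRingEquiv_pow_apply, ← pow_mul]
    have := G.orth 0 (k * h)
    simp only [pow_zero, AlgEquiv.one_apply] at this
    rw [this]
    have : 0 ≡ k * h [MOD n] ↔ m ∣ h := by
      rw [Nat.ModEq.comm, Nat.modEq_zero_iff_dvd, ← hmk, mul_comm m k]
      exact Nat.mul_dvd_mul_iff_left hk
    simp only [this]
  · have h1 := sum_range_mul (fun p => (σ ^ p) G.c) m k
    rw [hmk] at h1
    rw [← map_one (algebraMap R S), ← G.tr_c, G.algebraMap_tr, h1]
    refine Finset.sum_congr rfl fun l _ => ?_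
    rw [map_sum]
    refine Finset.sum_congr rfl fun i _ => ?_
    rw [fixedRingEquiv_pow_apply, ← pow_mul, ← AlgEquiv.mul_apply, ← pow_add, add_comm]

/-- With tr the trace to S' and tr c' = 1, the coordinates are tr(c' x a) and tr(y a). By `key`, Σ x
a · σ^h(tr(y a)) is 1 or 0 according as k divides h or not. This persists when x a is replaced by
its conjugates under powers of σ^k; weighting by the conjugates of c' and summing gives the claim.
-/
theorem exists_bottom (G : GaloisCoords R n σ) (hmk : m * k = n) :
    Nonempty (GaloisCoords R k (fixedRingAut σ k)) := by
  obtain ⟨G', -, -⟩ := G.exists_top hmk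
  have hm : 0 < m := G'.pos
  have hk : 0 < k := Nat.pos_of_ne_zero (by rintro rfl; simpa [← hmk] using G.pos)
  have htr : ∀ s, (G'.tr s : S) = ∑ l ∈ Finset.range m, (σ ^ (k * l)) s := fun s => by
    refine (G'.algebraMap_tr s).trans ?_
    simp_rw [fixedRingEquiv_pow_apply, ← pow_mul]
  have key : ∀ h, ∑ a, G.x a * (σ ^ h) (G'.tr (G.y a) : S) = if k ∣ h then 1 else 0 := by
    intro h
    have h1 : ∀ l, ∑ a, G.x a * (σ ^ (h + k * l)) (G.y a) = if n ∣ h + k * l then 1 else 0 := by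
      intro l
      have := G.orth 0 (h + k * l)
      simp only [pow_zero, AlgEquiv.one_apply] at this
      simp only [this, Nat.ModEq.comm (a := 0), Nat.modEq_zero_iff_dvd]
    have hfix : ∀ q (s : fixedRing (σ ^ k)), (σ ^ (k * q)) (s : S) = s := fun q s => by
      induction q with
      | zero => rfl
      | succ q ih => rw [Nat.mul_succ, pow_add, AlgEquiv.mul_apply, mem_fixedRing.mp s.2, ih]
    by_cases hd : k ∣ h
    · obtain ⟨q, rfl⟩ := hd
      rw [if_pos (dvd_mul_right _ _)]
      simp_rw [hfix, htr, Finset.mul_sum]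
      rw [Finset.sum_comm, Finset.sum_eq_single 0]
      · simpa using G.sum_mul_self
      · intro l hl hl0
        have := G.orth 0 (k * l)
        simp only [pow_zero, AlgEquiv.one_apply] at this
        rw [this, if_neg]
        rw [Nat.ModEq.comm, Nat.modEq_zero_iff_dvd, ← hmk, mul_comm m k,
          Nat.mul_dvd_mul_iff_left hk]
        exact fun hml => hl0 (Nat.eq_zero_of_dvd_of_lt hml (Finset.mem_range.mp hl))
      · intro h0
        exact absurd (Finset.mem_range.mpr hm) h0
    · rw [if_neg hd]
      simp_rw [htr, map_sum, Finset.mul_sum, ← AlgEquiv.mul_apply, ← pow_add]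
      rw [Finset.sum_comm]
      refine Finset.sum_eq_zero fun l _ => ?_
      rw [h1, if_neg]
      intro hn
      exact hd ((Nat.dvd_add_left (dvd_mul_right k l)).mp ((Dvd.intro_left m hmk).trans hn))
  refine ⟨(exists_of hk (fixedRingAut_pow σ k) ?_ (fun a => G'.tr (G'.c * G.x a))
    (fun a => G'.tr (G.y a)) (fun h => Subtype.ext ?_) (fun s hs => ?_)
    ⟨G'.tr G.c, Subtype.ext ?_⟩).choose⟩
  · intro r r' hr
    exact G.inj (congrArg Subtype.val hr)
  · have h2 : ∀ l, ∑ a, (σ ^ (k * l)) (G.x a) * (σ ^ h) (G'.tr (G.y a) : S) =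
        if k ∣ h then 1 else 0 := fun l => by
      have hfix : ∀ s : fixedRing (σ ^ k), (σ ^ (k * l)) ((σ ^ h) (s : S)) = (σ ^ h) (s : S) := by
        intro s
        rw [← fixedRingAut_pow_apply]
        generalize ((fixedRingAut σ k) ^ h) s = t
        induction l with
        | zero => rfl
        | succ q ih => rw [Nat.mul_succ, pow_add, AlgEquiv.mul_apply, mem_fixedRing.mp t.2, ih]
      have := congrArg (σ ^ (k * l)) (key h)
      rw [map_sum] at this
      simp_rw [map_mul, hfix] at this
      rw [this]
      split_ifs <;> simp
    have h3 : ((∑ a, G'.tr (G'.c * G.x a) * ((fixedRingAut σ k) ^ h) (G'.tr (G.y a)) :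
        fixedRing (σ ^ k)) : S) =
        ∑ a, (G'.tr (G'.c * G.x a) : S) * (σ ^ h) (G'.tr (G.y a) : S) := by
      rw [AddSubmonoidClass.coe_finsetSum]
      refine Finset.sum_congr rfl fun a _ => ?_
      rw [MulMemClass.coe_mul, fixedRingAut_pow_apply]
    rw [h3]
    simp_rw [htr (G'.c * _), map_mul, Finset.sum_mul]
    rw [Finset.sum_comm]
    simp_rw [mul_assoc, ← Finset.mul_sum, h2, ← Finset.sum_mul, ← htr, G'.tr_c]
    split_ifs <;> simp
  · obtain ⟨r, hr⟩ := G.fixed s (congrArg Subtype.val hs)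
    exact ⟨r, Subtype.ext hr⟩
  · rw [AddSubmonoidClass.coe_finsetSum]
    simp_rw [fixedRingAut_pow_apply, htr, map_sum, ← AlgEquiv.mul_apply, ← pow_add]
    rw [Finset.sum_comm, ← sum_range_mul (fun p => (σ ^ p) G.c), hmk, ← G.algebraMap_tr, G.tr_c]
    simp

end GaloisCoords

end Coords

end
end AlmostCyclic

namespace AlmostCyclic
noncomputable section

/-! ### Homogeneous elements of algebras over a cyclic Galois extension -/

section Degree

variable {R S A B : Type*} [CommRing R] [CommRing S] [Algebra R S] [Ring A] [Algebra R A]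
  [Ring B] [Algebra R B] {n : ℕ} {σ : S ≃ₐ[R] S}

/-- `x s = σ ^ h (s) x` for all `s ∈ S`. -/
def IsDeg (ι : S →ₐ[R] A) (σ : S ≃ₐ[R] S) (h : ℕ) (x : A) : Prop :=
  ∀ s, x * ι s = ι ((σ ^ h) s) * x

/-- `s x = x σ ^ h (s)` for all `s ∈ S`. -/
def IsCodeg (ι : S →ₐ[R] A) (σ : S ≃ₐ[R] S) (h : ℕ) (x : A) : Prop :=
  ∀ s, ι s * x = x * ι ((σ ^ h) s)

variable {ι : S →ₐ[R] A}

theorem IsDeg.mul {h g : ℕ} {x y : A} (hx : IsDeg ι σ h x) (hy : IsDeg ι σ g y) :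
    IsDeg ι σ (h + g) (x * y) := fun s => by
  rw [mul_assoc, hy, ← mul_assoc, hx, mul_assoc, pow_add]; rfl

theorem isDeg_base (s : S) : IsDeg ι σ 0 (ι s) := fun t => by
  rw [← map_mul, mul_comm, map_mul]; rfl

theorem isDeg_one : IsDeg ι σ 0 (1 : A) := fun t => by simp

theorem IsDeg.codeg_mul {h : ℕ} {x y : A} (hx : IsCodeg ι σ h x) (hy : IsDeg ι σ h y) (s : S) :
    x * y * ι s = ι s * (x * y) := by
  rw [mul_assoc, hy, ← mul_assoc, ← hx, mul_assoc]

theorem IsDeg.mul_codeg {h : ℕ} {x y : A} (hx : IsDeg ι σ h x) (hy : IsCodeg ι σ h y) (s : S) :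
    x * y * ι s = ι s * (x * y) := by
  have : s = (σ ^ h) ((σ ^ h).symm s) := ((σ ^ h).apply_symm_apply s).symm
  rw [this, mul_assoc, ← hy, ← mul_assoc, hx, mul_assoc]

theorem isDeg_list_prod {h : ℕ} (L : List A) (hL : ∀ x ∈ L, IsDeg ι σ h x) :
    IsDeg ι σ (h * L.length) L.prod := by
  induction L with
  | nil => exact isDeg_one
  | cons x L ih =>
    rw [List.prod_cons, List.length_cons, Nat.mul_succ, add_comm]
    exact (hL x List.mem_cons_self).mul (ih fun y hy => hL y (List.mem_cons_of_mem _ hy))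

theorem IsDeg.of_modEq {h g : ℕ} (hσ : σ ^ n = 1) (hg : h ≡ g [MOD n]) {x : A}
    (hx : IsDeg ι σ h x) : IsDeg ι σ g x := fun s => by
  rw [hx, pow_eq_pow_of_modEq hσ hg]

theorem IsCodeg.of_modEq {h g : ℕ} (hσ : σ ^ n = 1) (hg : h ≡ g [MOD n]) {x : A}
    (hx : IsCodeg ι σ h x) : IsCodeg ι σ g x := fun s => by
  rw [hx, pow_eq_pow_of_modEq hσ hg]

theorem IsDeg.isCodeg {h g : ℕ} (hσ : σ ^ n = 1) (hg : h + g ≡ 0 [MOD n]) {x : A}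
    (hx : IsDeg ι σ h x) : IsCodeg ι σ g x := fun s => by
  rw [hx, ← AlgEquiv.mul_apply, ← pow_add, pow_eq_pow_of_modEq hσ hg, pow_zero]; rfl

namespace GaloisCoords

variable (G : GaloisCoords R n σ)

/-- The projection to the elements of degree `h`. -/
def proj (ι : S →ₐ[R] A) (h : ℕ) : A →ₗ[R] A :=
  ∑ a, LinearMap.mulLeft R (ι ((σ ^ h) (G.x a))) ∘ₗ LinearMap.mulRight R (ι (G.y a))

theorem proj_apply (ι : S →ₐ[R] A) (h : ℕ) (x : A) :
    G.proj ι h x = ∑ a, ι ((σ ^ h) (G.x a)) * x * ι (G.y a) := by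
  simp [proj, mul_assoc]

theorem proj_congr {h g : ℕ} (hg : h ≡ g [MOD n]) (x : A) : G.proj ι h x = G.proj ι g x := by
  rw [proj_apply, proj_apply, pow_eq_pow_of_modEq G.pow hg]

/-- Centrality of Σ x a ⊗ y a lets s pass from the right end, where it is s, to the left end, where
it becomes σ^h(s). -/
theorem isDeg_proj (h : ℕ) (x : A) : IsDeg ι σ h (G.proj ι h x) := fun s => by
  let B : S →ₗ[R] S →ₗ[R] A := LinearMap.mk₂ R (fun u v => ι ((σ ^ h) u) * x * ι v)
    (by intros; simp [add_mul]) (by intros; simp) (by intros; simp [mul_add]) (by intros; simp)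
  have := G.sum_central B s
  simp only [B, LinearMap.mk₂_apply] at this
  rw [proj_apply, Finset.sum_mul, Finset.mul_sum]
  simp_rw [mul_assoc, ← map_mul, mul_comm (G.y _) s, ← mul_assoc]
  rw [← this]
  refine Finset.sum_congr rfl fun a _ => ?_
  simp [mul_assoc]

theorem proj_of_isDeg {g : ℕ} {x : A} (hx : IsDeg ι σ g x) (h : ℕ) :
    G.proj ι h x = if h ≡ g [MOD n] then x else 0 := by
  rw [proj_apply]
  simp_rw [mul_assoc, hx (G.y _), ← mul_assoc, ← map_mul, ← Finset.sum_mul, ← map_sum, G.orth]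
  split_ifs <;> simp

/-- Summing over h turns σ^h(x a) into the trace of x a, a scalar which may be moved next to y a. -/
theorem sum_proj (x : A) : ∑ h ∈ Finset.range n, G.proj ι h x = x := by
  simp_rw [proj_apply]
  rw [Finset.sum_comm]
  simp_rw [← Finset.sum_mul, ← map_sum, ← G.algebraMap_tr]
  have : ∀ a, ι (algebraMap R S (G.tr (G.x a))) * x * ι (G.y a) =
      x * ι (G.tr (1 * G.x a) • G.y a) := fun a => by
    rw [AlgHom.commutes, ← Algebra.smul_def, one_mul, map_smul, smul_mul_assoc, mul_smul_comm]
  simp_rw [this, ← Finset.mul_sum, ← map_sum, G.sum_tr_smul_y]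
  simp

theorem map_proj (f : A →ₐ[R] B) (h : ℕ) (x : A) :
    f (G.proj ι h x) = G.proj (f.comp ι) h (f x) := by
  simp [proj_apply]

theorem proj_deg_mul {g : ℕ} {w : A} (hw : IsDeg ι σ g w) (h : ℕ) (x : A) :
    G.proj ι (g + h) (w * x) = w * G.proj ι h x := by
  rw [proj_apply, proj_apply, Finset.mul_sum]
  refine Finset.sum_congr rfl fun a _ => ?_
  rw [← mul_assoc, ← mul_assoc w, ← mul_assoc w, hw, pow_add]; rfl

theorem proj_mul_deg {g : ℕ} {w : A} (hw : IsDeg ι σ g w) (h : ℕ) (x : A) :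
    G.proj ι (h + g) (x * w) = G.proj ι h x * w := by
  have h1 : G.proj ι (h + g) (x * w) =
      ∑ j ∈ Finset.range n, G.proj ι (h + g) (G.proj ι j x * w) := by
    rw [← map_sum, ← Finset.sum_mul, G.sum_proj]
  rw [h1]
  simp_rw [fun j => G.proj_of_isDeg ((G.isDeg_proj (ι := ι) j x).mul hw) (h + g)]
  have : ∀ j, (h + g ≡ j + g [MOD n]) ↔ j ≡ h [MOD n] := fun j =>
    ⟨fun hh => (Nat.ModEq.add_right_cancel' g hh).symm, fun hh => (hh.add_right g).symm⟩
  simp_rw [this]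
  exact sum_modEq_eq G.pos (fun j => G.proj ι j x * w) h
    fun i j hij => by rw [G.proj_congr hij]

end GaloisCoords

/-- `A` is an `R`-algebra containing `S` as a maximal commutative subring, with units for all
degrees. -/
structure IsCrossed (ι : S →ₐ[R] A) (σ : S ≃ₐ[R] S) : Prop where
  inj : Function.Injective ι
  cent : ∀ x : A, (∀ s, x * ι s = ι s * x) → ∃ s, ι s = x
  units : ∀ h : ℕ, ∃ (N : ℕ) (w w' : Fin N → A), (∀ a, IsDeg ι σ h (w a)) ∧
    (∀ a, IsCodeg ι σ h (w' a)) ∧ ∑ a, w a * w' a = 1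

end Degree

/-! ### Generators and words of the almost cyclic algebra -/

section DeltaBasics

variable {R S J B : Type*} [CommRing R] [CommRing S] [Algebra R S]
  [AddCommGroup J] [Module S J] [Ring B] [Algebra R B] {σ : S ≃ₐ[R] S} {n : ℕ} {h : σ ^ n = 1}
  (φ : NormTrivialization σ n J h)

namespace Delta

/-- The generator `j t`. -/
def gen (j : J) : Delta φ :=
  RingQuot.mkAlgHom R (DeltaRel φ) (FreeAlgebra.ι R (Sum.inr j : S ⊕ J))

theorem gen_add (j l : J) : gen φ (j + l) = gen φ j + gen φ l :=
  (RingQuot.mkAlgHom_rel R (DeltaRel.mod_add (φ := φ) j l)).trans (map_add _ _ _)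

theorem base_mul_gen (s : S) (j : J) : ofBase φ s * gen φ j = gen φ (s • j) :=
  (map_mul (RingQuot.mkAlgHom R (DeltaRel φ)) _ _).symm.trans
    (RingQuot.mkAlgHom_rel R (DeltaRel.left_mul (φ := φ) s j))

theorem gen_mul_base (s : S) (j : J) : gen φ j * ofBase φ s = gen φ (σ s • j) :=
  (map_mul (RingQuot.mkAlgHom R (DeltaRel φ)) _ _).symm.trans
    (RingQuot.mkAlgHom_rel R (DeltaRel.right_mul (φ := φ) s j))

theorem prod_gen (x : Fin n → J) :
    (List.ofFn fun i => gen φ (x i)).prod = ofBase φ (φ.val x) := by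
  have := RingQuot.mkAlgHom_rel R (DeltaRel.norm (φ := φ) x)
  rw [map_list_prod, List.map_ofFn] at this
  exact this

theorem isDeg_gen (j : J) : IsDeg (ofBase φ) σ 1 (gen φ j) := fun s => by
  rw [gen_mul_base, base_mul_gen, pow_one]

/-- The universal property of the almost cyclic algebra. -/
theorem exists_lift (f : S →ₐ[R] B) (j : J → B) (hadd : ∀ x y, j (x + y) = j x + j y)
    (hl : ∀ s x, f s * j x = j (s • x)) (hr : ∀ s x, j x * f s = j (σ s • x))
    (hn : ∀ x : Fin n → J, (List.ofFn fun i => j (x i)).prod = f (φ.val x)) :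
    ∃ F : Delta φ →ₐ[R] B, (∀ s, F (ofBase φ s) = f s) ∧ ∀ x, F (gen φ x) = j x := by
  refine ⟨RingQuot.liftAlgHom R ⟨FreeAlgebra.lift R (Sum.elim f j), ?_⟩, fun s => ?_,
    fun x => ?_⟩
  · intro a b hab
    induction hab with
    | base_algebraMap r => simp
    | base_add s t => simp
    | base_mul s t => simp
    | mod_add x y => simp [hadd]
    | left_mul s x => simp [hl]
    | right_mul s x => simp [hr]
    | norm x =>
      rw [map_list_prod, List.map_ofFn]
      have hx := hn x
      rw [NormTrivialization.val] at hx
      simpa [Function.comp_def] using hx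
  · exact (RingQuot.liftAlgHom_mkAlgHom_apply _ _ _ _).trans (by simp)
  · exact (RingQuot.liftAlgHom_mkAlgHom_apply _ _ _ _).trans (by simp)

/-- The product of a word in the generators. -/
def word (L : List J) : Delta φ := (L.map (gen φ)).prod

theorem isDeg_word (L : List J) : IsDeg (ofBase φ) σ L.length (word φ L) := by
  have := isDeg_list_prod (ι := ofBase φ) (σ := σ) (h := 1) (L.map (gen φ)) (by
    intro x hx
    obtain ⟨j, -, rfl⟩ := List.mem_map.mp hx
    exact isDeg_gen φ j)
  rwa [one_mul, List.length_map] at this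

theorem word_append (L L' : List J) : word φ (L ++ L') = word φ L * word φ L' := by
  simp [word]

/-- Letters are grouped into blocks of n, and the norm relation puts every block into S. -/
theorem word_mem_range (q : ℕ) (L : List J) (hL : L.length = n * q) :
    word φ L ∈ (ofBase φ).range := by
  induction q generalizing L with
  | zero =>
    rw [Nat.mul_zero, List.length_eq_zero_iff] at hL
    subst hL
    exact one_mem _
  | succ q ih =>
    rw [← List.take_append_drop n L, word_append]
    refine mul_mem ?_ (ih _ (by rw [List.length_drop, hL, Nat.mul_succ]; omega))
    have hlen : (L.take n).length = n := by
      rw [List.length_take, hL, Nat.mul_succ]; omega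
    have : word φ (L.take n) = (List.ofFn fun i : Fin n =>
        gen φ ((L.take n).get (Fin.cast hlen.symm i))).prod := by
      rw [word]
      congr 1
      refine List.ext_getElem (by rw [List.length_map, List.length_ofFn, hlen]) fun i h1 h2 => ?_
      simp
    rw [this, prod_gen]
    exact ⟨_, rfl⟩

theorem span_word : Submodule.span R {x | ∃ s L, x = ofBase φ s * word φ L} = ⊤ := by
  set M := Submodule.span R {x | ∃ s L, x = ofBase φ s * word φ L} with hM
  have hbase : ∀ s L, ofBase φ s * word φ L ∈ M := fun s L => Submodule.subset_span ⟨s, L, rfl⟩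
  have hmul : ∀ x ∈ M, ∀ y ∈ M, x * y ∈ M := by
    intro x hx y hy
    induction hx using Submodule.span_induction with
    | zero => simp
    | add a b _ _ ha hb => rw [add_mul]; exact add_mem ha hb
    | smul r a _ ha => rw [smul_mul_assoc]; exact M.smul_mem _ ha
    | mem x hx =>
      obtain ⟨s, L, rfl⟩ := hx
      induction hy using Submodule.span_induction with
      | zero => simp
      | add a b _ _ ha hb => rw [mul_add]; exact add_mem ha hb
      | smul r a _ ha => rw [mul_smul_comm]; exact M.smul_mem _ ha
      | mem y hy =>
        obtain ⟨t, L', rfl⟩ := hy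
        have : ofBase φ s * word φ L * (ofBase φ t * word φ L') =
            ofBase φ (s * (σ ^ L.length) t) * word φ (L ++ L') := by
          rw [word_append, map_mul, mul_assoc, ← mul_assoc (word φ L), isDeg_word]
          simp only [mul_assoc]
        rw [this]
        exact hbase _ _
  rw [eq_top_iff]
  rintro x -
  obtain ⟨a, rfl⟩ := RingQuot.mkAlgHom_surjective R (DeltaRel φ) x
  induction a with
  | grade0 r =>
    have := hbase (algebraMap R S r) []
    rw [AlgHom.commutes, word, List.map_nil, List.prod_nil, mul_one] at this
    rw [AlgHom.commutes]
    exact this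
  | grade1 a =>
    rcases a with s | j
    · have := hbase s []
      rwa [word, List.map_nil, List.prod_nil, mul_one] at this
    · have := hbase 1 [j]
      rwa [word, List.map_cons, List.map_nil, List.prod_singleton, map_one, one_mul] at this
  | mul a b ha hb => rw [map_mul]; exact hmul _ ha _ hb
  | add a b ha hb => rw [map_add]; exact add_mem ha hb

/-- The projection to degree zero fixes x. On a spanning element s · word it is the identity or zero
according as n divides the length of the word or not, and in the first case the word lies in S. -/
theorem exists_base_of_commute (G : GaloisCoords R n σ) (x : Delta φ)
    (hx : ∀ s, x * ofBase φ s = ofBase φ s * x) : ∃ s, ofBase φ s = x := by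
  have h0 : G.proj (ofBase φ) 0 x = x := by
    have : IsDeg (ofBase φ) σ 0 x := hx
    rw [G.proj_of_isDeg this, if_pos (Nat.ModEq.refl _)]
  have key : ∀ y, G.proj (ofBase φ) 0 y ∈ (ofBase φ).range := by
    intro y
    have hy : y ∈ Submodule.span R {x | ∃ s L, x = ofBase φ s * word φ L} := by
      rw [span_word]; trivial
    induction hy using Submodule.span_induction with
    | zero => simp
    | add a b _ _ ha hb => rw [map_add]; exact add_mem ha hb
    | smul r a _ ha => rw [map_smul]; exact Subalgebra.smul_mem _ ha _
    | mem y hy =>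
      obtain ⟨s, L, rfl⟩ := hy
      rw [G.proj_of_isDeg ((isDeg_base s).mul (isDeg_word φ L)), zero_add]
      split_ifs with hL
      · obtain ⟨q, hq⟩ := (Nat.modEq_zero_iff_dvd.mp hL.symm)
        exact mul_mem ⟨s, rfl⟩ (word_mem_range φ q L hq)
      · exact zero_mem _
  have := key x
  rwa [h0] at this

/-- Write 1 as a combination of values of φ. Each value is a word of length n; cut after i mod n
letters, it is a product of an element of degree i and one of codegree i. -/
theorem exists_units (G : GaloisCoords R n σ) (i : ℕ) :
    ∃ (N : ℕ) (w w' : Fin N → Delta φ), (∀ a, IsDeg (ofBase φ) σ i (w a)) ∧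
      (∀ a, IsCodeg (ofBase φ) σ i (w' a)) ∧ ∑ a, w a * w' a = 1 := by
  have h1 : (1 : S) ∈ Ideal.span (Set.range φ.val) := by rw [φ.span_val]; trivial
  obtain ⟨N, f, g, hfg⟩ := Submodule.mem_span_set'.mp h1
  choose x hx using fun a => (g a).2
  have hi : i % n < n := Nat.mod_lt _ G.pos
  refine ⟨N, fun a => ofBase φ (f a) * word φ ((List.ofFn (x a)).take (i % n)),
    fun a => word φ ((List.ofFn (x a)).drop (i % n)), fun a => ?_, fun a => ?_, ?_⟩
  · have := (isDeg_base (ι := ofBase φ) (σ := σ) (f a)).mul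
      (isDeg_word φ ((List.ofFn (x a)).take (i % n)))
    rw [List.length_take, List.length_ofFn, zero_add, min_eq_left hi.le] at this
    exact this.of_modEq G.pow (Nat.mod_modEq i n)
  · have := (isDeg_word φ ((List.ofFn (x a)).drop (i % n)))
    rw [List.length_drop, List.length_ofFn] at this
    refine (this.isCodeg (g := i % n) G.pow ?_).of_modEq G.pow (Nat.mod_modEq i n)
    rw [Nat.sub_add_cancel hi.le]
    exact (Nat.modEq_zero_iff_dvd.mpr dvd_rfl)
  · simp_rw [mul_assoc, ← word_append, List.take_append_drop]
    have h2 : ∀ a, word φ (List.ofFn (x a)) = ofBase φ (φ.val (x a)) := fun a => by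
      rw [← prod_gen, word, List.map_ofFn]; rfl
    simp_rw [h2, hx, ← map_mul, ← map_sum]
    rw [← map_one (ofBase φ), ← hfg]
    rfl

/-- Recognition of almost cyclic algebras. -/
theorem exists_algEquiv (G : GaloisCoords R n σ) (f : S →ₐ[R] B) (j : J → B)
    (hadd : ∀ x y, j (x + y) = j x + j y)
    (hl : ∀ s x, f s * j x = j (s • x)) (hr : ∀ s x, j x * f s = j (σ s • x))
    (hn : ∀ x : Fin n → J, (List.ofFn fun i => j (x i)).prod = f (φ.val x))
    (hinj : Function.Injective f) (hcent : ∀ b, (∀ s, b * f s = f s * b) → ∃ s, f s = b) :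
    ∃ F : B ≃ₐ[R] Delta φ, ∀ s, F (f s) = ofBase φ s := by
  obtain ⟨F, hF, -⟩ := exists_lift φ f j hadd hl hr hn
  have hF' : F.comp (ofBase φ) = f := AlgHom.ext hF
  -- Both claims reduce to degree zero: a factor of codegree i moves the component of degree i into
  -- the centralizer of S, which is S on both sides, and Σ w w' = 1 restores the component.
  have hbij : Function.Bijective F := by
    constructor
    · rw [injective_iff_map_eq_zero]
      intro x hx
      rw [← G.sum_proj (ι := ofBase φ) x]
      refine Finset.sum_eq_zero fun i _ => ?_
      obtain ⟨N, w, w', hw, hw', h1⟩ := exists_units φ G i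
      rw [← one_mul (G.proj (ofBase φ) i x), ← h1, Finset.sum_mul]
      refine Finset.sum_eq_zero fun a _ => ?_
      obtain ⟨s, hs⟩ := exists_base_of_commute φ G (w' a * G.proj (ofBase φ) i x)
        (IsDeg.codeg_mul (hw' a) (G.isDeg_proj i x))
      have h2 : F (w' a * G.proj (ofBase φ) i x) = 0 := by
        rw [map_mul, G.map_proj, hx, map_zero, mul_zero]
      rw [← hs, hF, ← map_zero f] at h2
      rw [mul_assoc, ← hs, hinj h2, map_zero, mul_zero]
    · intro b
      rw [← AlgHom.mem_range, ← G.sum_proj (ι := f) b]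
      refine sum_mem fun i _ => ?_
      obtain ⟨N, w, w', hw, hw', h1⟩ := exists_units φ G i
      rw [← one_mul (G.proj f i b), ← map_one F, ← h1, map_sum, Finset.sum_mul]
      refine sum_mem fun a _ => ?_
      rw [map_mul, mul_assoc]
      refine mul_mem ⟨_, rfl⟩ ?_
      have hc : IsCodeg f σ i (F (w' a)) := fun s => by
        rw [← hF, ← hF, ← map_mul, hw', map_mul]
      obtain ⟨s, hs⟩ := hcent (F (w' a) * G.proj f i b) (IsDeg.codeg_mul hc (G.isDeg_proj i b))
      exact ⟨ofBase φ s, (hF s).trans hs⟩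
  refine ⟨(AlgEquiv.ofBijective F hbij).symm, fun s => ?_⟩
  rw [AlgEquiv.symm_apply_eq]
  exact (hF s).symm

end Delta

end DeltaBasics

end
end AlmostCyclic

namespace AlmostCyclic
noncomputable section

/-! ### Positions of letters in words -/

theorem drop_append_cons {J : Type*} {n : ℕ} {L L' : List J} (hL : L.length < n) (a : J) :
    (L ++ a :: L').drop n = L'.drop (n - L.length - 1) := by
  obtain ⟨j, rfl⟩ := Nat.exists_eq_add_of_lt hL
  rw [List.drop_append, List.drop_eq_nil_of_le (by omega), List.nil_append]
  have : L.length + j + 1 - L.length = j + 1 := by omega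
  rw [this, List.drop_succ_cons]
  rfl

theorem getD_append_cons {J : Type*} [Zero J] (L L' : List J) (a b : J) (i : ℕ) :
    (L ++ a :: L').getD i 0 = if i = L.length then a else (L ++ b :: L').getD i 0 := by
  split_ifs with hi
  · subst hi; simp
  · rcases lt_or_gt_of_ne hi with hlt | hgt
    · rw [List.getD_append _ _ _ _ hlt, List.getD_append _ _ _ _ hlt]
    · obtain ⟨j, rfl⟩ := Nat.exists_eq_add_of_lt hgt
      rw [List.getD_append_right _ _ _ _ (by omega), List.getD_append_right _ _ _ _ (by omega)]
      have : L.length + j + 1 - L.length = j + 1 := by omega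
      rw [this, List.getD_cons_succ, List.getD_cons_succ]

/-! ### `S` embeds into the almost cyclic algebra -/

section Injective

variable {R S J : Type*} [CommRing R] [CommRing S] [Algebra R S]
  [AddCommGroup J] [Module S J] {σ : S ≃ₐ[R] S} {n : ℕ} {h : σ ^ n = 1}
  (φ : NormTrivialization σ n J h)

namespace NormTrivialization

/-- The value of a trivialization on the first `n` letters of a word. -/
def listVal (L : List J) : S := φ.val fun i => L.getD i 0

theorem listVal_congr {L L' : List J} (hL : ∀ i < n, L.getD i 0 = L'.getD i 0) :
    φ.listVal L = φ.listVal L' := by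
  rw [listVal, listVal]
  congr 1
  funext i
  exact hL i i.2

theorem listVal_append {L : List J} (hL : n ≤ L.length) (X : List J) :
    φ.listVal (L ++ X) = φ.listVal L :=
  φ.listVal_congr fun i hi => List.getD_append _ _ _ _ (by omega)

theorem listVal_ofFn (x : Fin n → J) : φ.listVal (List.ofFn x) = φ.val x := by
  rw [listVal]
  congr 1
  funext i
  simp

theorem listVal_append_cons {L L' : List J} (hL : L.length < n) (a : J) :
    φ.listVal (L ++ a :: L') =
      φ.val (Function.update (fun i : Fin n => (L ++ 0 :: L').getD i 0) ⟨L.length, hL⟩ a) := by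
  rw [listVal]
  congr 1
  funext i
  rw [getD_append_cons L L' a 0, Function.update_apply]
  simp only [Fin.ext_iff]

/-- Moving the window of a periodic sequence by one place is the rotation of its n entries, so
equivariance can be iterated. -/
theorem val_shift (X : ℕ → J) (hX : ∀ p, X (p + n) = X p) (i : ℕ) :
    (σ ^ i) (φ.val fun p : Fin n => X (p + i)) = φ.val fun p : Fin n => X p := by
  induction i with
  | zero => rfl
  | succ i ih =>
    rw [← ih, pow_succ, AlgEquiv.mul_apply, ← φ.val_rotate]
    congr 2
    funext p
    obtain ⟨q, rfl⟩ := (finRotate n).surjective p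
    rw [Function.comp_apply, Equiv.symm_apply_apply]
    cases n with
    | zero => exact q.elim0
    | succ n =>
      rw [coe_finRotate]
      split_ifs with hq
      · rw [hq, Fin.val_last, zero_add, ← hX i]
        congr 1
        omega
      · congr 1
        omega

/-- The value of a trivialization on words whose length is a multiple of `n`, extended by zero. -/
def wordVal (L : List J) : S :=
  if n ≤ L.length ∧ 0 < n then φ.listVal L * wordVal (L.drop n) else if L = [] then 1 else 0
termination_by L.length
decreasing_by simp only [List.length_drop]; omega

theorem wordVal_of_le (hn : 0 < n) {L : List J} (hL : n ≤ L.length) :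
    φ.wordVal L = φ.listVal L * φ.wordVal (L.drop n) := by
  rw [wordVal, if_pos ⟨hL, hn⟩]

theorem wordVal_of_lt {L : List J} (hL : L.length < n) :
    φ.wordVal L = if L = [] then 1 else 0 := by
  rw [wordVal, if_neg (by omega)]

/-- Complete blocks in front are stripped until the varied letter lies in the first block, where φ
is additive. If no complete block is left, all values vanish, since the word is neither empty nor
long enough. -/
theorem wordVal_add (hn : 0 < n) (L L' : List J) (a b : J) :
    φ.wordVal (L ++ (a + b) :: L') = φ.wordVal (L ++ a :: L') + φ.wordVal (L ++ b :: L') := by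
  induction hl : L.length using Nat.strong_induction_on generalizing L with
  | _ l ih =>
    by_cases hL : n ≤ L.length
    · have key : ∀ c, φ.wordVal (L ++ c :: L') =
          φ.listVal L * φ.wordVal (L.drop n ++ c :: L') := fun c => by
        rw [φ.wordVal_of_le hn (by rw [List.length_append]; omega), φ.listVal_append hL,
          List.drop_append_of_le_length hL]
      rw [key, key, key, ih _ (by rw [← hl]; simp only [List.length_drop]; omega) _ rfl, mul_add]
    · push Not at hL
      by_cases ht : n ≤ L.length + L'.length + 1
      · have key : ∀ c, φ.wordVal (L ++ c :: L') =
          φ.listVal (L ++ c :: L') * φ.wordVal (L'.drop (n - L.length - 1)) := fun c => by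
          rw [φ.wordVal_of_le hn (by simp; omega), drop_append_cons hL]
        rw [key, key, key, φ.listVal_append_cons hL, φ.listVal_append_cons hL,
          φ.listVal_append_cons hL, φ.isTwisted.map_add, add_mul]
      · have key : ∀ c, φ.wordVal (L ++ c :: L') = 0 := fun c => by
          rw [φ.wordVal_of_lt (by simp; omega), if_neg (by simp)]
        rw [key, key, key, add_zero]

theorem wordVal_smul (hn : 0 < n) (L L' : List J) (s : S) (a : J) :
    φ.wordVal (L ++ (s • a) :: L') = (σ ^ L.length) s * φ.wordVal (L ++ a :: L') := by
  induction hl : L.length using Nat.strong_induction_on generalizing L with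
  | _ l ih =>
    subst hl
    by_cases hL : n ≤ L.length
    · have key : ∀ c, φ.wordVal (L ++ c :: L') =
          φ.listVal L * φ.wordVal (L.drop n ++ c :: L') := fun c => by
        rw [φ.wordVal_of_le hn (by rw [List.length_append]; omega), φ.listVal_append hL,
          List.drop_append_of_le_length hL]
      have h2 : L.length ≡ (L.drop n).length [MOD n] := by
        rw [List.length_drop]
        conv_lhs => rw [← Nat.sub_add_cancel hL]
        exact Nat.add_mod_right _ _
      rw [key, key, ih _ (by simp only [List.length_drop]; omega) _ rfl,
        pow_eq_pow_of_modEq h h2]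
      ring
    · push Not at hL
      by_cases ht : n ≤ L.length + L'.length + 1
      · have key : ∀ c, φ.wordVal (L ++ c :: L') =
          φ.listVal (L ++ c :: L') * φ.wordVal (L'.drop (n - L.length - 1)) := fun c => by
          rw [φ.wordVal_of_le hn (by simp; omega), drop_append_cons hL]
        rw [key, key, φ.listVal_append_cons hL,
          φ.listVal_append_cons hL, φ.isTwisted.map_smul, smul_eq_mul, mul_assoc]
      · have key : ∀ c, φ.wordVal (L ++ c :: L') = 0 := fun c => by
          rw [φ.wordVal_of_lt (by simp; omega), if_neg (by simp)]
        rw [key, key, mul_zero]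

/-- This is where the symmetry of J and the equivariance of φ enter. After stripping blocks, the
inserted word x begins inside the first block. Exchanging the first |L| letters of that block with
those of the next block turns the first into a rotation of x, with value σ^|L|(φ x), and the second
into the first block of L ++ L'. -/
theorem wordVal_norm (hJ : IsSwap S J) (hn : 0 < n) (L L' : List J) (x : Fin n → J) :
    φ.wordVal (L ++ List.ofFn x ++ L') = (σ ^ L.length) (φ.val x) * φ.wordVal (L ++ L') := by
  induction hl : L.length using Nat.strong_induction_on generalizing L with
  | _ l ih =>
    subst hl
    by_cases hL : n ≤ L.length
    · have key : ∀ X, φ.wordVal (L ++ X) = φ.listVal L * φ.wordVal (L.drop n ++ X) := fun X => by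
        rw [φ.wordVal_of_le hn (by rw [List.length_append]; omega), φ.listVal_append hL,
          List.drop_append_of_le_length hL]
      have h2 : L.length ≡ (L.drop n).length [MOD n] := by
        rw [List.length_drop]
        conv_lhs => rw [← Nat.sub_add_cancel hL]
        exact Nat.add_mod_right _ _
      rw [List.append_assoc, key, key, ← List.append_assoc,
        ih _ (by simp only [List.length_drop]; omega) _ rfl, pow_eq_pow_of_modEq h h2]
      ring
    · push Not at hL
      have hd : (L ++ List.ofFn x ++ L').drop n = (List.ofFn x).drop (n - L.length) ++ L' := by
        rw [List.append_assoc, List.drop_append, List.drop_eq_nil_of_le hL.le, List.nil_append,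
          List.drop_append_of_le_length (by simp)]
      rw [φ.wordVal_of_le hn (by simp; omega), hd]
      by_cases ht : n ≤ L.length + L'.length
      · rw [φ.wordVal_of_le hn (L := L ++ L') (by simp; omega),
          φ.wordVal_of_le hn (L := _ ++ L') (by simp; omega)]
        have h3 : ((List.ofFn x).drop (n - L.length) ++ L').drop n = (L ++ L').drop n := by
          rw [List.drop_append, List.drop_append, List.drop_eq_nil_of_le (by simp),
            List.drop_eq_nil_of_le hL.le]
          simp
          congr 1
          omega
        rw [h3, ← mul_assoc, ← mul_assoc]
        congr 1
        -- The word x rotated by |L| places and continued periodically.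
        let X : ℕ → J := fun p => x ⟨(p + (n - L.length)) % n, Nat.mod_lt _ hn⟩
        have hX : ∀ p, X (p + n) = X p := fun p => by
          simp only [X]
          congr 2
          rw [add_right_comm, Nat.add_mod_right]
        have hX1 : (fun p : Fin n => X (p + L.length)) = x := by
          funext p
          simp only [X]
          congr 1
          ext
          change (p.1 + L.length + (n - L.length)) % n = p.1
          rw [add_assoc, Nat.add_sub_cancel' hL.le, Nat.add_mod_right, Nat.mod_eq_of_lt p.2]
        have h4 := φ.val_shift X hX L.length
        rw [hX1] at h4
        rw [h4]
        have := φ.isTwisted.swap_piecewise hJ φ.isTwisted (LinearMap.mul S S)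
          (fun i : Fin n => (L ++ List.ofFn x ++ L').getD i 0)
          (fun i : Fin n => ((List.ofFn x).drop (n - L.length) ++ L').getD i 0)
          (Finset.univ.filter fun i : Fin n => (i : ℕ) < L.length)
        simp only [LinearMap.mul_apply'] at this
        refine this.trans ?_
        rw [listVal]
        congr 2
        · funext p
          by_cases hp : (p : ℕ) < L.length
          · rw [Finset.piecewise_eq_of_mem _ _ _ (by simpa using hp),
              List.getD_append _ _ _ _ (by simp; omega)]
            have : (p : ℕ) + (n - L.length) < n := by omega
            simp only [X, Nat.mod_eq_of_lt this]
            rw [List.getD_eq_getElem _ _ (by simp; omega)]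
            simp [add_comm]
          · rw [Finset.piecewise_eq_of_notMem _ _ _ (by simpa using hp), List.append_assoc,
              List.getD_append_right _ _ _ _ (by omega), List.getD_append _ _ _ _ (by simp; omega)]
            have : ((p : ℕ) + (n - L.length)) % n = p - L.length := by
              have h5 : (p : ℕ) + (n - L.length) = (p - L.length) + n := by omega
              rw [h5, Nat.add_mod_right, Nat.mod_eq_of_lt (by omega)]
            simp only [X, this]
            rw [List.getD_eq_getElem _ _ (by simp; omega)]
            simp
        · funext p
          by_cases hp : (p : ℕ) < L.length
          · rw [Finset.piecewise_eq_of_mem _ _ _ (by simpa using hp), List.append_assoc,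
              List.getD_append _ _ _ _ hp, List.getD_append _ _ _ _ hp]
          · rw [Finset.piecewise_eq_of_notMem _ _ _ (by simpa using hp),
              List.getD_append_right _ _ _ _ (by simp; omega),
              List.getD_append_right _ _ _ _ (by omega)]
            congr 1
            simp
            omega
      · rw [φ.wordVal_of_lt (L := L ++ L') (by simp; omega),
          φ.wordVal_of_lt (L := _ ++ L') (by simp; omega)]
        by_cases hLL : L = [] ∧ L' = []
        · obtain ⟨rfl, rfl⟩ := hLL
          simp [listVal_ofFn]
        · rw [if_neg, if_neg, mul_zero, mul_zero]
          · simpa using hLL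
          · rw [List.append_eq_nil_iff, List.drop_eq_nil_iff, List.length_ofFn]
            rintro ⟨h1, h2⟩
            exact hLL ⟨List.eq_nil_of_length_eq_zero (by omega), h2⟩

/-- Functions on words which respect the relations of the almost cyclic algebra. -/
def wordFunctions : Submodule R (List J → S) where
  carrier := {F | (∀ L L' a b, F (L ++ (a + b) :: L') = F (L ++ a :: L') + F (L ++ b :: L')) ∧
    (∀ L L' s a, F (L ++ (s • a) :: L') = (σ ^ L.length) s * F (L ++ a :: L')) ∧
    ∀ L L' x, F (L ++ List.ofFn x ++ L') = (σ ^ L.length) (φ.val x) * F (L ++ L')}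
  add_mem' := by
    rintro F F' ⟨h1, h2, h3⟩ ⟨h1', h2', h3'⟩
    refine ⟨fun L L' a b => ?_, fun L L' s a => ?_, fun L L' x => ?_⟩
    · simp only [Pi.add_apply, h1, h1']; ring
    · simp only [Pi.add_apply, h2, h2']; ring
    · simp only [Pi.add_apply, h3, h3']; ring
  zero_mem' := by simp
  smul_mem' := by
    rintro r F ⟨h1, h2, h3⟩
    refine ⟨fun L L' a b => ?_, fun L L' s a => ?_, fun L L' x => ?_⟩
    · simp only [Pi.smul_apply, h1, smul_add]
    · simp only [Pi.smul_apply, h2, mul_smul_comm]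
    · simp only [Pi.smul_apply, h3, mul_smul_comm]

/-- The action of a generator on functions on words. -/
def genAction (j : J) : φ.wordFunctions →ₗ[R] φ.wordFunctions where
  toFun F := ⟨fun L => F.1 (L ++ [j]), by
    obtain ⟨F, h1, h2, h3⟩ := F
    refine ⟨fun L L' a b => ?_, fun L L' s a => ?_, fun L L' x => ?_⟩
    · simpa only [List.append_assoc, List.cons_append] using h1 L (L' ++ [j]) a b
    · simpa only [List.append_assoc, List.cons_append] using h2 L (L' ++ [j]) s a
    · simpa only [List.append_assoc, List.cons_append] using h3 L (L' ++ [j]) x⟩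
  map_add' F F' := rfl
  map_smul' r F := rfl

/-- The action of `S` on functions on words. -/
def baseAction : S →ₐ[R] Module.End R φ.wordFunctions where
  toFun s :=
    { toFun := fun F => ⟨fun L => (σ ^ L.length) s * F.1 L, by
        obtain ⟨F, h1, h2, h3⟩ := F
        refine ⟨fun L L' a b => ?_, fun L L' t a => ?_, fun L L' x => ?_⟩
        · simp only [h1, List.length_append, List.length_cons]; ring
        · simp only [h2, List.length_append, List.length_cons]; ring
        · have : L.length + n + L'.length = L.length + L'.length + n := by ring
          simp only [h3, List.length_append, List.length_ofFn, this, pow_add _ _ n, h, mul_one]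
          ring⟩
      map_add' := fun F F' => Subtype.ext (funext fun L => mul_add _ _ _)
      map_smul' := fun r F => Subtype.ext (funext fun L => mul_smul_comm _ _ _) }
  map_one' := by
    ext F L
    change (σ ^ L.length) 1 * F.1 L = F.1 L
    rw [map_one, one_mul]
  map_mul' s t := by
    ext F L
    change (σ ^ L.length) (s * t) * F.1 L = (σ ^ L.length) s * ((σ ^ L.length) t * F.1 L)
    rw [map_mul, mul_assoc]
  map_zero' := by
    ext F L
    change (σ ^ L.length) 0 * F.1 L = 0
    rw [map_zero, zero_mul]
  map_add' s t := by
    ext F L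
    change (σ ^ L.length) (s + t) * F.1 L = (σ ^ L.length) s * F.1 L + (σ ^ L.length) t * F.1 L
    rw [map_add, add_mul]
  commutes' r := by
    ext F L
    change (σ ^ L.length) (algebraMap R S r) * F.1 L = r • F.1 L
    rw [AlgEquiv.commutes, Algebra.smul_def]

end NormTrivialization

/-- The algebra acts on the functions on words that respect the relations: a generator appends its
letter, and s multiplies by σ^length(s). The function `wordVal` is one of them and takes the value 1
at the empty word, so s is recovered from its action there. -/
theorem Delta.ofBase_injective (hJ : IsSwap S J) (hn : 0 < n) :
    Function.Injective (Delta.ofBase φ) := by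
  have hprod : ∀ (w : List J) (F : φ.wordFunctions) (L : List J),
      ((w.map φ.genAction).prod F).1 L = F.1 (L ++ w) := by
    intro w
    induction w with
    | nil => intro F L; simp
    | cons j w ih =>
      intro F L
      rw [List.map_cons, List.prod_cons, Module.End.mul_apply]
      refine (ih F (L ++ [j])).trans ?_
      simp
  obtain ⟨F, hF, -⟩ := Delta.exists_lift φ φ.baseAction φ.genAction
    (fun a b => by ext F L; exact F.2.1 L [] a b)
    (fun s a => by ext F L; exact (F.2.2.1 L [] s a).symm)
    (fun s a => by
      ext F L
      refine Eq.trans ?_ (F.2.2.1 L [] (σ s) a).symm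
      change (σ ^ (L ++ [a]).length) s * F.1 (L ++ [a]) = _
      rw [List.length_append, List.length_singleton, pow_succ, AlgEquiv.mul_apply])
    (fun x => by
      ext F L
      have := hprod (List.ofFn x) F L
      rw [List.map_ofFn] at this
      refine this.trans ?_
      have h3 := F.2.2.2 L [] x
      rw [List.append_nil, List.append_nil] at h3
      exact h3)
  rw [injective_iff_map_eq_zero]
  intro s hs
  have h0 : φ.baseAction s = 0 := by rw [← hF, hs, map_zero]
  have h1 := congrArg (fun F => F.1 []) (LinearMap.congr_fun h0 ⟨φ.wordVal, φ.wordVal_add hn,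
    φ.wordVal_smul hn, φ.wordVal_norm hJ hn⟩)
  change (σ ^ 0) s * φ.wordVal [] = 0 at h1
  rwa [φ.wordVal_of_lt (by simpa using hn), if_pos rfl, mul_one] at h1

theorem Delta.isCrossed (hJ : IsSwap S J) (G : GaloisCoords R n σ) :
    IsCrossed (Delta.ofBase φ) σ :=
  ⟨Delta.ofBase_injective φ hJ G.pos, Delta.exists_base_of_commute φ G, Delta.exists_units φ G⟩

end Injective

end
end AlmostCyclic

namespace AlmostCyclic
noncomputable section

/-! ### Maps with the commutation relations of an almost cyclic algebra -/

section DeltaMap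

variable {R S K B : Type*} [CommRing R] [CommRing S] [Algebra R S]
  [AddCommGroup K] [Module S K] [Ring B] [Algebra R B] {σ : S ≃ₐ[R] S} {n : ℕ}

/-- The relations between `S` and the generators `j t`, except for the norm relation. -/
structure IsDeltaMap (σ : S ≃ₐ[R] S) (f : S →ₐ[R] B) (j : K → B) : Prop where
  add : ∀ x y, j (x + y) = j x + j y
  left : ∀ s x, f s * j x = j (s • x)
  right : ∀ s x, j x * f s = j (σ s • x)

variable {f : S →ₐ[R] B} {j : K → B}

theorem IsDeltaMap.isDeg (hj : IsDeltaMap σ f j) (x : K) : IsDeg f σ 1 (j x) := fun s => by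
  rw [hj.right, hj.left, pow_one]

theorem IsDeltaMap.isDeg_prod (hj : IsDeltaMap σ f j) {k : ℕ} (x : Fin k → K) :
    IsDeg f σ k (List.ofFn fun i => j (x i)).prod := by
  have := isDeg_list_prod (ι := f) (σ := σ) (h := 1) (List.ofFn fun i => j (x i)) (by
    intro y hy
    obtain ⟨i, rfl⟩ := (List.mem_ofFn' _ _).mp hy
    exact hj.isDeg _)
  rwa [one_mul, List.length_ofFn] at this

theorem ofFn_update_succ {K M : Type*} (g : K → M) {k : ℕ} (x : Fin (k + 1) → K) (i : Fin k) (a : K) :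
    (fun l : Fin k => g (Function.update x i.succ a l.succ)) =
      fun l : Fin k => g (Function.update (fun l => x l.succ) i a l) := by
  funext l
  simp only [Function.update_apply, Fin.succ_inj]

/-- A scalar leaving slot i passes i generators, each of which applies σ. -/
theorem IsDeltaMap.isTwisted_prod (hj : IsDeltaMap σ f j) {k : ℕ} (x : Fin k → K) (i : Fin k) :
    (∀ a b, (List.ofFn fun l => j (Function.update x i (a + b) l)).prod =
      (List.ofFn fun l => j (Function.update x i a l)).prod +
      (List.ofFn fun l => j (Function.update x i b l)).prod) ∧
    ∀ s a, (List.ofFn fun l => j (Function.update x i (s • a) l)).prod =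
      f ((σ ^ (i : ℕ)) s) * (List.ofFn fun l => j (Function.update x i a l)).prod := by
  induction k with
  | zero => exact i.elim0
  | succ k ih =>
    simp only [List.ofFn_succ, List.prod_cons]
    refine Fin.cases ?_ (fun i => ?_) i
    · have h : ∀ a : K, (fun l : Fin k => j (Function.update x 0 a l.succ)) =
          fun l => j (x l.succ) := fun a => by
        funext l; rw [Function.update_of_ne (Fin.succ_ne_zero l)]
      simp only [h, Function.update_self]
      refine ⟨fun a b => by rw [hj.add, add_mul], fun s a => ?_⟩
      rw [← hj.left, mul_assoc]; rfl
    · obtain ⟨h1, h2⟩ := ih (fun l => x l.succ) i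
      have h0 : ∀ a : K, Function.update x i.succ a 0 = x 0 := fun a =>
        Function.update_of_ne (Fin.succ_ne_zero i).symm _ _
      simp only [ofFn_update_succ, h0]
      refine ⟨fun a b => by rw [h1, mul_add], fun s a => ?_⟩
      rw [h2, ← mul_assoc, hj.isDeg, mul_assoc, pow_one, Fin.val_succ, pow_succ']; rfl

theorem IsDeltaMap.isTwisted (hj : IsDeltaMap σ f j) (hf : Function.Injective f)
    {Θ : (Fin n → K) → S} (hΘ : ∀ x, (List.ofFn fun i => j (x i)).prod = f (Θ x)) :
    IsTwisted σ Θ :=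
  ⟨fun x i a b => hf (by rw [map_add, ← hΘ, ← hΘ, ← hΘ, (hj.isTwisted_prod x i).1]),
    fun x i s a => hf (by
      rw [smul_eq_mul, map_mul, ← hΘ, ← hΘ, (hj.isTwisted_prod x i).2])⟩

theorem IsTwisted.map_zero {Q : Type*} [AddCommGroup Q] [Module S Q] {Θ : (Fin n → K) → Q}
    (h : IsTwisted σ Θ) (x : Fin n → K) (i : Fin n) : Θ (Function.update x i 0) = 0 := by
  have := h.map_smul x i 0 0
  rwa [smul_zero, _root_.map_zero, zero_smul] at this

/-- A multiadditive identity holds as soon as it holds on generators. -/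
theorem forall_of_update {P : (Fin n → K) → Prop} (gen : Set K)
    (hgen : AddSubmonoid.closure gen = ⊤)
    (hadd : ∀ x i a b, P (Function.update x i a) → P (Function.update x i b) →
      P (Function.update x i (a + b)))
    (hzero : ∀ x i, P (Function.update x i 0)) (hP : ∀ x, (∀ i, x i ∈ gen) → P x)
    (x : Fin n → K) : P x := by
  have key : ∀ (s : Finset (Fin n)) (x : Fin n → K), (∀ i ∉ s, x i ∈ gen) → P x := by
    intro s
    induction s using Finset.induction with
    | empty => exact fun x hx => hP x fun i => hx i (by simp)
    | insert i s hi ih =>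
      intro x hx
      have h : ∀ a ∈ AddSubmonoid.closure gen, P (Function.update x i a) := by
        intro a ha
        induction ha using AddSubmonoid.closure_induction with
        | zero => exact hzero x i
        | add a b _ _ ha hb => exact hadd x i a b ha hb
        | mem a ha =>
          refine ih _ fun l hl => ?_
          by_cases hli : l = i
          · subst hli; rwa [Function.update_self]
          · rw [Function.update_of_ne hli]
            exact hx l (by simp [hli, hl])
      have := h (x i) (by rw [hgen]; trivial)
      rwa [Function.update_eq_self] at this
  exact key Finset.univ x fun i hi => absurd (Finset.mem_univ i) hi

theorem IsTwisted.rotate_of_gen {Θ : (Fin n → K) → S} (h : IsTwisted σ Θ)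
    (gen : Set K) (hgen : AddSubmonoid.closure gen = ⊤)
    (hr : ∀ x, (∀ i, x i ∈ gen) → Θ (x ∘ (finRotate n).symm) = σ (Θ x)) (x : Fin n → K) :
    Θ (x ∘ (finRotate n).symm) = σ (Θ x) := by
  refine forall_of_update (P := fun x => Θ (x ∘ (finRotate n).symm) = σ (Θ x)) gen hgen ?_ ?_ hr x
  · intro x i a b ha hb
    rw [update_comp_finRotate_symm] at ha hb ⊢
    rw [h.map_add, h.map_add, _root_.map_add, ha, hb]
  · intro x i
    rw [update_comp_finRotate_symm, h.map_zero, h.map_zero, _root_.map_zero]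

end DeltaMap

/-! ### Corners -/

section CornerHom

variable {R S A : Type*} [CommRing R] [CommRing S] [Algebra R S] [Ring A] [Algebra R A] {e : A}

/-- The map to the corner `eAe` induced by a map that commutes with `e`. -/
def cornerHom (he : IsIdempotentElem e) (f : S →ₐ[R] A) (hc : ∀ s, e * f s = f s * e) :
    S →ₐ[R] he.Corner where
  toFun s := toCorner he (f s)
  map_one' := Subtype.ext (by change e * f 1 * e = e; rw [map_one, mul_one, he.eq])
  map_mul' s t := Subtype.ext (by
    change e * f (s * t) * e = (e * f s * e) * (e * f t * e)
    have : (e * f s * e) * (e * f t * e) = e * f s * (e * e) * f t * e := by simp only [mul_assoc]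
    rw [this, he.eq, map_mul, mul_assoc (e * f s), hc t]
    simp only [mul_assoc, he.eq])
  map_zero' := Subtype.ext (by change e * f 0 * e = 0; rw [map_zero, mul_zero, zero_mul])
  map_add' s t := Subtype.ext (by
    change e * f (s + t) * e = e * f s * e + e * f t * e
    rw [map_add, mul_add, add_mul])
  commutes' r := Subtype.ext (by
    change e * f (algebraMap R S r) * e = r • e
    rw [AlgHom.commutes, Algebra.algebraMap_eq_smul_one, mul_smul_comm, mul_one, smul_mul_assoc,
      he.eq])

theorem cornerHom_apply (he : IsIdempotentElem e) (f : S →ₐ[R] A) (hc : ∀ s, e * f s = f s * e)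
    (s : S) : (cornerHom he f hc s).1 = f s * e := by
  change e * f s * e = _
  rw [hc, mul_assoc, he.eq]

theorem corner_ext {he : IsIdempotentElem e} {x y : he.Corner} (h : x.1 = y.1) : x = y :=
  Subtype.ext h

/-- An element of the corner. -/
def mkCorner (he : IsIdempotentElem e) (x : A) (h1 : e * x = x) (h2 : x * e = x) : he.Corner :=
  ⟨x, (Subsemigroup.mem_corner_iff he).mpr ⟨h1, h2⟩⟩

theorem corner_list_prod (he : IsIdempotentElem e) (L : List he.Corner) :
    L.prod.1 = e * (L.map fun x : he.Corner => x.1).prod := by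
  induction L with
  | nil => exact (mul_one e).symm
  | cons x L ih =>
    have h1 : (x :: L).prod.1 = x.1 * L.prod.1 := rfl
    have h2 : ((x :: L).map fun x : he.Corner => x.1).prod =
        x.1 * (L.map fun x : he.Corner => x.1).prod := rfl
    rw [h1, h2, ih, ← mul_assoc, ← mul_assoc, mul_corner, corner_mul]

end CornerHom

/-! ### The corner of a tensor product of two almost cyclic algebras -/

section Product

variable {R S A B : Type*} [CommRing R] [CommRing S] [Algebra R S] [Ring A] [Algebra R A]
  [Ring B] [Algebra R B] {n : ℕ} {σ : S ≃ₐ[R] S}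

theorem IsCrossed.exists_retraction {ι : S →ₐ[R] A} (hA : IsCrossed ι σ)
    (G : GaloisCoords R n σ) : ∃ ρ : A →ₗ[R] S, ∀ x, ι (ρ x) = G.proj ι 0 x := by
  have h : ∀ x, ∃ s, ι s = G.proj ι 0 x := fun x => hA.cent _ (G.isDeg_proj 0 x)
  choose ρ hρ using h
  exact ⟨{ toFun := ρ
           map_add' := fun x y => hA.inj (by rw [hρ, map_add, map_add, hρ, hρ])
           map_smul' := fun r x => hA.inj (by
            rw [hρ, map_smul, RingHom.id_apply, map_smul, hρ]) }, hρ⟩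

theorem retraction_base {ι : S →ₐ[R] A} (hA : IsCrossed ι σ) (G : GaloisCoords R n σ)
    {ρ : A →ₗ[R] S} (hρ : ∀ x, ι (ρ x) = G.proj ι 0 x) (s : S) : ρ (ι s) = s :=
  hA.inj (by rw [hρ, G.proj_of_isDeg (isDeg_base s), if_pos (Nat.ModEq.refl _)])

namespace GaloisCoords

/-- The separability idempotent. -/
def sep (G : GaloisCoords R n σ) : S ⊗[R] S := ∑ a, G.x a ⊗ₜ G.y a

variable (G : GaloisCoords R n σ)

theorem lmul'_sep : Algebra.TensorProduct.lmul' R G.sep = 1 := by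
  simp [sep, G.sum_mul_self]

theorem tmul_sep (s t : S) : (s ⊗ₜ[R] t) * G.sep = ((s * t) ⊗ₜ[R] 1) * G.sep := by
  have := G.sum_central (TensorProduct.mk R S S) t
  simp only [TensorProduct.mk_apply] at this
  have h1 : ((1 : S) ⊗ₜ[R] t) * G.sep = (t ⊗ₜ[R] 1) * G.sep := by
    simp only [sep, Finset.mul_sum, Algebra.TensorProduct.tmul_mul_tmul, one_mul]
    exact this.symm
  have h2 : s ⊗ₜ[R] t = (s ⊗ₜ[R] 1) * ((1 : S) ⊗ₜ[R] t) := by simp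
  rw [h2, mul_assoc, h1, ← mul_assoc]
  simp

theorem mul_sep (z : S ⊗[R] S) :
    z * G.sep = (Algebra.TensorProduct.lmul' R z ⊗ₜ[R] 1) * G.sep := by
  induction z with
  | zero => simp
  | add x y hx hy => rw [add_mul, hx, hy, map_add, TensorProduct.add_tmul, add_mul]
  | tmul s t => rw [G.tmul_sep]; simp

theorem isAssociatedIdempotent_sep :
    IsAssociatedIdempotent (Algebra.TensorProduct.lmul' R (S := S)).toRingHom G.sep where
  idem := by
    rw [IsIdempotentElem, G.mul_sep, G.lmul'_sep, ← Algebra.TensorProduct.one_def, one_mul]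
  map_eq_one := G.lmul'_sep
  injOn x hx := by
    change Algebra.TensorProduct.lmul' R (G.sep * x) = 0 at hx
    rw [map_mul, G.lmul'_sep, one_mul] at hx
    rw [mul_comm, G.mul_sep, hx, TensorProduct.zero_tmul, zero_mul]

/-- The image of `sep` also absorbs z as μ(z) ⊗ 1 and has image 1 under multiplication; two such
elements each equal their product. -/
theorem map_sep (τ : S ≃ₐ[R] S) :
    Algebra.TensorProduct.map (τ : S →ₐ[R] S) (τ : S →ₐ[R] S) G.sep = G.sep := by
  set T := Algebra.TensorProduct.map (τ : S →ₐ[R] S) (τ : S →ₐ[R] S) with hT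
  have h1 : ∀ z, Algebra.TensorProduct.lmul' R (T z) = τ (Algebra.TensorProduct.lmul' R z) := by
    intro z
    induction z with
    | zero => simp
    | add x y hx hy => simp only [map_add, hx, hy]
    | tmul s t => simp [hT]
  have h2 : ∀ s t, (s ⊗ₜ[R] t) * T G.sep = ((s * t) ⊗ₜ[R] 1) * T G.sep := by
    intro s t
    have := congrArg T (G.tmul_sep (τ.symm s) (τ.symm t))
    simpa [hT, map_mul] using this
  have h3 : ∀ z, z * T G.sep = (Algebra.TensorProduct.lmul' R z ⊗ₜ[R] 1) * T G.sep := by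
    intro z
    induction z with
    | zero => simp
    | add x y hx hy => rw [add_mul, hx, hy, map_add, TensorProduct.add_tmul, add_mul]
    | tmul s t => rw [h2]; simp
  have h4 := G.mul_sep (T G.sep)
  have h5 := h3 G.sep
  rw [h1, G.lmul'_sep, map_one, ← Algebra.TensorProduct.one_def, one_mul] at h4
  rw [G.lmul'_sep, ← Algebra.TensorProduct.one_def, one_mul, mul_comm, h4] at h5
  exact h5.symm

end GaloisCoords

variable {ι : S →ₐ[R] A} {κ : S →ₐ[R] B}

/-- Elements of a tensor product which commute with `S ⊗ S` come from `S ⊗ S`. -/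
theorem exists_of_commute_tmul (G : GaloisCoords R n σ) (hA : IsCrossed ι σ)
    (hB : IsCrossed κ σ) (x : A ⊗[R] B)
    (hx : ∀ s t, x * (ι s ⊗ₜ κ t) = (ι s ⊗ₜ κ t) * x) :
    ∃ w, Algebra.TensorProduct.map ι κ w = x := by
  -- The tensor product of the two projections is averaging over S ⊗ S. It fixes the elements that
  -- commute with S ⊗ S, and its image lies in the image of S ⊗ S.
  have h1 : ∀ z, TensorProduct.map (G.proj ι 0) (G.proj κ 0) z =
      ∑ a, ∑ b, (ι (G.x a) ⊗ₜ κ (G.x b)) * z * (ι (G.y a) ⊗ₜ κ (G.y b)) := by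
    intro z
    induction z with
    | zero => simp
    | add x y hx hy => simp only [map_add, hx, hy, mul_add, add_mul, Finset.sum_add_distrib]
    | tmul u v =>
      rw [TensorProduct.map_tmul, G.proj_apply, G.proj_apply, TensorProduct.sum_tmul]
      simp only [TensorProduct.tmul_sum, Algebra.TensorProduct.tmul_mul_tmul]
      rfl
  have h2 : TensorProduct.map (G.proj ι 0) (G.proj κ 0) x = x := by
    rw [h1]
    have : ∀ a b, (ι (G.x a) ⊗ₜ κ (G.x b)) * x * (ι (G.y a) ⊗ₜ κ (G.y b)) =
        x * Algebra.TensorProduct.map ι κ ((G.x a * G.y a) ⊗ₜ (G.x b * G.y b)) := fun a b => by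
      rw [← hx, mul_assoc, Algebra.TensorProduct.tmul_mul_tmul]
      simp
    simp_rw [this, ← Finset.mul_sum, ← map_sum, ← TensorProduct.tmul_sum,
      ← TensorProduct.sum_tmul, G.sum_mul_self]
    rw [← Algebra.TensorProduct.one_def, map_one, mul_one]
  have h3 : ∀ z, TensorProduct.map (G.proj ι 0) (G.proj κ 0) z ∈
      (Algebra.TensorProduct.map ι κ).range := by
    intro z
    induction z with
    | zero => simp
    | add x y hx hy => rw [map_add]; exact add_mem hx hy
    | tmul u v =>
      obtain ⟨s, hs⟩ := hA.cent _ (G.isDeg_proj (ι := ι) 0 u)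
      obtain ⟨t, ht⟩ := hB.cent _ (G.isDeg_proj (ι := κ) 0 v)
      exact ⟨s ⊗ₜ t, by
        rw [TensorProduct.map_tmul, ← hs, ← ht]
        exact Algebra.TensorProduct.map_tmul ι κ s t⟩
  have := h3 x
  rwa [h2] at this

end Product

/-! ### The product theorem -/

section ProductTheorem

theorem closure_tmul {S I J : Type*} [CommRing S] [AddCommGroup I] [Module S I]
    [AddCommGroup J] [Module S J] : AddSubmonoid.closure {z : I ⊗[S] J | ∃ x y, x ⊗ₜ y = z} = ⊤ := by
  rw [eq_top_iff]
  rintro z -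
  induction z with
  | zero => exact zero_mem _
  | add x y hx hy => exact add_mem hx hy
  | tmul x y => exact AddSubmonoid.subset_closure ⟨x, y, rfl⟩


variable {R S I J : Type*} [CommRing R] [CommRing S] [Algebra R S]
    [AddCommGroup I] [Module S I] [Module.Invertible S I]
    [AddCommGroup J] [Module S J] [Module.Invertible S J]
    {n : ℕ} {σ : S ≃ₐ[R] S}

/-- In the corner of E both copies of S act alike, so E(xt ⊗ yt) is balanced over S and gives the
generators for I ⊗ J. The corner has S as its own centralizer, and the form read off from products
of n generators is φψ on pure tensors, so recognition applies. -/
theorem exists_product_equiv (G : GaloisCoords R n σ) {hσ : σ ^ n = 1}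
    (φ : NormTrivialization σ n I hσ) (ψ : NormTrivialization σ n J hσ) :
    ∃ θ : NormTrivialization σ n (I ⊗[S] J) hσ, IsProduct φ ψ θ ∧
      ∃ (e : S ⊗[R] S)
        (he : IsAssociatedIdempotent (Algebra.TensorProduct.lmul' R (S := S)).toRingHom e)
        (F : (he.idem.map (Algebra.TensorProduct.map
          (Delta.ofBase φ) (Delta.ofBase ψ))).Corner ≃ₐ[R] Delta θ),
        ∀ s : S, F (toCorner _ (Delta.ofBase φ s ⊗ₜ[R] 1)) = Delta.ofBase θ s := by
  have hA := Delta.isCrossed φ isSwap_of_invertible G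
  have hB := Delta.isCrossed ψ isSwap_of_invertible G
  obtain ⟨ρ, hρ⟩ := hA.exists_retraction G
  obtain ⟨ρ', hρ'⟩ := hB.exists_retraction G
  have hsep := G.isAssociatedIdempotent_sep
  set M := Algebra.TensorProduct.map (Delta.ofBase φ) (Delta.ofBase ψ) with hM
  set E := M G.sep with hE
  have he : IsIdempotentElem E := hsep.idem.map M
  have hMt : ∀ s t, M (s ⊗ₜ t) = Delta.ofBase φ s ⊗ₜ Delta.ofBase ψ t :=
    fun s t => Algebra.TensorProduct.map_tmul _ _ _ _
  have hM1 : ∀ s, M (s ⊗ₜ 1) = Delta.ofBase φ s ⊗ₜ 1 := fun s => by rw [hMt, map_one]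
  have hEz : ∀ z, M z * E = M (Algebra.TensorProduct.lmul' R z ⊗ₜ[R] 1) * E := fun z => by
    rw [hE, ← map_mul, G.mul_sep, map_mul]
  have hEc : ∀ z, E * M z = M z * E := fun z => by rw [hE, ← map_mul, mul_comm, map_mul]
  let b : S →ₐ[R] Delta φ ⊗[R] Delta ψ := M.comp Algebra.TensorProduct.includeLeft
  have hb : ∀ s, b s = M (s ⊗ₜ 1) := fun s => rfl
  let f : S →ₐ[R] he.Corner := cornerHom he b (fun s => hEc (s ⊗ₜ 1))
  have hfs : ∀ s, (f s).1 = M (s ⊗ₜ 1) * E := fun s => cornerHom_apply _ _ _ _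
  -- elements of degree one
  have hdeg : ∀ (x : I) (y : J) (z : S ⊗[R] S), (Delta.gen φ x ⊗ₜ Delta.gen ψ y) * M z =
      M (Algebra.TensorProduct.map (σ : S →ₐ[R] S) (σ : S →ₐ[R] S) z) *
        (Delta.gen φ x ⊗ₜ Delta.gen ψ y) := by
    intro x y z
    induction z with
    | zero => simp
    | add u v hu hv => simp only [map_add, mul_add, add_mul, hu, hv]
    | tmul s t =>
      have hSS : Algebra.TensorProduct.map (σ : S →ₐ[R] S) (σ : S →ₐ[R] S) (s ⊗ₜ[R] t) =
          σ s ⊗ₜ[R] σ t := Algebra.TensorProduct.map_tmul _ _ _ _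
      rw [hSS, hMt, hMt, Algebra.TensorProduct.tmul_mul_tmul,
        Algebra.TensorProduct.tmul_mul_tmul, Delta.isDeg_gen, Delta.isDeg_gen, pow_one]
  have hgE : ∀ (x : I) (y : J), (Delta.gen φ x ⊗ₜ Delta.gen ψ y) * E =
      E * (Delta.gen φ x ⊗ₜ Delta.gen ψ y) := fun x y => by rw [hE, hdeg, G.map_sep]
  let g₀ : I →+ J →+ (Delta φ ⊗[R] Delta ψ) := AddMonoidHom.mk'
    (fun x => AddMonoidHom.mk' (fun y => E * (Delta.gen φ x ⊗ₜ Delta.gen ψ y))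
      (fun y y' => by rw [Delta.gen_add, TensorProduct.tmul_add, mul_add]))
    (fun x x' => by
      ext y
      change E * (Delta.gen φ (x + x') ⊗ₜ Delta.gen ψ y) = _
      rw [Delta.gen_add, TensorProduct.add_tmul, mul_add]; rfl)
  have hEs : ∀ s, E * M (1 ⊗ₜ s) = E * M (s ⊗ₜ 1) := fun s => by
    rw [hEc, hEz, hEc]; simp
  let g : I ⊗[S] J →+ (Delta φ ⊗[R] Delta ψ) := TensorProduct.liftAddHom g₀ (by
    intro s x y
    change E * (Delta.gen φ (s • x) ⊗ₜ Delta.gen ψ y) =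
      E * (Delta.gen φ x ⊗ₜ Delta.gen ψ (s • y))
    have h1 : Delta.gen φ (s • x) ⊗ₜ[R] Delta.gen ψ y =
        M (s ⊗ₜ 1) * (Delta.gen φ x ⊗ₜ Delta.gen ψ y) := by
      rw [← Delta.base_mul_gen, hM1, Algebra.TensorProduct.tmul_mul_tmul, one_mul]
    have h2 : Delta.gen φ x ⊗ₜ[R] Delta.gen ψ (s • y) =
        M (1 ⊗ₜ s) * (Delta.gen φ x ⊗ₜ Delta.gen ψ y) := by
      rw [← Delta.base_mul_gen, hMt, map_one, Algebra.TensorProduct.tmul_mul_tmul, one_mul]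
    rw [h1, h2, ← mul_assoc, ← mul_assoc, hEs])
  have hg : ∀ x y, g (x ⊗ₜ y) = E * (Delta.gen φ x ⊗ₜ Delta.gen ψ y) := fun x y => rfl
  have hgE1 : ∀ z, E * g z = g z := fun z => by
    induction z with
    | zero => simp
    | add u v hu hv => rw [map_add, mul_add, hu, hv]
    | tmul x y => rw [hg, ← mul_assoc, he.eq]
  have hgE2 : ∀ z, g z * E = g z := fun z => by
    induction z with
    | zero => simp
    | add u v hu hv => rw [map_add, add_mul, hu, hv]
    | tmul x y => rw [hg, mul_assoc, hgE, ← mul_assoc, he.eq]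
  have hgl : ∀ (s : S) z, M (s ⊗ₜ 1) * g z = g (s • z) := fun s z => by
    induction z with
    | zero => simp
    | add u v hu hv => rw [map_add, mul_add, hu, hv, smul_add, map_add]
    | tmul x y =>
      rw [TensorProduct.smul_tmul', hg, hg, ← mul_assoc, ← hEc, mul_assoc, hM1,
        Algebra.TensorProduct.tmul_mul_tmul, one_mul, Delta.base_mul_gen]
  have hgr : ∀ (s : S) z, g z * M (s ⊗ₜ 1) = g (σ s • z) := fun s z => by
    induction z with
    | zero => simp
    | add u v hu hv => rw [map_add, add_mul, hu, hv, smul_add, map_add]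
    | tmul x y =>
      rw [TensorProduct.smul_tmul', hg, hg, mul_assoc, hM1,
        Algebra.TensorProduct.tmul_mul_tmul, mul_one, Delta.gen_mul_base]
  let j : I ⊗[S] J → he.Corner := fun z => mkCorner he (g z) (hgE1 z) (hgE2 z)
  have hj : IsDeltaMap σ f j :=
    { add := fun x y => corner_ext (map_add g x y)
      left := fun s x => corner_ext (by
        change (f s).1 * g x = g (s • x)
        rw [hfs, mul_assoc, hgE1, hgl])
      right := fun s x => corner_ext (by
        change g x * (f s).1 = g (σ s • x)
        rw [hfs, ← hEc, ← mul_assoc, hgE2, hgr]) }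
  -- The map from S ⊗ S to the tensor product of the algebras is split by the two projections to
  -- degree zero; this will show that S embeds in the corner.
  have hretr : ∀ z, TensorProduct.map ρ ρ' (M z) = z := fun z => by
    induction z with
    | zero => simp
    | add u v hu hv => rw [map_add, map_add, hu, hv]
    | tmul s t =>
      rw [hMt, TensorProduct.map_tmul, retraction_base hA G hρ, retraction_base hB G hρ']
  have hinj : Function.Injective f := by
    rw [injective_iff_map_eq_zero]
    intro s hs
    have h1 : M ((s ⊗ₜ 1) * G.sep) = 0 := by
      rw [map_mul, ← hE, ← hfs, hs]; rfl
    have h2 := hretr ((s ⊗ₜ 1) * G.sep)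
    rw [h1, map_zero] at h2
    have h3 := congrArg (Algebra.TensorProduct.lmul' R) h2
    rw [map_zero, map_mul, G.lmul'_sep, mul_one] at h3
    simpa using h3.symm
  have hcent : ∀ z : he.Corner, (∀ s, z * f s = f s * z) → ∃ s, f s = z := by
    intro z hz
    have h1 : ∀ s, z.1 * M (s ⊗ₜ 1) = M (s ⊗ₜ 1) * z.1 := fun s => by
      have := congrArg Subtype.val (hz s)
      change z.1 * (f s).1 = (f s).1 * z.1 at this
      rwa [hfs, ← hEc, ← mul_assoc, mul_corner, hEc, mul_assoc, corner_mul] at this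
    -- On E an element w of S ⊗ S acts as μ(w) in the first factor, so commuting with S is commuting
    -- with S ⊗ S.
    have h2 : ∀ w, z.1 * M w = M w * z.1 := fun w => by
      have h3 := h1 (Algebra.TensorProduct.lmul' R w)
      rw [← mul_corner he z, mul_assoc, hEc, hEz, ← hEc, ← mul_assoc, mul_corner, h1,
        ← corner_mul he z, ← mul_assoc, ← hEz, mul_assoc]
    obtain ⟨w, hw⟩ := exists_of_commute_tmul G hA hB z.1 (fun s t => by rw [← hMt, h2])
    refine ⟨Algebra.TensorProduct.lmul' R w, corner_ext ?_⟩
    rw [hfs, ← hEz, hw, mul_corner]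
  -- A product of n elements of degree one has degree n ≡ 0, so it lies in the centralizer of S.
  have hΘ : ∀ z : Fin n → I ⊗[S] J, ∃ s, (List.ofFn fun i => j (z i)).prod = f s := fun z => by
    obtain ⟨s, hs⟩ := hcent (List.ofFn fun i => j (z i)).prod
      (((hj.isDeg_prod z).of_modEq hσ (Nat.modEq_zero_iff_dvd.mpr dvd_rfl) :
        IsDeg f σ 0 (List.ofFn fun i => j (z i)).prod))
    exact ⟨s, hs.symm⟩
  choose Θ hΘ using hΘ
  have hpure : ∀ (x : Fin n → I) (y : Fin n → J),
      Θ (fun i => x i ⊗ₜ y i) = φ.val x * ψ.val y := by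
    intro x y
    apply hinj
    rw [← hΘ]
    apply corner_ext
    rw [corner_list_prod, List.map_ofFn, hfs]
    have h1 : ∀ (k : ℕ) (x : Fin k → I) (y : Fin k → J),
        E * (List.ofFn ((fun z : he.Corner => z.1) ∘ fun i => j (x i ⊗ₜ y i))).prod =
        E * ((List.ofFn fun i => Delta.gen φ (x i)).prod ⊗ₜ
          (List.ofFn fun i => Delta.gen ψ (y i)).prod) := by
      intro k
      induction k with
      | zero => intro x y; simp [Algebra.TensorProduct.one_def]
      | succ k ih =>
        intro x y
        rw [List.ofFn_succ, List.ofFn_succ, List.ofFn_succ, List.prod_cons, List.prod_cons,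
          List.prod_cons]
        change E * (g (x 0 ⊗ₜ y 0) *
          (List.ofFn ((fun z : he.Corner => z.1) ∘ fun i : Fin k => j (x i.succ ⊗ₜ y i.succ))).prod) = _
        rw [← hgE2, mul_assoc (g _), ih, ← mul_assoc, ← mul_assoc, mul_assoc E (g _), hgE2, hg,
          ← mul_assoc E E, he.eq, mul_assoc, Algebra.TensorProduct.tmul_mul_tmul]
    rw [h1, Delta.prod_gen, Delta.prod_gen, ← hMt, hEc, hEz]
    simp
  have htw := hj.isTwisted hinj hΘ
  -- The values contain all products φ(x)ψ(y), which generate the unit ideal; equivariance need only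
  -- be checked on entries that are pure tensors.
  obtain ⟨θ, hθ⟩ := exists_normTrivialization isSwap_of_invertible hσ htw (by
      rw [← top_le_iff]
      have h1 : Ideal.span (Set.range φ.val) * Ideal.span (Set.range ψ.val) = ⊤ := by
        rw [φ.span_val, ψ.span_val, Ideal.mul_top]
      rw [← h1, Ideal.span_mul_span']
      refine Ideal.span_mono ?_
      rintro _ ⟨_, ⟨x, rfl⟩, _, ⟨y, rfl⟩, rfl⟩
      exact ⟨_, hpure x y⟩)
    (htw.rotate_of_gen _ closure_tmul fun z hz => by
      choose x y hxy using hz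
      obtain rfl : z = fun i => x i ⊗ₜ y i := funext fun i => (hxy i).symm
      rw [hpure, map_mul, ← φ.val_rotate, ← ψ.val_rotate]
      exact hpure _ _)
  obtain ⟨F, hF⟩ := Delta.exists_algEquiv θ G f j hj.add hj.left hj.right
    (fun x => by rw [hΘ]; congr 1; exact (hθ x).symm) hinj hcent
  refine ⟨θ, fun x y => (hθ _).trans (hpure x y), G.sep, hsep, F, fun s => ?_⟩
  rw [← hF]
  congr 1
  apply corner_ext
  change E * (Delta.ofBase φ s ⊗ₜ 1) * E = E * b s * E
  rw [hb, hM1]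

end ProductTheorem

end
end AlmostCyclic

namespace AlmostCyclic
noncomputable section

/-! ### Dual bases of crossed algebras -/

section Frame

variable {R S A : Type*} [CommRing R] [CommRing S] [Algebra R S] [Ring A] [Algebra R A]
  {n : ℕ} {σ : S ≃ₐ[R] S} {ι : S →ₐ[R] A}

namespace IsCrossed

theorem mul_comm_of_commute (hA : IsCrossed ι σ) {x y : A} (hx : ∀ s, x * ι s = ι s * x)
    (hy : ∀ s, y * ι s = ι s * y) : x * y = y * x := by
  obtain ⟨s, rfl⟩ := hA.cent y hy
  exact hx s

/-- The elements of a given degree form a module whose tensor square is symmetric. -/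
theorem swap_and_sum (hA : IsCrossed ι σ) {h N : ℕ} {w w' : Fin N → A} (hw : ∀ a, IsDeg ι σ h (w a))
    (hw' : ∀ a, IsCodeg ι σ h (w' a)) (hs : ∑ a, w a * w' a = 1) :
    (∀ x y x', IsDeg ι σ h x → IsCodeg ι σ h y → IsDeg ι σ h x' → x * y * x' = x' * y * x) ∧
    ∑ a, w' a * w a = 1 := by
  set κ := ∑ a, w' a * w a with hκ
  have hκc : ∀ s, κ * ι s = ι s * κ := fun s => by
    rw [hκ, Finset.sum_mul, Finset.mul_sum]
    exact Finset.sum_congr rfl fun a _ => IsDeg.codeg_mul (hw' a) (hw a) s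
  obtain ⟨k, hk⟩ := hA.cent κ hκc
  -- Insert Σ w w' = 1 in front. A product of an element of degree h and one of codegree h, in
  -- either order, lies in the commutative ring S, so adjacent pairs can be interchanged; this
  -- yields the symmetry up to the factor Σ w' w.
  have key : ∀ x y x', IsDeg ι σ h x → IsCodeg ι σ h y → IsDeg ι σ h x' →
      x * y * x' = ι ((σ ^ h) k) * (x' * y * x) := by
    intro x y x' hx hy hx'
    calc x * y * x' = (∑ a, w a * w' a) * (x * y * x') := by rw [hs, one_mul]
      _ = ∑ a, w a * ((w' a * x) * (y * x')) := by
        rw [Finset.sum_mul]; simp only [mul_assoc]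
      _ = ∑ a, w a * ((y * x') * (w' a * x)) := Finset.sum_congr rfl fun a _ => by
        rw [hA.mul_comm_of_commute (IsDeg.codeg_mul (hw' a) hx) (IsDeg.codeg_mul hy hx')]
      _ = ∑ a, ((w a * y) * (x' * w' a)) * x := by simp only [mul_assoc]
      _ = ∑ a, ((x' * w' a) * (w a * y)) * x := Finset.sum_congr rfl fun a _ => by
        rw [hA.mul_comm_of_commute ((hw a).mul_codeg hy) (hx'.mul_codeg (hw' a))]
      _ = x' * κ * y * x := by
        rw [hκ]; simp only [mul_assoc, Finset.mul_sum, Finset.sum_mul]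
      _ = ι ((σ ^ h) k) * (x' * y * x) := by rw [← hk, hx']; simp only [mul_assoc]
  -- With x = x' = w a, `key` says that 1 - σ^h(k) kills the square of q a = w a · w' a. As Σ q a =
  -- 1, these squares generate the unit ideal.
  have hone : (σ ^ h) k = 1 := by
    have hq : ∀ a, ∃ s, ι s = w a * w' a := fun a => hA.cent _ ((hw a).mul_codeg (hw' a))
    choose q hq using hq
    have hqs : ∑ a, q a = 1 := hA.inj (by rw [map_sum, map_one, ← hs]; simp only [hq])
    have hann : ∀ a, (1 - (σ ^ h) k) * q a ^ 2 = 0 := fun a => hA.inj (by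
      have := key _ _ _ (hw a) (hw' a) (hw a)
      rw [map_mul, map_sub, map_one, map_zero, pow_two, map_mul, hq, sub_mul, one_mul,
        sub_eq_zero, ← mul_assoc (w a * w' a)]
      conv_lhs => rw [this]
      rw [mul_assoc])
    have htop : Ideal.span (Set.range q) = ⊤ := by
      rw [Ideal.eq_top_iff_one, ← hqs]
      exact sum_mem fun a _ => Ideal.subset_span ⟨a, rfl⟩
    have h2 := Ideal.span_pow_eq_top _ htop 2
    have h3 : (1 : S) ∈ Ideal.span ((fun x : S => x ^ 2) '' Set.range q) := by
      rw [h2]; trivial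
    have h4 : ∀ z ∈ Ideal.span ((fun x : S => x ^ 2) '' Set.range q),
        (1 - (σ ^ h) k) * z = 0 := by
      intro z hz
      induction hz using Submodule.span_induction with
      | mem z hz => obtain ⟨_, ⟨a, rfl⟩, rfl⟩ := hz; exact hann a
      | zero => rw [mul_zero]
      | add x y _ _ hx hy => rw [mul_add, hx, hy, add_zero]
      | smul r x _ hx => rw [smul_eq_mul, mul_left_comm, hx, mul_zero]
    have := h4 1 h3
    rw [mul_one, sub_eq_zero] at this
    exact this.symm
  refine ⟨fun x y x' hx hy hx' => by rw [key x y x' hx hy hx', hone, map_one, one_mul], ?_⟩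
  have : k = 1 := (σ ^ h).injective (by rw [hone, map_one])
  rw [← hk, this, map_one]

end IsCrossed

/-- Coordinates for a crossed algebra. -/
structure Frame (G : GaloisCoords R n σ) (ι : S →ₐ[R] A) where
  crossed : IsCrossed ι σ
  N : ℕ → ℕ
  w : ∀ l, Fin (N l) → A
  w' : ∀ l, Fin (N l) → A
  isDeg : ∀ l a, IsDeg ι σ l (w l a)
  isCodeg : ∀ l a, IsCodeg ι σ l (w' l a)
  sum_mul : ∀ l, ∑ a, w l a * w' l a = 1
  ρ : A →ₗ[R] S
  hρ : ∀ x, ι (ρ x) = G.proj ι 0 x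

theorem IsCrossed.nonempty_frame (hA : IsCrossed ι σ) (G : GaloisCoords R n σ) :
    Nonempty (Frame G ι) := by
  obtain ⟨ρ, hρ⟩ := hA.exists_retraction G
  choose N w w' h1 h2 h3 using hA.units
  exact ⟨⟨hA, N, w, w', h1, h2, h3, ρ, hρ⟩⟩

namespace Frame

variable {G : GaloisCoords R n σ} (F : Frame G ι)

theorem swap (F : Frame G ι) {h : ℕ} {x y x' : A} (hx : IsDeg ι σ h x) (hy : IsCodeg ι σ h y)
    (hx' : IsDeg ι σ h x') : x * y * x' = x' * y * x :=
  (F.crossed.swap_and_sum (F.isDeg h) (F.isCodeg h) (F.sum_mul h)).1 x y x' hx hy hx'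

theorem ρ_base (s : S) : F.ρ (ι s) = s := retraction_base F.crossed G F.hρ s

theorem ρ_base_mul (s : S) (x : A) : F.ρ (ι s * x) = s * F.ρ x := F.crossed.inj (by
  have h := G.proj_deg_mul (isDeg_base (ι := ι) (σ := σ) s) 0 x
  rw [add_zero] at h
  rw [F.hρ, h, map_mul, F.hρ])

theorem ρ_mul_base (x : A) (s : S) : F.ρ (x * ι s) = F.ρ x * s := F.crossed.inj (by
  have h := G.proj_mul_deg (isDeg_base (ι := ι) (σ := σ) s) 0 x
  rw [add_zero] at h
  rw [F.hρ, h, map_mul, F.hρ])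

/-- The index set of a frame. -/
abbrev Idx (F : Frame G ι) : Type := Σ l : Fin n, Fin (F.N l)

/-- The elements of a frame. -/
def u (c : F.Idx) : A := F.w c.1 c.2

/-- The dual elements of a frame. -/
def v (c : F.Idx) : A := F.w' c.1 c.2

theorem isDeg_u (c : F.Idx) : IsDeg ι σ c.1 (F.u c) := F.isDeg _ _

theorem isCodeg_v (c : F.Idx) : IsCodeg ι σ c.1 (F.v c) := F.isCodeg _ _

theorem sum_uv {M : Type*} [AddCommMonoid M] (L : ℕ → A →+ M) :
    ∑ c : F.Idx, L c.1 (F.u c * F.v c) = ∑ l ∈ Finset.range n, L l 1 := by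
  rw [Fintype.sum_sigma, Finset.sum_range]
  refine Finset.sum_congr rfl fun l _ => ?_
  rw [← F.sum_mul, map_sum]
  rfl

theorem u_mul_base_mul_v (c : F.Idx) (s : S) :
    F.u c * ι s * F.v c = ι ((σ ^ (c.1 : ℕ)) s) * (F.u c * F.v c) := by
  rw [F.isDeg_u, mul_assoc]

/-- Conjugating s by the pair u, v of degree l produces σ^l(s), and within each degree Σ u v = 1; so
the sum is the trace. -/
theorem sum_base (s : S) :
    ∑ c : F.Idx, F.u c * ι s * F.v c = algebraMap R A (G.tr s) := by
  simp_rw [F.u_mul_base_mul_v]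
  refine (F.sum_uv fun l => AddMonoidHom.mulLeft (ι ((σ ^ l) s))).trans ?_
  simp only [AddMonoidHom.coe_mulLeft, mul_one]
  rw [← map_sum, ← G.algebraMap_tr, AlgHom.commutes]

/-- If u c has degree l, then v c has degree n - l, so the degree-zero part of v c · x only sees the
component of x of degree l. -/
theorem v_mul_proj (c : F.Idx) (x : A) :
    ι (F.ρ (F.v c * x)) = F.v c * G.proj ι c.1 x := by
  have h1 : IsDeg ι σ (n - c.1) (F.v c) := by
    intro s
    have h2 := F.isCodeg_v c ((σ ^ (n - (c.1 : ℕ))) s)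
    rw [h2, ← AlgEquiv.mul_apply, ← pow_add, Nat.add_sub_cancel' c.1.2.le, G.pow]
    rfl
  rw [F.hρ, ← G.proj_deg_mul h1]
  refine G.proj_congr ?_ _
  rw [Nat.sub_add_cancel c.1.2.le]
  exact (Nat.modEq_zero_iff_dvd.mpr dvd_rfl).symm

theorem proj_mul_u (c : F.Idx) (x : A) :
    ι (F.ρ (x * F.u c)) = G.proj ι (n - c.1) x * F.u c := by
  rw [F.hρ, ← G.proj_mul_deg (F.isDeg_u c)]
  refine G.proj_congr ?_ _
  rw [Nat.sub_add_cancel c.1.2.le]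
  exact (Nat.modEq_zero_iff_dvd.mpr dvd_rfl).symm

theorem sum_apply_v_proj {M : Type*} [AddCommMonoid M] (T : A → A →+ M)
    (hT : ∀ c x, T (F.u c) (F.v c * x) = T 1 (F.u c * F.v c * x)) (x : A) :
    ∑ c, T (F.u c) (ι (F.ρ (F.v c * x))) = T 1 x := by
  simp_rw [F.v_mul_proj, hT]
  refine (F.sum_uv fun l => (T 1).comp (AddMonoidHom.mulRight (G.proj ι l x))).trans ?_
  simp only [AddMonoidHom.comp_apply, AddMonoidHom.coe_mulRight, one_mul]
  rw [← map_sum, G.sum_proj]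

theorem sum_u_ρ (x : A) : ∑ c, F.u c * ι (F.ρ (F.v c * x)) = x := by
  have := F.sum_apply_v_proj AddMonoidHom.mulLeft (fun c x => by simp [mul_assoc]) x
  simpa using this

theorem sum_ρ_v (x : A) : ∑ c, ι (F.ρ (x * F.u c)) * F.v c = x := by
  simp_rw [F.proj_mul_u, mul_assoc]
  refine (F.sum_uv fun l => AddMonoidHom.mulLeft (G.proj ι (n - l) x)).trans ?_
  simp only [AddMonoidHom.coe_mulLeft, mul_one]
  have h1 : ∑ l ∈ Finset.range n, G.proj ι (n - l) x = ∑ l ∈ Finset.range n, G.proj ι (l + 1) x := by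
    rw [← Finset.sum_range_reflect]
    refine Finset.sum_congr rfl fun l hl => ?_
    have := Finset.mem_range.mp hl
    congr 2
    lia
  have h2 := Finset.sum_range_succ (fun l => G.proj ι l x) n
  rw [Finset.sum_range_succ', G.proj_congr (show n ≡ 0 [MOD n] from
    Nat.modEq_zero_iff_dvd.mpr dvd_rfl)] at h2
  rw [h1, add_right_cancel h2, G.sum_proj]

/-- The trace of a crossed algebra. -/
def t : A →ₗ[R] R := G.tr ∘ₗ F.ρ

/-- By `sum_base` the trace of ρ(y) is Σ u ρ(y) v; multiplication by u on the left and v on the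
right preserves degree zero, so ρ may be taken outside. -/
theorem algebraMap_t (y : A) : algebraMap R S (F.t y) = ∑ c, F.ρ (F.u c * y * F.v c) := by
  apply F.crossed.inj
  rw [AlgHom.commutes, t, LinearMap.comp_apply, ← F.sum_base, map_sum]
  refine Finset.sum_congr rfl fun c _ => ?_
  have h1 : IsDeg ι σ (n - c.1) (F.v c) := fun s => by
    rw [F.isCodeg_v c, ← AlgEquiv.mul_apply, ← pow_add, Nat.add_sub_cancel' c.1.2.le, G.pow]
    rfl
  have h2 : (c.1 : ℕ) + 0 + (n - c.1) ≡ 0 [MOD n] := by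
    rw [add_zero, Nat.add_sub_cancel' c.1.2.le]
    exact Nat.modEq_zero_iff_dvd.mpr dvd_rfl
  rw [F.hρ (F.u c * y * F.v c), ← G.proj_congr h2, G.proj_mul_deg h1,
    G.proj_deg_mul (F.isDeg_u c), F.hρ]

/-- Only the component of y of codegree l contributes. The symmetry of degree l shows that the
degree-zero parts of x y and y x differ by σ^l, which the trace does not see. -/
theorem t_mul_comm_of_isDeg {l : ℕ} (hl : l < n) {x : A} (hx : IsDeg ι σ l x) (y : A) :
    F.t (x * y) = F.t (y * x) := by
  have hn : n ≡ 0 [MOD n] := Nat.modEq_zero_iff_dvd.mpr dvd_rfl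
  have hy : IsCodeg ι σ l (G.proj ι (n - l) y) :=
    (G.isDeg_proj (n - l) y).isCodeg G.pow (by rwa [Nat.sub_add_cancel hl.le])
  have h1 : ι (F.ρ (x * y)) = x * G.proj ι (n - l) y := by
    rw [F.hρ, ← G.proj_deg_mul hx, Nat.add_sub_cancel' hl.le, G.proj_congr hn]
  have h2 : ι (F.ρ (y * x)) = G.proj ι (n - l) y * x := by
    rw [F.hρ, ← G.proj_mul_deg hx, Nat.sub_add_cancel hl.le, G.proj_congr hn]
  have h3 : F.ρ (x * y) = (σ ^ l) (F.ρ (y * x)) := F.crossed.inj (by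
    calc ι (F.ρ (x * y)) = ∑ a, (x * G.proj ι (n - l) y * F.w l a) * F.w' l a := by
          simp_rw [mul_assoc _ (F.w l _), ← Finset.mul_sum, F.sum_mul, mul_one, h1]
      _ = ∑ a, F.w l a * (G.proj ι (n - l) y * x) * F.w' l a :=
          Finset.sum_congr rfl fun a _ => by
            rw [F.swap hx hy (F.isDeg l a), mul_assoc (F.w l a)]
      _ = ι ((σ ^ l) (F.ρ (y * x))) := by
          simp_rw [← h2, F.isDeg l _ _, mul_assoc, ← Finset.mul_sum, F.sum_mul, mul_one])
  rw [t, LinearMap.comp_apply, LinearMap.comp_apply, h3, G.tr_pow_apply]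

theorem t_mul_comm (x y : A) : F.t (x * y) = F.t (y * x) := by
  conv_lhs => rw [← G.sum_proj (ι := ι) x]
  conv_rhs => rw [← G.sum_proj (ι := ι) x]
  rw [Finset.sum_mul, Finset.mul_sum, map_sum, map_sum]
  exact Finset.sum_congr rfl fun l hl =>
    F.t_mul_comm_of_isDeg (Finset.mem_range.mp hl) (G.isDeg_proj l x) y

/-! ### The element which induces the transposition -/

/-- The index set of the dual bases. -/
abbrev BIdx (F : Frame G ι) : Type := F.Idx × Fin G.N

/-- A basis. -/
def d (b : F.BIdx) : A := F.u b.1 * ι (G.x b.2)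

/-- The dual basis for the trace form. -/
def d' (b : F.BIdx) : A := ι (G.y b.2) * F.v b.1

theorem sum_t_smul_d (x : A) : ∑ b, F.t (F.d' b * x) • F.d b = x := by
  conv_rhs => rw [← F.sum_u_ρ x]
  rw [Fintype.sum_prod_type]
  refine Finset.sum_congr rfl fun c _ => ?_
  conv_rhs => rw [← G.sum_tr_smul_x (F.ρ (F.v c * x)), map_sum, Finset.mul_sum]
  refine Finset.sum_congr rfl fun i _ => ?_
  rw [d, d', t, LinearMap.comp_apply, mul_assoc, F.ρ_base_mul, mul_comm (G.y i), map_smul,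
    mul_smul_comm]

theorem sum_t_smul_d' (x : A) : ∑ b, F.t (x * F.d b) • F.d' b = x := by
  conv_rhs => rw [← F.sum_ρ_v x]
  rw [Fintype.sum_prod_type]
  refine Finset.sum_congr rfl fun c _ => ?_
  conv_rhs => rw [← G.sum_tr_smul_y (F.ρ (x * F.u c)), map_sum, Finset.sum_mul]
  refine Finset.sum_congr rfl fun i _ => ?_
  rw [d, d', t, LinearMap.comp_apply, ← mul_assoc, F.ρ_mul_base, map_smul, smul_mul_assoc]

/-- The element of `A ⊗ A` which induces the transposition. -/
def γ : A ⊗[R] A := ∑ b, F.d b ⊗ₜ F.d' b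

/-- Right multiplication by x on the basis d and left multiplication by x on the dual basis d' have
the same matrix, because t is symmetric. -/
theorem γ_mul_left (x : A) : F.γ * (x ⊗ₜ 1) = (1 ⊗ₜ x) * F.γ := by
  simp only [γ, Finset.sum_mul, Finset.mul_sum, Algebra.TensorProduct.tmul_mul_tmul, mul_one,
    one_mul]
  have h1 : ∀ b, (F.d b * x) ⊗ₜ[R] F.d' b =
      ∑ c, F.t (F.d' c * (F.d b * x)) • (F.d c ⊗ₜ[R] F.d' b) := fun b => by
    conv_lhs => rw [← F.sum_t_smul_d (F.d b * x), TensorProduct.sum_tmul]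
    simp only [TensorProduct.smul_tmul']
  have h2 : ∀ c, F.d c ⊗ₜ[R] (x * F.d' c) =
      ∑ b, F.t (x * F.d' c * F.d b) • (F.d c ⊗ₜ[R] F.d' b) := fun c => by
    conv_lhs => rw [← F.sum_t_smul_d' (x * F.d' c), TensorProduct.tmul_sum]
    simp only [TensorProduct.tmul_smul]
  simp_rw [h1, h2]
  rw [Finset.sum_comm]
  refine Finset.sum_congr rfl fun c _ => Finset.sum_congr rfl fun b _ => ?_
  rw [← mul_assoc, F.t_mul_comm, ← mul_assoc]

theorem γ_mul_right (x : A) : F.γ * (1 ⊗ₜ x) = (x ⊗ₜ 1) * F.γ := by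
  simp only [γ, Finset.sum_mul, Finset.mul_sum, Algebra.TensorProduct.tmul_mul_tmul, mul_one,
    one_mul]
  have h1 : ∀ b, (x * F.d b) ⊗ₜ[R] F.d' b =
      ∑ c, F.t (F.d' c * (x * F.d b)) • (F.d c ⊗ₜ[R] F.d' b) := fun b => by
    conv_lhs => rw [← F.sum_t_smul_d (x * F.d b), TensorProduct.sum_tmul]
    simp only [TensorProduct.smul_tmul']
  have h2 : ∀ c, F.d c ⊗ₜ[R] (F.d' c * x) =
      ∑ b, F.t (F.d' c * x * F.d b) • (F.d c ⊗ₜ[R] F.d' b) := fun c => by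
    conv_lhs => rw [← F.sum_t_smul_d' (F.d' c * x), TensorProduct.tmul_sum]
    simp only [TensorProduct.tmul_smul]
  simp_rw [h1, h2]
  rw [Finset.sum_comm]
  refine Finset.sum_congr rfl fun c _ => Finset.sum_congr rfl fun b _ => ?_
  rw [mul_assoc]

theorem γ_mul_tmul (x y : A) : F.γ * (x ⊗ₜ y) = (y ⊗ₜ x) * F.γ := by
  have h1 : x ⊗ₜ[R] y = (x ⊗ₜ 1) * (1 ⊗ₜ y) := by simp
  have h2 : y ⊗ₜ[R] x = (1 ⊗ₜ x) * (y ⊗ₜ 1) := by simp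
  rw [h1, h2, ← mul_assoc, F.γ_mul_left, mul_assoc, F.γ_mul_right, mul_assoc]

/-- The image of the separability idempotent. -/
def e (_ : Frame G ι) : A ⊗[R] A := ∑ i, ι (G.x i) ⊗ₜ ι (G.y i)

theorem e_eq : F.e = Algebra.TensorProduct.map ι ι G.sep := by
  rw [GaloisCoords.sep, map_sum]
  exact Finset.sum_congr rfl fun i _ => (Algebra.TensorProduct.map_tmul _ _ _ _).symm

theorem base_mul_e (s : S) : (1 ⊗ₜ ι s) * F.e = (ι s ⊗ₜ 1) * F.e := by
  have h := congrArg (Algebra.TensorProduct.map ι ι) (G.tmul_sep 1 s)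
  rw [map_mul, map_mul, one_mul, ← e_eq] at h
  have h1 : Algebra.TensorProduct.map ι ι (1 ⊗ₜ[R] s) = 1 ⊗ₜ ι s := by
    rw [← map_one ι]; exact Algebra.TensorProduct.map_tmul _ _ _ _
  have h2 : Algebra.TensorProduct.map ι ι (s ⊗ₜ[R] 1) = ι s ⊗ₜ 1 := by
    rw [← map_one ι]; exact Algebra.TensorProduct.map_tmul _ _ _ _
  rwa [h1, h2] at h

theorem γ_eq : F.γ = ∑ c, (F.u c ⊗ₜ 1) * F.e * (1 ⊗ₜ F.v c) := by
  simp only [γ, e, Finset.sum_mul, Finset.mul_sum, Algebra.TensorProduct.tmul_mul_tmul, mul_one,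
    one_mul, Fintype.sum_prod_type, d, d']

theorem e_mul_base (s t : S) : F.e * (ι s ⊗ₜ ι t) = (ι s ⊗ₜ ι t) * F.e := by
  have h1 : ι s ⊗ₜ ι t = Algebra.TensorProduct.map ι ι (s ⊗ₜ[R] t) :=
    (Algebra.TensorProduct.map_tmul _ _ _ _).symm
  rw [e_eq, h1, ← map_mul, mul_comm, map_mul]

/-- Next to e the two copies of S act alike, so moving the first copy of S past 1 ⊗ v c twists it by
σ^l, l being the degree of u c. The second e then contributes Σ σ^l(x i) y i, which is zero for 0 <
l < n. -/
theorem e_mul_v_mul_e (c : F.Idx) : F.e * (1 ⊗ₜ F.v c) * F.e =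
    if (c.1 : ℕ) = 0 then (F.v c ⊗ₜ 1) * F.e else 0 := by
  have h1 : ∀ s, F.e * (1 ⊗ₜ F.v c) * (ι s ⊗ₜ 1) =
      F.e * (1 ⊗ₜ F.v c) * (1 ⊗ₜ ι ((σ ^ (c.1 : ℕ)) s)) := fun s => by
    have h2 := F.e_mul_base 1 s
    have h3 := F.e_mul_base s 1
    rw [map_one] at h2 h3
    calc F.e * (1 ⊗ₜ F.v c) * (ι s ⊗ₜ 1) = F.e * (ι s ⊗ₜ 1) * (1 ⊗ₜ F.v c) := by
          simp only [mul_assoc, Algebra.TensorProduct.tmul_mul_tmul, mul_one, one_mul]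
      _ = F.e * (1 ⊗ₜ ι s) * (1 ⊗ₜ F.v c) := by rw [h3, ← F.base_mul_e, h2]
      _ = _ := by
          simp only [mul_assoc, Algebra.TensorProduct.tmul_mul_tmul, mul_one]
          rw [F.isCodeg_v]
  have h4 : F.e * (1 ⊗ₜ F.v c) * F.e =
      F.e * (1 ⊗ₜ (F.v c * ι (∑ i, (σ ^ (c.1 : ℕ)) (G.x i) * (σ ^ 0) (G.y i)))) := by
    have h0 : ∀ z, z * F.e = ∑ i, z * (ι (G.x i) ⊗ₜ[R] ι (G.y i)) := fun z => by
      rw [e, Finset.mul_sum]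
    rw [h0, map_sum, Finset.mul_sum, TensorProduct.tmul_sum, Finset.mul_sum]
    refine Finset.sum_congr rfl fun i _ => ?_
    have h5 : ι (G.x i) ⊗ₜ[R] ι (G.y i) = (ι (G.x i) ⊗ₜ 1) * (1 ⊗ₜ ι (G.y i)) := by simp
    rw [h5, ← mul_assoc, h1]
    simp [mul_assoc, Algebra.TensorProduct.tmul_mul_tmul]
  rw [h4, G.orth]
  have h6 : ((c.1 : ℕ) ≡ 0 [MOD n]) ↔ (c.1 : ℕ) = 0 := by
    rw [Nat.ModEq, Nat.mod_eq_of_lt c.1.2, Nat.zero_mod]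
  simp only [h6]
  split_ifs with h
  · obtain ⟨s, hs⟩ := F.crossed.cent (F.v c) (fun s => by
      have := F.isCodeg_v c s
      rw [h, pow_zero] at this
      exact this.symm)
    have h2 := F.e_mul_base 1 s
    rw [map_one] at h2
    rw [map_one, mul_one, ← hs, h2, F.base_mul_e]
  · rw [map_zero, mul_zero, TensorProduct.tmul_zero, mul_zero]

/-- In γ = Σ (u ⊗ 1) e (1 ⊗ v) only the terms of degree zero survive multiplication by e, and there
Σ u v = 1. -/
theorem γ_mul_e : F.γ * F.e = F.e := by
  have h1 : ∀ c, (F.u c ⊗ₜ[R] (1 : A)) * F.e * (1 ⊗ₜ F.v c) * F.e =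
      if (c.1 : ℕ) = 0 then ((F.u c * F.v c) ⊗ₜ 1) * F.e else 0 := by
    intro c
    rw [mul_assoc, mul_assoc, ← mul_assoc F.e, F.e_mul_v_mul_e]
    split_ifs
    · rw [← mul_assoc, Algebra.TensorProduct.tmul_mul_tmul, one_mul]
    · rw [mul_zero]
  rw [γ_eq, Finset.sum_mul]
  simp_rw [h1]
  let L : A →+ A ⊗[R] A :=
    (AddMonoidHom.mulRight F.e).comp ((TensorProduct.mk R A A).flip 1).toAddMonoidHom
  have h2 : ∀ c : F.Idx, (if (c.1 : ℕ) = 0 then ((F.u c * F.v c) ⊗ₜ[R] (1 : A)) * F.e else 0) =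
      (if (c.1 : ℕ) = 0 then L else 0) (F.u c * F.v c) := fun c => by split_ifs <;> rfl
  simp_rw [h2]
  refine (F.sum_uv fun l => if l = 0 then L else 0).trans ?_
  rw [Finset.sum_eq_single_of_mem 0 (Finset.mem_range.mpr G.pos) (fun l _ hl => by
    rw [if_neg hl]; rfl), if_pos rfl]
  change ((1 : A) ⊗ₜ[R] (1 : A)) * F.e = F.e
  rw [← Algebra.TensorProduct.one_def, one_mul]

/-- Hence e generates the unit two-sided ideal: an element that commutes with A ⊗ A is known from
its product with e. The sum over c produces tr(x i), and Σ tr(x i) y i = 1. -/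
theorem sum_u_e_v : ∑ c, (F.u c ⊗ₜ[R] (1 : A)) * F.e * (F.v c ⊗ₜ 1) = 1 := by
  simp only [e, Finset.sum_mul, Finset.mul_sum, Algebra.TensorProduct.tmul_mul_tmul, mul_one,
    one_mul]
  rw [Finset.sum_comm]
  simp_rw [← TensorProduct.sum_tmul, F.sum_base, Algebra.algebraMap_eq_smul_one,
    TensorProduct.smul_tmul, ← TensorProduct.tmul_sum, ← map_smul, ← map_sum]
  have := G.sum_tr_smul_y 1
  simp_rw [one_mul] at this
  rw [this, map_one, Algebra.TensorProduct.one_def]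

end Frame

end Frame

end
end AlmostCyclic

namespace AlmostCyclic
noncomputable section

theorem span_apply_eq_top {S M : Type*} [CommRing S] [AddCommGroup M] [Module S M]
    [Module.Invertible S M] : Ideal.span {s | ∃ (f : M →ₗ[S] S) (x : M), f x = s} = ⊤ := by
  have h : ∀ z, contractLeft S M z ∈ Ideal.span {s | ∃ (f : M →ₗ[S] S) (x : M), f x = s} := by
    intro z
    induction z with
    | zero => rw [map_zero]; exact zero_mem _
    | add x y hx hy => rw [map_add]; exact add_mem hx hy
    | tmul f x => exact Ideal.subset_span ⟨f, x, (contractLeft_apply f x).symm⟩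
  obtain ⟨z, hz⟩ := (Module.Invertible.bijective (R := S) (M := M)).2 1
  rw [Ideal.eq_top_iff_one, ← hz]
  exact h z

/-! ### Splitting modules of a crossed algebra -/

section Rep

universe u v

variable {R S : Type u} {A : Type v} [CommRing R] [CommRing S] [Algebra R S] [Ring A] [Algebra R A]
  {n : ℕ} {σ : S ≃ₐ[R] S} {ι : S →ₐ[R] A} {G : GaloisCoords R n σ}
  {T' V : Type u} [CommRing T'] [Algebra R T'] [AddCommGroup V] [Module T' V]
  (θ : T' ⊗[R] A ≃ₐ[T'] Module.End T' V)

/-- The action of `T' ⊗ S` on `V`. -/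
def baseRep (ι : S →ₐ[R] A) : T' ⊗[R] S →ₐ[T'] Module.End T' V :=
  θ.toAlgHom.comp (Algebra.TensorProduct.map (AlgHom.id T' T') ι)

theorem baseRep_tmul (t : T') (s : S) : baseRep θ ι (t ⊗ₜ s) = t • θ (1 ⊗ₜ ι s) := by
  change θ (Algebra.TensorProduct.map (AlgHom.id T' T') ι (t ⊗ₜ s)) = _
  rw [Algebra.TensorProduct.map_tmul, ← map_smul, TensorProduct.smul_tmul', AlgHom.id_apply,
    smul_eq_mul, mul_one]

theorem baseRep_injective (F : Frame G ι) : Function.Injective (baseRep θ ι) := by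
  have h : ∀ z : T' ⊗[R] S, (F.ρ.lTensor T') (Algebra.TensorProduct.map (AlgHom.id T' T') ι z) = z := by
    intro z
    induction z with
    | zero => simp
    | add x y hx hy => rw [map_add, map_add, hx, hy]
    | tmul t s => rw [Algebra.TensorProduct.map_tmul, LinearMap.lTensor_tmul, F.ρ_base]; rfl
  exact θ.injective.comp (Function.LeftInverse.injective h)

/-- Averaging over the coordinates applies ρ to the factor A and fixes whatever commutes with S; so
the centralizer of S in T' ⊗ A is T' ⊗ S. -/
theorem exists_baseRep (F : Frame G ι) (u : Module.End T' V)
    (hu : ∀ s, u * θ (1 ⊗ₜ ι s) = θ (1 ⊗ₜ ι s) * u) : ∃ z, baseRep θ ι z = u := by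
  obtain ⟨z, rfl⟩ := θ.surjective u
  have hz : ∀ s, z * (1 ⊗ₜ ι s) = (1 ⊗ₜ ι s) * z := fun s =>
    θ.injective (by rw [map_mul, map_mul, hu])
  have h1 : ∀ z : T' ⊗[R] A, ∑ i, (1 ⊗ₜ ι (G.x i)) * z * (1 ⊗ₜ ι (G.y i)) =
      Algebra.TensorProduct.map (AlgHom.id T' T') ι (F.ρ.lTensor T' z) := by
    intro z
    induction z with
    | zero => simp
    | add x y hx hy => simp only [mul_add, add_mul, Finset.sum_add_distrib, hx, hy, map_add]
    | tmul t a =>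
      rw [LinearMap.lTensor_tmul, Algebra.TensorProduct.map_tmul, F.hρ, G.proj_apply,
        TensorProduct.tmul_sum]
      simp
  refine ⟨F.ρ.lTensor T' z, congrArg θ ((h1 z).symm.trans ?_)⟩
  have h2 : ∀ i, (1 ⊗ₜ ι (G.x i)) * z * (1 ⊗ₜ ι (G.y i)) = (1 ⊗ₜ ι (G.x i * G.y i)) * z :=
    fun i => by
      rw [mul_assoc, hz, ← mul_assoc, Algebra.TensorProduct.tmul_mul_tmul, map_mul, mul_one]
  rw [Finset.sum_congr rfl fun i _ => h2 i, ← Finset.sum_mul, ← TensorProduct.tmul_sum, ← map_sum,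
    G.sum_mul_self, map_one, ← Algebra.TensorProduct.one_def, one_mul]

/-- The endomorphisms of V over T' ⊗ S are the centralizer of S in T' ⊗ A, that is, T' ⊗ S itself.
As V is finite projective over T' ⊗ S, its dual tensored with V is this endomorphism ring, so V is
invertible. -/
theorem invertible_rep (F : Frame G ι) [Module.Finite T' V] [Module.Projective T' V] :
    letI : Module (T' ⊗[R] S) V := Module.compHom V (baseRep θ ι).toRingHom
    Module.Invertible (T' ⊗[R] S) V := by
  let _ : Module (T' ⊗[R] S) V := Module.compHom V (baseRep θ ι).toRingHom
  have hsm : ∀ (z : T' ⊗[R] S) (v : V), z • v = baseRep θ ι z v := fun _ _ => rfl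
  have hts : ∀ (t : T') (s : S) (v : V), (t ⊗ₜ[R] s) • v = t • θ (1 ⊗ₜ ι s) v := fun t s v => by
    rw [hsm, baseRep_tmul]; rfl
  have : IsScalarTower T' (T' ⊗[R] S) V := ⟨fun t z v => by
    rw [hsm, hsm, map_smul]; rfl⟩
  have : Module.Finite (T' ⊗[R] S) V := Module.Finite.of_restrictScalars_finite T' _ _
  have : Module.Projective (T' ⊗[R] S) V := by
    obtain ⟨N, f, g, -, -, hfg⟩ := Module.Finite.exists_comp_eq_id_of_projective T' V
    let L (v : V) (j : Fin N) : S →ₗ[R] T' :=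
      { toFun := fun b => g (θ (1 ⊗ₜ ι b) v) j
        map_add' := fun a b => by simp [TensorProduct.tmul_add]
        map_smul' := fun r b => by
          have h : (1 : T') ⊗ₜ[R] ι (r • b) = algebraMap R T' r • ((1 : T') ⊗ₜ[R] ι b) := by
            rw [map_smul, TensorProduct.tmul_smul, algebraMap_smul]
          rw [h, map_smul, LinearMap.smul_apply, map_smul, Pi.smul_apply, algebraMap_smul]
          rfl }
    have hL : ∀ t s v j b, L (t • θ (1 ⊗ₜ ι s) v) j b = t * L v j (s * b) := fun t s v j b => by
      change g (θ (1 ⊗ₜ ι b) (t • θ (1 ⊗ₜ ι s) v)) j = t * g (θ (1 ⊗ₜ ι (s * b)) v) j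
      rw [map_smul, map_smul, ← Module.End.mul_apply, ← map_mul,
        Algebra.TensorProduct.tmul_mul_tmul, ← map_mul, mul_comm b s, one_mul]
      rfl
    have hLc : ∀ v j (s : S), ∑ i, L v j (G.y i) ⊗ₜ[R] (s * G.x i) =
        ∑ i, L v j (s * G.y i) ⊗ₜ[R] G.x i := fun v j s =>
      G.sum_central ((TensorProduct.mk R T' S).flip.compl₂ (L v j)) s
    -- The T'-linear section g of a free presentation is averaged over the Galois coordinates, which
    -- makes it linear over T' ⊗ S; this is separability of S/R.
    let g' : V →+ (Fin N → T' ⊗[R] S) :=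
      { toFun := fun v j => ∑ i, L v j (G.y i) ⊗ₜ G.x i
        map_zero' := by
          funext j
          refine Finset.sum_eq_zero fun i _ => ?_
          change g (θ (1 ⊗ₜ ι (G.y i)) 0) j ⊗ₜ[R] G.x i = 0
          rw [map_zero, map_zero, Pi.zero_apply, TensorProduct.zero_tmul]
        map_add' := fun v v' => by
          funext j
          rw [Pi.add_apply, ← Finset.sum_add_distrib]
          refine Finset.sum_congr rfl fun i _ => ?_
          change g (θ (1 ⊗ₜ ι (G.y i)) (v + v')) j ⊗ₜ[R] G.x i = _
          rw [map_add, map_add, Pi.add_apply, TensorProduct.add_tmul]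
          rfl }
    have hg' : ∀ v j, g' v j = ∑ i, L v j (G.y i) ⊗ₜ G.x i := fun _ _ => rfl
    have hlin : ∀ (z : T' ⊗[R] S) v, g' (z • v) = z • g' v := by
      intro z v
      induction z with
      | zero => rw [zero_smul, zero_smul, map_zero]
      | add a b ha hb => rw [add_smul, add_smul, map_add, ha, hb]
      | tmul t s =>
        funext j
        rw [hts, hg', Pi.smul_apply, hg', smul_eq_mul]
        simp_rw [hL, Finset.mul_sum, Algebra.TensorProduct.tmul_mul_tmul, ← smul_eq_mul t,
          ← TensorProduct.smul_tmul', ← Finset.smul_sum, hLc]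
    refine Module.Projective.of_split (M := Fin N → T' ⊗[R] S)
      { toFun := g', map_add' := map_add g', map_smul' := hlin }
      (Fintype.linearCombination (T' ⊗[R] S) fun j => f (Pi.single j 1)) ?_
    ext v
    change Fintype.linearCombination (T' ⊗[R] S) (fun j => f (Pi.single j 1)) (g' v) = v
    rw [Fintype.linearCombination_apply]
    simp_rw [hg', Finset.sum_smul]
    rw [Finset.sum_comm]
    have h1 : ∀ i, ∑ j, (L v j (G.y i) ⊗ₜ[R] G.x i) • f (Pi.single j 1) =
        θ (1 ⊗ₜ ι (G.x i * G.y i)) v := by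
      intro i
      have h2 : ∑ j, L v j (G.y i) • f (Pi.single j 1) = θ (1 ⊗ₜ ι (G.y i)) v := by
        have h3 := LinearMap.congr_fun hfg (θ (1 ⊗ₜ ι (G.y i)) v)
        rw [LinearMap.comp_apply, LinearMap.id_apply] at h3
        conv_rhs => rw [← h3, pi_eq_sum_univ' (g (θ (1 ⊗ₜ ι (G.y i)) v)), map_sum]
        simp_rw [map_smul]
        rfl
      have h3 : ∀ j, (L v j (G.y i) ⊗ₜ[R] G.x i) • f (Pi.single j 1) =
          θ (1 ⊗ₜ ι (G.x i)) (L v j (G.y i) • f (Pi.single j 1)) := fun j => by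
        rw [hts, map_smul]
      rw [Finset.sum_congr rfl fun j _ => h3 j, ← map_sum, h2, ← Module.End.mul_apply,
          ← map_mul, Algebra.TensorProduct.tmul_mul_tmul,
        ← map_mul, one_mul]
    rw [Finset.sum_congr rfl fun i _ => h1 i, ← LinearMap.sum_apply, ← map_sum,
      ← TensorProduct.tmul_sum, ← map_sum, G.sum_mul_self, map_one,
      ← Algebra.TensorProduct.one_def, map_one]
    rfl
  have hbij : Function.Bijective (LinearMap.lsmul (T' ⊗[R] S) V) := by
    constructor
    · intro z z' hz
      refine baseRep_injective θ F (LinearMap.ext fun v => ?_)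
      exact LinearMap.congr_fun hz v
    · intro u
      have hu : ∀ z v, u (baseRep θ ι z v) = baseRep θ ι z (u v) := fun z v => u.map_smul z v
      obtain ⟨z, hz⟩ := exists_baseRep θ F
        ({ toFun := u, map_add' := u.map_add, map_smul' := fun t v => by
            have := hu (t ⊗ₜ 1) v
            rw [baseRep_tmul, map_one, ← Algebra.TensorProduct.one_def, map_one] at this
            exact this } : Module.End T' V) (fun s => by
          ext v
          have := hu (1 ⊗ₜ s) v
          rw [baseRep_tmul, one_smul] at this
          exact this)
      exact ⟨z, LinearMap.ext fun v => LinearMap.congr_fun hz v⟩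
  exact Module.Invertible.right ((dualTensorHomEquiv (T' ⊗[R] S) V V).trans
    (LinearEquiv.ofBijective _ hbij).symm)

/-- A bilinear map which is balanced over `S` is symmetric. -/
theorem rep_symm (F : Frame G ι) [Module.Finite T' V] [Module.Projective T' V] {Q : Type*}
    [AddCommGroup Q] [Module T' Q] (B : V →ₗ[T'] V →ₗ[T'] Q)
    (hB : ∀ s v v', B (θ (1 ⊗ₜ ι s) v) v' = B v (θ (1 ⊗ₜ ι s) v')) (v v' : V) :
    B v v' = B v' v := by
  let _ : Module (T' ⊗[R] S) V := Module.compHom V (baseRep θ ι).toRingHom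
  have := invertible_rep θ F
  refine (isSwap_of_invertible (S := T' ⊗[R] S) (M := V)).symm_of_balanced (fun v v' => B v v')
    (by intros; simp) (by intros; simp) (fun z v v' => ?_) v v'
  change B (baseRep θ ι z v) v' = B v (baseRep θ ι z v')
  induction z with
  | zero => simp
  | add a b ha hb => simp only [map_add, LinearMap.add_apply, ha, hb]
  | tmul t s =>
    rw [baseRep_tmul, LinearMap.smul_apply, LinearMap.smul_apply, map_smul, LinearMap.smul_apply,
      map_smul, hB]

/-- A family of alternating bilinear maps which is balanced over `S` vanishes. -/
theorem rep_alternating (F : Frame G ι) [Module.Finite T' V] [Module.Projective T' V] {Q : Type*}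
    [AddCommGroup Q] [Module T' Q] (C : S → V →ₗ[T'] V →ₗ[T'] Q)
    (hl : ∀ s z v v', C s (θ (1 ⊗ₜ ι z) v) v' = C (z * s) v v')
    (hr : ∀ s z v v', C s v (θ (1 ⊗ₜ ι z) v') = C (z * s) v v')
    (h0 : ∀ s v, C s v v = 0) (s : S) (v v' : V) : C s v v' = 0 := by
  let _ : Module (T' ⊗[R] S) V := Module.compHom V (baseRep θ ι).toRingHom
  have := invertible_rep θ F
  have hsm : ∀ (z : T' ⊗[R] S) (v : V), z • v = baseRep θ ι z v := fun _ _ => rfl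
  have hbal : ∀ (z : T' ⊗[R] S) s v v', C s (z • v) v' = C s v (z • v') := by
    intro z s v v'
    induction z with
    | zero => simp
    | add a b ha hb => simp only [add_smul, map_add, LinearMap.add_apply, ha, hb]
    | tmul t r =>
      rw [hsm, hsm, baseRep_tmul, LinearMap.smul_apply, LinearMap.smul_apply, map_smul,
        LinearMap.smul_apply, map_smul, hl, hr]
  have hself : ∀ (z : T' ⊗[R] S) s v, C s (z • v) v = 0 := by
    intro z s v
    induction z with
    | zero => simp
    | add a b ha hb => simp only [add_smul, map_add, LinearMap.add_apply, ha, hb, add_zero]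
    | tmul t r =>
      rw [hsm, baseRep_tmul, LinearMap.smul_apply, map_smul, LinearMap.smul_apply, hl, h0, smul_zero]
  have hswap := isSwap_of_invertible (S := T' ⊗[R] S) (M := V)
  -- Give one factor f(u) to each argument and interchange u with v and with v'. Both arguments
  -- become multiples of u, on which the form vanishes.
  have hkey : ∀ (f : V →ₗ[T' ⊗[R] S] T' ⊗[R] S) u v v', C s ((f u ^ 2) • v) v' = 0 := by
    intro f u v v'
    rw [pow_two, mul_smul, hbal, hswap.apply_smul f u v, hswap.apply_smul f u v', hbal, smul_smul,
      ← hbal, hself]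
  have htop := Ideal.span_pow_eq_top _ (span_apply_eq_top (S := T' ⊗[R] S) (M := V)) 2
  have h1 : ∀ z ∈ Ideal.span ((fun x : T' ⊗[R] S => x ^ 2) ''
      {s | ∃ (f : V →ₗ[T' ⊗[R] S] T' ⊗[R] S) (x : V), f x = s}), ∀ v, C s (z • v) v' = 0 := by
    intro z hz
    induction hz using Submodule.span_induction with
    | mem z hz => obtain ⟨_, ⟨f, u, rfl⟩, rfl⟩ := hz; exact fun v => hkey f u v v'
    | zero => simp
    | add a b _ _ ha hb => intro v; rw [add_smul, map_add, LinearMap.add_apply, ha, hb, add_zero]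
    | smul r a _ ha => intro v; rw [smul_eq_mul, mul_comm, mul_smul, ha]
  have h2 := h1 1 (by rw [htop]; trivial) v
  rwa [one_smul] at h2

end Rep

end
end AlmostCyclic

namespace AlmostCyclic
noncomputable section

/-! ### Tensor powers of algebras -/

section Pow

variable {R A B C : Type*} [CommRing R] [Ring A] [Algebra R A] [Ring B] [Algebra R B]
  [Ring C] [Algebra R C] {m : ℕ}

/-- The homomorphism of tensor powers induced by a homomorphism of algebras. -/
def powMap (f : A →ₐ[R] B) (m : ℕ) : (⨂[R] _ : Fin m, A) →ₐ[R] ⨂[R] _ : Fin m, B :=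
  PiTensorProduct.liftAlgHom
    ((PiTensorProduct.tprod R).compLinearMap fun _ => f.toLinearMap)
    (by
      change PiTensorProduct.tprod R (fun _ => f 1) = _
      rw [map_one]
      rfl)
    (fun x y => by
      rw [MultilinearMap.compLinearMap_apply, MultilinearMap.compLinearMap_apply,
        MultilinearMap.compLinearMap_apply, PiTensorProduct.tprod_mul_tprod]
      congr 1
      funext i
      exact map_mul f _ _)

theorem powMap_tprod (f : A →ₐ[R] B) (x : Fin m → A) :
    powMap f m (PiTensorProduct.tprod R x) = PiTensorProduct.tprod R fun i => f (x i) :=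
  PiTensorProduct.lift.tprod _

theorem powMap_apply (f : A →ₐ[R] B) (z : ⨂[R] _ : Fin m, A) :
    powMap f m z = PiTensorProduct.map (fun _ => f.toLinearMap) z := by
  induction z using PiTensorProduct.induction_on with
  | smul_tprod r x => rw [map_smul, map_smul, powMap_tprod, PiTensorProduct.map_tprod]; rfl
  | add x y hx hy => rw [map_add, map_add, hx, hy]

theorem powMap_comp (g : B →ₐ[R] C) (f : A →ₐ[R] B) (z : ⨂[R] _ : Fin m, A) :
    powMap g m (powMap f m z) = powMap (g.comp f) m z := by
  induction z using PiTensorProduct.induction_on with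
  | smul_tprod r x => simp only [map_smul, powMap_tprod]; rfl
  | add x y hx hy => simp only [map_add, hx, hy]

/-- The map to one of the factors of a tensor power. -/
abbrev slot (R : Type*) {A : Type*} [CommRing R] [Ring A] [Algebra R A] {m : ℕ} (i : Fin m) :
    A →ₐ[R] ⨂[R] _ : Fin m, A := PiTensorProduct.singleAlgHom (R := R) (A := fun _ => A) i

theorem slot_apply (i : Fin m) (a : A) :
    slot R i a = PiTensorProduct.tprod R (Function.update (1 : Fin m → A) i a) := rfl

theorem slot_mul_tprod (i : Fin m) (a : A) (z : Fin m → A) :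
    slot R i a * PiTensorProduct.tprod R z =
      PiTensorProduct.tprod R (Function.update z i (a * z i)) := by
  rw [slot_apply, PiTensorProduct.tprod_mul_tprod]
  congr 1
  funext l
  by_cases h : l = i
  · subst h; simp
  · simp [h]

theorem tprod_mul_slot (i : Fin m) (a : A) (z : Fin m → A) :
    PiTensorProduct.tprod R z * slot R i a =
      PiTensorProduct.tprod R (Function.update z i (z i * a)) := by
  rw [slot_apply, PiTensorProduct.tprod_mul_tprod]
  congr 1
  funext l
  by_cases h : l = i
  · subst h; simp
  · simp [h]

theorem slot_commute {i j : Fin m} (h : i ≠ j) (a b : A) :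
    Commute (slot R i a) (slot R j b) := by
  change slot R i a * slot R j b = slot R j b * slot R i a
  rw [slot_apply (i := j), slot_mul_tprod, tprod_mul_slot]
  simp [h]

theorem powMap_slot (f : A →ₐ[R] B) (i : Fin m) (a : A) :
    powMap f m (slot R i a) = slot R i (f a) := by
  rw [slot_apply, powMap_tprod, slot_apply]
  congr 1
  funext l
  by_cases h : l = i
  · subst h; simp
  · simp [h]

/-- The elements which satisfy a property that is compatible with products and sums and holds for
the factors. -/
theorem pow_induction {P : (⨂[R] _ : Fin m, A) → Prop} (h1 : P 1)
    (hmul : ∀ x y, P x → P y → P (x * y)) (hadd : ∀ x y, P x → P y → P (x + y))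
    (hsmul : ∀ (r : R) x, P x → P (r • x)) (hslot : ∀ i a, P (slot R i a))
    (z : ⨂[R] _ : Fin m, A) : P z := by
  have key : ∀ (s : Finset (Fin m)) (x : Fin m → A), (∀ i ∉ s, x i = 1) →
      P (PiTensorProduct.tprod R x) := by
    intro s
    induction s using Finset.induction with
    | empty =>
      intro x hx
      obtain rfl : x = 1 := funext fun i => hx i (by simp)
      exact h1
    | insert i s hi ih =>
      intro x hx
      have h := slot_mul_tprod (R := R) i (x i) (Function.update x i 1)
      rw [Function.update_self, mul_one, Function.update_idem, Function.update_eq_self] at h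
      rw [← h]
      refine hmul _ _ (hslot i _) (ih _ fun l hl => ?_)
      by_cases hli : l = i
      · subst hli; simp
      · rw [Function.update_of_ne hli]
        exact hx l (by simp [hli, hl])
  induction z using PiTensorProduct.induction_on with
  | smul_tprod r x => exact hsmul r _ (key Finset.univ x fun i hi => absurd (Finset.mem_univ i) hi)
  | add x y hx hy => exact hadd x y hx hy

end Pow

/-! ### The idempotents of a tensor power of a Galois extension -/

namespace GaloisCoords

variable {R S : Type*} [CommRing R] [CommRing S] [Algebra R S] {n : ℕ} {σ : S ≃ₐ[R] S}
  (G : GaloisCoords R n σ) {m : ℕ}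

theorem tprod_eq_prod_slot (x : Fin m → S) :
    PiTensorProduct.tprod R x = ∏ i, slot R i (x i) := by
  simp_rw [slot_apply]
  rw [← PiTensorProduct.tprod_prod]
  congr 1
  funext l
  rw [Finset.prod_apply, Finset.prod_eq_single l]
  · simp
  · intro i _ hi
    simp [hi.symm]
  · simp

theorem prod_tmul_prod {X Y κ : Type*} [CommRing X] [Algebra R X] [CommRing Y] [Algebra R Y]
    (s : Finset κ) (f : κ → X) (g : κ → Y) :
    ∏ i ∈ s, f i ⊗ₜ[R] g i = (∏ i ∈ s, f i) ⊗ₜ[R] ∏ i ∈ s, g i := by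
  classical
  induction s using Finset.induction with
  | empty => rfl
  | insert i s hi ih =>
    rw [Finset.prod_insert hi, Finset.prod_insert hi, Finset.prod_insert hi, ih,
      Algebra.TensorProduct.tmul_mul_tmul]

/-- The separability element of a tensor power is central. -/
theorem sum_pow_central {M : Type*} [AddCommGroup M] [Module R M]
    (B : (⨂[R] _ : Fin m, S) →ₗ[R] (⨂[R] _ : Fin m, S) →ₗ[R] M) (z : ⨂[R] _ : Fin m, S) :
    ∑ a : Fin m → Fin G.N, B (z * PiTensorProduct.tprod R (G.x ∘ a))
        (PiTensorProduct.tprod R (G.y ∘ a)) =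
      ∑ a : Fin m → Fin G.N, B (PiTensorProduct.tprod R (G.x ∘ a))
        (z * PiTensorProduct.tprod R (G.y ∘ a)) := by
  let W := ⨂[R] _ : Fin m, S
  -- The separability element of the tensor power is the product of those of the single factors, so
  -- centrality can be checked in one slot.
  let c : Fin m → W ⊗[R] W := fun i => ∑ b, slot R i (G.x b) ⊗ₜ slot R i (G.y b)
  have hc : ∏ i, c i = ∑ a : Fin m → Fin G.N,
      PiTensorProduct.tprod R (G.x ∘ a) ⊗ₜ PiTensorProduct.tprod R (G.y ∘ a) := by
    rw [Finset.prod_univ_sum, Fintype.piFinset_univ]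
    refine Finset.sum_congr rfl fun a _ => ?_
    rw [tprod_eq_prod_slot, tprod_eq_prod_slot]
    exact prod_tmul_prod _ _ _
  have hcomm : ∀ z : W, (z ⊗ₜ[R] 1) * ∏ i, c i = (1 ⊗ₜ[R] z) * ∏ i, c i := by
    intro z
    induction z using pow_induction with
    | h1 => rfl
    | hmul x y hx hy =>
      have h1 : (x * y) ⊗ₜ[R] (1 : W) = (x ⊗ₜ 1) * (y ⊗ₜ 1) := by simp
      have h2 : (1 : W) ⊗ₜ[R] (x * y) = (1 ⊗ₜ y) * (1 ⊗ₜ x) := by simp [mul_comm]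
      rw [h1, h2, mul_assoc, hy, mul_left_comm, hx, mul_assoc]
    | hadd x y hx hy => rw [TensorProduct.add_tmul, TensorProduct.tmul_add, add_mul, add_mul, hx, hy]
    | hsmul r x hx =>
      rw [← TensorProduct.smul_tmul', TensorProduct.tmul_smul, smul_mul_assoc, smul_mul_assoc, hx]
    | hslot i s =>
      have h1 : (slot R i s ⊗ₜ[R] (1 : W)) * c i = (1 ⊗ₜ slot R i s) * c i := by
        have := congrArg (Algebra.TensorProduct.map (slot R i) (slot R i)) (G.tmul_sep 1 s)
        simp only [sep, one_mul, map_mul, map_sum, Algebra.TensorProduct.map_tmul, map_one] at this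
        exact this.symm
      rw [← Finset.mul_prod_erase _ _ (Finset.mem_univ i), ← mul_assoc, h1, mul_assoc]
  have := congrArg (TensorProduct.lift B) (hcomm z)
  rw [hc] at this
  simpa only [Finset.mul_sum, Algebra.TensorProduct.tmul_mul_tmul, one_mul, map_sum,
    TensorProduct.lift.tmul] using this

/-- The homomorphism `s ↦ ∏ σ ^ (h i) (s i)`. -/
def twist (σ : S ≃ₐ[R] S) (h : Fin m → ℕ) : (⨂[R] _ : Fin m, S) →ₐ[R] S :=
  PiTensorProduct.liftAlgHom
    ((MultilinearMap.mkPiAlgebra R (Fin m) S).compLinearMap fun i => (σ ^ h i).toLinearMap)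
    (by simp) (fun x y => by simp [Finset.prod_mul_distrib])

theorem twist_tprod (h : Fin m → ℕ) (s : Fin m → S) :
    twist σ h (PiTensorProduct.tprod R s) = ∏ i, (σ ^ h i) (s i) := by
  refine (PiTensorProduct.lift.tprod _).trans ?_
  simp

theorem twist_slot (h : Fin m → ℕ) (i : Fin m) (s : S) :
    twist σ h (slot R i s) = (σ ^ h i) s := by
  rw [slot_apply, twist_tprod, Finset.prod_eq_single i]
  · simp
  · intro l _ hl
    simp [hl]
  · simp

/-- The element of the tensor power on which `twist σ h` takes the value `s`, and which `z`
multiplies through `twist σ h z`. -/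
def Q (h : Fin m → ℕ) (s : S) : ⨂[R] _ : Fin m, S :=
  ∑ a : Fin m → Fin G.N, G.tr (s * ∏ i, (σ ^ h i) (G.x (a i))) •
    PiTensorProduct.tprod R (G.y ∘ a)

/-- By centrality, multiplication by z moves into the argument of the functional tr(s · twist(·))
that defines Q. -/
theorem mul_Q (h : Fin m → ℕ) (s : S) (z : ⨂[R] _ : Fin m, S) :
    z * G.Q h s = G.Q h (twist σ h z * s) := by
  let L : (⨂[R] _ : Fin m, S) →ₗ[R] R :=
    G.tr ∘ₗ LinearMap.mulLeft R s ∘ₗ (twist σ h).toLinearMap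
  have hL : ∀ x, L x = G.tr (s * twist σ h x) := fun _ => rfl
  have := G.sum_pow_central ((LinearMap.lsmul R (⨂[R] _ : Fin m, S)).comp L) z
  simp only [LinearMap.comp_apply, LinearMap.lsmul_apply, hL, map_mul, twist_tprod,
    Function.comp_apply] at this
  rw [Q, Q, Finset.mul_sum]
  simp_rw [mul_smul_comm]
  rw [← this]
  refine Finset.sum_congr rfl fun a _ => ?_
  rw [← mul_assoc, mul_comm s]

/-- After expanding the trace, the sum over a is a product over the m slots of orthogonality
relations with the same shift l. It is 1 for l ≡ 0 and otherwise 0, the latter because there is at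
least one slot. -/
theorem twist_Q (h : Fin m → ℕ) (hm : 0 < m) (s : S) : twist σ h (G.Q h s) = s := by
  rw [Q, map_sum]
  simp_rw [map_smul, twist_tprod, Algebra.smul_def, G.algebraMap_tr, Finset.sum_mul, map_mul,
    map_prod, mul_assoc, ← Finset.prod_mul_distrib]
  rw [Finset.sum_comm]
  simp_rw [← Finset.mul_sum]
  have h1 : ∀ l, ∑ a : Fin m → Fin G.N, ∏ i, (σ ^ l) ((σ ^ h i) (G.x (a i))) *
      (σ ^ h i) ((G.y ∘ a) i) = if l ≡ 0 [MOD n] then 1 else 0 := by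
    intro l
    have h2 : ∀ i : Fin m, ∑ b, (σ ^ l) ((σ ^ h i) (G.x b)) * (σ ^ h i) (G.y b) =
        if l ≡ 0 [MOD n] then 1 else 0 := fun i => by
      have h3 : l + h i ≡ h i [MOD n] ↔ l ≡ 0 [MOD n] := by
        conv_lhs => rw [← zero_add (h i), ← add_assoc, add_zero]
        exact ⟨fun h => Nat.ModEq.add_right_cancel' _ h, fun h => h.add_right _⟩
      simp_rw [← AlgEquiv.mul_apply, ← pow_add, G.orth, h3]
    have h4 := Finset.prod_univ_sum (fun _ : Fin m => (Finset.univ : Finset (Fin G.N)))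
      (fun i b => (σ ^ l) ((σ ^ h i) (G.x b)) * (σ ^ h i) (G.y b))
    rw [Fintype.piFinset_univ] at h4
    refine h4.symm.trans ?_
    simp_rw [h2]
    rw [Finset.prod_const, Finset.card_univ, Fintype.card_fin]
    split_ifs
    · rw [one_pow]
    · rw [zero_pow hm.ne']
  simp_rw [h1, mul_ite, mul_one, mul_zero]
  exact sum_modEq_eq G.pos (fun l => (σ ^ l) s) 0 fun i j h => G.modEq i j h s

theorem Q_add (h : Fin m → ℕ) (s s' : S) : G.Q h (s + s') = G.Q h s + G.Q h s' := by
  simp only [Q, add_mul, map_add, add_smul, Finset.sum_add_distrib]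

theorem Q_zero (h : Fin m → ℕ) : G.Q h 0 = 0 := by
  simp [Q]

/-- Summing over all exponents replaces each σ^(h i)(x (a i)) by a trace, and Σ tr(x b) y b = 1 in
every slot. For tr s = 1 this splits 1 by multidegree. -/
theorem sum_Q (s : S) :
    ∑ h : Fin m → Fin n, G.Q (fun i => (h i : ℕ)) s = G.tr s • 1 := by
  simp only [Q]
  rw [Finset.sum_comm]
  have h1 : ∀ a : Fin m → Fin G.N,
      ∑ h : Fin m → Fin n, G.tr (s * ∏ i, (σ ^ (h i : ℕ)) (G.x (a i))) •
        PiTensorProduct.tprod R (G.y ∘ a) =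
      G.tr s • PiTensorProduct.tprod R fun i => G.tr (G.x (a i)) • G.y (a i) := by
    intro a
    have h2 := Finset.prod_univ_sum (fun _ : Fin m => (Finset.univ : Finset (Fin n)))
      (fun i b => (σ ^ (b : ℕ)) (G.x (a i)))
    rw [Fintype.piFinset_univ] at h2
    have h3 : ∀ i, ∑ b : Fin n, (σ ^ (b : ℕ)) (G.x (a i)) = algebraMap R S (G.tr (G.x (a i))) :=
      fun i => by
        rw [G.algebraMap_tr, Finset.sum_range]
    simp_rw [h3] at h2
    rw [← Finset.sum_smul, ← map_sum, ← Finset.mul_sum, ← h2, ← map_prod, mul_comm,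
      ← Algebra.smul_def, map_smul, smul_eq_mul, MultilinearMap.map_smul_univ, smul_smul, mul_comm]
    rfl
  simp_rw [h1]
  rw [← Finset.smul_sum]
  congr 1
  have h4 := (PiTensorProduct.tprod R (s := fun _ : Fin m => S)).map_sum
    (fun (_ : Fin m) (b : Fin G.N) => G.tr (G.x b) • G.y b)
  rw [← h4, PiTensorProduct.one_def]
  congr 1
  funext i
  have := G.sum_tr_smul_y 1
  simp only [one_mul] at this
  exact this

end GaloisCoords

end
end AlmostCyclic

namespace AlmostCyclic
noncomputable section

/-! ### Permutations of two factors -/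

section Pair

variable {R S A : Type*} [CommRing R] [CommRing S] [Algebra R S] [Ring A] [Algebra R A]
  {n : ℕ} {σ : S ≃ₐ[R] S} {ι : S →ₐ[R] A} {G : GaloisCoords R n σ} {m : ℕ}

/-- The homomorphism to a pair of factors. -/
def pairSlot (R : Type*) {A : Type*} [CommRing R] [Ring A] [Algebra R A] {m : ℕ} {i j : Fin m}
    (h : i ≠ j) : A ⊗[R] A →ₐ[R] ⨂[R] _ : Fin m, A :=
  Algebra.TensorProduct.lift (slot R i) (slot R j) fun a b => slot_commute h a b

theorem pairSlot_tmul {i j : Fin m} (h : i ≠ j) (a b : A) :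
    pairSlot R h (a ⊗ₜ b) = slot R i a * slot R j b :=
  Algebra.TensorProduct.lift_tmul _ _ _ a b

theorem mul_slot_of_mul_tprod {π : Equiv.Perm (Fin m)} {p : ⨂[R] _ : Fin m, A}
    (hp : ∀ z, p * PiTensorProduct.tprod R z = PiTensorProduct.tprod R (z ∘ π.symm) * p)
    (i : Fin m) (a : A) : p * slot R i a = slot R (π i) a * p := by
  rw [slot_apply, hp, slot_apply]
  congr 2
  funext l
  simp only [Function.comp_apply, Function.update_apply, Equiv.symm_apply_eq]
  rfl

theorem pairSlot_mul_tprod {i j : Fin m} (h : i ≠ j) (a b : A) (z : Fin m → A) :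
    pairSlot R h (a ⊗ₜ b) * PiTensorProduct.tprod R z = PiTensorProduct.tprod R
      (Function.update (Function.update z j (b * z j)) i (a * z i)) := by
  rw [pairSlot_tmul, mul_assoc, slot_mul_tprod, slot_mul_tprod, Function.update_of_ne h]

theorem tprod_mul_pairSlot {i j : Fin m} (h : i ≠ j) (a b : A) (z : Fin m → A) :
    PiTensorProduct.tprod R z * pairSlot R h (a ⊗ₜ b) = PiTensorProduct.tprod R
      (Function.update (Function.update z j (z j * b)) i (z i * a)) := by
  rw [pairSlot_tmul, ← mul_assoc, tprod_mul_slot, tprod_mul_slot, Function.update_of_ne h.symm,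
    Function.update_comm h]

theorem pairSlot_mul_tprod_comm {i j : Fin m} (h : i ≠ j) (x : A ⊗[R] A) {z : Fin m → A}
    (hi : z i = 1) (hj : z j = 1) : pairSlot R h x * PiTensorProduct.tprod R z =
      PiTensorProduct.tprod R z * pairSlot R h x := by
  induction x with
  | zero => rw [map_zero, zero_mul, mul_zero]
  | add x y hx hy => rw [map_add, add_mul, mul_add, hx, hy]
  | tmul a b =>
    rw [pairSlot_mul_tprod, tprod_mul_pairSlot, hi, hj, mul_one, one_mul, mul_one, one_mul]

theorem GaloisCoords.comm_sep (G : GaloisCoords R n σ) :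
    ∑ a, G.y a ⊗ₜ[R] G.x a = G.sep := by
  have h1 : ∑ a, G.y a ⊗ₜ[R] G.x a = Algebra.TensorProduct.comm R S S G.sep := by
    simp [GaloisCoords.sep]
  rw [h1]
  have h2 : ∀ s, (1 ⊗ₜ[R] s) * Algebra.TensorProduct.comm R S S G.sep =
      (s ⊗ₜ[R] 1) * Algebra.TensorProduct.comm R S S G.sep := fun s => by
    have := congrArg (Algebra.TensorProduct.comm R S S) (G.tmul_sep 1 s)
    simpa using this.symm
  have h3 : ∀ z, z * Algebra.TensorProduct.comm R S S G.sep =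
      (Algebra.TensorProduct.lmul' R z ⊗ₜ[R] 1) * Algebra.TensorProduct.comm R S S G.sep := by
    intro z
    induction z with
    | zero => simp
    | add x y hx hy => rw [add_mul, hx, hy, map_add, TensorProduct.add_tmul, add_mul]
    | tmul s t =>
      have h4 : s ⊗ₜ[R] t = (s ⊗ₜ[R] 1) * ((1 : S) ⊗ₜ[R] t) := by simp
      rw [h4, mul_assoc, h2, ← mul_assoc]
      simp
  have h5 := h3 G.sep
  have h6 := G.mul_sep (Algebra.TensorProduct.comm R S S G.sep)
  have h7 : Algebra.TensorProduct.lmul' R (Algebra.TensorProduct.comm R S S G.sep) = 1 := by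
    rw [← h1, map_sum]
    simp only [Algebra.TensorProduct.lmul'_apply_tmul, mul_comm (G.y _), G.sum_mul_self]
  rw [G.lmul'_sep, ← Algebra.TensorProduct.one_def, one_mul, mul_comm, h6, h7,
    ← Algebra.TensorProduct.one_def, one_mul] at h5
  exact h5.symm

namespace Frame

variable (F : Frame G ι)

/-- The idempotent e is symmetric under the switch, hence commutes with γ. -/
theorem e_mul_γ : F.e * F.γ = F.e := by
  have h1 : F.e = ∑ i, ι (G.y i) ⊗ₜ ι (G.x i) := by
    rw [F.e_eq, ← G.comm_sep, map_sum]
    exact Finset.sum_congr rfl fun i _ => Algebra.TensorProduct.map_tmul _ _ _ _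
  have h2 : F.γ * F.e = F.e * F.γ := by
    conv_lhs => rw [h1]
    rw [e, Finset.mul_sum, Finset.sum_mul]
    exact Finset.sum_congr rfl fun i _ => F.γ_mul_tmul _ _
  rw [← h2, F.γ_mul_e]

theorem pairSlot_γ_mul_tprod {i j : Fin m} (h : i ≠ j) (z : Fin m → A) :
    pairSlot R h F.γ * PiTensorProduct.tprod R z =
      PiTensorProduct.tprod R (z ∘ (Equiv.swap i j).symm) * pairSlot R h F.γ := by
  have h1 := pairSlot_mul_tprod (R := R) h (z i) (z j)
    (Function.update (Function.update z i 1) j 1)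
  have h2 := pairSlot_mul_tprod (R := R) h (z j) (z i)
    (Function.update (Function.update z i 1) j 1)
  have h3 : ∀ a b, Function.update (Function.update (Function.update (Function.update z i 1) j 1) j
      (b * (Function.update (Function.update z i 1) j 1) j)) i
      (a * (Function.update (Function.update z i 1) j 1) i) =
      Function.update (Function.update z j b) i a := fun a b => by
    rw [Function.update_self, Function.update_of_ne h, Function.update_self, mul_one, mul_one,
      Function.update_idem, Function.update_comm h.symm, Function.update_idem,
      Function.update_comm h.symm]
  rw [h3, Function.update_eq_self, Function.update_eq_self] at h1
  rw [h3] at h2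
  have h4 : z ∘ (Equiv.swap i j).symm = Function.update (Function.update z j (z i)) i (z j) := by
    funext l
    simp only [Equiv.symm_swap, Function.comp_apply, Equiv.swap_apply_def, Function.update_apply]
    split_ifs <;> rfl
  rw [h4, ← h2, ← h1, ← mul_assoc, ← map_mul, F.γ_mul_tmul, map_mul, mul_assoc, mul_assoc,
    pairSlot_mul_tprod_comm h F.γ (by rw [Function.update_of_ne h, Function.update_self])
      (by rw [Function.update_self])]

/-- An element that does not distinguish S in slot i from S in slot j merges x a and y a, and Σ x a
· y a = 1. -/
theorem mul_pairSlot_e {i j : Fin m} (h : i ≠ j) {X : ⨂[R] _ : Fin m, A}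
    (hX : ∀ s, X * slot R i (ι s) = X * slot R j (ι s)) : X * pairSlot R h F.e = X := by
  simp only [e, map_sum, pairSlot_tmul, Finset.mul_sum, ← mul_assoc, hX]
  simp only [mul_assoc, ← map_mul, ← Finset.mul_sum, ← map_sum, G.sum_mul_self]
  rw [map_one, map_one, mul_one]

/-- A class of elements which permute the factors of a tensor power. -/
structure IsPermSystem (_ : Frame G ι)
    (P : Equiv.Perm (Fin m) → (⨂[R] _ : Fin m, A) → Prop) : Prop where
  one : P 1 1
  mul : ∀ π π' p p', P π p → P π' p' → P (π * π') (p * p')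
  mul_tprod : ∀ π p, P π p → ∀ z, p * PiTensorProduct.tprod R z =
    PiTensorProduct.tprod R (z ∘ π.symm) * p
  swap : ∀ i j, ∃ p, P (Equiv.swap i j) p ∧ ∀ X : ⨂[R] _ : Fin m, A,
    (∀ s, X * slot R i (ι s) = X * slot R j (ι s)) → X * p = X

/-- This class asks only for the intertwining property. In contrast to the class of the elements
`perm`, it does not need R and S in one universe. -/
theorem isPermSystem_mul_tprod : F.IsPermSystem fun (π : Equiv.Perm (Fin m)) p =>
    ∀ z, p * PiTensorProduct.tprod R z = PiTensorProduct.tprod R (z ∘ π.symm) * p where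
  one z := by rw [one_mul, mul_one]; rfl
  mul π π' p p' hp hp' z := by rw [mul_assoc, hp', ← mul_assoc, hp, mul_assoc]; rfl
  mul_tprod _ _ hp := hp
  swap i j := by
    by_cases h : i = j
    · subst h
      refine ⟨1, fun z => ?_, fun X _ => mul_one X⟩
      rw [one_mul, mul_one, Equiv.swap_self]
      rfl
    · exact ⟨pairSlot R h F.γ, F.pairSlot_γ_mul_tprod h, fun X hX => by
        conv_lhs => rw [← F.mul_pairSlot_e h hX, mul_assoc, ← map_mul, F.e_mul_γ,
          F.mul_pairSlot_e h hX]⟩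

/-- The image of `Q` in the tensor power of `A`. -/
def q (_ : Frame G ι) (h : Fin m → ℕ) (s : S) : ⨂[R] _ : Fin m, A := powMap ι m (G.Q h s)

theorem powMap_mul_q (h : Fin m → ℕ) (s : S) (z : ⨂[R] _ : Fin m, S) :
    powMap ι m z * F.q h s = F.q h (GaloisCoords.twist σ h z * s) := by
  rw [q, ← map_mul, G.mul_Q, q]

theorem q_mul_powMap (h : Fin m → ℕ) (s : S) (z : ⨂[R] _ : Fin m, S) :
    F.q h s * powMap ι m z = F.q h (GaloisCoords.twist σ h z * s) := by
  rw [← powMap_mul_q, q, ← map_mul, ← map_mul, mul_comm]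

theorem slot_mul_q (h : Fin m → ℕ) (s z : S) (i : Fin m) :
    slot R i (ι z) * F.q h s = F.q h ((σ ^ h i) z * s) := by
  rw [← powMap_slot, powMap_mul_q, GaloisCoords.twist_slot]

theorem q_mul_slot (h : Fin m → ℕ) (s z : S) (i : Fin m) :
    F.q h s * slot R i (ι z) = F.q h ((σ ^ h i) z * s) := by
  rw [← powMap_slot, q_mul_powMap, GaloisCoords.twist_slot]

theorem q_mul_q (h : Fin m → ℕ) (hm : 0 < m) (s t : S) : F.q h s * F.q h t = F.q h (s * t) := by
  conv_lhs => rw [q, powMap_mul_q, G.twist_Q h hm]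

theorem mul_q_of_mul_tprod {π : Equiv.Perm (Fin m)} {p : ⨂[R] _ : Fin m, A}
    (hp : ∀ z, p * PiTensorProduct.tprod R z = PiTensorProduct.tprod R (z ∘ π.symm) * p)
    (h : Fin m → ℕ) (s : S) : p * F.q h s = F.q (h ∘ π.symm) s * p := by
  rw [q, q, GaloisCoords.Q, GaloisCoords.Q, map_sum, map_sum, Finset.mul_sum, Finset.sum_mul]
  refine Fintype.sum_equiv (Equiv.arrowCongr π (Equiv.refl _)) _ _ fun a => ?_
  rw [map_smul, map_smul, mul_smul_comm, smul_mul_assoc, powMap_tprod, powMap_tprod, hp]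
  congr 1
  congr 2
  exact (Equiv.prod_comp π.symm fun i => (σ ^ h i) (G.x (a i))).symm

/-- Shifting the exponents ki by one slot amounts to applying σ^k, also at the wrap-around because
σ^(km) = 1; the trace in Q turns this into σ^k on s. -/
theorem mul_q_of_rotate {k : ℕ} (hmk : m * k = n) {h : Fin m → ℕ} (hh : ∀ i, h i = k * i)
    {p : ⨂[R] _ : Fin m, A} (hp : ∀ z, p * PiTensorProduct.tprod R z =
      PiTensorProduct.tprod R (z ∘ (finRotate m).symm) * p) (s : S) :
    p * F.q h s = F.q h ((σ ^ k) s) * p := by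
  have h1 : G.Q (h ∘ (finRotate m).symm) s = G.Q h ((σ ^ k) s) := by
    have h2 : ∀ i : Fin m, σ ^ h i = σ ^ k * σ ^ h ((finRotate m).symm i) := fun i => by
      rw [hh, hh, pow_mul, pow_mul, ← pow_finRotate (pow_pow_eq_one hmk G.pow),
        Equiv.apply_symm_apply]
    simp only [GaloisCoords.Q]
    refine Finset.sum_congr rfl fun a _ => ?_
    rw [← G.tr_pow_apply k (s * _), map_mul, map_prod]
    congr 3
    refine Finset.prod_congr rfl fun i _ => ?_
    exact (congrArg (fun τ : S ≃ₐ[R] S => τ (G.x (a i))) (h2 i)).symm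
  rw [F.mul_q_of_mul_tprod hp, q, q, h1]

end Frame

/-! ### Powers of the cyclic permutation -/

theorem coe_finRotate_pow {n : ℕ} (l : ℕ) (i : Fin n) :
    (((finRotate n ^ l) i : Fin n) : ℕ) = (i + l) % n := by
  induction l with
  | zero => exact (Nat.mod_eq_of_lt i.2).symm
  | succ l ih =>
    rw [pow_succ', Equiv.Perm.mul_apply]
    cases n with
    | zero => exact i.elim0
    | succ n =>
      rw [coe_finRotate, ← add_assoc, Nat.add_mod, ← ih]
      split_ifs with h
      · rw [h, Fin.val_last]
        simp
      · have h1 : (((finRotate (n + 1) ^ l) i : Fin (n + 1)) : ℕ) < n := by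
          have h2 := ((finRotate (n + 1) ^ l) i).2
          have h3 : (((finRotate (n + 1) ^ l) i : Fin (n + 1)) : ℕ) ≠ n := fun h4 =>
            h (Fin.ext h4)
          lia
        rcases Nat.eq_zero_or_pos n with rfl | hn
        · lia
        · rw [Nat.mod_eq_of_lt (show 1 < n + 1 by lia), Nat.mod_eq_of_lt]
          lia

theorem finRotate_pow_self (n : ℕ) : finRotate n ^ n = 1 :=
  Equiv.ext fun i => Fin.ext (by
    rw [coe_finRotate_pow, Nat.add_mod_right, Nat.mod_eq_of_lt i.2]
    rfl)

theorem eq_finRotate_pow {n : ℕ} (hn : 0 < n) {π : Equiv.Perm (Fin n)}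
    (h : ∀ i, (π i : ℕ) ≡ π ⟨0, hn⟩ + i [MOD n]) : π = finRotate n ^ (π ⟨0, hn⟩ : ℕ) :=
  Equiv.ext fun i => Fin.ext (by
    rw [coe_finRotate_pow, add_comm, ← Nat.mod_eq_of_lt (π i).2]
    exact h i)

/-- Insert 1 = Σ σ^a(x c) σ^a(y c) in front of X; the second exponent may be changed to b, and the
sum becomes zero. -/
theorem GaloisCoords.eq_zero_of_pow_mul {R S B : Type*} [CommRing R] [CommRing S] [Algebra R S]
    [Ring B] [Algebra R B] {n : ℕ} {σ : S ≃ₐ[R] S} (G : GaloisCoords R n σ) (f : S →ₐ[R] B)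
    {a b : ℕ} (hab : ¬ a ≡ b [MOD n]) {X : B} (hX : ∀ z, f ((σ ^ a) z) * X = f ((σ ^ b) z) * X) :
    X = 0 := by
  have h1 := G.orth a a
  have h2 := G.orth a b
  rw [if_pos (Nat.ModEq.refl _)] at h1
  rw [if_neg hab] at h2
  calc X = f (∑ c, (σ ^ a) (G.x c) * (σ ^ a) (G.y c)) * X := by rw [h1, map_one, one_mul]
    _ = f (∑ c, (σ ^ a) (G.x c) * (σ ^ b) (G.y c)) * X := by
      simp only [map_sum, map_mul, Finset.sum_mul, mul_assoc, hX]
    _ = 0 := by rw [h2, map_zero, zero_mul]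

namespace Frame

variable (F : Frame G ι)

/-- The factors are gathered in slot 0 one at a time. After j factors of degree k, slot 0 carries
the twist σ^(kj), the same as slot j under q; so the transposition (0 j) is absorbed by what stands
on its left, and it brings the next factor from slot j to slot 0. The transpositions accumulate to a
cycle. -/
theorem q_mul_tprod_aux (hm : 0 < m) {k : ℕ} {h : Fin m → ℕ} (hh : ∀ i, h i = k * i)
    {P : Equiv.Perm (Fin m) → (⨂[R] _ : Fin m, A) → Prop} (hP : F.IsPermSystem P)
    (j : ℕ) (hj : j ≤ m) :
    ∃ (π : Equiv.Perm (Fin m)) (p : ⨂[R] _ : Fin m, A), P π p ∧ (∀ i, (π i : ℕ) =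
        if (i : ℕ) + 1 < j then (i : ℕ) + 1 else if (i : ℕ) + 1 = j then 0 else i) ∧
      ∀ z : Fin m → A, (∀ i, IsDeg ι σ k (z i)) →
        F.q h 1 * PiTensorProduct.tprod R (fun i : Fin m => if (i : ℕ) < j then z i else 1) =
        F.q h 1 * slot R ⟨0, hm⟩ ((List.ofFn z).take j).prod * p := by
  induction j with
  | zero =>
    refine ⟨1, 1, hP.one, fun i => by simp, fun z hz => ?_⟩
    have h1 : PiTensorProduct.tprod R (fun i : Fin m => if (i : ℕ) < 0 then z i else 1) = 1 := by
      simp only [Nat.not_lt_zero, if_false]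
      rfl
    rw [h1, List.take_zero, List.prod_nil, map_one, mul_one, mul_one]
  | succ j ih =>
    obtain ⟨π, p, hp, hπ, h0⟩ := ih (by lia)
    set l : Fin m := ⟨j, hj⟩ with hl
    have hπl : π l = l := Fin.ext (by rw [hπ]; simp [hl])
    obtain ⟨p', hp', hX⟩ := hP.swap ⟨0, hm⟩ l
    refine ⟨Equiv.swap ⟨0, hm⟩ l * π, p' * p, hP.mul _ _ _ _ hp' hp, fun i => ?_, fun z hz => ?_⟩
    · rw [Equiv.Perm.mul_apply, Equiv.swap_apply_def]
      have hi := hπ i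
      simp only [Fin.ext_iff, hl]
      split_ifs at hi ⊢ <;> lia
    have hlen : j < (List.ofFn z).length := by rwa [List.length_ofFn]
    set y := ((List.ofFn z).take j).prod with hy
    have hdeg : IsDeg ι σ (k * j) y := by
      have := isDeg_list_prod (ι := ι) (σ := σ) (h := k) ((List.ofFn z).take j) (fun x hx => by
        obtain ⟨i, rfl⟩ := List.mem_ofFn.mp (List.mem_of_mem_take hx)
        exact hz i)
      rwa [List.length_take, List.length_ofFn, min_eq_left (by lia)] at this
    have h1 : F.q h 1 * slot R ⟨0, hm⟩ y * p' = F.q h 1 * slot R ⟨0, hm⟩ y := hX _ fun s => by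
      by_cases h2 : ⟨0, hm⟩ = l
      · rw [h2]
      · rw [mul_assoc, mul_assoc, ← map_mul, hdeg, map_mul, (slot_commute h2 y (ι s)).eq,
          ← mul_assoc, ← mul_assoc, F.q_mul_slot, F.q_mul_slot, hh, hh, mul_zero]
        rfl
    have h2 : (fun i : Fin m => if (i : ℕ) < j + 1 then z i else 1) =
        Function.update (fun i : Fin m => if (i : ℕ) < j then z i else 1) l
          ((fun i : Fin m => if (i : ℕ) < j then z i else 1) l * z l) := by
      funext i
      by_cases hi : i = l
      · subst hi
        simp [hl]
      · have : (i : ℕ) ≠ j := fun h3 => hi (Fin.ext h3)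
        rw [Function.update_of_ne hi]
        have h4 : (i : ℕ) < j + 1 ↔ (i : ℕ) < j := by lia
        simp only [h4]
    have h3 : ((List.ofFn z).take (j + 1)).prod = y * z l := by
      rw [List.take_succ_eq_append_getElem hlen, List.prod_append, List.prod_singleton,
        List.getElem_ofFn]
    rw [h2, ← tprod_mul_slot, ← mul_assoc, h0 z hz, h3, map_mul]
    calc F.q h 1 * slot R ⟨0, hm⟩ y * p * slot R l (z l)
        = F.q h 1 * slot R ⟨0, hm⟩ y * slot R l (z l) * p := by
          rw [mul_assoc, mul_slot_of_mul_tprod (hP.mul_tprod _ _ hp), hπl, ← mul_assoc]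
      _ = F.q h 1 * slot R ⟨0, hm⟩ y * (p' * slot R l (z l)) * p := by rw [← mul_assoc, h1]
      _ = F.q h 1 * (slot R ⟨0, hm⟩ y * slot R ⟨0, hm⟩ (z l)) * (p' * p) := by
          rw [mul_slot_of_mul_tprod (hP.mul_tprod _ _ hp'), Equiv.swap_apply_right]
          simp only [mul_assoc]

theorem exists_q_mul_tprod (hm : 0 < m) {k : ℕ} {h : Fin m → ℕ} (hh : ∀ i, h i = k * i)
    {P : Equiv.Perm (Fin m) → (⨂[R] _ : Fin m, A) → Prop} (hP : F.IsPermSystem P) :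
    ∃ p, P (finRotate m) p ∧ ∀ z : Fin m → A, (∀ i, IsDeg ι σ k (z i)) →
      F.q h 1 * PiTensorProduct.tprod R z = F.q h 1 * slot R ⟨0, hm⟩ (List.ofFn z).prod * p := by
  obtain ⟨π, p, hp, hπ, h0⟩ := F.q_mul_tprod_aux hm hh hP m le_rfl
  have h1 : π = finRotate m := Equiv.ext fun i => Fin.ext (by
    have h2 := coe_finRotate_pow 1 i
    rw [pow_one] at h2
    rw [hπ, h2]
    have := i.2
    split_ifs with h3 h4
    · rw [Nat.mod_eq_of_lt h3]
    · rw [h4, Nat.mod_self]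
    · lia)
  subst h1
  refine ⟨p, hp, fun z hz => ?_⟩
  have h2 := h0 z hz
  have h3 : (fun i : Fin m => if (i : ℕ) < m then z i else 1) = z :=
    funext fun i => if_pos i.2
  rw [h3, List.take_of_length_le (by rw [List.length_ofFn])] at h2
  exact h2

end Frame

end Pair

/-! ### The action on the tensor powers of a splitting module -/

section TensorRep

universe u v

variable {R S : Type u} {A : Type v} [CommRing R] [CommRing S] [Algebra R S] [Ring A] [Algebra R A]
  {n : ℕ} {σ : S ≃ₐ[R] S} {ι : S →ₐ[R] A} {G : GaloisCoords R n σ}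
  {T' V : Type u} [CommRing T'] [Algebra R T'] [AddCommGroup V] [Module T' V]
  [Module R V] [IsScalarTower R T' V]
  (θ : T' ⊗[R] A ≃ₐ[T'] Module.End T' V) {m : ℕ}

theorem tensorAction_tprod (x : Fin m → A) (v : Fin m → V) :
    tensorAction θ m (PiTensorProduct.tprod R x) (PiTensorProduct.tprod T' v) =
      PiTensorProduct.tprod T' fun i => θ (1 ⊗ₜ x i) (v i) := by
  rw [tensorAction, PiTensorProduct.lift.tprod]
  exact PiTensorProduct.map_tprod _ _

theorem tensor_ext {Q : Type*} [AddCommGroup Q] [Module T' Q] {f g : (⨂[T'] _ : Fin m, V) →ₗ[T'] Q}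
    (h : ∀ v, f (PiTensorProduct.tprod T' v) = g (PiTensorProduct.tprod T' v)) : f = g :=
  PiTensorProduct.ext (MultilinearMap.ext h)

theorem tensorAction_one : tensorAction θ m 1 = 1 := tensor_ext fun v => by
  rw [PiTensorProduct.one_def, tensorAction_tprod]
  simp_rw [Pi.one_apply, ← Algebra.TensorProduct.one_def, map_one]
  rfl

theorem tensorAction_mul (a b : ⨂[R] _ : Fin m, A) :
    tensorAction θ m (a * b) = tensorAction θ m a * tensorAction θ m b := by
  induction a using PiTensorProduct.induction_on with
  | add x y hx hy => rw [add_mul, map_add, map_add, hx, hy, add_mul]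
  | smul_tprod r x =>
    induction b using PiTensorProduct.induction_on with
    | add z y hz hy => rw [mul_add, map_add, map_add, hz, hy, mul_add]
    | smul_tprod r' y =>
      rw [smul_mul_smul_comm, map_smul, map_smul, map_smul, PiTensorProduct.tprod_mul_tprod,
        smul_mul_smul_comm]
      congr 1
      refine tensor_ext fun v => ?_
      rw [Module.End.mul_apply, tensorAction_tprod, tensorAction_tprod, tensorAction_tprod]
      congr 1
      funext i
      rw [← Module.End.mul_apply, ← map_mul, Algebra.TensorProduct.tmul_mul_tmul, one_mul]
      rfl

theorem tensorAction_slot (i : Fin m) (a : A) (v : Fin m → V) :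
    tensorAction θ m (slot R i a) (PiTensorProduct.tprod T' v) =
      PiTensorProduct.tprod T' (Function.update v i (θ (1 ⊗ₜ a) (v i))) := by
  rw [slot_apply, tensorAction_tprod]
  congr 1
  funext l
  by_cases h : l = i
  · subst h; simp
  · rw [Function.update_of_ne h, Function.update_of_ne h, Pi.one_apply,
      ← Algebra.TensorProduct.one_def, map_one]
    rfl

/-- The permutation of the factors of a tensor power. -/
def permEnd (T' V : Type*) [CommRing T'] [AddCommGroup V] [Module T' V] {m : ℕ}
    (π : Equiv.Perm (Fin m)) : Module.End T' (⨂[T'] _ : Fin m, V) :=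
  PiTensorProduct.lift ((PiTensorProduct.tprod T').domDomCongr π.symm)

theorem permEnd_tprod (π : Equiv.Perm (Fin m)) (v : Fin m → V) :
    permEnd T' V π (PiTensorProduct.tprod T' v) = PiTensorProduct.tprod T' (v ∘ π.symm) :=
  PiTensorProduct.lift.tprod _

theorem permEnd_mul (π π' : Equiv.Perm (Fin m)) :
    permEnd T' V (π * π') = permEnd T' V π * permEnd T' V π' := tensor_ext fun v => by
  rw [Module.End.mul_apply, permEnd_tprod, permEnd_tprod, permEnd_tprod]
  rfl

theorem permEnd_one : permEnd T' V (1 : Equiv.Perm (Fin m)) = 1 := tensor_ext fun v => by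
  rw [permEnd_tprod]
  rfl

/-- The bilinear map in two of the factors. -/
def slotBilin {T' V Q : Type*} [CommRing T'] [AddCommGroup V] [Module T' V] [AddCommGroup Q]
    [Module T' Q] {m : ℕ} (L : (⨂[T'] _ : Fin m, V) →ₗ[T'] Q) (w : Fin m → V) {i j : Fin m}
    (h : i ≠ j) : V →ₗ[T'] V →ₗ[T'] Q :=
  LinearMap.mk₂ T' (fun v v' => L (PiTensorProduct.tprod T'
      (Function.update (Function.update w i v) j v')))
    (fun a b c => by
      simp only [Function.update_comm h, MultilinearMap.map_update_add, map_add])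
    (fun r a b => by
      simp only [Function.update_comm h, MultilinearMap.map_update_smul, map_smul])
    (fun a b c => by simp only [MultilinearMap.map_update_add, map_add])
    (fun r a b => by simp only [MultilinearMap.map_update_smul, map_smul])

theorem slotBilin_apply {Q : Type*} [AddCommGroup Q] [Module T' Q]
    (L : (⨂[T'] _ : Fin m, V) →ₗ[T'] Q) (w : Fin m → V) {i j : Fin m} (h : i ≠ j) (v v' : V) :
    slotBilin L w h v v' = L (PiTensorProduct.tprod T'
      (Function.update (Function.update w i v) j v')) := rfl

theorem pairSlot_e_mul_slot (F : Frame G ι) {i j : Fin m} (h : i ≠ j) (s : S) :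
    pairSlot R h F.e * slot R i (ι s) = pairSlot R h F.e * slot R j (ι s) := by
  have h1 : slot R i (ι s) = pairSlot R h (ι s ⊗ₜ 1) := by rw [pairSlot_tmul, map_one, mul_one]
  have h2 : slot R j (ι s) = pairSlot R h (1 ⊗ₜ ι s) := by rw [pairSlot_tmul, map_one, one_mul]
  have h3 := F.e_mul_base s 1
  have h4 := F.e_mul_base 1 s
  rw [map_one] at h3 h4
  rw [h1, h2, ← map_mul, ← map_mul, h3, h4, F.base_mul_e]

/-- After applying e, the action is balanced over S in the two slots, hence symmetric in them
because V is invertible over T' ⊗ S. -/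
theorem tensorAction_e_mul_perm (F : Frame G ι) [Module.Finite T' V] [Module.Projective T' V]
    {i j : Fin m} (h : i ≠ j) :
    tensorAction θ m (pairSlot R h F.e) * permEnd T' V (Equiv.swap i j) =
      tensorAction θ m (pairSlot R h F.e) := by
  refine tensor_ext fun v => ?_
  rw [Module.End.mul_apply, permEnd_tprod]
  have hB := rep_symm θ F (slotBilin (tensorAction θ m (pairSlot R h F.e)) v h) (fun s a b => by
    rw [slotBilin_apply, slotBilin_apply]
    have h1 := tensorAction_slot θ i (ι s) (Function.update (Function.update v i a) j b)
    have h2 := tensorAction_slot θ j (ι s) (Function.update (Function.update v i a) j b)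
    rw [Function.update_of_ne h, Function.update_self, Function.update_comm h.symm,
      Function.update_idem] at h1
    rw [Function.update_self, Function.update_idem] at h2
    rw [← h1, ← h2, ← Module.End.mul_apply, ← Module.End.mul_apply,
      ← tensorAction_mul, ← tensorAction_mul, pairSlot_e_mul_slot]) (v i) (v j)
  rw [slotBilin_apply, slotBilin_apply, Function.update_eq_self, Function.update_eq_self] at hB
  rw [hB]
  congr 2
  funext l
  rw [Function.comp_apply, Equiv.symm_swap, Equiv.swap_apply_def]
  split_ifs with h1 h2
  · subst h1; rw [Function.update_of_ne h, Function.update_self]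
  · subst h2; rw [Function.update_self]
  · rw [Function.update_of_ne h2, Function.update_of_ne h1]

theorem perm_mul_tensorAction_pair {i j : Fin m} (h : i ≠ j) (a b : A) :
    permEnd T' V (Equiv.swap i j) * tensorAction θ m (pairSlot R h (a ⊗ₜ b)) =
      tensorAction θ m (pairSlot R h (b ⊗ₜ a)) * permEnd T' V (Equiv.swap i j) := by
  refine tensor_ext fun v => ?_
  simp only [pairSlot_tmul, tensorAction_mul, Module.End.mul_apply, permEnd_tprod,
    tensorAction_slot, Equiv.symm_swap]
  congr 1
  funext l
  simp only [Function.comp_apply, Equiv.swap_apply_def, Function.update_apply]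
  split_ifs <;> simp_all

/-- The element `γ` acts as the transposition. -/
theorem tensorAction_γ (F : Frame G ι) [Module.Finite T' V] [Module.Projective T' V]
    {i j : Fin m} (h : i ≠ j) :
    tensorAction θ m (pairSlot R h F.γ) = permEnd T' V (Equiv.swap i j) := by
  set Φ : A ⊗[R] A → Module.End T' (⨂[T'] _ : Fin m, V) :=
    fun z => tensorAction θ m (pairSlot R h z) with hΦ
  set w := permEnd T' V (Equiv.swap i j) with hw
  have hmul : ∀ x y, Φ (x * y) = Φ x * Φ y := fun x y => by
    simp only [hΦ, map_mul, tensorAction_mul]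
  have hone : Φ 1 = 1 := by simp only [hΦ, map_one, tensorAction_one]
  have hww : w * w = 1 := by rw [hw, ← permEnd_mul, Equiv.swap_mul_self, permEnd_one]
  -- The transposition times the action of γ commutes with everything in the two slots and acts as 1
  -- on e. Since e generates the unit two-sided ideal, it is 1.
  have hδ : ∀ a b, w * Φ F.γ * Φ (a ⊗ₜ b) = Φ (a ⊗ₜ b) * (w * Φ F.γ) := fun a b => by
    rw [mul_assoc, ← hmul, F.γ_mul_tmul, hmul, ← mul_assoc, ← mul_assoc]
    congr 1
    exact perm_mul_tensorAction_pair θ h b a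
  have hwe : w * Φ F.e = Φ F.e := by
    have h1 : w * Φ F.e = Φ F.e * w := by
      have h2 : F.e = ∑ k, ι (G.y k) ⊗ₜ ι (G.x k) := by
        rw [F.e_eq, ← G.comm_sep, map_sum]
        exact Finset.sum_congr rfl fun _ _ => Algebra.TensorProduct.map_tmul _ _ _ _
      conv_rhs => rw [h2]
      rw [Frame.e]
      simp only [hΦ, map_sum, Finset.mul_sum, Finset.sum_mul]
      exact Finset.sum_congr rfl fun k _ => perm_mul_tensorAction_pair θ h _ _
    rw [h1]
    exact tensorAction_e_mul_perm θ F h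
  have hδe : w * Φ F.γ * Φ F.e = Φ F.e := by rw [mul_assoc, ← hmul, F.γ_mul_e, hwe]
  have hδ1 : w * Φ F.γ = 1 := by
    have h1 : Φ 1 = ∑ c, Φ (F.u c ⊗ₜ 1) * Φ F.e * Φ (F.v c ⊗ₜ 1) := by
      simp only [← hmul]
      rw [← F.sum_u_e_v]
      simp only [hΦ, map_sum]
    rw [← mul_one (w * Φ F.γ), ← hone, h1, Finset.mul_sum]
    refine Finset.sum_congr rfl fun c _ => ?_
    rw [← mul_assoc, ← mul_assoc, hδ, mul_assoc (Φ _), hδe]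
  calc Φ F.γ = w * (w * Φ F.γ) := by rw [← mul_assoc, hww, one_mul]
    _ = w := by rw [hδ1, mul_one]

end TensorRep

end
end AlmostCyclic

namespace AlmostCyclic
noncomputable section

/-! ### The regular splitting module -/

section Regular

universe u v

variable {R S : Type u} {A : Type v} [CommRing R] [CommRing S] [Algebra R S] [Ring A] [Algebra R A]
  {n : ℕ} {σ : S ≃ₐ[R] S} {ι : S →ₐ[R] A} {G : GaloisCoords R n σ}

/-- The algebra `A` as a right module over `S`. -/
@[nolint unusedArguments]
def RightModule (_ι : S →ₐ[R] A) : Type v := A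

namespace RightModule

/-- The underlying element of `A`. -/
def val (x : RightModule ι) : A := x

/-- An element of `A`, as an element of the right module. -/
def ofVal (a : A) : RightModule ι := a

instance : AddCommGroup (RightModule ι) := inferInstanceAs (AddCommGroup A)

instance : Module S (RightModule ι) where
  smul s := fun x : A => (x * ι s : A)
  one_smul := fun x : A => show x * ι 1 = x by rw [map_one, mul_one]
  mul_smul s t := fun x : A => show x * ι (s * t) = x * ι t * ι s by
    rw [mul_comm s, map_mul, mul_assoc]
  smul_zero s := zero_mul (ι s)
  smul_add s := fun x y : A => add_mul x y (ι s)
  add_smul s t := fun x : A => show x * ι (s + t) = x * ι s + x * ι t by rw [map_add, mul_add]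
  zero_smul := fun x : A => show x * ι 0 = 0 by rw [map_zero, mul_zero]

/-- The coordinates of an element of `A`. -/
def coords (F : Frame G ι) : RightModule ι →ₗ[S] (F.Idx → S) where
  toFun := fun (x : A) c => F.ρ (F.v c * x)
  map_add' := fun x y : A => funext fun c => by
    change F.ρ (F.v c * (x + y)) = F.ρ (F.v c * x) + F.ρ (F.v c * y)
    rw [mul_add, map_add]
  map_smul' s := fun x : A => funext fun c => by
    change F.ρ (F.v c * (x * ι s)) = s * F.ρ (F.v c * x)
    rw [← mul_assoc, F.ρ_mul_base, mul_comm]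

/-- The element with given coordinates. -/
def ofCoords (F : Frame G ι) : (F.Idx → S) →ₗ[S] RightModule ι :=
  Fintype.linearCombination S fun c => ofVal (F.u c)

/-- The functional `x ↦ ρ (a x)`. -/
def functional (F : Frame G ι) (a : A) : RightModule ι →ₗ[S] S where
  toFun := fun (x : A) => F.ρ (a * x)
  map_add' := fun x y : A => by
    change F.ρ (a * (x + y)) = F.ρ (a * x) + F.ρ (a * y)
    rw [mul_add, map_add]
  map_smul' s := fun x : A => by
    change F.ρ (a * (x * ι s)) = s * F.ρ (a * x)
    rw [← mul_assoc, F.ρ_mul_base, mul_comm]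

theorem ofCoords_coords (F : Frame G ι) (x : RightModule ι) : ofCoords F (coords F x) = x :=
  F.sum_u_ρ x

theorem finite (F : Frame G ι) : Module.Finite S (RightModule ι) :=
  Module.Finite.of_surjective (ofCoords F) fun x => ⟨_, ofCoords_coords F x⟩

theorem projective (F : Frame G ι) : Module.Projective S (RightModule ι) :=
  Module.Projective.of_split (coords F) (ofCoords F) (LinearMap.ext (ofCoords_coords F))

theorem small (F : Frame G ι) : Small.{u} (RightModule ι) :=
  small_of_surjective (f := ofCoords F) fun x => ⟨_, ofCoords_coords F x⟩

/-- Left multiplication. -/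
def mulLeft (ι : S →ₐ[R] A) (a : A) : Module.End S (RightModule ι) where
  toFun := fun x : A => (a * x : A)
  map_add' := fun x y : A => mul_add a x y
  map_smul' s := fun x : A => (mul_assoc a x (ι s)).symm

/-- The action of `S ⊗ A`. -/
def act (ι : S →ₐ[R] A) : S ⊗[R] A →+ Module.End S (RightModule ι) :=
  TensorProduct.liftAddHom
    (AddMonoidHom.mk' (fun s => AddMonoidHom.mk' (fun a => s • mulLeft ι a) (fun a b => by
      rw [← smul_add]
      congr 1
      exact LinearMap.ext fun x : A => add_mul a b x))
      (fun s t => AddMonoidHom.ext fun a => add_smul s t _))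
    (fun r s a => LinearMap.ext fun x : A => by
      change a * x * ι (r • s) = (r • a) * x * ι s
      rw [map_smul, mul_smul_comm, smul_mul_assoc, smul_mul_assoc])

theorem act_mul (y z : S ⊗[R] A) : act ι (y * z) = act ι y * act ι z := by
  induction y with
  | zero => rw [zero_mul, map_zero, zero_mul]
  | add a b ha hb => rw [add_mul, map_add, map_add, ha, hb, add_mul]
  | tmul s a =>
    induction z with
    | zero => rw [mul_zero, map_zero, mul_zero]
    | add b c hb hc => rw [mul_add, map_add, map_add, hb, hc, mul_add]
    | tmul t b =>
      rw [Algebra.TensorProduct.tmul_mul_tmul]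
      refine LinearMap.ext fun x : A => ?_
      change a * b * x * ι (s * t) = a * (b * x * ι t) * ι s
      rw [mul_comm s, map_mul]
      simp only [mul_assoc]

theorem act_smul (s : S) (z : S ⊗[R] A) : act ι (s • z) = s • act ι z := by
  induction z with
  | zero => rw [smul_zero, map_zero, smul_zero]
  | add a b ha hb => rw [smul_add, map_add, map_add, ha, hb, smul_add]
  | tmul t a =>
    refine LinearMap.ext fun x : A => ?_
    change a * x * ι (s * t) = a * x * ι t * ι s
    rw [mul_comm s, map_mul, mul_assoc (a * x)]

/-- A tensor is determined by its coefficients along d, namely traces against d', and `algebraMap_t`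
computes such traces from the action on the elements v c. -/
theorem act_injective (F : Frame G ι) : Function.Injective (act ι) := by
  let L : Module.End S (RightModule ι) → S ⊗[R] A := fun T =>
    ∑ b, (∑ c, F.ρ (F.u c * F.d' b * val (T (ofVal (F.v c))))) ⊗ₜ F.d b
  have hadd : ∀ T T', L (T + T') = L T + L T' := by
    intro T T'
    simp only [L]
    rw [← Finset.sum_add_distrib]
    refine Finset.sum_congr rfl fun b _ => ?_
    rw [← TensorProduct.add_tmul, ← Finset.sum_add_distrib]
    congr 1
    refine Finset.sum_congr rfl fun c _ => ?_
    rw [← map_add, ← mul_add]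
    rfl
  have hL : ∀ z, L (act ι z) = z := by
    intro z
    induction z with
    | zero =>
      have := hadd 0 0
      rw [add_zero, left_eq_add] at this
      rw [map_zero, this]
    | add x y hx hy => rw [map_add, hadd, hx, hy]
    | tmul s a =>
      change ∑ b, (∑ c, F.ρ (F.u c * F.d' b * (a * F.v c * ι s))) ⊗ₜ F.d b = _
      have h1 : ∀ b, ∑ c, F.ρ (F.u c * F.d' b * (a * F.v c * ι s)) = F.t (F.d' b * a) • s := by
        intro b
        rw [Algebra.smul_def, F.algebraMap_t, Finset.sum_mul]
        refine Finset.sum_congr rfl fun c _ => ?_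
        rw [← F.ρ_mul_base]
        simp only [mul_assoc]
      simp_rw [h1, TensorProduct.smul_tmul, ← TensorProduct.tmul_sum]
      rw [F.sum_t_smul_d]
  exact Function.LeftInverse.injective hL

/-- An endomorphism T is determined by its values on the u c. Right multiplication by Galois
coordinates extracts the component of x of the degree of u c, so that x ↦ T(u c) ρ(v c · x) is
realized. -/
theorem act_surjective (F : Frame G ι) : Function.Surjective (act ι) := by
  intro T
  refine ⟨∑ c, ∑ i, G.y i ⊗ₜ (val (T (ofVal (F.u c))) * F.v c * ι ((σ ^ (c.1 : ℕ)) (G.x i))), ?_⟩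
  refine LinearMap.ext fun x => ?_
  rw [map_sum]
  refine (LinearMap.sum_apply _ _ _).trans ?_
  conv_rhs => rw [← ofCoords_coords F x, ofCoords, Fintype.linearCombination_apply, map_sum]
  refine Finset.sum_congr rfl fun c _ => ?_
  rw [map_smul, map_sum]
  refine (LinearMap.sum_apply _ _ _).trans ?_
  change ∑ i, (val (T (ofVal (F.u c))) * F.v c * ι ((σ ^ (c.1 : ℕ)) (G.x i)) * x.val * ι (G.y i) : A) =
    val (T (ofVal (F.u c))) * ι (F.ρ (F.v c * x.val))
  rw [F.v_mul_proj, G.proj_apply, Finset.mul_sum, Finset.mul_sum]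
  exact Finset.sum_congr rfl fun i _ => by simp only [mul_assoc]

end RightModule

/-- An element of a tensor power of `A` which acts as zero for all splitting modules vanishes. -/
theorem eq_zero_of_tensorAction (F : Frame G ι) {m : ℕ} (b : ⨂[R] _ : Fin m, A)
    (hb : ∀ (T' V : Type u) [CommRing T'] [Algebra R T'] [AddCommGroup V] [Module T' V] [Module R V]
      [IsScalarTower R T' V] [Module.Finite T' V] [Module.Projective T' V]
      (θ : T' ⊗[R] A ≃ₐ[T'] Module.End T' V), tensorAction θ m b = 0) : b = 0 := by
  have := RightModule.small F
  have := RightModule.finite F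
  have := RightModule.projective F
  -- A may live in a larger universe than S, but it is a quotient of a free S-module of finite rank,
  -- so a copy of it lives in the universe of S, as the quantification over splitting modules
  -- demands.
  let V := Shrink.{u} (RightModule ι)
  let e : V ≃ₗ[S] RightModule ι := Shrink.linearEquiv S (RightModule ι)
  let _ : Module R V := Module.compHom V (algebraMap R S)
  have : IsScalarTower R S V := IsScalarTower.of_algebraMap_smul fun _ _ => rfl
  have : Module.Finite S V := Module.Finite.equiv e.symm
  have : Module.Projective S V := Module.Projective.of_equiv e.symm
  let θ₀ : S ⊗[R] A ≃+* Module.End S (RightModule ι) :=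
    { Equiv.ofBijective (RightModule.act ι)
        ⟨RightModule.act_injective F, RightModule.act_surjective F⟩ with
      map_add' := map_add _
      map_mul' := RightModule.act_mul }
  let θ₁ : S ⊗[R] A ≃ₐ[S] Module.End S (RightModule ι) :=
    AlgEquiv.ofLinearEquiv (A₁ := S ⊗[R] A) (A₂ := Module.End S (RightModule ι))
      { θ₀ with map_smul' := RightModule.act_smul } (map_one θ₀) (map_mul θ₀)
  let θ : S ⊗[R] A ≃ₐ[S] Module.End S V := θ₁.trans (LinearEquiv.conjAlgEquiv S e.symm)
  have hθ : ∀ (a : A) (v : V), e (θ (1 ⊗ₜ a) v) = (a * (e v).val : A) := by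
    intro a v
    change e (e.symm (RightModule.act ι (1 ⊗ₜ a) (e v))) = _
    rw [LinearEquiv.apply_symm_apply]
    change a * (e v).val * ι 1 = _
    rw [map_one, mul_one]
  -- These are the coefficients of a tensor along the products of the elements d. By `algebraMap_t`
  -- in every slot they can be read off from the action on V, so they vanish for b.
  let tt : (Fin m → F.BIdx) → (⨂[R] _ : Fin m, A) →ₗ[R] R := fun β =>
    PiTensorProduct.lift ((MultilinearMap.mkPiAlgebra R (Fin m) R).compLinearMap fun i =>
      F.t ∘ₗ LinearMap.mulLeft R (F.d' (β i)))
  have htt : ∀ β z, tt β (PiTensorProduct.tprod R z) = ∏ i, F.t (F.d' (β i) * z i) := fun β z =>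
    (PiTensorProduct.lift.tprod _).trans (by simp)
  let Ξ : (Fin m → F.BIdx) → (Fin m → F.Idx) → (⨂[S] _ : Fin m, V) →ₗ[S] S := fun β c =>
    PiTensorProduct.lift ((MultilinearMap.mkPiAlgebra S (Fin m) S).compLinearMap fun i =>
      RightModule.functional F (F.u (c i) * F.d' (β i)) ∘ₗ e.toLinearMap)
  have hΞ : ∀ β c x, Ξ β c (PiTensorProduct.tprod S x) =
      ∏ i, F.ρ (F.u (c i) * F.d' (β i) * (e (x i)).val) := fun β c x =>
    (PiTensorProduct.lift.tprod _).trans (by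
      rw [MultilinearMap.compLinearMap_apply, MultilinearMap.mkPiAlgebra_apply]
      rfl)
  have h1 : ∀ β z, algebraMap R S (tt β z) = ∑ c : Fin m → F.Idx, Ξ β c (tensorAction θ m z
      (PiTensorProduct.tprod S fun i => e.symm (RightModule.ofVal (F.v (c i))))) := by
    intro β z
    induction z using PiTensorProduct.induction_on with
    | add x y hx hy =>
      simp only [map_add, hx, hy, LinearMap.add_apply, Finset.sum_add_distrib]
    | smul_tprod r z =>
      have h2 : ∀ c : Fin m → F.Idx, Ξ β c (tensorAction θ m (PiTensorProduct.tprod R z)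
          (PiTensorProduct.tprod S fun i => e.symm (RightModule.ofVal (F.v (c i))))) =
          ∏ i, F.ρ (F.u (c i) * (F.d' (β i) * z i) * F.v (c i)) := fun c => by
        rw [tensorAction_tprod, hΞ]
        refine Finset.prod_congr rfl fun i _ => ?_
        refine (congrArg (fun y => F.ρ (_ * RightModule.val y)) (hθ _ _)).trans ?_
        rw [LinearEquiv.apply_symm_apply]
        congr 1
        change _ * (_ * F.v (c i)) = _
        simp only [mul_assoc]
      have h3 : ∀ (r : R) (f : Module.End S (⨂[S] _ : Fin m, V)) x c,
          Ξ β c ((r • f) x) = algebraMap R S r * Ξ β c (f x) := fun r f x c => by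
        rw [← algebraMap_smul S r f, LinearMap.smul_apply, map_smul, smul_eq_mul]
      simp_rw [map_smul, h3, h2, ← Finset.mul_sum]
      rw [smul_eq_mul, map_mul, htt, map_prod]
      simp_rw [F.algebraMap_t]
      rw [Finset.prod_univ_sum, Fintype.piFinset_univ]
  have h4 : ∀ z, ∑ β, tt β z • PiTensorProduct.tprod R (F.d ∘ β) = z := by
    intro z
    induction z using PiTensorProduct.induction_on with
    | add x y hx hy => simp only [map_add, add_smul, Finset.sum_add_distrib, hx, hy]
    | smul_tprod r z =>
      simp_rw [map_smul, smul_eq_mul, mul_smul, ← Finset.smul_sum, htt]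
      congr 1
      have h5 := (PiTensorProduct.tprod R (s := fun _ : Fin m => A)).map_sum
        (fun i (b : F.BIdx) => F.t (F.d' b * z i) • F.d b)
      simp_rw [F.sum_t_smul_d, MultilinearMap.map_smul_univ] at h5
      exact h5.symm
  rw [← h4 b]
  refine Finset.sum_eq_zero fun β _ => ?_
  have h6 : tt β b = 0 := G.inj (by
    rw [h1, hb S V θ, map_zero]
    exact Finset.sum_eq_zero fun c _ => map_zero _)
  rw [h6, zero_smul]

end Regular

end
end AlmostCyclic

namespace AlmostCyclic
noncomputable section

/-! ### Permutations and the exterior power -/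

section Exterior

universe u v

variable {R S : Type u} {A : Type v} [CommRing R] [CommRing S] [Algebra R S] [Ring A] [Algebra R A]
  {n : ℕ} {σ : S ≃ₐ[R] S} {ι : S →ₐ[R] A} {G : GaloisCoords R n σ}

theorem eq_of_tensorAction (F : Frame G ι) {m : ℕ} (a b : ⨂[R] _ : Fin m, A)
    (h : ∀ (T' V : Type u) [CommRing T'] [Algebra R T'] [AddCommGroup V] [Module T' V] [Module R V]
      [IsScalarTower R T' V] [Module.Finite T' V] [Module.Projective T' V]
      (θ : T' ⊗[R] A ≃ₐ[T'] Module.End T' V), tensorAction θ m a = tensorAction θ m b) : a = b := by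
  rw [← sub_eq_zero]
  refine eq_zero_of_tensorAction F _ fun T' V _ _ _ _ _ _ _ _ θ => ?_
  rw [map_sub, h T' V θ, sub_self]

/-- Permutations are products of transpositions, and γ acts as a transposition. By faithfulness of
the action the element is unique, so composition carries over to products. -/
theorem exists_perm (F : Frame G ι) {m : ℕ} (π : Equiv.Perm (Fin m)) :
    ∃ g : ⨂[R] _ : Fin m, A, ∀ (T' V : Type u) [CommRing T'] [Algebra R T'] [AddCommGroup V]
      [Module T' V] [Module R V] [IsScalarTower R T' V] [Module.Finite T' V]
      [Module.Projective T' V] (θ : T' ⊗[R] A ≃ₐ[T'] Module.End T' V),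
      tensorAction θ m g = permEnd T' V π := by
  induction π using Equiv.Perm.swap_induction_on with
  | one => exact ⟨1, fun T' V _ _ _ _ _ _ _ _ θ => by rw [tensorAction_one, permEnd_one]⟩
  | swap_mul f i j hij ih =>
    obtain ⟨g, hg⟩ := ih
    refine ⟨pairSlot R hij F.γ * g, fun T' V _ _ _ _ _ _ _ _ θ => ?_⟩
    rw [tensorAction_mul, tensorAction_γ, hg, permEnd_mul]

/-- The element of a tensor power which acts as a permutation of the factors. -/
def Frame.perm (F : Frame G ι) {m : ℕ} (π : Equiv.Perm (Fin m)) : ⨂[R] _ : Fin m, A :=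
  (exists_perm F π).choose

namespace Frame

variable (F : Frame G ι) {m : ℕ}

section

variable {T' V : Type u} [CommRing T'] [Algebra R T'] [AddCommGroup V]
  [Module T' V] [Module R V] [IsScalarTower R T' V]
  (θ : T' ⊗[R] A ≃ₐ[T'] Module.End T' V)

theorem tensorAction_perm (π : Equiv.Perm (Fin m)) [Module.Finite T' V] [Module.Projective T' V] :
    tensorAction θ m (F.perm π) = permEnd T' V π :=
  (exists_perm F π).choose_spec T' V θ

end

theorem perm_one : F.perm (1 : Equiv.Perm (Fin m)) = 1 :=
  eq_of_tensorAction F _ _ fun T' V _ _ _ _ _ _ _ _ θ => by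
    rw [tensorAction_perm, tensorAction_one, permEnd_one]

theorem perm_mul (π π' : Equiv.Perm (Fin m)) : F.perm (π * π') = F.perm π * F.perm π' :=
  eq_of_tensorAction F _ _ fun T' V _ _ _ _ _ _ _ _ θ => by
    rw [tensorAction_mul, tensorAction_perm, tensorAction_perm, tensorAction_perm, permEnd_mul]

theorem perm_mul_tprod (π : Equiv.Perm (Fin m)) (z : Fin m → A) :
    F.perm π * PiTensorProduct.tprod R z = PiTensorProduct.tprod R (z ∘ π.symm) * F.perm π :=
  eq_of_tensorAction F _ _ fun T' V _ _ _ _ _ _ _ _ θ => by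
    rw [tensorAction_mul, tensorAction_mul, tensorAction_perm]
    refine tensor_ext fun v => ?_
    rw [Module.End.mul_apply, Module.End.mul_apply, permEnd_tprod, tensorAction_tprod,
      tensorAction_tprod, permEnd_tprod]
    rfl

theorem perm_mul_slot (π : Equiv.Perm (Fin m)) (i : Fin m) (a : A) :
    F.perm π * slot R i a = slot R (π i) a * F.perm π :=
  mul_slot_of_mul_tprod (F.perm_mul_tprod π) i a

theorem perm_mul_q (π : Equiv.Perm (Fin m)) (h : Fin m → ℕ) (s : S) :
    F.perm π * F.q h s = F.q (h ∘ π.symm) s * F.perm π :=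
  F.mul_q_of_mul_tprod (F.perm_mul_tprod π) h s

/-- The antisymmetrizer. -/
def anti (m : ℕ) : ⨂[R] _ : Fin m, A :=
  ∑ π : Equiv.Perm (Fin m), (Equiv.Perm.sign π : ℤ) • F.perm π

end Frame

section

variable {T' V : Type u} [CommRing T'] [Algebra R T'] [AddCommGroup V]
  [Module T' V] [Module R V] [IsScalarTower R T' V]
  (θ : T' ⊗[R] A ≃ₐ[T'] Module.End T' V) (F : Frame G ι) {m : ℕ}

theorem End.zsmul_apply {M : Type*} [AddCommGroup M] [Module T' M] (k : ℤ) (f : Module.End T' M)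
    (x : M) : (k • f) x = k • f x :=
  LinearMap.smul_apply k f x

theorem toExteriorPower_tprod (v : Fin m → V) :
    toExteriorPower T' V m (PiTensorProduct.tprod T' v) = exteriorPower.ιMulti T' m v :=
  PiTensorProduct.lift.tprod _

theorem toExteriorPower_permEnd (π : Equiv.Perm (Fin m)) (x : ⨂[T'] _ : Fin m, V) :
    toExteriorPower T' V m (permEnd T' V π x) =
      (Equiv.Perm.sign π : ℤ) • toExteriorPower T' V m x := by
  have : toExteriorPower T' V m ∘ₗ permEnd T' V π =
      (Equiv.Perm.sign π : ℤ) • toExteriorPower T' V m := tensor_ext fun v => by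
    rw [LinearMap.comp_apply, permEnd_tprod, toExteriorPower_tprod, LinearMap.smul_apply,
      toExteriorPower_tprod]
    rw [AlternatingMap.map_perm, Equiv.Perm.sign_symm]
    rfl
  exact LinearMap.congr_fun this x

/-- The antisymmetrizer acts as the alternatization of the universal multilinear map, which factors
through the exterior power. -/
theorem tensorAction_anti [Module.Finite T' V] [Module.Projective T' V]
    (x : ⨂[T'] _ : Fin m, V) (hx : toExteriorPower T' V m x = 0) :
    tensorAction θ m (F.anti m) x = 0 := by
  have : tensorAction θ m (F.anti m) = exteriorPower.alternatingMapLinearEquiv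
      (MultilinearMap.alternatization (PiTensorProduct.tprod T' (s := fun _ : Fin m => V))) ∘ₗ
        toExteriorPower T' V m := tensor_ext fun v => by
    rw [LinearMap.comp_apply, toExteriorPower_tprod,
      exteriorPower.alternatingMapLinearEquiv_apply_ιMulti, MultilinearMap.alternatization_apply,
      Frame.anti, map_sum, LinearMap.sum_apply]
    refine Fintype.sum_equiv (Equiv.inv _) _ _ fun π => ?_
    rw [map_zsmul, F.tensorAction_perm, End.zsmul_apply, permEnd_tprod, Equiv.inv_apply,
      Equiv.Perm.sign_inv]
    rfl
  rw [this, LinearMap.comp_apply, hx, map_zero]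

theorem tensorAction_q_tprod (h : Fin m → ℕ) (s : S) (v : Fin m → V) :
    tensorAction θ m (F.q h s) (PiTensorProduct.tprod T' v) =
      ∑ a : Fin m → Fin G.N, algebraMap R T' (G.tr (s * ∏ i, (σ ^ h i) (G.x (a i)))) •
        PiTensorProduct.tprod T' fun i => θ (1 ⊗ₜ ι (G.y (a i))) (v i) := by
  rw [Frame.q, GaloisCoords.Q, map_sum, map_sum, LinearMap.sum_apply]
  refine Finset.sum_congr rfl fun a _ => ?_
  rw [map_smul, map_smul, ← algebraMap_smul T', LinearMap.smul_apply, powMap_tprod,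
    tensorAction_tprod]
  rfl

/-- Interchanging the values of the index a at i and j pairs off terms of opposite sign; a term
fixed by this has two equal entries and vanishes by itself, also in characteristic two. -/
theorem toExteriorPower_q_of_eq {h : Fin m → ℕ} {i j : Fin m} (hij : i ≠ j)
    (hh : h i ≡ h j [MOD n]) (s : S) (v : Fin m → V) (hv : v i = v j) :
    toExteriorPower T' V m (tensorAction θ m (F.q h s) (PiTensorProduct.tprod T' v)) = 0 := by
  rw [tensorAction_q_tprod, map_sum]
  have hc : ∀ a : Fin m → Fin G.N, ∏ l, (σ ^ h l) (G.x ((a ∘ Equiv.swap i j) l)) =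
      ∏ l, (σ ^ h l) (G.x (a l)) := fun a => by
    rw [← Equiv.prod_comp (Equiv.swap i j) fun l => (σ ^ h l) (G.x (a l))]
    refine Finset.prod_congr rfl fun l _ => ?_
    rw [Function.comp_apply]
    congr 1
    refine pow_eq_pow_of_modEq (g := σ) G.pow ?_
    rw [Equiv.swap_apply_def]
    split_ifs with h1 h2
    · rw [h1]; exact hh
    · rw [h2]; exact hh.symm
    · rfl
  have hperm : ∀ a : Fin m → Fin G.N,
      (fun l => θ (1 ⊗ₜ ι (G.y ((a ∘ Equiv.swap i j) l))) (v l)) =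
      (fun l => θ (1 ⊗ₜ ι (G.y (a l))) (v l)) ∘ Equiv.swap i j := fun a => by
    funext l
    have : v (Equiv.swap i j l) = v l := by
      rw [Equiv.swap_apply_def]
      split_ifs with h1 h2
      · rw [h1, hv]
      · rw [h2, hv]
      · rfl
    rw [Function.comp_apply, Function.comp_apply, this]
  refine Finset.sum_involution (fun a _ => a ∘ Equiv.swap i j) ?_ ?_ (fun _ _ => Finset.mem_univ _)
    ?_
  · intro a _
    rw [map_smul, map_smul, toExteriorPower_tprod, toExteriorPower_tprod, hc, hperm,
      AlternatingMap.map_swap _ _ hij, smul_neg, add_neg_cancel]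
  · intro a _ ha h1
    apply ha
    have h2 : a i = a j := by
      have := congrFun h1 i
      rwa [Function.comp_apply, Equiv.swap_apply_left, eq_comm] at this
    rw [map_smul, toExteriorPower_tprod, AlternatingMap.map_eq_zero_of_eq _ _ _ hij, smul_zero]
    rw [h2, hv]
  · intro a _
    rw [Function.comp_assoc]
    funext l
    simp

/-- With equal degrees in slots i and j, the map to the exterior power is alternating in these slots
and balanced over S. Locally V is a line over T' ⊗ S, so such a map is zero. -/
theorem toExteriorPower_q_eq_zero [Module.Finite T' V] [Module.Projective T' V] {h : Fin m → ℕ}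
    {i j : Fin m} (hij : i ≠ j) (hh : h i ≡ h j [MOD n]) (s : S) (x : ⨂[T'] _ : Fin m, V) :
    toExteriorPower T' V m (tensorAction θ m (F.q h s) x) = 0 := by
  -- The twist by σ^(h i) is chosen so that z acting in slot i or j changes the index s to z s.
  let L : S → (⨂[T'] _ : Fin m, V) →ₗ[T'] ⋀[T']^m V := fun s =>
    toExteriorPower T' V m ∘ₗ tensorAction θ m (F.q h ((σ ^ h i) s))
  have hL : ∀ s l z v, h l ≡ h i [MOD n] →
      L s (PiTensorProduct.tprod T' (Function.update v l (θ (1 ⊗ₜ ι z) (v l)))) =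
        L (z * s) (PiTensorProduct.tprod T' v) := fun s l z v hl => by
    simp only [L]
    rw [← tensorAction_slot, LinearMap.comp_apply, LinearMap.comp_apply, ← Module.End.mul_apply,
      ← tensorAction_mul, F.q_mul_slot, pow_eq_pow_of_modEq (g := σ) G.pow hl, map_mul]
  have key : ∀ s v, L s (PiTensorProduct.tprod T' v) = 0 := by
    intro s v
    have := rep_alternating θ F (fun s => slotBilin (L s) v hij) (fun s z a b => by
        have h1 := hL s i z (Function.update (Function.update v i a) j b) rfl
        rw [Function.update_of_ne hij, Function.update_self, Function.update_comm hij.symm,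
          Function.update_idem] at h1
        exact h1)
      (fun s z a b => by
        have h1 := hL s j z (Function.update (Function.update v i a) j b) hh.symm
        rw [Function.update_self, Function.update_idem] at h1
        exact h1)
      (fun s a => toExteriorPower_q_of_eq θ F hij hh _ _ (by
        rw [Function.update_of_ne hij, Function.update_self, Function.update_self]))
      s (v i) (v j)
    rwa [slotBilin_apply, Function.update_eq_self, Function.update_eq_self] at this
  have h1 : L ((σ ^ h i).symm s) = 0 := tensor_ext fun v => key _ v
  have h2 := LinearMap.congr_fun h1 x
  simp only [L, AlgEquiv.apply_symm_apply] at h2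
  exact h2

/-- Moving q past a permutation permutes its multidegree, and in the exterior power the permutation
cancels its sign. So the left side sums q over all bijective multidegrees; the others contribute
nothing, and the sum over all of them is tr s by `sum_Q`. -/
theorem toExteriorPower_q_anti [Module.Finite T' V] [Module.Projective T' V] (s : S)
    (x : ⨂[T'] _ : Fin n, V) :
    toExteriorPower T' V n (tensorAction θ n (F.q (fun i => (i : ℕ)) s * F.anti n) x) =
      algebraMap R T' (G.tr s) • toExteriorPower T' V n x := by
  have h1 : ∀ π : Equiv.Perm (Fin n), toExteriorPower T' V n (tensorAction θ n
      (F.q (fun i => (i : ℕ)) s * (Equiv.Perm.sign π : ℤ) • F.perm π) x) =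
      toExteriorPower T' V n (tensorAction θ n (F.q (fun i => (π i : ℕ)) s) x) := by
    intro π
    have h2 := F.perm_mul_q π (fun i => (π i : ℕ)) s
    have h3 : (fun i => (π i : ℕ)) ∘ π.symm = fun i : Fin n => (i : ℕ) := by
      funext i
      simp
    rw [h3] at h2
    rw [mul_smul_comm, ← h2, map_zsmul, End.zsmul_apply, map_zsmul, tensorAction_mul,
      Module.End.mul_apply, F.tensorAction_perm, toExteriorPower_permEnd, smul_smul,
      ← Units.val_mul, Int.units_mul_self, Units.val_one, one_smul]
  have h4 := congrArg (powMap ι n) (G.sum_Q (m := n) s)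
  rw [map_sum, map_smul, map_one] at h4
  have h5 : algebraMap R T' (G.tr s) • toExteriorPower T' V n x =
      toExteriorPower T' V n (tensorAction θ n (G.tr s • 1) x) := by
    rw [map_smul, tensorAction_one, ← algebraMap_smul T' (G.tr s) (1 : Module.End T' _),
      LinearMap.smul_apply, map_smul, Module.End.one_apply]
  rw [h5, ← h4, Frame.anti, Finset.mul_sum, map_sum, map_sum, LinearMap.sum_apply,
    LinearMap.sum_apply, map_sum, map_sum]
  simp_rw [h1]
  refine Finset.sum_of_injOn (fun π : Equiv.Perm (Fin n) => (π : Fin n → Fin n))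
    (fun _ _ _ _ h => Equiv.coe_fn_injective h) (fun _ _ => Finset.mem_univ _) ?_ (fun _ _ => rfl)
  intro h _ hh
  have : ¬ Function.Injective h := fun hi => hh
    ⟨Equiv.ofBijective h (Finite.injective_iff_bijective.mp hi), Finset.mem_univ _, rfl⟩
  simp only [Function.Injective, not_forall] at this
  obtain ⟨i, j, hij, hne⟩ := this
  exact toExteriorPower_q_eq_zero θ F hne (by rw [hij]) s x

end

namespace Frame

variable (F : Frame G ι)

/-- The standard exterior idempotent. -/
def ext : ⨂[R] _ : Fin n, A := F.q (fun i => (i : ℕ)) G.c * F.anti n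

section

variable {T' V : Type u} [CommRing T'] [Algebra R T'] [AddCommGroup V]
  [Module T' V] [Module R V] [IsScalarTower R T' V] [Module.Finite T' V] [Module.Projective T' V]
  (θ : T' ⊗[R] A ≃ₐ[T'] Module.End T' V)

theorem toExteriorPower_ext (x : ⨂[T'] _ : Fin n, V) :
    toExteriorPower T' V n (tensorAction θ n F.ext x) = toExteriorPower T' V n x := by
  rw [ext, toExteriorPower_q_anti, G.tr_c, map_one, one_smul]

theorem tensorAction_ext_of (x : ⨂[T'] _ : Fin n, V) (hx : toExteriorPower T' V n x = 0) :
    tensorAction θ n F.ext x = 0 := by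
  rw [ext, tensorAction_mul, Module.End.mul_apply, tensorAction_anti θ F x hx, map_zero]

end

/-- The element `ext` does not change images in the exterior power and kills what maps to zero
there, so it is a projection along the kernel. -/
theorem isExteriorIdempotent_ext : IsExteriorIdempotent n F.ext := by
  refine ⟨eq_of_tensorAction F _ _ fun T' V _ _ _ _ _ _ _ _ θ => ?_,
    fun T' V _ _ _ _ _ _ _ _ θ => ?_⟩
  · refine LinearMap.ext fun x => ?_
    rw [tensorAction_mul, Module.End.mul_apply, ← sub_eq_zero, ← map_sub]
    exact F.tensorAction_ext_of θ _ (by rw [map_sub, F.toExteriorPower_ext θ, sub_self])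
  · ext x
    rw [LinearMap.mem_ker, LinearMap.mem_ker]
    exact ⟨fun h => by rw [← F.toExteriorPower_ext θ, h, map_zero], F.tensorAction_ext_of θ x⟩

/-- The difference between `ext` x and x dies in the exterior power, so it is killed by f. The
companion statement is dual: f x and x differ by an element of the same kernel, which the
antisymmetrizer kills. -/
theorem mul_ext_of_isExteriorIdempotent {f : ⨂[R] _ : Fin n, A} (hf : IsExteriorIdempotent n f) :
    f * F.ext = f :=
  eq_of_tensorAction F _ _ fun T' V _ _ _ _ _ _ _ _ θ => LinearMap.ext fun x => by
    rw [tensorAction_mul, Module.End.mul_apply, ← sub_eq_zero, ← map_sub, ← LinearMap.mem_ker,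
      hf.2 T' V θ, LinearMap.mem_ker, map_sub, F.toExteriorPower_ext θ, sub_self]

theorem anti_mul_of_isExteriorIdempotent {f : ⨂[R] _ : Fin n, A} (hf : IsExteriorIdempotent n f) :
    F.anti n * f = F.anti n :=
  eq_of_tensorAction F _ _ fun T' V _ _ _ _ _ _ _ _ θ => LinearMap.ext fun x => by
    rw [tensorAction_mul, Module.End.mul_apply, ← sub_eq_zero, ← map_sub]
    refine tensorAction_anti θ F _ ?_
    rw [← LinearMap.mem_ker, ← hf.2 T' V θ, LinearMap.mem_ker, map_sub, ← Module.End.mul_apply,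
      ← tensorAction_mul, hf.1.eq, sub_self]

end Frame

end Exterior

end
end AlmostCyclic

namespace AlmostCyclic
noncomputable section

/-! ### The corner of the diagonal idempotent -/

section Diagonal

universe u v

variable {R S : Type u} {A : Type v} [CommRing R] [CommRing S] [Algebra R S] [Ring A] [Algebra R A]
  {n : ℕ} {σ : S ≃ₐ[R] S} {ι : S →ₐ[R] A} {G : GaloisCoords R n σ}

/-- The first of `n` factors. -/
def GaloisCoords.first (G : GaloisCoords R n σ) : Fin n := ⟨0, G.pos⟩

namespace Frame

variable (F : Frame G ι) {m : ℕ}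

theorem pairSlot_e_mul_perm {i j : Fin m} (h : i ≠ j) :
    pairSlot R h F.e * F.perm (Equiv.swap i j) = pairSlot R h F.e :=
  eq_of_tensorAction F _ _ fun T' V _ _ _ _ _ _ _ _ θ => by
    rw [tensorAction_mul, tensorAction_perm, tensorAction_e_mul_perm θ F h]

theorem mul_perm_swap {i j : Fin m} {X : ⨂[R] _ : Fin m, A}
    (hX : ∀ s, X * slot R i (ι s) = X * slot R j (ι s)) : X * F.perm (Equiv.swap i j) = X := by
  by_cases h : i = j
  · subst h
    rw [Equiv.swap_self]
    exact (congrArg (X * ·) F.perm_one).trans (mul_one X)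
  · conv_rhs => rw [← F.mul_pairSlot_e h hX, ← F.pairSlot_e_mul_perm h, ← mul_assoc,
      F.mul_pairSlot_e h hX]

theorem isPermSystem_perm : F.IsPermSystem fun (π : Equiv.Perm (Fin m)) p => p = F.perm π where
  one := F.perm_one.symm
  mul π π' p p' hp hp' := by rw [hp, hp', F.perm_mul]
  mul_tprod π p hp z := by rw [hp, F.perm_mul_tprod]
  swap i j := ⟨_, rfl, fun _ hX => F.mul_perm_swap hX⟩

/-- The idempotent of the diagonal, multiplied by an element of `S`. -/
def diag (s : S) : ⨂[R] _ : Fin n, A := F.q (fun i => (i : ℕ)) s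

theorem diag_mul_diag (s t : S) : F.diag s * F.diag t = F.diag (s * t) := F.q_mul_q _ G.pos s t

theorem slot_mul_diag (s t : S) (i : Fin n) :
    slot R i (ι t) * F.diag s = F.diag ((σ ^ (i : ℕ)) t * s) := F.slot_mul_q _ s t i

theorem diag_mul_slot (s t : S) (i : Fin n) :
    F.diag s * slot R i (ι t) = F.diag ((σ ^ (i : ℕ)) t * s) := F.q_mul_slot _ s t i

theorem slot_first_mul_diag (s t : S) : slot R G.first (ι t) * F.diag s = F.diag (t * s) :=
  F.slot_mul_diag s t G.first

theorem diag_one_mul_slot_first (t : S) : F.diag 1 * slot R G.first (ι t) = F.diag t := by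
  rw [diag_mul_slot, mul_one]
  rfl

theorem perm_finRotate_mul_diag (s : S) :
    F.perm (finRotate n) * F.diag s = F.diag (σ s) * F.perm (finRotate n) :=
  F.mul_q_of_rotate (mul_one n) (fun _ => (one_mul _).symm) (F.perm_mul_tprod _) s

/-- Collecting the n factors of degree one in a single slot leaves their product there, at the price
of one rotation of the slots. -/
theorem diag_mul_tprod (z : Fin n → A) (hz : ∀ i, IsDeg ι σ 1 (z i)) :
    F.diag 1 * PiTensorProduct.tprod R z =
      F.diag 1 * slot R G.first (List.ofFn z).prod * F.perm (finRotate n) := by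
  obtain ⟨p, rfl, hp⟩ := F.exists_q_mul_tprod G.pos (h := fun i => (i : ℕ))
    (fun _ => (one_mul _).symm) F.isPermSystem_perm
  exact hp z hz

theorem perm_finRotate_pow_mul_diag (l : ℕ) (s : S) :
    F.perm (finRotate n ^ l) * F.diag s = F.diag ((σ ^ l) s) * F.perm (finRotate n ^ l) := by
  induction l generalizing s with
  | zero => rw [pow_zero, pow_zero, F.perm_one, one_mul, mul_one]; rfl
  | succ l ih =>
    rw [pow_succ, F.perm_mul, mul_assoc, F.perm_finRotate_mul_diag, ← mul_assoc, ih, mul_assoc,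
      pow_succ]
    rfl

/-- The cyclic permutation of the factors, in the corner of the diagonal idempotent. -/
def rot : ⨂[R] _ : Fin n, A := F.diag 1 * F.perm (finRotate n)

theorem rot_pow (l : ℕ) : F.diag 1 * F.rot ^ l = F.diag 1 * F.perm (finRotate n ^ l) := by
  induction l with
  | zero => rw [pow_zero, pow_zero, F.perm_one]
  | succ l ih =>
    rw [pow_succ, ← mul_assoc, ih, rot, ← mul_assoc, mul_assoc (F.diag 1),
      F.perm_finRotate_pow_mul_diag, map_one, ← mul_assoc, F.diag_mul_diag, one_mul, mul_assoc,
      ← F.perm_mul, pow_succ]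

theorem rot_pow_self : F.diag 1 * F.rot ^ n = F.diag 1 := by
  rw [rot_pow, finRotate_pow_self, perm_one, mul_one]

theorem diag_mul_rot : F.diag 1 * F.rot = F.rot := by
  rw [rot, ← mul_assoc, F.diag_mul_diag, one_mul]

theorem rot_mul_diag (s : S) : F.rot * F.diag s = F.diag (σ s) * F.rot := by
  rw [rot, mul_assoc, F.perm_finRotate_mul_diag, ← mul_assoc, ← mul_assoc, F.diag_mul_diag,
    F.diag_mul_diag, one_mul, mul_one]

/-- Let X be the product. Computing z in slot i on its right in two ways, through slot π i on the
left or through the first slot, shows that σ^(π i) z and σ^(π 0 + i) z act alike on X. Orthogonality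
kills X unless the exponents agree modulo n. -/
theorem diag_perm_diag_eq_zero {π : Equiv.Perm (Fin n)} {i : Fin n}
    (h : ¬ (π i : ℕ) ≡ π G.first + i [MOD n]) (s t : S) : F.diag s * F.perm π * F.diag t = 0 := by
  set X := F.diag s * F.perm π * F.diag t with hX
  have h1 : ∀ j z, slot R j (ι z) * X = slot R G.first (ι ((σ ^ (j : ℕ)) z)) * X := fun j z => by
    simp only [hX, ← mul_assoc]
    rw [F.slot_mul_diag, F.slot_first_mul_diag]
  have h2 : ∀ j z, X * slot R j (ι z) = slot R (π j) (ι z) * X := fun j z => by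
    simp only [hX, ← mul_assoc]
    rw [mul_assoc _ (F.diag t), F.diag_mul_slot, ← F.slot_mul_diag, ← mul_assoc,
      mul_assoc _ (F.perm π), F.perm_mul_slot, ← mul_assoc, F.diag_mul_slot, F.slot_mul_diag]
  refine G.eq_zero_of_pow_mul ((slot R G.first).comp ι) h fun z => ?_
  change slot R G.first (ι ((σ ^ (π i : ℕ)) z)) * X = slot R G.first (ι ((σ ^ _) z)) * X
  have h3 : X * slot R i (ι z) = X * slot R G.first (ι ((σ ^ (i : ℕ)) z)) := by
    simp only [hX, mul_assoc]
    rw [F.diag_mul_slot, F.diag_mul_slot]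
    rfl
  rw [← h1, ← h2, h3, h2, h1, pow_add]
  rfl

/-- A permutation that survives between diagonal idempotents satisfies π i ≡ π 0 + i, so it is a
power of the rotation, whose sign is the corresponding power. -/
theorem diag_anti_diag (s : S) : F.diag 1 * F.anti n * F.diag s =
    ∑ l ∈ Finset.range n, ((Equiv.Perm.sign (finRotate n) : ℤ) ^ l) • (F.diag 1 * F.rot ^ l *
      F.diag s) := by
  simp only [rot_pow]
  rw [anti, Finset.mul_sum, Finset.sum_mul, Finset.sum_range]
  symm
  refine Finset.sum_of_injOn (fun l : Fin n => finRotate n ^ (l : ℕ)) ?_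
    (fun _ _ => Finset.mem_univ _) ?_ ?_
  · intro a _ b _ h
    have h1 := congrArg (fun π : Equiv.Perm (Fin n) => ((π G.first : Fin n) : ℕ)) h
    simp only [coe_finRotate_pow] at h1
    have hf : ((G.first : Fin n) : ℕ) = 0 := rfl
    rw [hf, zero_add, zero_add, Nat.mod_eq_of_lt a.2, Nat.mod_eq_of_lt b.2] at h1
    exact Fin.ext h1
  · intro π _ hπ
    rw [mul_smul_comm, smul_mul_assoc]
    by_cases h : ∀ i, (π i : ℕ) ≡ π G.first + i [MOD n]
    · exact absurd ⟨π G.first, Finset.mem_coe.mpr (Finset.mem_univ _),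
        (eq_finRotate_pow G.pos h).symm⟩ hπ
    · push Not at h
      obtain ⟨i, hi⟩ := h
      rw [F.diag_perm_diag_eq_zero hi]
      exact zsmul_zero _
  · intro l _
    rw [mul_smul_comm, smul_mul_assoc, map_pow, Units.val_pow_eq_pow_val]

section

variable {f : ⨂[R] _ : Fin n, A}

/-- With α = f · diag c and β = diag 1 · anti, this and the next two statements give αβ = f, βf = β
and βα = diag 1 · anti · diag c. They identify the corner of any exterior idempotent with one that
does not depend on f. -/
theorem diag_c_anti (hf : IsExteriorIdempotent n f) :
    f * F.diag G.c * (F.diag 1 * F.anti n) = f := by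
  rw [← mul_assoc, mul_assoc f, F.diag_mul_diag, mul_one, mul_assoc]
  exact F.mul_ext_of_isExteriorIdempotent hf

theorem diag_anti_mul (hf : IsExteriorIdempotent n f) :
    F.diag 1 * F.anti n * f = F.diag 1 * F.anti n := by
  rw [mul_assoc, F.anti_mul_of_isExteriorIdempotent hf]

theorem anti_diag_c (hf : IsExteriorIdempotent n f) :
    F.diag 1 * F.anti n * (f * F.diag G.c) = F.diag 1 * F.anti n * F.diag G.c := by
  rw [← mul_assoc, F.diag_anti_mul hf]

end

end Frame

end Diagonal

end
end AlmostCyclic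

namespace AlmostCyclic
noncomputable section

/-! ### Tensor powers over a Galois extension of the base ring -/

section ChangeBase

variable {R T C : Type*} [CommRing R] [CommRing T] [Algebra R T] [Ring C] [Algebra R C]
  [Algebra T C] [IsScalarTower R T C] {m : ℕ}

theorem changeBase_tprod (x : Fin m → C) :
    changeBase R T C m (PiTensorProduct.tprod R x) = PiTensorProduct.tprod T x :=
  PiTensorProduct.lift.tprod _

theorem pow_induction_tprod {P : (⨂[R] _ : Fin m, C) → Prop}
    (add : ∀ x y, P x → P y → P (x + y))
    (tprod : ∀ x : Fin m → C, P (PiTensorProduct.tprod R x)) (z : ⨂[R] _ : Fin m, C) (hm : 0 < m) :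
    P z := by
  induction z using PiTensorProduct.induction_on with
  | add x y hx hy => exact add x y hx hy
  | smul_tprod r x =>
    have := (PiTensorProduct.tprod R (s := fun _ : Fin m => C)).map_update_smul x ⟨0, hm⟩ r
      (x ⟨0, hm⟩)
    rw [Function.update_eq_self] at this
    rw [← this]
    exact tprod _

theorem changeBase_slot (i : Fin m) (x : C) :
    changeBase R T C m (slot R i x) = slot T i x := by
  rw [slot_apply, slot_apply, changeBase_tprod]

theorem changeBase_surjective (hm : 0 < m) : Function.Surjective (changeBase R T C m) := by
  intro z
  induction z using PiTensorProduct.induction_on with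
  | smul_tprod t x =>
    refine ⟨slot R ⟨0, hm⟩ (algebraMap T C t) * PiTensorProduct.tprod R x, ?_⟩
    rw [map_mul, changeBase_slot, changeBase_tprod, AlgHom.commutes, ← Algebra.smul_def]
  | add x y hx hy =>
    obtain ⟨a, rfl⟩ := hx
    obtain ⟨b, rfl⟩ := hy
    exact ⟨a + b, map_add _ _ _⟩

namespace GaloisCoords

variable {k : ℕ} {σ : T ≃ₐ[R] T} (G : GaloisCoords R k σ)

theorem changeBase_powMap (σ : T ≃ₐ[R] T) (z : ⨂[R] _ : Fin m, T) :
    changeBase R T C m (powMap (IsScalarTower.toAlgHom R T C) m z) =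
      algebraMap T _ (twist σ (fun _ => 0) z) := by
  induction z using pow_induction with
  | h1 => simp only [map_one]
  | hmul x y hx hy => simp only [map_mul, hx, hy]
  | hadd x y hx hy => simp only [map_add, hx, hy]
  | hsmul r x hx =>
    rw [map_smul, map_smul, map_smul, hx, Algebra.smul_def r (twist σ (fun _ => 0) x), map_mul,
      ← IsScalarTower.algebraMap_apply, ← Algebra.smul_def]
  | hslot i t =>
    rw [powMap_slot, changeBase_slot, twist_slot, ← AlgHom.commutes (slot T i)]
    rfl

variable (C m) in
/-- The image in a tensor power of `C` of the element of the tensor power of `T` on which the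
multiplication map takes the value `t`. -/
def bal (t : T) : ⨂[R] _ : Fin m, C :=
  powMap (IsScalarTower.toAlgHom R T C) m (G.Q (fun _ => 0) t)

theorem slot_mul_bal (i : Fin m) (t s : T) :
    slot R i (algebraMap T C t) * G.bal C m s = G.bal C m (t * s) := by
  rw [bal, ← IsScalarTower.toAlgHom_apply R T C, ← powMap_slot, ← map_mul, G.mul_Q, twist_slot]
  rfl

theorem bal_add (s t : T) : G.bal C m (s + t) = G.bal C m s + G.bal C m t := by
  rw [bal, Q_add, map_add]
  rfl

theorem bal_zero : G.bal C m 0 = 0 := by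
  rw [bal, Q_zero, map_zero]

theorem bal_mul_bal (hm : 0 < m) (s t : T) : G.bal C m s * G.bal C m t = G.bal C m (s * t) := by
  rw [bal, bal, ← map_mul, G.mul_Q, G.twist_Q _ hm, bal]

theorem changeBase_bal (hm : 0 < m) (t : T) :
    changeBase R T C m (G.bal C m t) = algebraMap T _ t := by
  rw [bal, changeBase_powMap σ, G.twist_Q _ hm]

theorem powMap_mul_comm (z : ⨂[R] _ : Fin m, T) (x : ⨂[R] _ : Fin m, C) :
    powMap (IsScalarTower.toAlgHom R T C) m z * x =
      x * powMap (IsScalarTower.toAlgHom R T C) m z := by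
  induction z using PiTensorProduct.induction_on with
  | add y z hy hz => rw [map_add, add_mul, mul_add, hy, hz]
  | smul_tprod r z =>
    rw [map_smul, smul_mul_assoc, mul_smul_comm, powMap_tprod]
    congr 1
    induction x using PiTensorProduct.induction_on with
    | add x y hx hy => rw [add_mul, mul_add, hx, hy]
    | smul_tprod r x =>
      rw [smul_mul_assoc, mul_smul_comm, PiTensorProduct.tprod_mul_tprod,
        PiTensorProduct.tprod_mul_tprod]
      congr 2
      funext i
      exact Algebra.commutes (z i) (x i)

theorem bal_mul_comm (t : T) (x : ⨂[R] _ : Fin m, C) : G.bal C m t * x = x * G.bal C m t :=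
  powMap_mul_comm _ x

variable (C m) in
/-- The lift of a tensor power over `T` to the tensor power over `R`. -/
def unbase : (⨂[T] _ : Fin m, C) →+ ⨂[R] _ : Fin m, C :=
  PiTensorProduct.liftAddHom (fun p => G.bal C m p.1 * PiTensorProduct.tprod R p.2)
    (fun t f i hf => by rw [MultilinearMap.map_coord_zero _ i hf, mul_zero])
    (fun f => by rw [G.bal_zero, zero_mul])
    (fun t f i x y => by
      classical
      have := (PiTensorProduct.tprod R (s := fun _ : Fin m => C)).map_update_add f i x y
      rw [← mul_add]
      convert congrArg (G.bal C m t * ·) this.symm using 3)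
    (fun t t' f => by rw [G.bal_add, add_mul])
    (fun t f i t' => by
      have := slot_mul_tprod (R := R) i (algebraMap T C t') f
      rw [← Algebra.smul_def] at this
      rw [← G.slot_mul_bal i t' t, ← G.bal_mul_comm, mul_assoc, this]
      congr!)

theorem unbase_tprod (x : Fin m → C) :
    G.unbase C m (PiTensorProduct.tprod T x) = G.bal C m 1 * PiTensorProduct.tprod R x := rfl

/-- So the tensor power over T is the factor of the tensor power over R cut out by the central
idempotent `bal 1`, and `unbase` is the inclusion of this factor. -/
theorem unbase_changeBase (hm : 0 < m) (z : ⨂[R] _ : Fin m, C) :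
    G.unbase C m (changeBase R T C m z) = G.bal C m 1 * z := by
  refine pow_induction_tprod (P := fun z => G.unbase C m (changeBase R T C m z) = G.bal C m 1 * z)
    (fun x y hx hy => ?_) (fun x => ?_) z hm
  · rw [map_add, map_add, hx, hy, mul_add]
  · rw [changeBase_tprod, unbase_tprod]

theorem unbase_mul (hm : 0 < m) (x y : ⨂[T] _ : Fin m, C) :
    G.unbase C m (x * y) = G.unbase C m x * G.unbase C m y := by
  obtain ⟨x, rfl⟩ := changeBase_surjective (R := R) hm x
  obtain ⟨y, rfl⟩ := changeBase_surjective (R := R) hm y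
  rw [← map_mul, G.unbase_changeBase hm, G.unbase_changeBase hm, G.unbase_changeBase hm, mul_assoc,
    ← mul_assoc x, ← G.bal_mul_comm]
  simp only [← mul_assoc, G.bal_mul_bal hm, one_mul]

theorem changeBase_unbase (hm : 0 < m) (x : ⨂[T] _ : Fin m, C) :
    changeBase R T C m (G.unbase C m x) = x := by
  obtain ⟨x, rfl⟩ := changeBase_surjective (R := R) hm x
  rw [G.unbase_changeBase hm, map_mul, G.changeBase_bal hm, map_one, one_mul]

theorem unbase_changeBase_mul (hm : 0 < m) (x : ⨂[R] _ : Fin m, C) (y : ⨂[T] _ : Fin m, C) :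
    G.unbase C m (changeBase R T C m x * y) = x * G.unbase C m y := by
  obtain ⟨y, rfl⟩ := changeBase_surjective (R := R) hm y
  rw [← map_mul, G.unbase_changeBase hm, G.unbase_changeBase hm, ← mul_assoc, ← mul_assoc, G.bal_mul_comm]

theorem unbase_mul_changeBase (hm : 0 < m) (x : ⨂[R] _ : Fin m, C) (y : ⨂[T] _ : Fin m, C) :
    G.unbase C m (y * changeBase R T C m x) = G.unbase C m y * x := by
  obtain ⟨y, rfl⟩ := changeBase_surjective (R := R) hm y
  rw [← map_mul, G.unbase_changeBase hm, G.unbase_changeBase hm, mul_assoc]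

end GaloisCoords

end ChangeBase

section ChangeBase

variable {R T S : Type*} [CommRing R] [CommRing T] [Algebra R T] [CommRing S] [Algebra R S]
  [Algebra T S] [IsScalarTower R T S] {m k : ℕ} {σ : T ≃ₐ[R] T}

theorem GaloisCoords.isAssociatedIdempotent_bal (G : GaloisCoords R k σ) (hm : 0 < m) :
    IsAssociatedIdempotent (changeBase R T S m).toRingHom (G.bal S m 1) where
  idem := by rw [IsIdempotentElem, G.bal_mul_bal hm, one_mul]
  map_eq_one := (G.changeBase_bal hm 1).trans (map_one _)
  injOn x hx := by
    have h := congrArg (G.unbase S m) hx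
    rw [map_zero] at h
    refine Eq.trans ?_ h
    refine Eq.trans ?_ (G.unbase_changeBase hm _).symm
    rw [← mul_assoc, G.bal_mul_bal hm, one_mul]

theorem IsAssociatedIdempotent.eq {X Y : Type*} [CommRing X] [CommRing Y] {f : X →+* Y} {e e' : X}
    (he : IsAssociatedIdempotent f e) (he' : IsAssociatedIdempotent f e') : e = e' := by
  have key : ∀ {a b}, IsAssociatedIdempotent f a → IsAssociatedIdempotent f b → a * b = a :=
    fun {a b} ha hb => by
      have := ha.injOn (b - 1) (by rw [map_mul, map_sub, hb.map_eq_one, map_one, sub_self, mul_zero])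
      rwa [mul_sub, mul_one, sub_eq_zero] at this
  rw [← key he he', mul_comm, key he' he]

end ChangeBase

end
end AlmostCyclic

namespace AlmostCyclic
noncomputable section

/-! ### The centralizer of an intermediate ring -/

section RelCentralizer

variable {R S A : Type*} [CommRing R] [CommRing S] [Algebra R S] [Ring A] [Algebra R A]

theorem mem_relCentralizer {ι : S →ₐ[R] A} {S' : Subalgebra R S} {x : A} :
    x ∈ relCentralizer ι S' ↔ ∀ s ∈ S', ι s * x = x * ι s := by
  rw [relCentralizer, Subalgebra.mem_centralizer_iff]
  exact ⟨fun h s hs => h _ ⟨s, hs, rfl⟩, by rintro h _ ⟨s, hs, rfl⟩; exact h s hs⟩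

/-- The map from `S` to the centralizer of `S'`. -/
def baseRel (ι : S →ₐ[R] A) (S' : Subalgebra R S) : S →ₐ[S'] relCentralizer ι S' where
  toFun s := ⟨ι s, mem_relCentralizer.mpr fun t _ => by rw [← map_mul, mul_comm, map_mul]⟩
  map_one' := Subtype.ext (map_one ι)
  map_mul' s t := Subtype.ext (map_mul ι s t)
  map_zero' := Subtype.ext (map_zero ι)
  map_add' s t := Subtype.ext (map_add ι s t)
  commutes' _ := rfl

variable {n : ℕ} {σ : S ≃ₐ[R] S} {ι : S →ₐ[R] A} {k : ℕ}

theorem IsDeg.mem_relCentralizer {x : A} {h : ℕ} (hx : IsDeg ι σ (k * h) x) :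
    x ∈ relCentralizer ι (fixedRing (σ ^ k)) :=
  AlmostCyclic.mem_relCentralizer.mpr fun s hs => by
    have : ∀ h : ℕ, ((σ ^ k) ^ h) s = s := fun h => by
      induction h with
      | zero => rfl
      | succ h ih => rw [pow_succ, AlgEquiv.mul_apply, mem_fixedRing.mp hs, ih]
    rw [hx, pow_mul, this]

theorem isDeg_baseRel {x : relCentralizer ι (fixedRing (σ ^ k))} {h : ℕ} :
    IsDeg (baseRel ι (fixedRing (σ ^ k))) (fixedRingEquiv (σ ^ k)) h x ↔
      IsDeg ι σ (k * h) (x : A) := by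
  refine forall_congr' fun s => ?_
  rw [Subtype.ext_iff, fixedRingEquiv_pow_apply, ← pow_mul]
  rfl

theorem isCodeg_baseRel {x : relCentralizer ι (fixedRing (σ ^ k))} {h : ℕ} :
    IsCodeg (baseRel ι (fixedRing (σ ^ k))) (fixedRingEquiv (σ ^ k)) h x ↔
      IsCodeg ι σ (k * h) (x : A) := by
  refine forall_congr' fun s => ?_
  rw [Subtype.ext_iff, fixedRingEquiv_pow_apply, ← pow_mul]
  rfl

theorem IsCodeg.mem_relCentralizer {x : A} {h : ℕ} (hx : IsCodeg ι σ (k * h) x) :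
    x ∈ relCentralizer ι (fixedRing (σ ^ k)) :=
  AlmostCyclic.mem_relCentralizer.mpr fun s hs => by
    have : ∀ h : ℕ, ((σ ^ k) ^ h) s = s := fun h => by
      induction h with
      | zero => rfl
      | succ h ih => rw [pow_succ, AlgEquiv.mul_apply, mem_fixedRing.mp hs, ih]
    have h1 := hx s
    rw [pow_mul, this] at h1
    exact h1

theorem IsCrossed.baseRel (hA : IsCrossed ι σ) (k : ℕ) :
    IsCrossed (baseRel ι (fixedRing (σ ^ k))) (fixedRingEquiv (σ ^ k)) where
  inj s t h := hA.inj (congrArg Subtype.val h)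
  cent x hx := by
    obtain ⟨s, hs⟩ := hA.cent (x : A) fun s => congrArg Subtype.val (hx s)
    exact ⟨s, Subtype.ext hs⟩
  units h := by
    obtain ⟨N, w, w', h1, h2, h3⟩ := hA.units (k * h)
    refine ⟨N, fun a => ⟨w a, (h1 a).mem_relCentralizer⟩, fun a => ⟨w' a, (h2 a).mem_relCentralizer⟩,
      fun a => isDeg_baseRel.mpr (h1 a), fun a => isCodeg_baseRel.mpr (h2 a), Subtype.ext ?_⟩
    rw [AddSubmonoidClass.coe_finsetSum]
    exact h3

end RelCentralizer

/-! ### Twisted idempotents -/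

section TwistedIdempotent

variable {R T S B : Type*} [CommRing R] [CommRing T] [CommRing S] [Algebra R S]
  [Algebra T S] [Ring B] [Algebra R B] {m : ℕ} {τ : S ≃ₐ[T] S}

/-- A corner `E B E` which contains `S` as its own centralizer, and an element `U` of order `m` which
induces `τ` on `S`. -/
structure CyclicCorner (f : S →ₐ[R] B) (τ : S ≃ₐ[T] S) (m : ℕ) (E U : B) : Prop where
  idem : E * E = E
  base_comm : ∀ s, E * f s = f s * E
  inj : ∀ s, f s * E = 0 → s = 0
  cent : ∀ x, E * x = x → x * E = x → (∀ s, x * f s = f s * x) → ∃ s, f s * E = x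
  mul_U : E * U = U
  U_mul : U * E = U
  U_base : ∀ s, U * f s = f (τ s) * U
  U_pow : E * U ^ m = E

namespace CyclicCorner

variable {f : S →ₐ[R] B} {E U : B} {ε : ℤ}

theorem pow_base (H : CyclicCorner f τ m E U) (l : ℕ) (s : S) :
    U ^ l * f s = f ((τ ^ l) s) * U ^ l := by
  induction l generalizing s with
  | zero => simp
  | succ l ih => rw [pow_succ, mul_assoc, H.U_base, ← mul_assoc, ih, mul_assoc, pow_succ]; rfl

theorem pow_comm (H : CyclicCorner f τ m E U) (l : ℕ) : U ^ l * E = E * U ^ l := by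
  have : Commute U E := by rw [Commute, SemiconjBy, H.U_mul, H.mul_U]
  exact (this.pow_left l).eq

variable (E U m) in
/-- The sum of the powers of `ε U`. -/
def norm (ε : ℤ) : B := ∑ l ∈ Finset.range m, ε ^ l • (E * U ^ l)

theorem mul_norm (H : CyclicCorner f τ m E U) : E * norm m E U ε = norm m E U ε := by
  rw [norm, Finset.mul_sum]
  simp_rw [mul_smul_comm, ← mul_assoc, H.idem]

theorem norm_mul (H : CyclicCorner f τ m E U) : norm m E U ε * E = norm m E U ε := by
  rw [norm, Finset.sum_mul]
  simp_rw [smul_mul_assoc, mul_assoc, H.pow_comm, ← mul_assoc, H.idem]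

/-- Multiplication by U shifts the terms; the last one wraps around to the first since ε^m = 1 and E
U^m = E. -/
theorem U_mul_norm (H : CyclicCorner f τ m E U) (hε : ε * ε = 1) (hm : ε ^ m = 1) :
    U * norm m E U ε = ε • norm m E U ε := by
  have h1 : U * norm m E U ε = ε • ∑ l ∈ Finset.range m, ε ^ (l + 1) • (E * U ^ (l + 1)) := by
    rw [norm, Finset.mul_sum, Finset.smul_sum (r := ε)]
    refine Finset.sum_congr rfl fun l _ => ?_
    rw [smul_smul, pow_succ' ε, ← mul_assoc, hε, one_mul, mul_smul_comm, ← mul_assoc, H.U_mul,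
      pow_succ', ← mul_assoc, H.mul_U]
  have h2 := Finset.sum_range_succ (fun l => ε ^ l • (E * U ^ l)) m
  rw [Finset.sum_range_succ', hm, H.U_pow, pow_zero, pow_zero, mul_one] at h2
  rw [h1, add_right_cancel h2]
  rfl

theorem pow_mul_norm (H : CyclicCorner f τ m E U) (hε : ε * ε = 1) (hm : ε ^ m = 1) (l : ℕ) :
    U ^ l * norm m E U ε = ε ^ l • norm m E U ε := by
  induction l with
  | zero => simp
  | succ l ih =>
    rw [pow_succ, mul_assoc, H.U_mul_norm hε hm, mul_smul_comm, ih, smul_smul, pow_succ']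

/-- Moving s to the left past U^l gives its conjugate, while the right-hand factor absorbs ε^l U^l
because ε² = 1; the conjugates add up to the trace. -/
theorem norm_base_norm (H : CyclicCorner f τ m E U) (G : GaloisCoords T m τ) (hε : ε * ε = 1)
    (hm : ε ^ m = 1) (s : S) :
    norm m E U ε * f s * norm m E U ε = f (algebraMap T S (G.tr s)) * norm m E U ε := by
  conv_lhs => arg 1; arg 1; rw [norm]
  rw [Finset.sum_mul, Finset.sum_mul, G.algebraMap_tr, map_sum, Finset.sum_mul]
  refine Finset.sum_congr rfl fun l _ => ?_
  rw [smul_mul_assoc, smul_mul_assoc, mul_assoc E, H.pow_base, ← mul_assoc, mul_assoc,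
    H.pow_mul_norm hε hm, mul_smul_comm, smul_smul, ← mul_pow, hε, one_pow, one_smul,
    H.base_comm, mul_assoc, H.mul_norm]

theorem base_norm_comm (H : CyclicCorner f τ m E U) (t : T) :
    norm m E U ε * f (algebraMap T S t) = f (algebraMap T S t) * norm m E U ε := by
  rw [norm, Finset.sum_mul, Finset.mul_sum]
  refine Finset.sum_congr rfl fun l _ => ?_
  rw [smul_mul_assoc, mul_assoc, H.pow_base, AlgEquiv.commutes, ← mul_assoc, H.base_comm,
    mul_smul_comm, mul_assoc]

theorem sum_norm (H : CyclicCorner f τ m E U) (G : GaloisCoords T m τ) :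
    ∑ a, f (G.x a) * norm m E U ε * f (G.y a) = E := by
  simp only [norm, Finset.mul_sum, Finset.sum_mul]
  rw [Finset.sum_comm]
  have h1 : ∀ l, ∑ a, f (G.x a) * ε ^ l • (E * U ^ l) * f (G.y a) =
      ε ^ l • (f (∑ a, (τ ^ 0) (G.x a) * (τ ^ l) (G.y a)) * (E * U ^ l)) := fun l => by
    rw [map_sum, Finset.sum_mul, Finset.smul_sum (r := ε ^ l)]
    refine Finset.sum_congr rfl fun a _ => ?_
    rw [mul_smul_comm, smul_mul_assoc, mul_assoc, mul_assoc, H.pow_base, ← mul_assoc E,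
      H.base_comm, map_mul, mul_assoc, mul_assoc]
    rfl
  simp_rw [h1, G.orth]
  rw [Finset.sum_eq_single_of_mem 0 (Finset.mem_range.mpr G.pos)]
  · rw [if_pos (Nat.ModEq.refl _), pow_zero, pow_zero, map_one, one_smul, one_mul, mul_one]
  · intro l hl h0
    have : ¬ 0 ≡ l [MOD m] := fun h => h0 (by
      rw [Nat.ModEq, Nat.zero_mod, Nat.mod_eq_of_lt (Finset.mem_range.mp hl)] at h
      exact h.symm)
    rw [if_neg this, map_zero, zero_mul]
    exact zsmul_zero _

/-- The idempotent which cuts out the descended algebra. -/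
def proj (_ : CyclicCorner f τ m E U) (G : GaloisCoords T m τ) (ε : ℤ) : B :=
  norm m E U ε * f G.c

theorem norm_c_norm (H : CyclicCorner f τ m E U) (G : GaloisCoords T m τ) (hε : ε * ε = 1)
    (hm : ε ^ m = 1) : norm m E U ε * f G.c * norm m E U ε = norm m E U ε := by
  rw [H.norm_base_norm G hε hm, G.tr_c, map_one, map_one, one_mul]

theorem proj_mul_norm (H : CyclicCorner f τ m E U) (G : GaloisCoords T m τ) (hε : ε * ε = 1)
    (hm : ε ^ m = 1) : H.proj G ε * norm m E U ε = norm m E U ε :=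
  H.norm_c_norm G hε hm

theorem mul_proj (H : CyclicCorner f τ m E U) (G : GaloisCoords T m τ) :
    E * H.proj G ε = H.proj G ε := by
  rw [proj, ← mul_assoc, H.mul_norm]

theorem proj_base (H : CyclicCorner f τ m E U) (G : GaloisCoords T m τ) (t : T) :
    H.proj G ε * f (algebraMap T S t) = f (algebraMap T S t) * H.proj G ε := by
  rw [proj, mul_assoc, ← map_mul, mul_comm, map_mul, ← mul_assoc, H.base_norm_comm, mul_assoc]

/-- If s kills p, then tr(z s) kills the norm element for every z, hence kills E by `sum_norm`. So
all these traces vanish, and s = 0 by the dual bases. -/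
theorem eq_zero_of_base_mul_proj (H : CyclicCorner f τ m E U) (G : GaloisCoords T m τ)
    (hε : ε * ε = 1) (hm : ε ^ m = 1) (s : S) (hs : f s * H.proj G ε = 0) : s = 0 := by
  have h1 : f s * norm m E U ε = 0 := by
    rw [← H.proj_mul_norm G hε hm, ← mul_assoc, hs, zero_mul]
  have h2 : ∀ z, G.tr (z * s) = 0 := fun z => G.inj (by
    have h3 := H.norm_base_norm G hε hm (z * s)
    rw [map_mul, ← mul_assoc, mul_assoc _ (f s), h1, mul_zero] at h3
    have h4 := congrArg (fun w => ∑ a, f (G.x a) * w * f (G.y a)) h3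
    simp only [mul_zero, zero_mul, Finset.sum_const_zero] at h4
    rw [map_zero]
    refine H.inj _ ?_
    rw [h4]
    conv_lhs => rw [← H.sum_norm (ε := ε) G]
    rw [Finset.mul_sum]
    refine Finset.sum_congr rfl fun a _ => ?_
    rw [← mul_assoc, ← mul_assoc, ← map_mul, mul_comm, map_mul, mul_assoc (f (G.x a))])
  rw [← G.sum_tr_smul_x s]
  exact Finset.sum_eq_zero fun a _ => by rw [mul_comm, h2, zero_smul]

/-- Here y = x · norm commutes with T. Its average over the coordinates of S/T commutes with S, so
it is s E with s in S. Compressing this between norm · c and norm gives back y on one side and tr(c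
s) · norm on the other. -/
theorem exists_base_of_commute (H : CyclicCorner f τ m E U) (G : GaloisCoords T m τ)
    (hε : ε * ε = 1) (hm : ε ^ m = 1) (x : B) (h1 : H.proj G ε * x = x) (h2 : x * H.proj G ε = x)
    (hx : ∀ t, x * f (algebraMap T S t) = f (algebraMap T S t) * x) :
    ∃ t, f (algebraMap T S t) * H.proj G ε = x := by
  set N := norm m E U ε with hN
  have hE : E * x = x := by rw [← h1, ← mul_assoc, H.mul_proj]
  set y := x * N with hy
  have hyT : ∀ t, y * f (algebraMap T S t) = f (algebraMap T S t) * y := fun t => by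
    rw [hy, mul_assoc, hN, H.base_norm_comm, ← mul_assoc, hx, mul_assoc]
  -- The separability element of S/T is central and y commutes with T, so both sides have the same
  -- expansion with coefficients tr(z x a y b) in T.
  have hc : ∀ z, (∑ a, f (G.x a) * y * f (G.y a)) * f z =
      f z * ∑ a, f (G.x a) * y * f (G.y a) := fun z => by
    have hx' : ∀ a, f z * (f (G.x a) * y * f (G.y a)) =
        ∑ b, f (algebraMap T S (G.tr (z * G.x a * G.y b))) * (f (G.x b) * y * f (G.y a)) :=
      fun a => by
        rw [← mul_assoc, ← mul_assoc, ← map_mul, ← G.sum_tr_smul_x (z * G.x a), map_sum,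
          Finset.sum_mul, Finset.sum_mul]
        refine Finset.sum_congr rfl fun b _ => ?_
        rw [G.sum_tr_smul_x, Algebra.smul_def, map_mul]
        simp only [mul_assoc]
    have hy' : ∀ b, f (G.x b) * y * f (G.y b) * f z =
        ∑ a, f (algebraMap T S (G.tr (z * G.x a * G.y b))) * (f (G.x b) * y * f (G.y a)) :=
      fun b => by
        rw [mul_assoc, ← map_mul, ← G.sum_tr_smul_y (G.y b * z), map_sum, Finset.mul_sum]
        refine Finset.sum_congr rfl fun a _ => ?_
        rw [Algebra.smul_def, map_mul, ← mul_assoc, mul_assoc (f (G.x b)), hyT,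
          ← mul_assoc, ← map_mul, mul_comm (G.x b), map_mul, mul_comm (G.y b), mul_right_comm]
        simp only [mul_assoc]
    rw [Finset.sum_mul, Finset.mul_sum]
    simp_rw [hx', hy']
    exact Finset.sum_comm
  obtain ⟨s, hs⟩ := H.cent (∑ a, f (G.x a) * y * f (G.y a))
    (by
      rw [Finset.mul_sum]
      exact Finset.sum_congr rfl fun a _ => by
        rw [← mul_assoc, ← mul_assoc, H.base_comm, mul_assoc (f (G.x a)), hy, ← mul_assoc E, hE])
    (by
      rw [Finset.sum_mul]
      exact Finset.sum_congr rfl fun a _ => by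
        rw [mul_assoc, ← H.base_comm, ← mul_assoc, mul_assoc (f (G.x a)), hy, mul_assoc x, hN,
          H.norm_mul]) hc
  refine ⟨G.tr (G.c * s), ?_⟩
  have h3 : N * f G.c * (∑ a, f (G.x a) * y * f (G.y a)) * N = y := by
    rw [Finset.mul_sum, Finset.sum_mul]
    have h4 : ∀ a, N * f G.c * (f (G.x a) * y * f (G.y a)) * N =
        f (algebraMap T S (G.tr (G.c * G.x a)) * algebraMap T S (G.tr (G.y a))) * y := fun a => by
      have h5 : y = N * f G.c * y := by rw [hy, ← mul_assoc]; exact congrArg (· * N) h1.symm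
      have h6 : N * f (G.y a) * N = f (algebraMap T S (G.tr (G.y a))) * N :=
        H.norm_base_norm G hε hm _
      have h7 : N * f (G.c * G.x a) * N = f (algebraMap T S (G.tr (G.c * G.x a))) * N :=
        H.norm_base_norm G hε hm _
      calc N * f G.c * (f (G.x a) * y * f (G.y a)) * N
          = N * f (G.c * G.x a) * (N * f G.c * y) * f (G.y a) * N := by
            rw [← h5, map_mul]; simp only [mul_assoc]
        _ = N * f (G.c * G.x a) * N * f G.c * x * (N * f (G.y a) * N) := by
            rw [hy]; simp only [mul_assoc]
        _ = f (algebraMap T S (G.tr (G.c * G.x a))) * (N * f G.c * x) *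
            (f (algebraMap T S (G.tr (G.y a))) * N) := by rw [h6, h7]; simp only [mul_assoc]
        _ = _ := by
            have h8 : N * f G.c * x = x := h1
            rw [h8, mul_assoc, ← mul_assoc x, hx, mul_assoc _ x, ← hy, ← mul_assoc, ← map_mul f]
    simp_rw [h4]
    rw [← Finset.sum_mul, ← map_sum]
    have h9 : ∑ a, algebraMap T S (G.tr (G.c * G.x a)) * algebraMap T S (G.tr (G.y a)) = 1 := by
      have h10 := congrArg G.tr (G.sum_tr_smul_y G.c)
      rw [map_sum, G.tr_c] at h10
      simp_rw [map_smul, smul_eq_mul] at h10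
      simp_rw [← map_mul, ← map_sum, h10, map_one]
    rw [h9, map_one, one_mul]
  have h11 : y = f (algebraMap T S (G.tr (G.c * s))) * N := by
    rw [← h3, ← hs, ← H.base_comm]
    have h12 : N * f G.c * (E * f s) * N = N * f (G.c * s) * N := by
      rw [H.base_comm, map_mul]
      simp only [mul_assoc]
      rw [hN, H.mul_norm]
    rw [h12]
    exact H.norm_base_norm G hε hm _
  rw [proj, ← mul_assoc, ← hN, ← h11, hy, mul_assoc]
  exact h2

end CyclicCorner

end TwistedIdempotent

end
end AlmostCyclic

namespace AlmostCyclic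
noncomputable section

/-! ### Descent of the norm -/

section NormModule

variable {R S J : Type*} [CommRing R] [CommRing S] [Algebra R S] [AddCommGroup J] [Module S J]
  {τ : S ≃ₐ[R] S} {m : ℕ} (h : τ ^ m = 1)

theorem rotation_iterate_smul (l : ℕ) (s : S) (x : NormTensor τ m J) :
    (rotation τ m J h)^[l] (s • x) = (τ ^ l) s • (rotation τ m J h)^[l] x := by
  induction l with
  | zero => rfl
  | succ l ih =>
    rw [Function.iterate_succ_apply', Function.iterate_succ_apply', ih, rotation_smul, pow_succ']
    rfl

theorem rotation_iterate_add (l : ℕ) (x y : NormTensor τ m J) :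
    (rotation τ m J h)^[l] (x + y) = (rotation τ m J h)^[l] x + (rotation τ m J h)^[l] y :=
  iterate_map_add (rotation τ m J h) l x y

theorem rotation_iterate_pureTensor (l : ℕ) (j : Fin m → J) :
    (rotation τ m J h)^[l] (pureTensor τ j) = pureTensor τ (j ∘ (finRotate m ^ l).symm) := by
  induction l with
  | zero => rfl
  | succ l ih =>
    rw [Function.iterate_succ_apply', ih, rotation_pureTensor, pow_succ']
    rfl

theorem rotation_iterate_self (x : NormTensor τ m J) : (rotation τ m J h)^[m] x = x := by
  induction x using normTensor_induction with
  | hp s j =>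
    rw [rotation_iterate_smul, rotation_iterate_pureTensor, h, finRotate_pow_self]
    rfl
  | ha x y hx hy => rw [rotation_iterate_add, hx, hy]

theorem rotation_sum_iterate (x : NormTensor τ m J) :
    rotation τ m J h (∑ l ∈ Finset.range m, (rotation τ m J h)^[l] x) =
      ∑ l ∈ Finset.range m, (rotation τ m J h)^[l] x := by
  have h1 := Finset.sum_range_succ (fun l => (rotation τ m J h)^[l] x) m
  rw [Finset.sum_range_succ', rotation_iterate_self] at h1
  rw [map_sum]
  simp_rw [← Function.iterate_succ_apply' (rotation τ m J h)]
  exact add_right_cancel h1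

theorem coe_smul_normTensor (t : fixedRing τ) (x : NormTensor τ m J) : t • x = (t : S) • x := rfl

/-- The trace to the module of fixed elements. -/
def normTrace : NormTensor τ m J →ₗ[fixedRing τ] normModule τ m J h where
  toFun x := ⟨∑ l ∈ Finset.range m, (rotation τ m J h)^[l] x, rotation_sum_iterate h x⟩
  map_add' x y := Subtype.ext (by
    simp only [rotation_iterate_add, Finset.sum_add_distrib]
    rfl)
  map_smul' t x := Subtype.ext (by
    have ht : ∀ l, (τ ^ l) (t : S) = t := fun l => by
      induction l with
      | zero => rfl
      | succ l ih => rw [pow_succ, AlgEquiv.mul_apply, mem_fixedRing.mp t.2, ih]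
    simp only [coe_smul_normTensor, rotation_iterate_smul, ht, ← Finset.smul_sum]
    rfl)

theorem coe_normTrace (x : NormTensor τ m J) :
    (normTrace h x : NormTensor τ m J) = ∑ l ∈ Finset.range m, (rotation τ m J h)^[l] x := rfl

theorem normTrace_smul (G : GaloisCoords (fixedRing τ) m (fixedRingEquiv τ)) (s : S)
    (x : normModule τ m J h) : normTrace h (s • (x : NormTensor τ m J)) = G.tr s • x := by
  have hx : ∀ l, (rotation τ m J h)^[l] (x : NormTensor τ m J) = x := fun l => by
    induction l with
    | zero => rfl
    | succ l ih => rw [Function.iterate_succ_apply', ih]; exact x.2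
  refine Subtype.ext ?_
  have h1 : (G.tr s : S) = _ := G.algebraMap_tr s
  rw [coe_normTrace, Submodule.coe_smul, coe_smul_normTensor, h1, Finset.sum_smul]
  refine Finset.sum_congr rfl fun l _ => ?_
  rw [rotation_iterate_smul, hx, fixedRingEquiv_pow_apply]

/-- Galois descent: orthogonality leaves only the unrotated term, so the norm tensor module is
spanned over S by its fixed elements. -/
theorem sum_smul_normTrace (G : GaloisCoords (fixedRing τ) m (fixedRingEquiv τ))
    (x : NormTensor τ m J) :
    ∑ a, G.x a • (normTrace h (G.y a • x) : NormTensor τ m J) = x := by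
  simp only [coe_normTrace, rotation_iterate_smul, Finset.smul_sum, smul_smul]
  rw [Finset.sum_comm]
  have h1 : ∀ l, ∑ a, (G.x a * (τ ^ l) (G.y a)) • (rotation τ m J h)^[l] x =
      (if 0 ≡ l [MOD m] then (1 : S) else 0) • (rotation τ m J h)^[l] x := fun l => by
    rw [← G.orth 0 l, Finset.sum_smul]
    simp only [fixedRingEquiv_pow_apply]
    rfl
  simp_rw [h1]
  rw [Finset.sum_eq_single_of_mem 0 (Finset.mem_range.mpr G.pos)]
  · rw [if_pos (Nat.ModEq.refl _), one_smul]
    rfl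
  · intro l hl h0
    have : ¬ 0 ≡ l [MOD m] := fun h => h0 (by
      rw [Nat.ModEq, Nat.zero_mod, Nat.mod_eq_of_lt (Finset.mem_range.mp hl)] at h
      exact h.symm)
    rw [if_neg this, zero_smul]

/-- The extension of a functional from the fixed elements. -/
def extendFunctional (G : GaloisCoords (fixedRing τ) m (fixedRingEquiv τ))
    (g : normModule τ m J h →ₗ[fixedRing τ] fixedRing τ) : NormTensor τ m J →ₗ[S] S where
  toFun x := ∑ a, G.x a * (g (normTrace h (G.y a • x)) : S)
  map_add' x y := by
    simp only [smul_add, map_add, Subalgebra.coe_add, mul_add, Finset.sum_add_distrib]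
  map_smul' s x := by
    have := G.sum_central ((LinearMap.mul (fixedRing τ) S).compl₂
      (Algebra.linearMap (fixedRing τ) S ∘ₗ g ∘ₗ normTrace h ∘ₗ
        (LinearMap.toSpanSingleton S (NormTensor τ m J) x).restrictScalars (fixedRing τ))) s
    have h1 : ∀ z z' : S, (LinearMap.mul (fixedRing τ) S).compl₂
      (Algebra.linearMap (fixedRing τ) S ∘ₗ g ∘ₗ normTrace h ∘ₗ
        (LinearMap.toSpanSingleton S (NormTensor τ m J) x).restrictScalars (fixedRing τ)) z z' =
        z * (g (normTrace h (z' • x)) : S) := fun _ _ => rfl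
    simp only [h1] at this
    rw [RingHom.id_apply, smul_eq_mul, Finset.mul_sum]
    simp only [← mul_assoc]
    rw [this]
    refine Finset.sum_congr rfl fun a _ => ?_
    rw [smul_smul, mul_comm s]

theorem extendFunctional_coe (G : GaloisCoords (fixedRing τ) m (fixedRingEquiv τ))
    (g : normModule τ m J h →ₗ[fixedRing τ] fixedRing τ) (x : normModule τ m J h) :
    extendFunctional h G g x = g x := by
  change ∑ a, G.x a * (g (normTrace h (G.y a • (x : NormTensor τ m J))) : S) = g x
  have h1 := congrArg (fun s => s * (g x : S)) (G.sum_tr_smul_x 1)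
  simp only [Finset.sum_mul, one_mul] at h1
  rw [← h1]
  refine Finset.sum_congr rfl fun a _ => ?_
  rw [normTrace_smul h G, map_smul, smul_eq_mul, Subalgebra.coe_mul, Algebra.smul_def, ← mul_assoc,
    mul_comm (G.x a)]
  rfl

/-- A functional on the fixed elements extends to the whole module over S, where vectors and values
can be interchanged by symmetry. -/
theorem normModule_apply_smul (hJ : IsSwap S J)
    (G : GaloisCoords (fixedRing τ) m (fixedRingEquiv τ))
    (g : normModule τ m J h →ₗ[fixedRing τ] fixedRing τ) (x y : normModule τ m J h) :
    g x • y = g y • x := by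
  refine Subtype.ext ?_
  have := hJ.normTensor.apply_smul (extendFunctional h G g) (x : NormTensor τ m J) y
  rw [extendFunctional_coe, extendFunctional_coe] at this
  exact this

theorem closure_smul_normModule (G : GaloisCoords (fixedRing τ) m (fixedRingEquiv τ)) :
    AddSubmonoid.closure {y : NormTensor τ m J | ∃ (s : S) (x : normModule τ m J h),
      s • (x : NormTensor τ m J) = y} = ⊤ := by
  rw [eq_top_iff]
  rintro x -
  rw [← sum_smul_normTrace h G x]
  exact sum_mem fun a _ => AddSubmonoid.subset_closure ⟨_, _, rfl⟩

end NormModule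

end
end AlmostCyclic

namespace AlmostCyclic
noncomputable section

/-! ### The algebra generated by the norm -/

section Rotate

theorem cons_comp_finRotate_symm {K : Type*} {k : ℕ} (y : Fin k → K) (v : K) :
    (Fin.snoc y v : Fin (k + 1) → K) ∘ (finRotate (k + 1)).symm = Fin.cons v y := by
  rw [Equiv.comp_symm_eq]
  funext i
  refine Fin.lastCases ?_ (fun i => ?_) i
  · simp
  · simp

variable {R S K B : Type*} [CommRing R] [CommRing S] [Algebra R S]
  [AddCommGroup K] [Module S K] [Ring B] [Algebra R B] {σ : S ≃ₐ[R] S} {n : ℕ}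
  {f : S →ₐ[R] B} {j : K → B}

/-- The norm form of an almost cyclic algebra commutes with the cyclic permutation. -/
theorem IsDeltaMap.apply_rotate (hj : IsDeltaMap σ f j) (hf : Function.Injective f)
    (hσ : σ ^ n = 1) {Θ : (Fin n → K) → S} (hΘ : ∀ x, (List.ofFn fun i => j (x i)).prod = f (Θ x))
    (hK : ∀ (g : K →ₗ[S] S) (x y : K), g x • y = g y • x)
    (h1 : Ideal.span (Set.range Θ) = ⊤) (x : Fin n → K) :
    Θ (x ∘ (finRotate n).symm) = σ (Θ x) := by
  have hT := hj.isTwisted hf hΘ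
  cases n with
  | zero =>
    have h2 : ∀ x, Θ x = 1 := fun x => hf (by rw [← hΘ, map_one]; rfl)
    rw [h2, h2, map_one]
  | succ k =>
    obtain ⟨y, v, rfl⟩ : ∃ y v, x = (Fin.snoc y v : Fin (k + 1) → K) :=
      ⟨Fin.init x, x (Fin.last k), (Fin.snoc_init_self x).symm⟩
    rw [cons_comp_finRotate_symm]
    have hcu : ∀ (z : Fin k → K) v w, Function.update (Fin.cons v z : Fin (k + 1) → K) 0 w =
        Fin.cons w z := fun z v w => Fin.update_cons_zero (α := fun _ => K) v z w
    have hsu : ∀ v w, Function.update (Fin.snoc y v : Fin (k + 1) → K) (Fin.last k) w =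
        Fin.snoc y w := fun v w => Fin.update_snoc_last (α := fun _ => K) v y w
    let g : (Fin k → K) → K →ₗ[S] S := fun z =>
      { toFun := fun v => Θ (Fin.cons v z)
        map_add' := fun a b => by
          have := hT.map_add (Fin.cons v z) 0 a b
          simpa only [hcu] using this
        map_smul' := fun s a => by
          have := hT.map_smul (Fin.cons v z) 0 s a
          simp only [hcu] at this
          exact this }
    -- Linearity holds because the last slot is twisted by σ^k and the outer σ completes it to
    -- σ^(k+1) = 1.
    let d : K →ₗ[S] S :=
      { toFun := fun v => σ (Θ (Fin.snoc y v))
        map_add' := fun a b => by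
          have := congrArg σ (hT.map_add (Fin.snoc y v) (Fin.last k) a b)
          simpa only [hsu, map_add] using this
        map_smul' := fun s a => by
          have := congrArg σ (hT.map_smul (Fin.snoc y v) (Fin.last k) s a)
          simp only [hsu, smul_eq_mul, map_mul, Fin.val_last] at this
          rw [this, ← AlgEquiv.mul_apply, ← pow_succ', hσ]
          rfl }
    have hcons : ∀ v z, (List.ofFn fun i => j ((Fin.cons v z : Fin (k + 1) → K) i)).prod =
        j v * (List.ofFn fun i => j (z i)).prod := fun v z => by
      rw [List.ofFn_succ, List.prod_cons]
      rfl
    have hsnoc : ∀ v z, (List.ofFn fun i => j ((Fin.snoc z v : Fin (k + 1) → K) i)).prod =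
        (List.ofFn fun i => j (z i)).prod * j v := fun v z => by
      rw [List.ofFn_succ', List.prod_concat]
      simp
    -- Bracketing j v · (product over y) · j v in two ways shows that Θ(v, y) and σ(Θ(y, v)) agree
    -- on j v, hence on every product that starts with j v.
    have key : ∀ v z, (g y - d) v * g z v = 0 := fun v z => hf (by
      have h2 : f (g y v) * j v = f (d v) * j v := by
        change f (Θ (Fin.cons v y)) * j v = f (σ (Θ (Fin.snoc y v))) * j v
        rw [← hΘ, hcons, mul_assoc, ← hsnoc, hΘ, hj.right, hj.left]
      change f ((g y v - d v) * Θ (Fin.cons v z)) = f 0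
      rw [map_mul, ← hΘ, hcons, ← mul_assoc, map_sub, sub_mul, h2, sub_self, zero_mul, map_zero])
    -- For x starting with w, the interchange of v and w moves the difference onto w, where `key`
    -- applies. Squares of the values of Θ still generate the unit ideal.
    have hsq : ∀ x, (g y - d) v * Θ x ^ 2 = 0 := fun x => by
      obtain ⟨w, z, rfl⟩ : ∃ w z, x = (Fin.cons w z : Fin (k + 1) → K) :=
        ⟨x 0, Fin.tail x, (Fin.cons_self_tail x).symm⟩
      have h3 := congrArg (g z) (hK (g y - d) v w)
      rw [map_smul, map_smul, smul_eq_mul, smul_eq_mul] at h3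
      change (g y - d) v * (g z w) ^ 2 = 0
      rw [pow_two, ← mul_assoc, h3, mul_right_comm, key, zero_mul]
    have h4 : (1 : S) ∈ Ideal.span ((fun x : S => x ^ 2) '' Set.range Θ) := by
      rw [Ideal.span_pow_eq_top _ h1 2]
      trivial
    have h5 : ∀ z ∈ Ideal.span ((fun x : S => x ^ 2) '' Set.range Θ), (g y - d) v * z = 0 := by
      intro z hz
      induction hz using Submodule.span_induction with
      | mem z hz => obtain ⟨_, ⟨a, rfl⟩, rfl⟩ := hz; exact hsq a
      | zero => rw [mul_zero]
      | add x y _ _ hx hy => rw [mul_add, hx, hy, add_zero]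
      | smul r x _ hx => rw [smul_eq_mul, mul_left_comm, hx, mul_zero]
    have h6 := h5 1 h4
    rw [mul_one] at h6
    exact sub_eq_zero.mp h6

theorem IsDeltaMap.exists_prod_smul (hj : IsDeltaMap σ f j) {k : ℕ} (s : Fin k → S) (x : Fin k → K) :
    ∃ u, (List.ofFn fun i => j (s i • x i)).prod = f u * (List.ofFn fun i => j (x i)).prod := by
  induction k with
  | zero => exact ⟨1, by rw [map_one, one_mul]; rfl⟩
  | succ k ih =>
    obtain ⟨u, hu⟩ := ih (fun i => s i.succ) (fun i => x i.succ)
    refine ⟨s 0 * σ u, ?_⟩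
    rw [List.ofFn_succ, List.prod_cons, hu, List.ofFn_succ, List.prod_cons, ← hj.left, mul_assoc,
      ← mul_assoc (j (x 0)), hj.right, ← hj.left, map_mul]
    simp only [mul_assoc]

end Rotate

/-- The functional tr(c ·), with tr c = 1, carries an expression of 1 over S to one over T. -/
theorem GaloisCoords.span_eq_top_of_map {T S : Type*} [CommRing T] [CommRing S] [Algebra T S] {m : ℕ}
    {τ : S ≃ₐ[T] S} (G : GaloisCoords T m τ) {X : Set T}
    (h : Ideal.span (algebraMap T S '' X) = ⊤) : Ideal.span X = ⊤ := by
  have key : ∀ z ∈ Ideal.span (algebraMap T S '' X), ∀ c, G.tr (c * z) ∈ Ideal.span X := by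
    intro z hz
    induction hz using Submodule.span_induction with
    | mem z hz =>
      obtain ⟨t, ht, rfl⟩ := hz
      intro c
      rw [mul_comm, ← Algebra.smul_def, map_smul, smul_eq_mul, mul_comm]
      exact Ideal.mul_mem_left _ _ (Ideal.subset_span ht)
    | zero => intro c; rw [mul_zero, map_zero]; exact zero_mem _
    | add x y _ _ hx hy => intro c; rw [mul_add, map_add]; exact add_mem (hx c) (hy c)
    | smul r x _ hx => intro c; rw [smul_eq_mul, ← mul_assoc]; exact hx _
  rw [Ideal.eq_top_iff_one, ← G.tr_c, ← mul_one G.c]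
  exact key 1 (by rw [h]; trivial) _

end
end AlmostCyclic

namespace AlmostCyclic
noncomputable section

/-! ### The almost cyclic algebra cut out of a realization of the norm -/

section NormBracket

variable {R S J B : Type*} [CommRing R] [CommRing S] [Algebra R S] [AddCommGroup J] [Module S J]
  [Ring B] [Algebra R B] {σ : S ≃ₐ[R] S} {n : ℕ} {hσ : σ ^ n = 1} {φ : NormTrivialization σ n J hσ}
  {m k : ℕ} {hmk : m * k = n} {f : S →ₐ[R] B} {E U : B} {ε : ℤ}

/-- A realization of `J ⊗ τ(J) ⊗ ⋯ ⊗ τ ^ (m - 1)(J)`, where `τ = σ ^ k`, in a corner of an algebra. -/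
structure NormBracket (φ : NormTrivialization σ n J hσ) (hmk : m * k = n) (f : S →ₐ[R] B)
    (E U : B) where
  corner : CyclicCorner f (fixedRingEquiv (σ ^ k)) m E U
  coord : B →ₗ[R] S
  coord_base : ∀ s, coord (f s * E) = s
  br : NormTensor (σ ^ k) m J →+ B
  br_smul : ∀ s y, br (s • y) = f s * br y
  br_base : ∀ y s, br y * f s = f (σ s) * br y
  mul_br : ∀ y, E * br y = br y
  br_mul : ∀ y, br y * E = br y
  U_br : ∀ y, U * br y = br (rotation (σ ^ k) m J (pow_pow_eq_one hmk hσ) y) * U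
  prod_pureTensor : ∀ x : Fin k → Fin m → J,
    (List.ofFn fun i => br (pureTensor (σ ^ k) (x i))).prod =
      f (φ.val fun p : Fin n => x (finProdFinEquiv.symm (Fin.cast hmk.symm p)).2
        (finProdFinEquiv.symm (Fin.cast hmk.symm p)).1) * U

namespace NormBracket

variable (M : NormBracket φ hmk f E U)

theorem isDeltaMap : IsDeltaMap σ f M.br where
  add := map_add M.br
  left s x := (M.br_smul s x).symm
  right s x := by rw [M.br_base, M.br_smul]

/-- The product of the values of the bracket. -/
def prod {l : ℕ} (y : Fin l → NormTensor (σ ^ k) m J) : B := (List.ofFn fun i => M.br (y i)).prod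

theorem mul_prod {l : ℕ} (hl : 0 < l) (y : Fin l → NormTensor (σ ^ k) m J) :
    E * M.prod y = M.prod y := by
  obtain ⟨l, rfl⟩ := Nat.exists_eq_succ_of_ne_zero hl.ne'
  rw [prod, List.ofFn_succ, List.prod_cons, ← mul_assoc, M.mul_br]

theorem prod_mul {l : ℕ} (hl : 0 < l) (y : Fin l → NormTensor (σ ^ k) m J) :
    M.prod y * E = M.prod y := by
  obtain ⟨l, rfl⟩ := Nat.exists_eq_succ_of_ne_zero hl.ne'
  rw [prod, List.ofFn_succ', List.prod_concat, mul_assoc, M.br_mul]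

theorem prod_base {l : ℕ} (y : Fin l → NormTensor (σ ^ k) m J) (s : S) :
    M.prod y * f s = f ((σ ^ l) s) * M.prod y :=
  M.isDeltaMap.isDeg_prod y s

theorem br_rsmul (r : R) (y : NormTensor (σ ^ k) m J) : M.br (r • y) = r • M.br y := by
  rw [← algebraMap_smul S r y, M.br_smul, AlgHom.commutes, ← Algebra.smul_def]

/-- The bracket as a linear map. -/
def brLin : NormTensor (σ ^ k) m J →ₗ[R] B where
  toFun := M.br
  map_add' := map_add M.br
  map_smul' := M.br_rsmul

/-- The multilinear form which describes the products. -/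
def form : MultilinearMap R (fun _ : Fin k => NormTensor (σ ^ k) m J) S :=
  (M.coord ∘ₗ LinearMap.mulRight R (U ^ (m - 1))).compMultilinearMap
    ((MultilinearMap.mkPiAlgebraFin R k B).compLinearMap fun _ => M.brLin)

theorem form_apply (y : Fin k → NormTensor (σ ^ k) m J) :
    M.form y = M.coord (M.prod y * U ^ (m - 1)) := rfl

/-- A product of k brackets induces σ^k on S, just as U does. Multiplied by U^(m-1), the inverse of
U in the corner, it commutes with S, hence lies in S · E. -/
theorem prod_eq (hm : 0 < m) (hk : 0 < k) (y : Fin k → NormTensor (σ ^ k) m J) :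
    M.prod y = f (M.form y) * U := by
  have hU : U ^ (m - 1) * U = U ^ m := by rw [← pow_succ, Nat.sub_add_cancel hm]
  have h0 : (σ ^ k) ^ m = 1 := pow_pow_eq_one hmk hσ
  obtain ⟨s, hs⟩ := M.corner.cent (M.prod y * U ^ (m - 1))
    (by rw [← mul_assoc, M.mul_prod hk])
    (by rw [mul_assoc, M.corner.pow_comm, ← mul_assoc, M.prod_mul hk])
    (fun s => by
      rw [mul_assoc, M.corner.pow_base, ← mul_assoc, M.prod_base, mul_assoc,
        fixedRingEquiv_pow_apply, ← AlgEquiv.mul_apply, ← pow_succ', Nat.sub_add_cancel hm, h0]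
      rfl)
  rw [form_apply, ← hs, M.coord_base]
  calc M.prod y = M.prod y * (E * U ^ m) := by rw [M.corner.U_pow, M.prod_mul hk]
    _ = M.prod y * U ^ (m - 1) * U := by
      rw [← mul_assoc, M.prod_mul hk, ← hU, mul_assoc]
    _ = f s * U := by rw [← hs, mul_assoc, M.corner.mul_U]

theorem eq_of_base_mul_U (M : NormBracket φ hmk f E U) (hm : 0 < m) {s t : S}
    (h : f s * U = f t * U) : s = t := by
  have hU : U * U ^ (m - 1) * E = E := by
    rw [← pow_succ', Nat.sub_add_cancel hm, M.corner.pow_comm, M.corner.U_pow]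
  have h1 := congrArg (fun x => x * U ^ (m - 1) * E) h
  simp only [mul_assoc] at h1 hU
  rw [hU] at h1
  rw [← M.coord_base s, h1, M.coord_base]

theorem form_pureTensor (hm : 0 < m) (hk : 0 < k) (x : Fin k → Fin m → J) :
    M.form (fun i => pureTensor (σ ^ k) (x i)) = φ.val fun p : Fin n =>
      x (finProdFinEquiv.symm (Fin.cast hmk.symm p)).2
        (finProdFinEquiv.symm (Fin.cast hmk.symm p)).1 :=
  M.eq_of_base_mul_U hm (by rw [← M.prod_eq hm hk, ← M.prod_pureTensor]; rfl)

/-- Every element is a sum of multiples s y with y fixed, and scalars come out of a product. So the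
ideal contains all values of the form, in particular those on pure tensors, which are the values of
φ. -/
theorem span_form (G : GaloisCoords (fixedRing (σ ^ k)) m (fixedRingEquiv (σ ^ k)))
    (hm : 0 < m) (hk : 0 < k) : Ideal.span (Set.range
      fun y : Fin k → normModule (σ ^ k) m J (pow_pow_eq_one hmk hσ) =>
        M.form fun i => (y i : NormTensor (σ ^ k) m J)) = ⊤ := by
  set I := Ideal.span (Set.range
      fun y : Fin k → normModule (σ ^ k) m J (pow_pow_eq_one hmk hσ) =>
        M.form fun i => (y i : NormTensor (σ ^ k) m J)) with hI
  have key : ∀ y, M.form y ∈ I := forall_of_update _ (closure_smul_normModule _ G)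
    (fun x i a b ha hb => by rw [MultilinearMap.map_update_add]; exact add_mem ha hb)
    (fun x i => by rw [MultilinearMap.map_update_zero]; exact zero_mem _)
    (fun x hx => by
      choose s y hsy using hx
      obtain ⟨u, hu⟩ := M.isDeltaMap.exists_prod_smul s fun i => (y i : NormTensor (σ ^ k) m J)
      simp only [hsy] at hu
      have : M.form x = u * M.form fun i => (y i : NormTensor (σ ^ k) m J) :=
        M.eq_of_base_mul_U hm (by
          rw [← M.prod_eq hm hk, map_mul, mul_assoc, ← M.prod_eq hm hk]
          exact hu)
      rw [this]
      exact Ideal.mul_mem_left _ _ (Ideal.subset_span ⟨y, rfl⟩))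
  rw [eq_top_iff, ← φ.span_val, Ideal.span_le]
  rintro _ ⟨x, rfl⟩
  have h1 := key fun i => pureTensor (σ ^ k) fun l => x (Fin.cast hmk (finProdFinEquiv (l, i)))
  rw [M.form_pureTensor hm hk] at h1
  have h2 : (fun p : Fin n => x (Fin.cast hmk (finProdFinEquiv
      ((finProdFinEquiv.symm (Fin.cast hmk.symm p)).1,
        (finProdFinEquiv.symm (Fin.cast hmk.symm p)).2)))) = x := funext fun p => by
    rw [Prod.mk.eta, Equiv.apply_symm_apply]
    rfl
  rw [h2] at h1
  exact h1

theorem norm_mul_br (y : normModule (σ ^ k) m J (pow_pow_eq_one hmk hσ)) :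
    CyclicCorner.norm m E U ε * M.br y = M.br y * CyclicCorner.norm m E U ε := by
  have h1 : Commute U (M.br y) := by
    have := M.U_br y
    rwa [show rotation (σ ^ k) m J (pow_pow_eq_one hmk hσ) (y : NormTensor (σ ^ k) m J) = y from y.2]
      at this
  rw [CyclicCorner.norm, Finset.sum_mul, Finset.mul_sum]
  refine Finset.sum_congr rfl fun l _ => ?_
  rw [smul_mul_assoc, mul_smul_comm, mul_assoc, (h1.pow_left l).eq, ← mul_assoc, M.mul_br,
    ← mul_assoc, M.br_mul]

theorem tr_symm (G : GaloisCoords (fixedRing (σ ^ k)) m (fixedRingEquiv (σ ^ k))) :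
    G.tr (σ.symm G.c) = 1 := by
  refine G.inj (σ.injective ?_)
  have h1 := G.algebraMap_tr G.c
  rw [G.algebraMap_tr, map_one, map_one, map_sum]
  rw [G.tr_c, map_one] at h1
  rw [h1]
  refine Finset.sum_congr rfl fun l _ => ?_
  rw [fixedRingEquiv_pow_apply, fixedRingEquiv_pow_apply, ← pow_mul, ← AlgEquiv.mul_apply,
    ← pow_succ', pow_succ, AlgEquiv.mul_apply, AlgEquiv.apply_symm_apply]

/-- The norm element commutes with the bracket of a fixed element; moving c past the bracket
replaces it by σ⁻¹(c), which still has trace 1. -/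
theorem proj_br_proj (G : GaloisCoords (fixedRing (σ ^ k)) m (fixedRingEquiv (σ ^ k)))
    (hε : ε * ε = 1) (hm : ε ^ m = 1) (y : normModule (σ ^ k) m J (pow_pow_eq_one hmk hσ)) :
    M.corner.proj G ε * (M.br y * M.corner.proj G ε) = M.br y * M.corner.proj G ε := by
  have h1 : f G.c * M.br y = M.br y * f (σ.symm G.c) := by
    rw [M.br_base, AlgEquiv.apply_symm_apply]
  have h2 := M.corner.norm_base_norm G hε hm (σ.symm G.c)
  rw [tr_symm, map_one, map_one, one_mul] at h2
  simp only [CyclicCorner.proj]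
  calc CyclicCorner.norm m E U ε * f G.c * (M.br y * (CyclicCorner.norm m E U ε * f G.c))
      = CyclicCorner.norm m E U ε * (f G.c * M.br y) * (CyclicCorner.norm m E U ε * f G.c) := by
        simp only [mul_assoc]
    _ = M.br y * (CyclicCorner.norm m E U ε * f (σ.symm G.c) * CyclicCorner.norm m E U ε) *
          f G.c := by
        rw [h1, ← mul_assoc (CyclicCorner.norm m E U ε), M.norm_mul_br]
        simp only [mul_assoc]
    _ = _ := by rw [h2, mul_assoc]

-- In the corner of p the ring S' is its own centralizer, and the elements br(y) p with y fixed have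
-- degree one. A product of k of them is (form · U) p = ε · form · p, since U p = ε p; this is the
-- origin of the sign in θ. The recognition theorem over S'/R then applies.
set_option maxHeartbeats 1000000 in
theorem exists_equiv (G : GaloisCoords (fixedRing (σ ^ k)) m (fixedRingEquiv (σ ^ k)))
    (G' : GaloisCoords R k (fixedRingAut σ k)) (hJ : IsSwap S J)
    (hε : ε * ε = 1) (hm : ε ^ m = 1) (hp : IsIdempotentElem (M.corner.proj G ε)) :
    Module.Invertible (fixedRing (σ ^ k)) (normModule (σ ^ k) m J (pow_pow_eq_one hmk hσ)) ∧
    ∃ θ : NormTrivialization (fixedRingAut σ k) k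
        (normModule (σ ^ k) m J (pow_pow_eq_one hmk hσ)) (fixedRingAut_pow σ k),
      IsIteratedNorm hmk φ (pow_pow_eq_one hmk hσ) (ε : R) θ ∧
      ∃ F : hp.Corner ≃ₐ[R] Delta θ, ∀ s : fixedRing (σ ^ k),
        F (toCorner hp (f s)) = Delta.ofBase θ s := by
  have hm0 : 0 < m := G.pos
  have hk0 : 0 < k := G'.pos
  set p := M.corner.proj G ε with hpdef
  set N := normModule (σ ^ k) m J (pow_pow_eq_one hmk hσ) with hN
  let fT : fixedRing (σ ^ k) →ₐ[R] hp.Corner :=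
    cornerHom hp (f.comp (fixedRing (σ ^ k)).val) (M.corner.proj_base G)
  have hfT : ∀ t, (fT t).1 = f (t : S) * p := fun t => cornerHom_apply hp _ _ t
  let j : N → hp.Corner := fun y => mkCorner hp (M.br y * p) (M.proj_br_proj G hε hm y)
    (by rw [mul_assoc, hp.eq])
  have hjv : ∀ y, (j y).1 = M.br y * p := fun y => rfl
  have hj : IsDeltaMap (fixedRingAut σ k) fT j :=
    { add := fun x y => corner_ext (by
        change (j (x + y)).1 = (j x).1 + (j y).1
        rw [hjv, hjv, hjv, ← add_mul, ← map_add]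
        rfl)
      left := fun s y => corner_ext (by
        change (fT s).1 * (j y).1 = (j (s • y)).1
        rw [hfT, hjv, hjv, mul_assoc, M.proj_br_proj G hε hm, ← mul_assoc, ← M.br_smul]
        rfl)
      right := fun s y => corner_ext (by
        change (j y).1 * (fT s).1 = (j (fixedRingAut σ k s • y)).1
        have h1 := M.corner.proj_base (ε := ε) G s
        have h2 : algebraMap (fixedRing (σ ^ k)) S s = (s : S) := rfl
        rw [h2] at h1
        rw [hfT, hjv, hjv, mul_assoc, ← mul_assoc p, h1, mul_assoc (f (s : S)), hp.eq,
          ← mul_assoc, M.br_base, ← M.br_smul]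
        rfl) }
  have hUp : U * p = ε • p := by
    rw [hpdef, CyclicCorner.proj, ← mul_assoc, M.corner.U_mul_norm hε hm, smul_mul_assoc]
  have hprod : ∀ {l : ℕ} (y : Fin l → N), (List.ofFn fun i => j (y i)).prod.1 =
      M.prod (fun i => (y i : NormTensor (σ ^ k) m J)) * p := by
    intro l
    induction l with
    | zero => intro y; exact (one_mul p).symm
    | succ l ih =>
      intro y
      have h1 : (List.ofFn fun i => j (y i)).prod.1 =
          (j (y 0)).1 * (List.ofFn fun i : Fin l => j (y i.succ)).prod.1 := by
        rw [List.ofFn_succ, List.prod_cons]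
        rfl
      rw [h1, ih, hjv, NormBracket.prod, NormBracket.prod, List.ofFn_succ, List.prod_cons,
        mul_assoc, mul_assoc]
      congr 1
      have h2 := corner_mul hp (List.ofFn fun i : Fin l => j (y i.succ)).prod
      rw [ih] at h2
      exact h2
  have hval : ∀ y : Fin k → N, (List.ofFn fun i => j (y i)).prod.1 =
      f (ε • M.form fun i => (y i : NormTensor (σ ^ k) m J)) * p := fun y => by
    rw [hprod, M.prod_eq hm0 hk0, mul_assoc, hUp, mul_smul_comm, map_zsmul, smul_mul_assoc]
  -- The product has degree k and σ^k fixes S', so it commutes with S' and equals t p with t in S'.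
  -- As S acts faithfully on p, t is ε times the form.
  have hΘ : ∀ y : Fin k → N, ∃ t : fixedRing (σ ^ k),
      (t : S) = ε • M.form fun i => (y i : NormTensor (σ ^ k) m J) := fun y => by
    obtain ⟨t, ht⟩ := M.corner.exists_base_of_commute G hε hm (List.ofFn fun i => j (y i)).prod.1
      (corner_mul hp _) (mul_corner hp _) (fun t => by
        have h2 : algebraMap (fixedRing (σ ^ k)) S t = (t : S) := rfl
        have h3 := M.corner.proj_base (ε := ε) G t
        rw [h2, ← hpdef] at h3
        have h4 : (σ ^ k) (t : S) = t := t.2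
        rw [hprod, h2, mul_assoc, h3, ← mul_assoc, M.prod_base, h4, mul_assoc])
    refine ⟨t, sub_eq_zero.mp (M.corner.eq_zero_of_base_mul_proj G hε hm _ ?_)⟩
    rw [map_sub, sub_mul, ← hpdef, ← hval, sub_eq_zero]
    exact ht
  choose Θ hΘ using hΘ
  have hn : ∀ y : Fin k → N, (List.ofFn fun i => j (y i)).prod = fT (Θ y) := fun y =>
    corner_ext (by rw [hval, hfT, hΘ])
  have hinj : Function.Injective fT := fun s t hst => by
    have h1 := congrArg Subtype.val hst
    change (fT s).1 = (fT t).1 at h1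
    rw [hfT, hfT, ← sub_eq_zero, ← sub_mul, ← map_sub] at h1
    exact Subtype.ext (sub_eq_zero.mp (M.corner.eq_zero_of_base_mul_proj G hε hm _ h1))
  have hT := hj.isTwisted hinj hn
  have hspan : Ideal.span (Set.range Θ) = ⊤ := by
    refine G.span_eq_top_of_map ?_
    rw [eq_top_iff, ← M.span_form G hm0 hk0, Ideal.span_le]
    rintro _ ⟨y, rfl⟩
    have h1 : (M.form fun i => (y i : NormTensor (σ ^ k) m J)) = (ε : S) * (Θ y : S) := by
      rw [hΘ, zsmul_eq_mul, ← mul_assoc, ← Int.cast_mul, hε, Int.cast_one, one_mul]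
    change (M.form fun i => (y i : NormTensor (σ ^ k) m J)) ∈ _
    rw [h1]
    exact Ideal.mul_mem_left _ _ (Ideal.subset_span ⟨Θ y, ⟨y, rfl⟩, rfl⟩)
  have hK := normModule_apply_smul (pow_pow_eq_one hmk hσ) hJ G
  -- In slot 0 there is no twist, so freezing the other entries of Θ gives linear functionals; their
  -- values generate the unit ideal.
  have hinv : Module.Invertible (fixedRing (σ ^ k)) N := by
    refine invertible_of_apply_smul hK ?_
    rw [eq_top_iff, ← hspan, Ideal.span_le]
    rintro _ ⟨y, rfl⟩
    let g : N →ₗ[fixedRing (σ ^ k)] fixedRing (σ ^ k) :=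
      { toFun := fun v => Θ (Function.update y ⟨0, hk0⟩ v)
        map_add' := fun a b => hT.map_add y ⟨0, hk0⟩ a b
        map_smul' := fun s a => hT.map_smul y ⟨0, hk0⟩ s a }
    refine Ideal.subset_span ⟨g, y ⟨0, hk0⟩, ?_⟩
    change Θ (Function.update y ⟨0, hk0⟩ (y ⟨0, hk0⟩)) = Θ y
    rw [Function.update_eq_self]
  refine ⟨hinv, ?_⟩
  obtain ⟨θ, hθ⟩ := exists_normTrivialization isSwap_of_invertible (fixedRingAut_pow σ k) hT hspan
    (hj.apply_rotate hinj (fixedRingAut_pow σ k) hn hK hspan)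
  refine ⟨θ, ⟨M.form, fun x => M.form_pureTensor hm0 hk0 x, fun y => ?_⟩, ?_⟩
  · rw [hθ, hΘ, Int.cast_smul_eq_zsmul]
  obtain ⟨F, hF⟩ := Delta.exists_algEquiv θ G' fT j hj.add hj.left hj.right
    (fun y => (hn y).trans (congrArg fT (hθ y).symm)) hinj (fun b hb => by
      obtain ⟨t, ht⟩ := M.corner.exists_base_of_commute G hε hm b.1 (corner_mul hp b)
        (mul_corner hp b) (fun t => by
          have h1 := congrArg Subtype.val (hb t)
          change b.1 * (fT t).1 = (fT t).1 * b.1 at h1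
          have h2 : algebraMap (fixedRing (σ ^ k)) S t = (t : S) := rfl
          have h3 := M.corner.proj_base (ε := ε) G t
          rw [h2, ← hpdef] at h3
          rw [hfT, mul_assoc _ p, corner_mul hp, ← h3, ← mul_assoc, mul_corner hp] at h1
          exact h1)
      exact ⟨t, corner_ext (by rw [hfT]; exact ht)⟩)
  exact ⟨F, hF⟩

end NormBracket

end NormBracket

end
end AlmostCyclic

namespace AlmostCyclic
noncomputable section

/-! ### The tensor power of a crossed algebra over an intermediate ring -/

section Tower

variable {R S A : Type*} [CommRing R] [CommRing S] [Algebra R S] [Ring A] [Algebra R A]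
  {n m k : ℕ} {σ : S ≃ₐ[R] S} {ι : S →ₐ[R] A}

theorem Frame.exists_of_commute_slot {G : GaloisCoords R n σ} (F : Frame G ι) (hm : 0 < m)
    (x : ⨂[R] _ : Fin m, A) (hx : ∀ i s, x * slot R i (ι s) = slot R i (ι s) * x) :
    ∃ w, powMap ι m w = x := by
  have h0 : ∀ w, x * powMap ι m w = powMap ι m w * x := fun w => by
    induction w using pow_induction with
    | h1 => rw [map_one, one_mul, mul_one]
    | hmul y z hy hz => rw [map_mul, ← mul_assoc, hy, mul_assoc, hz, mul_assoc]
    | hadd y z hy hz => rw [map_add, mul_add, add_mul, hy, hz]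
    | hsmul r y hy => rw [map_smul, mul_smul_comm, smul_mul_assoc, hy]
    | hslot i s => rw [powMap_slot, hx]
  have h1 : ∀ z : ⨂[R] _ : Fin m, A, powMap ι m (PiTensorProduct.map (fun _ => F.ρ) z) =
      ∑ a : Fin m → Fin G.N, powMap ι m (PiTensorProduct.tprod R (G.x ∘ a)) * z *
        powMap ι m (PiTensorProduct.tprod R (G.y ∘ a)) := fun z => by
    refine pow_induction_tprod (P := fun z => powMap ι m (PiTensorProduct.map (fun _ => F.ρ) z) =
      ∑ a : Fin m → Fin G.N, powMap ι m (PiTensorProduct.tprod R (G.x ∘ a)) * z *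
        powMap ι m (PiTensorProduct.tprod R (G.y ∘ a))) (fun x y hx hy => ?_) (fun z => ?_) z hm
    · simp only [map_add, hx, hy, mul_add, add_mul, Finset.sum_add_distrib]
    · rw [PiTensorProduct.map_tprod, powMap_tprod]
      simp only [F.hρ, G.proj_apply, pow_zero, AlgEquiv.one_apply]
      rw [MultilinearMap.map_sum]
      refine Finset.sum_congr rfl fun a _ => ?_
      rw [powMap_tprod, powMap_tprod, PiTensorProduct.tprod_mul_tprod,
        PiTensorProduct.tprod_mul_tprod]
      rfl
  refine ⟨_, (h1 x).trans ?_⟩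
  simp_rw [← h0, mul_assoc, ← map_mul, PiTensorProduct.tprod_mul_tprod]
  rw [← Finset.mul_sum, ← map_sum]
  have h2 := MultilinearMap.map_sum (PiTensorProduct.tprod R) fun (_ : Fin m) a => G.x a * G.y a
  simp only [G.sum_mul_self] at h2
  refine (congrArg (fun w => x * powMap ι m w) h2.symm).trans ?_
  exact (congrArg (x * ·) (map_one (powMap ι m))).trans (mul_one x)

theorem GaloisCoords.twist_changeBase (z : ⨂[R] _ : Fin m, S) :
    twist (fixedRingEquiv (σ ^ k)) (fun i : Fin m => (i : ℕ))
      (changeBase R (fixedRing (σ ^ k)) S m z) = twist σ (fun i : Fin m => k * i) z := by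
  induction z using pow_induction with
  | h1 => simp only [map_one]
  | hmul x y hx hy => simp only [map_mul, hx, hy]
  | hadd x y hx hy => simp only [map_add, hx, hy]
  | hsmul r x hx =>
    rw [map_smul (twist σ _), ← hx, map_smul (changeBase R _ S m)]
    exact (twist (fixedRingEquiv (σ ^ k)) fun i : Fin m => (i : ℕ)).toLinearMap.map_smul_of_tower r
      _
  | hslot i t => rw [changeBase_slot, twist_slot, twist_slot, fixedRingEquiv_pow_apply, pow_mul]

/-- A crossed algebra with coordinates for an intermediate ring. -/
structure Tower (ι : S →ₐ[R] A) (σ : S ≃ₐ[R] S) (n m k : ℕ) where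
  G : GaloisCoords R n σ
  bot : GaloisCoords R k (fixedRingAut σ k)
  top : GaloisCoords (fixedRing (σ ^ k)) m (fixedRingEquiv (σ ^ k))
  F : Frame G ι
  D : Frame top (baseRel ι (fixedRing (σ ^ k)))
  hmk : m * k = n

namespace Tower

variable (X : Tower ι σ n m k)

/-- The map from the tensor power over the intermediate ring to the tensor power over `R`. -/
def ground : (⨂[fixedRing (σ ^ k)] _ : Fin m, relCentralizer ι (fixedRing (σ ^ k))) →+
    ⨂[R] _ : Fin m, A :=
  (powMap (relCentralizer ι (fixedRing (σ ^ k))).val m).toRingHom.toAddMonoidHom.comp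
    (X.bot.unbase (relCentralizer ι (fixedRing (σ ^ k))) m)

theorem ground_apply (x : ⨂[fixedRing (σ ^ k)] _ : Fin m, relCentralizer ι (fixedRing (σ ^ k))) :
    X.ground x = powMap (relCentralizer ι (fixedRing (σ ^ k))).val m (X.bot.unbase _ m x) := rfl

theorem ground_mul (x y : ⨂[fixedRing (σ ^ k)] _ : Fin m, relCentralizer ι (fixedRing (σ ^ k))) :
    X.ground (x * y) = X.ground x * X.ground y := by
  rw [ground_apply, X.bot.unbase_mul X.top.pos, map_mul]
  rfl

theorem ground_slot_mul (i : Fin m) (a : relCentralizer ι (fixedRing (σ ^ k)))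
    (y : ⨂[fixedRing (σ ^ k)] _ : Fin m, relCentralizer ι (fixedRing (σ ^ k))) :
    X.ground (slot (fixedRing (σ ^ k)) i a * y) = slot R i (a : A) * X.ground y := by
  rw [ground_apply, ← changeBase_slot (R := R), X.bot.unbase_changeBase_mul X.top.pos, map_mul,
    powMap_slot]
  rfl

theorem ground_mul_slot (i : Fin m) (a : relCentralizer ι (fixedRing (σ ^ k)))
    (y : ⨂[fixedRing (σ ^ k)] _ : Fin m, relCentralizer ι (fixedRing (σ ^ k))) :
    X.ground (y * slot (fixedRing (σ ^ k)) i a) = X.ground y * slot R i (a : A) := by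
  rw [ground_apply, ← changeBase_slot (R := R), X.bot.unbase_mul_changeBase X.top.pos, map_mul,
    powMap_slot]
  rfl

theorem ground_mul_tprod (a : Fin m → relCentralizer ι (fixedRing (σ ^ k)))
    (y : ⨂[fixedRing (σ ^ k)] _ : Fin m, relCentralizer ι (fixedRing (σ ^ k))) :
    X.ground (y * PiTensorProduct.tprod (fixedRing (σ ^ k)) a) =
      X.ground y * PiTensorProduct.tprod R fun i => (a i : A) := by
  rw [ground_apply, ← changeBase_tprod (R := R), X.bot.unbase_mul_changeBase X.top.pos, map_mul,
    powMap_tprod]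
  rfl

theorem ground_changeBase (b : ⨂[R] _ : Fin m, relCentralizer ι (fixedRing (σ ^ k))) :
    X.ground (changeBase R (fixedRing (σ ^ k)) _ m b) =
      powMap ι m (X.bot.bal S m 1) * powMap (relCentralizer ι (fixedRing (σ ^ k))).val m b := by
  rw [ground_apply, X.bot.unbase_changeBase X.top.pos, map_mul, GaloisCoords.bal,
    GaloisCoords.bal, powMap_comp, powMap_comp]
  rfl

theorem ground_powMap (z : ⨂[fixedRing (σ ^ k)] _ : Fin m, S) :
    X.ground (powMap (baseRel ι (fixedRing (σ ^ k))) m z) =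
      powMap ι m (X.bot.unbase S m z) := by
  obtain ⟨z, rfl⟩ := changeBase_surjective (R := R) X.top.pos z
  refine pow_induction_tprod (P := fun z => X.ground (powMap (baseRel ι (fixedRing (σ ^ k))) m
    (changeBase R _ S m z)) = powMap ι m (X.bot.unbase S m (changeBase R _ S m z)))
    (fun x y hx hy => ?_) (fun z => ?_) z X.top.pos
  · simp only [map_add, hx, hy]
  · rw [changeBase_tprod, powMap_tprod, ← changeBase_tprod (R := R), ground_changeBase,
      GaloisCoords.unbase_tprod, map_mul, powMap_tprod, powMap_tprod]
    rfl

/-- Both elements absorb the tensor power of S through the same twist; evaluating the product with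
Q(1) in two ways identifies them. -/
theorem unbase_Q (s : S) : X.bot.unbase S m (X.top.Q (fun i => (i : ℕ)) s) =
    X.G.Q (fun i : Fin m => k * i) s := by
  have h1 : ∀ z : ⨂[R] _ : Fin m, S, z * X.bot.unbase S m (X.top.Q (fun i => (i : ℕ)) s) =
      X.bot.unbase S m (X.top.Q (fun i => (i : ℕ))
        (GaloisCoords.twist σ (fun i : Fin m => k * i) z * s)) := fun z => by
    rw [← X.bot.unbase_changeBase_mul X.top.pos, X.top.mul_Q, GaloisCoords.twist_changeBase]
  have h2 := h1 (X.G.Q (fun i : Fin m => k * i) 1)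
  rw [X.G.twist_Q _ X.top.pos, one_mul, mul_comm, X.G.mul_Q, ← GaloisCoords.twist_changeBase,
    X.bot.changeBase_unbase X.top.pos, X.top.twist_Q _ X.top.pos, mul_one] at h2
  exact h2.symm

/-- The idempotent of the diagonal over the intermediate ring. -/
def E : ⨂[R] _ : Fin m, A := X.F.q (fun i => k * i) 1

theorem ground_diag (s : S) : X.ground (X.D.diag s) = X.F.q (fun i => k * i) s := by
  rw [Frame.diag, Frame.q, ground_powMap, unbase_Q, Frame.q]

/-- The rotation of the factors in the corner of the diagonal over the intermediate ring. -/
def U : ⨂[R] _ : Fin m, A := X.ground X.D.rot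

/-- The embedding of `S` in the first factor. -/
def base (X : Tower ι σ n m k) : S →ₐ[R] ⨂[R] _ : Fin m, A := (slot R X.top.first).comp ι

theorem base_apply (s : S) : X.base s = slot R X.top.first (ι s) := rfl

theorem base_mul_q (s t : S) : X.base s * X.F.q (fun i => k * i) t =
    X.F.q (fun i => k * i) (s * t) := by
  rw [base_apply, Frame.slot_mul_q]
  rfl

theorem q_mul_base (s t : S) : X.F.q (fun i => k * i) t * X.base s =
    X.F.q (fun i => k * i) (s * t) := by
  rw [base_apply, Frame.q_mul_slot]
  rfl

theorem base_mul_E (s : S) : X.base s * X.E = X.F.q (fun i => k * i) s := by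
  rw [E, base_mul_q, mul_one]

theorem E_mul_base (s : S) : X.E * X.base s = X.F.q (fun i => k * i) s := by
  rw [E, q_mul_base, mul_one]

theorem slot_mul_E (i : Fin m) (s : S) :
    slot R i (ι s) * X.E = X.base (((σ ^ k) ^ (i : ℕ)) s) * X.E := by
  rw [base_mul_E, E, Frame.slot_mul_q, mul_one, pow_mul]

theorem E_mul_slot (i : Fin m) (s : S) :
    X.E * slot R i (ι s) = X.E * X.base (((σ ^ k) ^ (i : ℕ)) s) := by
  rw [E_mul_base, E, Frame.q_mul_slot, mul_one, pow_mul]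

theorem E_mul_E : X.E * X.E = X.E := by
  rw [E, X.F.q_mul_q _ X.top.pos, one_mul]

/-- The coordinate of the diagonal corner. -/
def coord : (⨂[R] _ : Fin m, A) →ₗ[R] S :=
  (GaloisCoords.twist σ fun i : Fin m => k * i).toLinearMap ∘ₗ
    PiTensorProduct.map fun _ => X.F.ρ

theorem coord_powMap (z : ⨂[R] _ : Fin m, S) :
    X.coord (powMap ι m z) = GaloisCoords.twist σ (fun i : Fin m => k * i) z := by
  refine pow_induction_tprod (P := fun z => X.coord (powMap ι m z) =
    GaloisCoords.twist σ (fun i : Fin m => k * i) z)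
    (fun x y hx hy => by simp only [map_add, hx, hy]) (fun z => ?_) z X.top.pos
  rw [powMap_tprod, coord, LinearMap.comp_apply, PiTensorProduct.map_tprod]
  simp only [Frame.ρ_base]
  rfl

theorem coord_base_mul_E (s : S) : X.coord (X.base s * X.E) = s := by
  rw [base_mul_E, Frame.q, coord_powMap, X.G.twist_Q _ X.top.pos]

theorem E_mul_ground_pow (l : ℕ) : X.E * X.U ^ l = X.ground (X.D.diag 1 * X.D.rot ^ l) := by
  induction l with
  | zero => rw [pow_zero, pow_zero, mul_one, mul_one, ground_diag, E]
  | succ l ih => rw [pow_succ, ← mul_assoc, ih, U, ← ground_mul, pow_succ, mul_assoc]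

/-- The rotation is transported from the tensor power over S'. On E, slot i acts through σ^(ki) in
the first slot, so an element of the corner commuting with the first copy of S commutes with all of
them and comes from the tensor power of S. -/
theorem corner : CyclicCorner X.base (fixedRingEquiv (σ ^ k)) m X.E X.U where
  idem := X.E_mul_E
  base_comm s := by rw [E_mul_base, base_mul_E]
  inj s hs := by rw [← X.coord_base_mul_E s, hs, map_zero]
  cent x h1 h2 hx := by
    obtain ⟨w, hw⟩ := X.F.exists_of_commute_slot X.top.pos x fun i s => by
      conv_lhs => rw [← h2, mul_assoc, E_mul_slot, ← mul_assoc, h2, hx]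
      conv_rhs => rw [← h1, ← mul_assoc, slot_mul_E, mul_assoc, h1]
    refine ⟨GaloisCoords.twist σ (fun i : Fin m => k * i) w, ?_⟩
    rw [base_mul_E, ← h2, ← hw, E, Frame.powMap_mul_q, mul_one]
  mul_U := by
    rw [E, ← ground_diag, U, ← ground_mul, Frame.diag_mul_rot]
  U_mul := by
    rw [E, ← ground_diag, U, ← ground_mul, Frame.rot_mul_diag, map_one, Frame.diag_mul_rot]
  U_base s := by
    have h1 : X.D.rot * X.D.diag 1 = X.D.rot := by
      rw [Frame.rot_mul_diag, map_one, Frame.diag_mul_rot]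
    have h2 : X.D.rot * slot (fixedRing (σ ^ k)) X.top.first (baseRel ι (fixedRing (σ ^ k)) s) =
        slot (fixedRing (σ ^ k)) X.top.first
          (baseRel ι (fixedRing (σ ^ k)) (fixedRingEquiv (σ ^ k) s)) * X.D.rot := by
      conv_lhs => rw [← h1, mul_assoc, Frame.diag_one_mul_slot_first, Frame.rot_mul_diag]
      conv_rhs => rw [← X.D.diag_mul_rot, ← mul_assoc, Frame.slot_first_mul_diag, mul_one]
    have h3 := congrArg X.ground h2
    rw [ground_mul_slot, ground_slot_mul] at h3
    exact h3
  U_pow := by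
    rw [E_mul_ground_pow, Frame.rot_pow_self, ground_diag, E]

theorem E_mul_tprod (z : Fin m → A) (hz : ∀ i, IsDeg ι σ k (z i)) {s : S}
    (hs : (List.ofFn z).prod = ι s) :
    X.E * PiTensorProduct.tprod R z = X.base s * X.U := by
  let a : Fin m → relCentralizer ι (fixedRing (σ ^ k)) := fun i =>
    ⟨z i, IsDeg.mem_relCentralizer (h := 1) (by rw [mul_one]; exact hz i)⟩
  have ha : (List.ofFn a).prod = baseRel ι (fixedRing (σ ^ k)) s := Subtype.ext (by
    have := map_list_prod (relCentralizer ι (fixedRing (σ ^ k))).val (List.ofFn a)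
    rw [List.map_ofFn] at this
    exact this.trans hs)
  have h1 := X.D.diag_mul_tprod a fun i => isDeg_baseRel.mpr (by rw [mul_one]; exact hz i)
  rw [ha, Frame.diag_one_mul_slot_first, ← mul_one s, ← X.D.slot_first_mul_diag, mul_assoc] at h1
  have h2 := congrArg X.ground h1
  rw [ground_mul_tprod, ground_diag, ground_slot_mul] at h2
  exact h2

/-- By construction U comes from the tensor power of D, but it must be moved past tensors of
generators, which lie outside D. Gathering factors of degree k directly over R gives E · tensor = s
· E p, and over S' the same tensor gives s · U; such s generate the unit ideal, so U = E p. -/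
theorem exists_U_eq (hs : Ideal.span {s | ∃ z : Fin m → A, (∀ i, IsDeg ι σ k (z i)) ∧
      (List.ofFn z).prod = ι s} = ⊤) :
    ∃ p, X.E * p = X.U ∧ ∀ z, p * PiTensorProduct.tprod R z =
      PiTensorProduct.tprod R (z ∘ (finRotate m).symm) * p := by
  obtain ⟨p, hp, h1⟩ := X.F.exists_q_mul_tprod X.top.pos (h := fun i => k * i) (fun _ => rfl)
    X.F.isPermSystem_mul_tprod
  refine ⟨p, ?_, hp⟩
  have h2 : ∀ s ∈ Ideal.span {s | ∃ z : Fin m → A, (∀ i, IsDeg ι σ k (z i)) ∧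
      (List.ofFn z).prod = ι s}, X.base s * (X.E * p) = X.base s * X.U := fun s hs => by
    induction hs using Submodule.span_induction with
    | mem s hs =>
      obtain ⟨z, hz, hzs⟩ := hs
      rw [← X.E_mul_tprod z hz hzs, E, h1 z hz, hzs, ← mul_assoc]
      congr 1
      exact (X.base_mul_E s).trans (X.E_mul_base s).symm
    | zero => rw [map_zero, zero_mul, zero_mul]
    | add x y _ _ hx hy => rw [map_add, add_mul, add_mul, hx, hy]
    | smul a x _ hx => rw [smul_eq_mul, map_mul, mul_assoc, mul_assoc, hx]
  have h3 := h2 1 (by rw [hs]; trivial)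
  rwa [map_one, one_mul, one_mul] at h3

end Tower

end Tower

end
end AlmostCyclic

namespace AlmostCyclic
noncomputable section

/-! ### The norm in the tensor power of an almost cyclic algebra -/

section TensorPower

variable {R S A : Type*} [CommRing R] [CommRing S] [Algebra R S] [Ring A] [Algebra R A]
  {n m k : ℕ} {σ : S ≃ₐ[R] S} {ι : S →ₐ[R] A}

theorem GaloisCoords.twist_powMap (h : Fin m → ℕ) (z : ⨂[R] _ : Fin m, S) :
    twist σ h (powMap (σ : S →ₐ[R] S) m z) = σ (twist σ h z) := by
  induction z using pow_induction with
  | h1 => simp only [map_one]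
  | hmul x y hx hy => simp only [map_mul, hx, hy]
  | hadd x y hx hy => simp only [map_add, hx, hy]
  | hsmul r x hx => simp only [map_smul, hx]
  | hslot i t =>
    rw [powMap_slot, twist_slot, twist_slot]
    change (σ ^ h i * σ) t = (σ * σ ^ h i) t
    rw [← pow_succ, pow_succ']

theorem GaloisCoords.powMap_Q (G : GaloisCoords R n σ) (hm : 0 < m) (h : Fin m → ℕ) (s : S) :
    powMap (σ : S →ₐ[R] S) m (G.Q h s) = G.Q h (σ s) := by
  set w := powMap (σ.symm : S →ₐ[R] S) m (G.Q h 1) with hw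
  have h1 : powMap (σ : S →ₐ[R] S) m w = G.Q h 1 := by
    have h2 : (σ : S →ₐ[R] S).comp (σ.symm : S →ₐ[R] S) = AlgHom.id R S :=
      AlgHom.ext fun s => σ.apply_symm_apply s
    rw [hw, powMap_comp, h2, powMap_apply]
    exact congrArg (fun f : (⨂[R] _ : Fin m, S) →ₗ[R] _ => f (G.Q h 1)) PiTensorProduct.map_id
  have h3 : twist σ h w = 1 := σ.injective (by
    rw [← twist_powMap, h1, G.twist_Q h hm, map_one])
  have h4 : powMap (σ : S →ₐ[R] S) m (G.Q h s) * G.Q h 1 = powMap (σ : S →ₐ[R] S) m (G.Q h s) := by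
    conv_lhs => rw [← h1, ← map_mul, mul_comm, G.mul_Q, h3, one_mul]
  rw [← h4, G.mul_Q, twist_powMap, G.twist_Q h hm, mul_one]

theorem tprod_mul_powMap (v : Fin m → A) (hv : ∀ i, IsDeg ι σ 1 (v i)) (z : ⨂[R] _ : Fin m, S) :
    PiTensorProduct.tprod R v * powMap ι m z =
      powMap ι m (powMap (σ : S →ₐ[R] S) m z) * PiTensorProduct.tprod R v := by
  induction z using PiTensorProduct.induction_on with
  | add x y hx hy => simp only [map_add, mul_add, add_mul, hx, hy]
  | smul_tprod r x =>
    rw [map_smul, map_smul, map_smul, mul_smul_comm, smul_mul_assoc, powMap_tprod, powMap_tprod,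
      powMap_tprod, PiTensorProduct.tprod_mul_tprod, PiTensorProduct.tprod_mul_tprod]
    congr 2
    funext i
    exact (hv i (x i)).trans (by rw [pow_one]; rfl)

theorem mul_prod_tprod {e : ⨂[R] _ : Fin m, A} (he : e * e = e) (g : Fin k → Fin m → A)
    (h : ∀ i, PiTensorProduct.tprod R (g i) * e = e * PiTensorProduct.tprod R (g i)) :
    e * (List.ofFn fun i => e * PiTensorProduct.tprod R (g i)).prod =
      e * PiTensorProduct.tprod R fun l => (List.ofFn fun i => g i l).prod := by
  induction k with
  | zero => simp only [List.ofFn_zero, List.prod_nil]; rfl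
  | succ k ih =>
    have h1 : (PiTensorProduct.tprod R fun l => (List.ofFn fun i => g i l).prod) =
        PiTensorProduct.tprod R (g 0) *
          PiTensorProduct.tprod R fun l => (List.ofFn fun i : Fin k => g i.succ l).prod := by
      simp only [List.ofFn_succ, List.prod_cons]
      exact (PiTensorProduct.tprod_mul_tprod _ _).symm
    rw [List.ofFn_succ, List.prod_cons, h1, ← mul_assoc, ← mul_assoc, he, ← h, mul_assoc,
      ih _ fun i => h i.succ, ← mul_assoc, ← mul_assoc, h]

theorem prod_ofFn_prod (hmk : m * k = n) (g : Fin m → Fin k → A) :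
    (List.ofFn fun l => (List.ofFn fun i => g l i).prod).prod = (List.ofFn fun p : Fin n =>
      g (finProdFinEquiv.symm (Fin.cast hmk.symm p)).1
        (finProdFinEquiv.symm (Fin.cast hmk.symm p)).2).prod := by
  subst hmk
  rw [List.ofFn_mul, List.prod_flatten, List.map_ofFn]
  congr 2
  funext l
  change _ = (List.ofFn _).prod
  congr 2
  funext i
  have h1 : (⟨l * k + i, by
      have := Nat.mul_le_mul_right k l.2
      have := i.2
      lia⟩ : Fin (m * k)) = finProdFinEquiv (l, i) :=
    Fin.ext (by rw [finProdFinEquiv_apply_val]; lia)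
  have h2 : finProdFinEquiv.symm (⟨l * k + i, by
      have := Nat.mul_le_mul_right k l.2
      have := i.2
      lia⟩ : Fin (m * k)) = (l, i) := by rw [h1, Equiv.symm_apply_apply]
  exact (congrArg (fun q : Fin m × Fin k => g q.1 q.2) h2).symm

end TensorPower

/-! ### The bracket of generators and the norm tensor module -/

section Bracket

variable {R S J : Type*} [CommRing R] [CommRing S] [Algebra R S] [AddCommGroup J] [Module S J]
  {n m k : ℕ} {σ : S ≃ₐ[R] S} {hσ : σ ^ n = 1} {φ : NormTrivialization σ n J hσ}

namespace Tower

variable (X : Tower (Delta.ofBase φ) σ n m k)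

/-- The pure tensor of generators. -/
def genTensor (φ : NormTrivialization σ n J hσ) (j : Fin m → J) : ⨂[R] _ : Fin m, Delta φ :=
  PiTensorProduct.tprod R fun l => Delta.gen φ (j l)

theorem genTensor_mul_q (j : Fin m → J) (s : S) :
    genTensor φ j * X.F.q (fun i => k * i) s = X.F.q (fun i => k * i) (σ s) * genTensor φ j := by
  rw [genTensor, Frame.q, tprod_mul_powMap _ fun i => Delta.isDeg_gen φ (j i),
    X.G.powMap_Q X.top.pos, Frame.q]

theorem genTensor_mul_E (j : Fin m → J) : genTensor φ j * X.E = X.E * genTensor φ j := by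
  rw [E, genTensor_mul_q, map_one]

theorem isTwisted_E_mul (i : Fin m) (j : Fin m → J) (s : S) (x : J) :
    X.E * genTensor φ (Function.update j i (s • x)) =
      X.base (((σ ^ k) ^ (i : ℕ)) s) * (X.E * genTensor φ (Function.update j i x)) := by
  have h1 : genTensor φ (Function.update j i (s • x)) =
      slot R i (Delta.ofBase φ s) * genTensor φ (Function.update j i x) := by
    rw [genTensor, genTensor, slot_mul_tprod]
    congr 1
    funext l
    by_cases h : l = i
    · subst h
      rw [Function.update_self, Function.update_self, Function.update_self, Delta.base_mul_gen]
    · rw [Function.update_of_ne h, Function.update_of_ne h, Function.update_of_ne h]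
  rw [h1, ← mul_assoc, E_mul_slot, X.corner.base_comm, mul_assoc]

theorem genTensor_update_add (i : Fin m) (j : Fin m → J) (x y : J) :
    genTensor φ (Function.update j i (x + y)) =
      genTensor φ (Function.update j i x) + genTensor φ (Function.update j i y) := by
  have h1 : ∀ x, (fun l => Delta.gen φ (Function.update j i x l)) =
      Function.update (fun l => Delta.gen φ (j l)) i (Delta.gen φ x) := fun x => by
    funext l
    by_cases h : l = i
    · subst h; simp
    · simp [h]
  simp only [genTensor, h1, Delta.gen_add, MultilinearMap.map_update_add]

/-- S acts on the tensor power by left multiplication through the first slot. Since slot i on E acts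
as σ^(ki) there, E(j₀t ⊗ ⋯ ⊗ jₘ₋₁t) is twisted multilinear for σ^k. -/
theorem exists_bracket : ∃ br : NormTensor (σ ^ k) m J →+ ⨂[R] _ : Fin m, Delta φ,
    (∀ s y, br (s • y) = X.base s * br y) ∧
    ∀ j, br (pureTensor (σ ^ k) j) = X.E * genTensor φ j := by
  let : Module S (⨂[R] _ : Fin m, Delta φ) := Module.compHom _ X.base.toRingHom
  have h : IsTwisted (σ ^ k) fun j : Fin m → J => X.E * genTensor φ j :=
    ⟨fun j i a b => by rw [genTensor_update_add, mul_add], fun j i s a => X.isTwisted_E_mul i j s a⟩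
  exact ⟨h.lift.toAddMonoidHom, fun s y => h.lift.map_smul s y, fun j => h.lift_pureTensor j⟩

theorem E_mul_tprod_prod (x : Fin k → Fin m → J) :
    X.E * (PiTensorProduct.tprod R fun l => (List.ofFn fun i => Delta.gen φ (x i l)).prod) =
      X.base (φ.val fun p : Fin n => x (finProdFinEquiv.symm (Fin.cast X.hmk.symm p)).2
        (finProdFinEquiv.symm (Fin.cast X.hmk.symm p)).1) * X.U := by
  refine X.E_mul_tprod _ (fun l => ?_) ?_
  · have := isDeg_list_prod (ι := Delta.ofBase φ) (σ := σ) (h := 1)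
      (List.ofFn fun i => Delta.gen φ (x i l)) fun y hy => by
        obtain ⟨i, rfl⟩ := List.mem_ofFn.mp hy
        exact Delta.isDeg_gen φ _
    rwa [List.length_ofFn, one_mul] at this
  · exact (prod_ofFn_prod X.hmk fun l i => Delta.gen φ (x i l)).trans (Delta.prod_gen φ _)

theorem span_eq_top (X : Tower (Delta.ofBase φ) σ n m k) : Ideal.span {s | ∃ z : Fin m → Delta φ,
    (∀ i, IsDeg (Delta.ofBase φ) σ k (z i)) ∧ (List.ofFn z).prod = Delta.ofBase φ s} = ⊤ := by
  rw [eq_top_iff, ← φ.span_val, Ideal.span_le]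
  rintro _ ⟨x, rfl⟩
  refine Ideal.subset_span ⟨fun l => (List.ofFn fun i => Delta.gen φ
    (x (Fin.cast X.hmk (finProdFinEquiv (l, i))))).prod, fun l => ?_, ?_⟩
  · have := isDeg_list_prod (ι := Delta.ofBase φ) (σ := σ) (h := 1)
      (List.ofFn fun i => Delta.gen φ (x (Fin.cast X.hmk (finProdFinEquiv (l, i)))))
      fun y hy => by
        obtain ⟨i, rfl⟩ := List.mem_ofFn.mp hy
        exact Delta.isDeg_gen φ _
    rwa [List.length_ofFn, one_mul] at this
  · refine (prod_ofFn_prod X.hmk fun l i => Delta.gen φ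
      (x (Fin.cast X.hmk (finProdFinEquiv (l, i))))).trans ((Delta.prod_gen φ _).trans ?_)
    congr 2
    funext p
    rw [Prod.mk.eta, Equiv.apply_symm_apply]
    rfl

/-- E commutes with tensors of generators, so k brackets multiply slot by slot; gathering the m
slots yields the n generators in the order i + kl, that is, φ, times U. Rotation of a bracket is
conjugation by U because U = E p with p permuting all factors. -/
theorem nonempty_normBracket : Nonempty (NormBracket φ X.hmk X.base X.E X.U) := by
  obtain ⟨br, h1, h2⟩ := X.exists_bracket
  obtain ⟨p, hp, hp'⟩ := X.exists_U_eq X.span_eq_top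
  have hk : 0 < k := X.bot.pos
  have hrec : ∀ {P : NormTensor (σ ^ k) m J → Prop},
      (∀ s j, P (s • pureTensor (σ ^ k) j)) → (∀ x y, P x → P y → P (x + y)) → ∀ y, P y :=
    fun h3 h4 y => normTensor_induction h3 h4 y
  have hbr : ∀ s j, br (s • pureTensor (σ ^ k) j) = X.base s * (X.E * genTensor φ j) :=
    fun s j => by rw [h1, h2]
  refine ⟨⟨X.corner, X.coord, X.coord_base_mul_E, br, h1, ?_, ?_, ?_, ?_, ?_⟩⟩
  · refine fun y s => hrec (P := fun y => br y * X.base s = X.base (σ s) * br y)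
      (fun t j => ?_) (fun x y hx hy => ?_) y
    · rw [hbr, mul_assoc, ← genTensor_mul_E, mul_assoc, E_mul_base, genTensor_mul_q,
        ← E_mul_base, X.corner.base_comm, mul_assoc, ← mul_assoc, ← mul_assoc, ← map_mul,
        mul_comm t, map_mul, mul_assoc, mul_assoc, genTensor_mul_E]
    · rw [map_add, add_mul, mul_add, hx, hy]
  · refine hrec (fun t j => ?_) (fun x y hx hy => ?_)
    · rw [hbr, ← mul_assoc, X.corner.base_comm, mul_assoc, ← mul_assoc X.E, X.E_mul_E]
    · rw [map_add, mul_add, hx, hy]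
  · refine hrec (fun t j => ?_) (fun x y hx hy => ?_)
    · rw [hbr, mul_assoc, mul_assoc, genTensor_mul_E, ← mul_assoc X.E, X.E_mul_E]
    · rw [map_add, add_mul, hx, hy]
  · refine hrec (fun t j => ?_) (fun x y hx hy => ?_)
    · rw [hbr, rotation_smul, rotation_pureTensor, hbr, ← mul_assoc, X.corner.U_base,
        mul_assoc, ← mul_assoc X.U, X.corner.U_mul, mul_assoc]
      congr 1
      conv_lhs => rw [← hp, mul_assoc, genTensor, hp', ← mul_assoc]
      conv_rhs => rw [← hp, ← mul_assoc, mul_assoc X.E, genTensor_mul_E, ← mul_assoc, X.E_mul_E]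
      rfl
    · rw [map_add, mul_add, map_add, map_add, add_mul, hx, hy]
  · intro x
    have h3 : ∀ x : Fin k → Fin m → J, (List.ofFn fun i => X.E * genTensor φ (x i)).prod =
        X.E * (List.ofFn fun i => X.E * genTensor φ (x i)).prod := fun x => by
      obtain ⟨l, rfl⟩ := Nat.exists_eq_succ_of_ne_zero hk.ne'
      rw [List.ofFn_succ, List.prod_cons, ← mul_assoc, ← mul_assoc, X.E_mul_E]
    simp only [h2]
    rw [← X.E_mul_tprod_prod x, h3]
    exact mul_prod_tprod X.E_mul_E (fun i l => Delta.gen φ (x i l)) fun i => X.genTensor_mul_E (x i)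

end Tower

end Bracket

end
end AlmostCyclic

namespace AlmostCyclic
noncomputable section

/-! ### Exterior powers -/

/-- The maps x ↦ βxα and y ↦ αyβ are mutually inverse, since αβ and βα are the units of the two
corners. -/
theorem exists_corner_equiv {R B : Type*} [CommRing R] [Ring B] [Algebra R B] {g p α β : B}
    (hg : IsIdempotentElem g) (hp : IsIdempotentElem p) (h1 : α * β = g) (h2 : β * α = p)
    (h3 : g * α = α) (h4 : β * g = β) :
    ∃ F : hg.Corner ≃ₐ[R] hp.Corner, ∀ x y, β * x * α = p * y * p →
      F (toCorner hg x) = toCorner hp y := by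
  have h5 : p * β = β := by rw [← h2, mul_assoc, h1, h4]
  have h6 : α * p = α := by rw [← h2, ← mul_assoc, h1, h3]
  let F : hg.Corner ≃ₐ[R] hp.Corner :=
    { toFun := fun x => mkCorner hp (β * x.1 * α) (by rw [← mul_assoc, ← mul_assoc, h5])
        (by rw [mul_assoc, h6])
      invFun := fun y => mkCorner hg (α * y.1 * β) (by rw [← mul_assoc, ← mul_assoc, h3])
        (by rw [mul_assoc, h4])
      left_inv := fun x => corner_ext (by
        change α * (β * x.1 * α) * β = x.1
        rw [mul_assoc β, ← mul_assoc, h1, mul_assoc, mul_assoc, h1, mul_corner, corner_mul])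
      right_inv := fun y => corner_ext (by
        change β * (α * y.1 * β) * α = y.1
        rw [mul_assoc α, ← mul_assoc, h2, mul_assoc, mul_assoc, h2, mul_corner, corner_mul])
      map_mul' := fun x y => corner_ext (by
        change β * (x.1 * y.1) * α = β * x.1 * α * (β * y.1 * α)
        have h7 : α * (β * (y.1 * α)) = y.1 * α := by
          rw [← mul_assoc, h1, ← mul_assoc, corner_mul]
        simp only [mul_assoc, h7])
      map_add' := fun x y => corner_ext (by
        change β * (x.1 + y.1) * α = β * x.1 * α + β * y.1 * α
        rw [mul_add, add_mul])
      commutes' := fun r => corner_ext (by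
        change β * (r • g) * α = r • p
        rw [mul_smul_comm, smul_mul_assoc, h4, h2]) }
  refine ⟨F, fun x y hxy => corner_ext ?_⟩
  change β * (g * x * g) * α = p * y * p
  rw [← hxy, ← mul_assoc, ← mul_assoc, h4, mul_assoc _ g, h3]

section Power

universe u v w

variable {R : Type u} {S : Type v} {A : Type w} [CommRing R] [CommRing S] [Algebra R S] [Ring A]
  [Algebra R A] {n m k : ℕ} {σ : S ≃ₐ[R] S} {ι : S →ₐ[R] A}

namespace Tower

variable (X : Tower ι σ n m k)

theorem powMap_bal : powMap ι m (X.bot.bal S m 1) =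
    powMap (relCentralizer ι (fixedRing (σ ^ k))).val m (X.bot.bal _ m 1) := by
  rw [GaloisCoords.bal, GaloisCoords.bal, powMap_comp, powMap_comp]
  rfl

theorem isPowerIdempotent_ext :
    IsPowerIdempotent ι (fixedRing (σ ^ k)) m (X.ground X.D.ext) := by
  have hm := X.top.pos
  have h1 : X.ground X.D.ext = powMap (relCentralizer ι (fixedRing (σ ^ k))).val m
      (X.bot.unbase _ m X.D.ext) := rfl
  have h2 : powMap ι m (X.bot.bal S m 1) * X.ground X.D.ext = X.ground X.D.ext := by
    conv_lhs => rw [h1, ← ground_changeBase, X.bot.changeBase_unbase hm]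
  refine ⟨?_, X.bot.bal S m 1, X.bot.unbase _ m X.D.ext, X.bot.isAssociatedIdempotent_bal hm,
    ?_, ?_, ?_, ?_⟩
  · rw [IsIdempotentElem, ← ground_mul, X.D.isExteriorIdempotent_ext.1]
  · rw [← powMap_apply, h2]
  · rw [← powMap_apply]
    conv_rhs => rw [← h2]
    rw [powMap_bal, h1, ← map_mul, ← map_mul, X.bot.bal_mul_comm]
  · rw [h1, powMap_apply]
  · rw [X.bot.changeBase_unbase hm]
    exact X.D.isExteriorIdempotent_ext

/-- The idempotent e' associated to a map is unique, so g = e' g is recovered from the image of b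
over S' by `ground`. -/
theorem exists_of_isPowerIdempotent {g : ⨂[R] _ : Fin m, A}
    (hg : IsPowerIdempotent ι (fixedRing (σ ^ k)) m g) :
    ∃ f, IsExteriorIdempotent m f ∧ X.ground f = g := by
  obtain ⟨e, b, he, h1, -, h2, h3⟩ := hg.exists_eq
  refine ⟨_, h3, ?_⟩
  rw [ground_changeBase, powMap_apply, powMap_apply, h2,
    (X.bot.isAssociatedIdempotent_bal X.top.pos).eq he, h1]

theorem slot_mul_ground (i : Fin m) (s : fixedRing (σ ^ k))
    (y : ⨂[fixedRing (σ ^ k)] _ : Fin m, relCentralizer ι (fixedRing (σ ^ k))) :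
    slot R i (ι s) * X.ground y = X.ground y * slot R i (ι s) := by
  have h1 : slot (fixedRing (σ ^ k)) i (algebraMap _ (relCentralizer ι (fixedRing (σ ^ k))) s) * y =
      y * slot (fixedRing (σ ^ k)) i (algebraMap _ (relCentralizer ι (fixedRing (σ ^ k))) s) := by
    rw [AlgHom.commutes, Algebra.commutes]
  have h2 := congrArg X.ground h1
  rw [ground_slot_mul, ground_mul_slot] at h2
  exact h2

theorem ground_anti : X.ground (X.D.diag 1 * X.D.anti m * X.D.diag X.top.c) =
    X.corner.proj X.top (Equiv.Perm.sign (finRotate m) : ℤ) := by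
  rw [Frame.diag_anti_diag, map_sum, CyclicCorner.proj, CyclicCorner.norm, Finset.sum_mul]
  refine Finset.sum_congr rfl fun l _ => ?_
  rw [map_zsmul, ground_mul, ← E_mul_ground_pow, ground_diag, ← E_mul_base, smul_mul_assoc,
    mul_assoc, ← mul_assoc _ X.E, X.corner.pow_comm]
  simp only [← mul_assoc, X.E_mul_E]

theorem exists_equiv {g : ⨂[R] _ : Fin m, A}
    (hg : IsPowerIdempotent ι (fixedRing (σ ^ k)) m g) :
    ∃ (hp : IsIdempotentElem (X.corner.proj X.top (Equiv.Perm.sign (finRotate m) : ℤ)))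
      (F : hg.idem.Corner ≃ₐ[R] hp.Corner), ∀ (l : Fin m) (s : fixedRing (σ ^ k)),
      F (toCorner hg.idem (slot R l (ι s))) = toCorner hp (X.base s) := by
  obtain ⟨f, hf, hfg⟩ := X.exists_of_isPowerIdempotent hg
  set p := X.corner.proj X.top (Equiv.Perm.sign (finRotate m) : ℤ) with hp'
  have h1 : X.ground (f * X.D.diag X.top.c) * X.ground (X.D.diag 1 * X.D.anti m) = g := by
    rw [← ground_mul, X.D.diag_c_anti hf, hfg]
  have h2 : X.ground (X.D.diag 1 * X.D.anti m) * X.ground (f * X.D.diag X.top.c) = p := by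
    rw [← ground_mul, X.D.anti_diag_c hf, ground_anti]
  have h3 : g * X.ground (f * X.D.diag X.top.c) = X.ground (f * X.D.diag X.top.c) := by
    rw [← hfg, ← ground_mul, ← mul_assoc, hf.1]
  have h4 : X.ground (X.D.diag 1 * X.D.anti m) * g = X.ground (X.D.diag 1 * X.D.anti m) := by
    rw [← hfg, ← ground_mul, X.D.diag_anti_mul hf]
  have hp : IsIdempotentElem p := by
    rw [IsIdempotentElem, ← h2, mul_assoc, ← mul_assoc _ (X.ground (X.D.diag 1 * X.D.anti m)),
      h1, h3]
  obtain ⟨F, hF⟩ := exists_corner_equiv (R := R) hg.idem hp h1 h2 h3 h4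
  refine ⟨hp, F, fun l s => hF _ _ ?_⟩
  have h5 : ∀ l : ℕ, ((σ ^ k) ^ l) (s : S) = s := fun l => by
    have := ((fixedRingEquiv (σ ^ k)) ^ l).commutes s
    rw [fixedRingEquiv_pow_apply] at this
    exact this
  -- On E, slot l differs from the first slot by a power of σ^k, which fixes S'; so the slot in
  -- which s is placed is immaterial.
  have h6 : slot R l (ι s) * p = X.base s * p := by
    rw [hp', ← X.corner.mul_proj, ← mul_assoc, slot_mul_E, h5, mul_assoc]
  have h7 : p * X.base s = X.base s * p := X.corner.proj_base X.top s
  rw [← X.slot_mul_ground, mul_assoc, h2, h6, h7, mul_assoc, hp]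

end Tower

theorem sign_finRotate_eq (hm : 0 < m) : (Equiv.Perm.sign (finRotate m) : ℤ) = (-1) ^ (m - 1) := by
  obtain ⟨m, rfl⟩ := Nat.exists_eq_succ_of_ne_zero hm.ne'
  rw [Nat.succ_eq_add_one, sign_finRotate]
  simp

/-- The corner of p does not involve g, so a single θ serves all idempotents g. -/
theorem exists_power_equiv {J : Type*} [AddCommGroup J] [Module S J] [Module.Invertible S J]
    (G : GaloisCoords R n σ) {hσ : σ ^ n = 1} (φ : NormTrivialization σ n J hσ) (hmk : m * k = n) :
    IsCyclicGalois R (fixedRing (σ ^ k)) k (fixedRingAut σ k) ∧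
    Module.Invertible (fixedRing (σ ^ k)) (normModule (σ ^ k) m J (pow_pow_eq_one hmk hσ)) ∧
    ∃ θ : NormTrivialization (fixedRingAut σ k) k
        (normModule (σ ^ k) m J (pow_pow_eq_one hmk hσ)) (fixedRingAut_pow σ k),
      IsIteratedNorm hmk φ (pow_pow_eq_one hmk hσ) ((-1) ^ (m - 1)) θ ∧
      (∃ g, IsPowerIdempotent (Delta.ofBase φ) (fixedRing (σ ^ k)) m g) ∧
      ∀ (g : ⨂[R] _ : Fin m, Delta φ)
        (hg : IsPowerIdempotent (Delta.ofBase φ) (fixedRing (σ ^ k)) m g),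
        ∃ F : hg.idem.Corner ≃ₐ[R] Delta θ, ∀ (l : Fin m) (s : fixedRing (σ ^ k)),
          F (toCorner hg.idem (slot R l (Delta.ofBase φ s))) = Delta.ofBase θ s := by
  obtain ⟨bot⟩ := G.exists_bottom hmk
  obtain ⟨top, -⟩ := G.exists_top hmk
  have hA := Delta.isCrossed φ isSwap_of_invertible G
  obtain ⟨F⟩ := hA.nonempty_frame G
  obtain ⟨D⟩ := (hA.baseRel k).nonempty_frame top
  let X : Tower (Delta.ofBase φ) σ n m k := ⟨G, bot, top, F, D, hmk⟩
  obtain ⟨M⟩ := X.nonempty_normBracket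
  -- The standard exterior idempotent serves here to show that p is idempotent.
  obtain ⟨hp, -⟩ := X.exists_equiv X.isPowerIdempotent_ext
  have hε : (Equiv.Perm.sign (finRotate m) : ℤ) * Equiv.Perm.sign (finRotate m) = 1 := by
    rw [← Units.val_mul, Int.units_mul_self, Units.val_one]
  have hεm : (Equiv.Perm.sign (finRotate m) : ℤ) ^ m = 1 := by
    rw [← Units.val_pow_eq_pow_val, ← map_pow, finRotate_pow_self, map_one, Units.val_one]
  obtain ⟨hI, θ, hθ, F₁, hF₁⟩ := M.exists_equiv top bot isSwap_of_invertible hε hεm hp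
  refine ⟨bot.isCyclicGalois, hI, θ, ?_, ⟨_, X.isPowerIdempotent_ext⟩, fun g hg => ?_⟩
  · rw [sign_finRotate_eq top.pos] at hθ
    push_cast at hθ
    exact hθ
  · obtain ⟨hp', F₂, hF₂⟩ := X.exists_equiv hg
    exact ⟨F₂.trans F₁, fun l s => (congrArg F₁ (hF₂ l s)).trans (hF₁ s)⟩

end Power

end
end AlmostCyclic

theorem mainTheorem10 {R S I J : Type*} [CommRing R] [CommRing S] [Algebra R S]
    [AddCommGroup I] [Module S I] [Module.Invertible S I]
    [AddCommGroup J] [Module S J] [Module.Invertible S J]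
    (n : ℕ) (σ : S ≃ₐ[R] S) (hσ : IsCyclicGalois R S n σ)
    (φ : NormTrivialization σ n I hσ.pow_eq_one) (ψ : NormTrivialization σ n J hσ.pow_eq_one) :
    (∃ θ : NormTrivialization σ n (I ⊗[S] J) hσ.pow_eq_one, IsProduct φ ψ θ ∧
      ∃ (e : S ⊗[R] S)
        (he : IsAssociatedIdempotent (Algebra.TensorProduct.lmul' R (S := S)).toRingHom e)
        (F : (he.idem.map (Algebra.TensorProduct.map
          (Delta.ofBase φ) (Delta.ofBase ψ))).Corner ≃ₐ[R] Delta θ),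
        ∀ s : S, F (toCorner _ (Delta.ofBase φ s ⊗ₜ[R] 1)) = Delta.ofBase θ s) ∧
    (∀ (m k : ℕ) (hmk : m * k = n),
      IsCyclicGalois R (fixedRing (σ ^ k)) k (fixedRingAut σ k) ∧
      Module.Invertible (fixedRing (σ ^ k))
        (normModule (σ ^ k) m I (pow_pow_eq_one hmk hσ.pow_eq_one)) ∧
      ∃ θ : NormTrivialization (fixedRingAut σ k) k
          (normModule (σ ^ k) m I (pow_pow_eq_one hmk hσ.pow_eq_one)) (fixedRingAut_pow σ k),
        IsIteratedNorm hmk φ (pow_pow_eq_one hmk hσ.pow_eq_one) ((-1) ^ (m - 1)) θ ∧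
        (∃ g, IsPowerIdempotent (Delta.ofBase φ) (fixedRing (σ ^ k)) m g) ∧
        ∀ (g : ⨂[R] _ : Fin m, Delta φ)
          (hg : IsPowerIdempotent (Delta.ofBase φ) (fixedRing (σ ^ k)) m g),
          ∃ F : hg.idem.Corner ≃ₐ[R] Delta θ, ∀ (l : Fin m) (s : fixedRing (σ ^ k)),
            F (toCorner hg.idem (PiTensorProduct.singleAlgHom (R := R) (A := fun _ => Delta φ) l
              (Delta.ofBase φ s))) = Delta.ofBase θ s) := by
  obtain ⟨G⟩ := hσ.exists_coords
  exact ⟨exists_product_equiv G φ ψ, fun m k hmk => exists_power_equiv G φ hmk⟩
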